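/- **Setting.** Let $M$ be a smooth (Hausdorff) manifold of dimension $2m+1$ with a contact metric structure $(\phi,\xi,\lambda,g)$: $\lambda$ is a contact form with Reeb field $\xi$, $\omega=d\lambda$, $g$ is a Riemannian metric, $\phi$ is a $(1,1)$-tensor, and $$\lambda(X)=g(X,\xi),\quad \omega(X,Y)=g(X,\phi Y),\quad g(\phi X,\phi Y)=g(X,Y)-\lambda(X)\lambda(Y),\quad \phi^2=-I+\xi\otimes\lambda,\quad \phi\xi=0,\quad \lambda\circ\phi=0 .$$ Let $\nabla$ be a contact metric connection: a smooth affine connection with $\nabla\lambda=0$, $\nabla\xi=0$, $\nabla\omega=0$, $\nabla g=0$, $\nabla\phi=0$. Let $\Gamma^k_{ji}$ be its coefficients, $\nabla_{\partial_i}\partial_j=\Gamma^k_{ji}\partial_k$, and define $R^i_{jkl}$ and $T^j_{kl}$ by $[\nabla_k,\nabla_l]v^i=R^i_{jkl}v^j+T^j_{kl}\nabla_jv^i$. Elements of $\mathcal W\otimes\Lambda_n$ are smooth $n$-forms $a(x,y,dx,\nu)$ whose coefficients are complex formal power series in $\nu$ and in the tangent coordinates $y^i$. The product is $$(a\circ b)(y)=\exp\Big(\tfrac{\nu}{2}h^{ij}\tfrac{\partial^2}{\partial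 y^i\partial z^j}\Big)a(y)\,b(z)\Big|_{z=y},\qquad h^{ij}=g^{ij}+i\,g^{ik}\phi^j_k ,$$ combined with the wedge product of forms. Let $[a,b]=a\circ b-(-1)^{pq}b\circ a$ for a $p$-form $a$ and a $q$-form $b$. Put $\deg y^i=1$, $\deg\nu=2$; $F^k$ denotes the terms of degree at least $k$. The subspace $\mathcal W^\xi\otimes\Lambda$ consists of the $a$ with $\xi^i\partial a/\partial y^i=0$. Let $$\delta=dx^i\wedge\frac{\partial}{\partial y^i},\qquad d_\nabla a=dx^i\wedge\Big(\frac{\partial a}{\partial x^i}-y^j\Gamma^k_{ji}\frac{\partial a}{\partial y^k}\Big),\qquad \delta^*=y^i(\delta_i^j-\lambda_i\xi^j)\,i_{\partial/\partial x^j}.$$ For $a$ of polynomial degree $l$ in $y$ and form degree $n$, write $a=a'+a''$ with $a''=\lambda\wedge i_\xi a$, and put $\delta^{-1}a=\frac1{l+n}\delta^*a'+\frac1{l+n-1}\delta^*a''$, where a summand with zero denominator is replaced by $0$. Put $$\omega=\tfrac12\omega_{ij}dx^i\wedge dx^j,\qquad T=\tfrac12\,\omega_{kn}T^n_{ij}\,y^k\,dx^i\wedge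 dx^j,\qquad R=-\tfrac14\,\omega_{in}R^n_{jkl}\,y^iy^j\,dx^k\wedge dx^l$$ (with this sign of $R$ one has $d_\nabla^2=\frac i\nu[R,\cdot]$ and $\delta R=d_\nabla T$). For $r\in F^2\mathcal W^\xi\otimes\Lambda_1$ let $$Da=d_\nabla a-\delta a+\tfrac i\nu[r,a],\qquad \Omega=\omega-\delta r+T+R+d_\nabla r+\tfrac i\nu\,r\circ r .$$ **Theorem 3.3.** Let $\nabla$ be a contact metric connection. 1. There is exactly one $r\in F^2\mathcal W^\xi\otimes\Lambda_1$ with $\delta^{-1}r=0$, $(i_\xi r)|_{y=0}=0$ and Weyl curvature $\Omega=\omega$. For this $r$ the connection $D$ is abelian, that is, $D^2=0$ on $\mathcal W^\xi\otimes\Lambda$. 2. For every $r\in F^2\mathcal W^\xi\otimes\Lambda_1$, $\Omega=\omega$ is equivalent to $\delta r=T+R+d_\nabla r+\frac i\nu r\circ r$. 3. The $r$ of part 1 is the only solution in $F^2\mathcal W^\xi\otimes\Lambda_1$ of $$r=\delta^{-1}(T+R)+\delta^{-1}\Big(d_\nabla r+\tfrac i\nu\,r\circ r\Big),$$ and it is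 obtained by iterating the right-hand side: from any starting point $r_0\in F^2\mathcal W^\xi\otimes\Lambda_1$, the $N$-th iterate agrees with $r$ modulo $F^{N+2}$. 4. More generally, two elements $r,r'\in F^2\mathcal W^\xi\otimes\Lambda_1$ with $\delta^{-1}r=\delta^{-1}r'=0$, both of Weyl curvature $\omega$, coincide as soon as $(i_\xi r)|_{y=0}=(i_\xi r')|_{y=0}$. -/

import Mathlib

open scoped Manifold ContDiff Topology TensorProduct
open Bundle

noncomputable section

namespace WickFedosov

/-! ## Complex exterior forms on a finite-dimensional real vector space -/

/-- The model space `ℝ^(2m+1)`.  Mathlib's tangent space `TangentSpace (𝓡 (2 * m + 1)) x` is this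
space, the identification being made by the preferred chart at `x`; below, all components at `x`
refer to that chart. -/
abbrev Model (m : ℕ) : Type := EuclideanSpace ℝ (Fin (2 * m + 1))

/-- `∂/∂xⁱ`, the `i`-th standard basis vector. -/
def e {m : ℕ} (i : Fin (2 * m + 1)) : Model m := EuclideanSpace.single i 1

/-- The `i`-th component of a vector. -/
def coord {m : ℕ} (v : Model m) (i : Fin (2 * m + 1)) : ℝ := v i

/-- The wedge product of complex-valued alternating forms,
`(α ∧ β)(v) = ∑ over (p,q)-shuffles σ of sign(σ) α(v_σ(1), …, v_σ(p)) β(v_σ(p+1), …, v_σ(p+q))`. The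
degree of the result is a separate argument, so that no casts between `1 + n` and `n + 1` occur. -/
def wedge {m p q N : ℕ} (h : p + q = N) (α : Model m [⋀^Fin p]→L[ℝ] ℂ)
    (β : Model m [⋀^Fin q]→L[ℝ] ℂ) : Model m [⋀^Fin N]→L[ℝ] ℂ :=
  let f : Model m [⋀^Fin N]→ₗ[ℝ] ℂ :=
    ((LinearMap.mul' ℝ ℂ).compAlternatingMap
      (α.toAlternatingMap.domCoprod β.toAlternatingMap)).domDomCongr
        (finSumFinEquiv.trans (finCongr h))
  { f with
    cont := by
      have key : ∀ σ : Equiv.Perm.ModSumCongr (Fin p) (Fin q),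
          Continuous fun v : Fin p ⊕ Fin q → Model m =>
            (LinearMap.mul' ℝ ℂ)
              (AlternatingMap.domCoprod.summand α.toAlternatingMap β.toAlternatingMap σ v) := by
        intro σ
        induction σ using Quotient.inductionOn' with | _ σ
        have : (fun v : Fin p ⊕ Fin q → Model m => (LinearMap.mul' ℝ ℂ)
            (AlternatingMap.domCoprod.summand α.toAlternatingMap β.toAlternatingMap
              (Quotient.mk'' σ) v))
            = fun v => (Equiv.Perm.sign σ : ℤ) •
              (α (fun i => v (σ (Sum.inl i))) * β (fun i => v (σ (Sum.inr i)))) := by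
          funext v
          rw [AlternatingMap.domCoprod.summand_mk'']
          change (LinearMap.mul' ℝ ℂ) (((Equiv.Perm.sign σ : ℤˣ) : ℤ) •
            (α (fun i => v (σ (Sum.inl i))) ⊗ₜ[ℝ] β (fun i => v (σ (Sum.inr i))))) = _
          rw [map_zsmul, LinearMap.mul'_apply]
        rw [this]
        have ha : Continuous fun v : Fin p ⊕ Fin q → Model m =>
            α (fun i => v (σ (Sum.inl i))) := α.cont.comp (by fun_prop)
        have hb : Continuous fun v : Fin p ⊕ Fin q → Model m =>
            β (fun i => v (σ (Sum.inr i))) := β.cont.comp (by fun_prop)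
        exact (ha.mul hb).const_smul _
      have hsum : Continuous fun v : Fin p ⊕ Fin q → Model m =>
          (LinearMap.mul' ℝ ℂ) (α.toAlternatingMap.domCoprod β.toAlternatingMap v) := by
        have : (fun v : Fin p ⊕ Fin q → Model m =>
            (LinearMap.mul' ℝ ℂ) (α.toAlternatingMap.domCoprod β.toAlternatingMap v))
            = fun v => ∑ σ : Equiv.Perm.ModSumCongr (Fin p) (Fin q), (LinearMap.mul' ℝ ℂ)
              (AlternatingMap.domCoprod.summand α.toAlternatingMap β.toAlternatingMap σ v) := by
          funext v
          rw [AlternatingMap.domCoprod_apply, _root_.sum_apply, map_sum]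
        rw [this]
        exact continuous_finsetSum _ fun σ _ => key σ
      exact hsum.comp (by fun_prop :
        Continuous fun (v : Fin N → Model m) (i : Fin p ⊕ Fin q) =>
          v ((finSumFinEquiv.trans (finCongr h)) i)) }

/-- A real covector as a complex-valued `1`-form. -/
def oneForm {m : ℕ} (α : Model m →L[ℝ] ℝ) : Model m [⋀^Fin 1]→L[ℝ] ℂ :=
  ContinuousAlternatingMap.ofSubsingleton ℝ (Model m) ℂ (0 : Fin 1) (Complex.ofRealCLM ∘L α)

/-- The `1`-form `dxⁱ`. -/
def dx {m : ℕ} (i : Fin (2 * m + 1)) : Model m [⋀^Fin 1]→L[ℝ] ℂ :=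
  oneForm (EuclideanSpace.proj i)

/-! ## Sections of the bundle `W ⊗ Λ_n` -/

/-- A family `a x k l : y ↦ a_{k,(l)}(x, y, dx)`: the coefficient at `ν^k` of the part of `y`-degree
`l` of an `n`-form with values in the bundle of formal Wick algebras.  The sections of `W ⊗ Λ_n` are
those families that satisfy `IsSection` below. -/
abbrev WForm (m : ℕ) (M : Type*) (n : ℕ) : Type _ :=
  M → ℕ → ℕ → Model m → Model m [⋀^Fin n]→L[ℝ] ℂ

section Manifold

variable {m : ℕ} {M : Type*} [TopologicalSpace M] [ChartedSpace (Model m) M]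
  [IsManifold (𝓡 (2 * m + 1)) ∞ M]

/-- For `p` in the domain of the preferred chart at `x`, the map from the coordinates of tangent
vectors at `p` in that chart to `T_p M`: the vector `∑ vⁱ e_i` goes to `∑ vⁱ ∂/∂xⁱ`. -/
def frameMap (x p : M) : Model m →L[ℝ] Model m :=
  (trivializationAt (Model m) (TangentSpace (𝓡 (2 * m + 1)) : M → Type _) x).symmL ℝ p

/-- The coordinate vector field `∂/∂xʲ` of the preferred chart at `x`. -/
def coordField (x : M) (j : Fin (2 * m + 1)) : Π p : M, TangentSpace (𝓡 (2 * m + 1)) p :=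
  fun p => frameMap x p (e j)

/-- The expression of `a` in the preferred chart at `x`: `u` is the base point and `y` the fibre
point, both in the coordinates of this chart. -/
def inChart {n : ℕ} (a : WForm m M n) (x : M) (k l : ℕ) (u y : Model m) :
    Model m [⋀^Fin n]→L[ℝ] ℂ :=
  let p := (extChartAt (𝓡 (2 * m + 1)) x).symm u
  (a p k l (frameMap x p y)).compContinuousLinearMap (frameMap x p)

/-- `a ∈ 𝒲 ⊗ Λ_n`: each `a x k l` is a homogeneous polynomial of degree `l` in `y`, and its
coefficients are smooth functions of the base point in every chart. -/
structure IsSection {n : ℕ} (a : WForm m M n) : Prop where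
  polynomial : ∀ x k l, ∃ A : ContinuousMultilinearMap ℝ (fun _ : Fin l => Model m)
    (Model m [⋀^Fin n]→L[ℝ] ℂ), ∀ y, a x k l y = A fun _ => y
  smooth : ∀ x k l, ContDiffOn ℝ ∞
    (fun z : Model m × Model m => inChart a x k l z.1 z.2)
    ((extChartAt (𝓡 (2 * m + 1)) x).target ×ˢ Set.univ)

/-- `a ∈ F^d 𝒲 ⊗ Λ_n`: only terms with `ν`-degree at least `d`, where `ν` has degree `2` and the
`y`'s have degree `1`. -/
def InFiltration {n : ℕ} (d : ℕ) (a : WForm m M n) : Prop :=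
  ∀ x k l, 2 * k + l < d → a x k l = 0

/-- `δ = dxⁱ ∧ ∂/∂yⁱ`. -/
def delta {n : ℕ} (a : WForm m M n) : WForm m M (n + 1) := fun x k l y =>
  ∑ i, wedge (Nat.add_comm 1 n) (dx i) (fderiv ℝ (a x k (l + 1)) y (e i))

/-- Division by `ν` (applied only to elements without a term of order `ν⁰`). -/
def divNu {n : ℕ} (a : WForm m M n) : WForm m M n := fun x k => a x (k + 1)

/-! ### Affine connections -/

/-- Affine connections on `M`. -/
abbrev AffineConnection (m : ℕ) (M : Type*) [TopologicalSpace M] [ChartedSpace (Model m) M]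
    [IsManifold (𝓡 (2 * m + 1)) ∞ M] : Type _ :=
  CovariantDerivative (𝓡 (2 * m + 1)) (Model m) (TangentSpace (𝓡 (2 * m + 1)) : M → Type _)

/-- The coefficients `Γ^c_{ji}` of the connection at `x`, `∇_{∂/∂xⁱ} ∂/∂xʲ = Γ^c_{ji} ∂/∂xᶜ`. -/
def christoffel (cov : AffineConnection m M) (x : M) (c j i : Fin (2 * m + 1)) : ℝ :=
  coord (cov (coordField x j) x (e i)) c

/-- The torsion components `T^j_{kl}`, defined by
`[∇_k, ∇_l] v^i = R^i_{jkl} v^j + T^j_{kl} ∇_j v^i`. In this convention `T^j_{kl}` are the components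
of minus the usual torsion tensor, `T^j_{kl} = Γ^j_{kl} - Γ^j_{lk}`. -/
def torsionComp (cov : AffineConnection m M) (x : M) (j k l : Fin (2 * m + 1)) : ℝ :=
  -coord (cov.torsion x (e k) (e l)) j

/-- The curvature components `R^i_{jkl}`, defined by
`[∇_k, ∇_l] v^i = R^i_{jkl} v^j + T^j_{kl} ∇_j v^i`, that is,
`R(∂_k, ∂_l) ∂_j = ∇_k (∇_l ∂_j) - ∇_l (∇_k ∂_j) = R^i_{jkl} ∂_i` (coordinate fields commute). -/
def curvatureComp (cov : AffineConnection m M) (x : M) (i j k l : Fin (2 * m + 1)) : ℝ :=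
  coord (cov (fun p => cov (coordField x j) p (coordField x l p)) x (e k)) i
    - coord (cov (fun p => cov (coordField x j) p (coordField x k p)) x (e l)) i

/-- The exterior covariant derivative
`d_∇ a = dxⁱ ∧ (∂a/∂xⁱ - yʲ Γ^c_{ji} ∂a/∂yᶜ)`, computed at `x` in the preferred chart at `x`. -/
def dNabla (cov : AffineConnection m M) {n : ℕ} (a : WForm m M n) : WForm m M (n + 1) :=
  fun x k l y => ∑ i, wedge (Nat.add_comm 1 n) (dx i)
    (fderiv ℝ (fun u => inChart a x k l u y) (extChartAt (𝓡 (2 * m + 1)) x x) (e i)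
      - ∑ j, ∑ c, (coord y j * christoffel cov x c j i) • fderiv ℝ (a x k l) y (e c))

/-- Differentiability at `x` of a vector field. -/
def DiffAt (Y : Π x : M, TangentSpace (𝓡 (2 * m + 1)) x) (x : M) : Prop :=
  MDifferentiableAt (𝓡 (2 * m + 1)) ((𝓡 (2 * m + 1)).prod 𝓘(ℝ, Model m))
    (fun p => TotalSpace.mk' (Model m) (E := fun p => TangentSpace (𝓡 (2 * m + 1)) p) p (Y p)) x

/-! ### Contact metric structures -/

/-- The exterior derivative of a `1`-form on `M`, `dλ(X, Y) = (∂_i λ_j - ∂_j λ_i) Xⁱ Yʲ`. -/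
def extDerivOne (lam : Π x : M, TangentSpace (𝓡 (2 * m + 1)) x →L[ℝ] ℝ) (x : M)
    (X Y : TangentSpace (𝓡 (2 * m + 1)) x) : ℝ :=
  extDeriv (fun u : Model m =>
    let p := (extChartAt (𝓡 (2 * m + 1)) x).symm u
    ContinuousAlternatingMap.ofSubsingleton ℝ (Model m) ℝ (0 : Fin 1)
      (ContinuousLinearMap.comp (lam p : Model m →L[ℝ] ℝ) (frameMap x p)))
    (extChartAt (𝓡 (2 * m + 1)) x x) ![(X : Model m), (Y : Model m)]

end Manifold

/-- A contact metric structure `(φ, ξ, λ, g)` on a manifold of dimension `2m + 1`.  That `λ` is a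
contact form follows from the other relations, see `ContactMetricStructure.isContact`. -/
structure ContactMetricStructure (m : ℕ) (M : Type*) [TopologicalSpace M]
    [ChartedSpace (Model m) M] [IsManifold (𝓡 (2 * m + 1)) ∞ M] where
  /-- The contact form `λ`. -/
  lam : Π x : M, TangentSpace (𝓡 (2 * m + 1)) x →L[ℝ] ℝ
  /-- The Reeb vector field `ξ`. -/
  reeb : Π x : M, TangentSpace (𝓡 (2 * m + 1)) x
  /-- The tensor field `φ` of type `(1, 1)`. -/
  phi : Π x : M, TangentSpace (𝓡 (2 * m + 1)) x →L[ℝ] TangentSpace (𝓡 (2 * m + 1)) x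
  /-- The associated Riemannian metric `g`. -/
  g : ContMDiffRiemannianMetric (𝓡 (2 * m + 1)) ∞ (Model m)
    (TangentSpace (𝓡 (2 * m + 1)) : M → Type _)
  lam_smooth : ContMDiff (𝓡 (2 * m + 1)) ((𝓡 (2 * m + 1)).prod 𝓘(ℝ, Model m →L[ℝ] ℝ)) ∞
    (fun x => TotalSpace.mk' (Model m →L[ℝ] ℝ)
      (E := fun x => TangentSpace (𝓡 (2 * m + 1)) x →L[ℝ] ℝ) x (lam x))
  reeb_smooth : ContMDiff (𝓡 (2 * m + 1)) ((𝓡 (2 * m + 1)).prod 𝓘(ℝ, Model m)) ∞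
    (fun x => TotalSpace.mk' (Model m)
      (E := fun x => TangentSpace (𝓡 (2 * m + 1)) x) x (reeb x))
  phi_smooth : ContMDiff (𝓡 (2 * m + 1))
    ((𝓡 (2 * m + 1)).prod 𝓘(ℝ, Model m →L[ℝ] Model m)) ∞
    (fun x => TotalSpace.mk' (Model m →L[ℝ] Model m)
      (E := fun x => TangentSpace (𝓡 (2 * m + 1)) x →L[ℝ] TangentSpace (𝓡 (2 * m + 1)) x)
      x (phi x))
  /-- `i_ξ λ = 1`. -/
  lam_reeb : ∀ x, lam x (reeb x) = 1
  /-- `i_ξ ω = 0` for `ω = dλ`. -/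
  omega_reeb : ∀ x X, extDerivOne lam x (reeb x) X = 0
  lam_eq : ∀ x X, lam x X = g.inner x X (reeb x)
  /-- `ω(X, Y) = g(X, φ Y)` for `ω = dλ`. -/
  omega_eq : ∀ x X Y, extDerivOne lam x X Y = g.inner x X (phi x Y)
  inner_phi_phi : ∀ x X Y,
    g.inner x (phi x X) (phi x Y) = g.inner x X Y - lam x X * lam x Y
  phi_phi : ∀ x X, phi x (phi x X) = -X + lam x X • reeb x
  phi_reeb : ∀ x, phi x (reeb x) = 0
  lam_phi : ∀ x X, lam x (phi x X) = 0

namespace ContactMetricStructure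

variable {m : ℕ} {M : Type*} [TopologicalSpace M] [ChartedSpace (Model m) M]
  [IsManifold (𝓡 (2 * m + 1)) ∞ M] (S : ContactMetricStructure m M)

/-- `λ ∧ (dλ)^m ≠ 0` everywhere: `λ ≠ 0` and `dλ` is non-degenerate on `ker λ`. -/
theorem isContact (x : M) : S.lam x ≠ 0 ∧ ∀ X, S.lam x X = 0 →
    (∀ Y, S.lam x Y = 0 → extDerivOne S.lam x X Y = 0) → X = 0 := by
  refine ⟨fun h => by simpa [h] using S.lam_reeb x, fun X hX h => ?_⟩
  by_contra hne
  have h1 := h (S.phi x X) (S.lam_phi x X)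
  rw [S.omega_eq, S.phi_phi, hX, zero_smul, add_zero, map_neg, neg_eq_zero] at h1
  exact (S.g.pos x X hne).ne' h1

/-- The components `ω_{ij}` of `ω = dλ`. -/
def omegaComp (x : M) (i j : Fin (2 * m + 1)) : ℝ := extDerivOne S.lam x (e i) (e j)

/-- The components `g_{ij}` of the metric. -/
def gMatrix (x : M) : Matrix (Fin (2 * m + 1)) (Fin (2 * m + 1)) ℝ :=
  Matrix.of fun i j => S.g.inner x (e i) (e j)

/-- The components of the Wick tensor, `h^{ij} = g^{ij} + i π^{ij}` with `π^{ij} = g^{ik} φ^j_k`;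
that is, `h(α, β) = ḡ(α, β + i φᵗ β)`. -/
def wick (x : M) (i j : Fin (2 * m + 1)) : ℂ :=
  (((S.gMatrix x)⁻¹ i j : ℝ) : ℂ)
    + Complex.I * ((∑ k, (S.gMatrix x)⁻¹ i k * coord (S.phi x (e k)) j : ℝ) : ℂ)

/-- The Wick product `(a ∘ b)(y) = exp((ν/2) h^{ij} ∂²/∂yⁱ∂zʲ) a(y) b(z) |_{z = y}` of a `p`-form and
a `q`-form, with coefficients multiplied by the wedge product. -/
def circ {p q N : ℕ} (h : p + q = N) (a : WForm m M p) (b : WForm m M q) : WForm m M N :=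
  fun x k l y =>
    ∑ s ∈ Finset.range (k + 1), ∑ ks ∈ Finset.HasAntidiagonal.antidiagonal (k - s),
      ∑ ls ∈ Finset.HasAntidiagonal.antidiagonal l, ∑ I : Fin s → Fin (2 * m + 1),
        ∑ J : Fin s → Fin (2 * m + 1),
          ((1 / (s.factorial : ℂ)) * (1 / 2) ^ s * ∏ t, S.wick x (I t) (J t)) •
            wedge h (iteratedFDeriv ℝ s (a x ks.1 (ls.1 + s)) y fun t => e (I t))
              (iteratedFDeriv ℝ s (b x ks.2 (ls.2 + s)) y fun t => e (J t))

/-- The graded commutator `[r, a] = r ∘ a - (-1)ⁿ a ∘ r` of a `1`-form and an `n`-form. -/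
def comm {n : ℕ} (r : WForm m M 1) (a : WForm m M n) : WForm m M (n + 1) :=
  S.circ (Nat.add_comm 1 n) r a - (-1 : ℂ) ^ n • S.circ rfl a r

/-- `ξ`-transversality, `ξⁱ ∂a/∂yⁱ = 0`. -/
def IsTransverse {n : ℕ} (a : WForm m M n) : Prop :=
  ∀ x k l y, fderiv ℝ (a x k l) y (S.reeb x : Model m) = 0

/-- `a ∈ F^d 𝒲^ξ ⊗ Λ_n`; for `d = 0` this is `𝒲^ξ ⊗ Λ_n`. -/
structure MemTransverse {n : ℕ} (d : ℕ) (a : WForm m M n) : Prop where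
  isSection : IsSection a
  transverse : S.IsTransverse a
  filtration : InFiltration d a

/-- The projection `P = id - ξ ⊗ λ` of `T_x M` onto `ker λ`. -/
def proj (x : M) (y : Model m) : Model m :=
  let ξ : Model m := S.reeb x
  y - S.lam x y • ξ

/-- The component `a'' = λ ∧ i_ξ a` of a form in `Λ^λ`; the component in `Λ^ξ` is
`a' = a - λ ∧ i_ξ a`. -/
def lamPart {n : ℕ} (x : M) (α : Model m [⋀^Fin (n + 1)]→L[ℝ] ℂ) :
    Model m [⋀^Fin (n + 1)]→L[ℝ] ℂ :=
  wedge (Nat.add_comm 1 n) (oneForm (S.lam x)) (α.curryLeft (S.reeb x : Model m))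

/-- The operator `δ⁻¹`.  With `δ* = yⁱ P_i^j i_{∂/∂xʲ}`, the interior product with the vector `P y`,
it maps `a'` of `y`-degree `l` and form degree `n + 1` to `(l + n + 1)⁻¹ δ* a'`, and `a''` to
`(l + n)⁻¹ δ* a''` (to `0` if `l + n = 0`).  On `0`-forms it vanishes. -/
def deltaInv {n : ℕ} (a : WForm m M (n + 1)) : WForm m M n
  | _, _, 0, _ => 0
  | x, k, l + 1, y =>
    ((l : ℂ) + n + 1)⁻¹ • (a x k l y - S.lamPart x (a x k l y)).curryLeft (S.proj x y)
      + ((l : ℂ) + n)⁻¹ • (S.lamPart x (a x k l y)).curryLeft (S.proj x y)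

/-- The formal function `(i_ξ r)|_{y = 0}` (coefficientwise in `ν`) of a `1`-form `r`. -/
def reebPart (r : WForm m M 1) : M → ℕ → ℂ := fun x k => r x k 0 0 fun _ => (S.reeb x : Model m)

/-- The form `ω = ½ ω_{ij} dxⁱ ∧ dxʲ`, of degree `0` in `ν` and in `y`. -/
def omegaForm : WForm m M 2
  | x, 0, 0, _ => (1 / 2 : ℂ) • ∑ i, ∑ j, S.omegaComp x i j • wedge rfl (dx i) (dx j)
  | _, _, _, _ => 0

/-- `T = ½ T_{kij} yᵏ dxⁱ ∧ dxʲ` with `T_{kij} = ω_{kn} T^n_{ij}`. -/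
def torsionForm (cov : AffineConnection m M) : WForm m M 2
  | x, 0, 1, y => (1 / 2 : ℂ) • ∑ k, ∑ i, ∑ j,
      (coord y k * ∑ n, S.omegaComp x k n * torsionComp cov x n i j) • wedge rfl (dx i) (dx j)
  | _, _, _, _ => 0

/-- `R = -¼ R_{ijkl} yⁱ yʲ dxᵏ ∧ dxˡ` with `R_{ijkl} = ω_{in} R^n_{jkl}`.  The sign is the one for
which `d_∇² = (i/ν) [R, ·]` and `δ R = d_∇ T`. -/
def curvatureForm (cov : AffineConnection m M) : WForm m M 2
  | x, 0, 2, y => (-1 / 4 : ℂ) • ∑ i, ∑ j, ∑ k, ∑ l,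
      (coord y i * coord y j * ∑ n, S.omegaComp x i n * curvatureComp cov x n j k l) •
        wedge rfl (dx k) (dx l)
  | _, _, _, _ => 0

/-- Contact metric connections: smooth affine connections for which `λ`, `ξ`, `ω`, `g` and `φ` are
parallel. -/
structure IsContactMetricConnection (cov : AffineConnection m M) : Prop where
  smooth : CovariantDerivative.ContMDiffCovariantDerivative cov ∞
  nabla_lam : ∀ (Y : Π x : M, TangentSpace (𝓡 (2 * m + 1)) x) (x : M), DiffAt Y x →
    ∀ v, mvfderiv (𝓡 (2 * m + 1)) (fun p => S.lam p (Y p)) x v = S.lam x (cov Y x v)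
  nabla_reeb : ∀ x, cov S.reeb x = 0
  nabla_omega : ∀ (Y Z : Π x : M, TangentSpace (𝓡 (2 * m + 1)) x) (x : M),
    DiffAt Y x → DiffAt Z x →
    ∀ v, mvfderiv (𝓡 (2 * m + 1)) (fun p => extDerivOne S.lam p (Y p) (Z p)) x v
      = extDerivOne S.lam x (cov Y x v) (Z x) + extDerivOne S.lam x (Y x) (cov Z x v)
  nabla_g : ∀ (Y Z : Π x : M, TangentSpace (𝓡 (2 * m + 1)) x) (x : M),
    DiffAt Y x → DiffAt Z x →
    ∀ v, mvfderiv (𝓡 (2 * m + 1)) (fun p => S.g.inner p (Y p) (Z p)) x v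
      = S.g.inner x (cov Y x v) (Z x) + S.g.inner x (Y x) (cov Z x v)
  nabla_phi : ∀ (Y : Π x : M, TangentSpace (𝓡 (2 * m + 1)) x) (x : M), DiffAt Y x →
    ∀ v, cov (fun p => S.phi p (Y p)) x v = S.phi x (cov Y x v)

/-! ## Fedosov connections -/

/-- `(i/ν) r ∘ r` (the term of order `ν⁰` of `r ∘ r` vanishes, `r` being a `1`-form). -/
def rr (r : WForm m M 1) : WForm m M 2 := Complex.I • divNu (S.circ rfl r r)

/-- The Fedosov connection `D a = d_∇ a - δ a + (i/ν) [r, a]`. -/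
def fedosov (cov : AffineConnection m M) (r : WForm m M 1) {n : ℕ} (a : WForm m M n) :
    WForm m M (n + 1) :=
  dNabla cov a - delta a + Complex.I • divNu (S.comm r a)

/-- The Weyl curvature `Ω = ω - δ r + T + R + d_∇ r + (i/ν) r ∘ r`. -/
def weylCurvature (cov : AffineConnection m M) (r : WForm m M 1) : WForm m M 2 :=
  S.omegaForm - delta r + S.torsionForm cov + S.curvatureForm cov + dNabla cov r + S.rr r

/-- `D` is abelian: `D² = 0` on `𝒲^ξ ⊗ Λ`. -/
def IsAbelian (cov : AffineConnection m M) (r : WForm m M 1) : Prop :=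
  ∀ (n : ℕ) (a : WForm m M n), S.MemTransverse 0 a →
    S.fedosov cov r (S.fedosov cov r a) = 0

/-- The map `r ↦ δ⁻¹(T + R) + δ⁻¹(d_∇ r + (i/ν) r ∘ r)`. -/
def iterMap (cov : AffineConnection m M) (r : WForm m M 1) : WForm m M 1 :=
  S.deltaInv (S.torsionForm cov + S.curvatureForm cov) + S.deltaInv (dNabla cov r + S.rr r)

end ContactMetricStructure

end WickFedosov

end

open scoped Manifold ContDiff Topology TensorProduct
open Bundle

noncomputable section

namespace WickFedosov

/-! ## The algebra of alternating forms -/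

section Forms

variable {m : ℕ}

/-! This is Fedosov's construction carried out transversally to the Reeb field. Everything rests on
the one-form s = ω_{ij} yⁱ dxʲ (`solder`). The antisymmetric part of the Wick tensor h is i times a
real tensor whose contraction with ω is -1 + ξ ⊗ λ, and the term ξ ⊗ λ is invisible to ξ-transverse
elements. Hence (i/ν)[s, ·] = δ on such elements (`fib_bracket_solder`), (i/ν) s ∘ s = ω
(`sq_solder`) and d_∇ s = -T (`torsionForm_eq`). With ρ = r - s the connection becomes D = d_∇ +
(i/ν)[ρ, ·] and its Weyl curvature Ω = R + d_∇ρ + (i/ν) ρ ∘ ρ (`fedosov_eq`, `weylCurvature_eq`).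

Three facts then give D² = (i/ν)[Ω, ·] and the Bianchi identity δ(Ω - ω) = d_∇(Ω - ω) + (i/ν)[r, Ω -
ω]: the product is associative (`circ_assoc`); d_∇ is a graded derivation of it because h is
parallel (`fib_dNabla_circ`); and d_∇² = (i/ν)[R, ·] (`fib_dNabla_dNabla_eq_br`). In the last one R
is quadratic in y, so its commutator could contain a second-order contraction. That term vanishes
because the curvature endomorphisms are skew for both g and ω (`sum_wickTensor_comm`). The form ω
does not depend on y and is therefore central, so Ω = ω implies D² = 0.

The equation is solved with the Hodge decomposition δδ⁻¹ + δ⁻¹δ = id on transverse forms of positive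
form degree, in which the only exception is the λ-component of one-forms in y-degree zero
(`dl_dlInv_add_dlInv_dl`, `dl_dlInv_zero`). The operator δ⁻¹ raises the total degree by one, d_∇
preserves it, and on F² so do differences of (i/ν) r ∘ r. Thus `iterMap` is a contraction for the
complete filtration and has a unique fixed point r, the limit of the iteration. Since δ⁻¹δ⁻¹ = 0 and
the image of δ⁻¹ has no component of y-degree zero, r is normalised. For A = Ω - ω one finds δ⁻¹A =
0, so A = δ⁻¹δA = δ⁻¹(d_∇A + (i/ν)[r, A]) by the Bianchi identity. The right-hand side has higher
degree than A, hence A = 0. The same degree argument for the difference of two normalised solutions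
with equal i_ξ r at y = 0 gives uniqueness.

Identities are verified fibrewise, at the centre of the preferred chart of each point (`fib`).
Differentiating requires the expression of a section in one fixed chart (`loc`), and the two are
linked by naturality under coordinate changes (`loc_dNabla`, `curv_center`, `wick_eq_wickLoc`). -/

/-- The space of complex-valued alternating `n`-forms on the model space. -/
abbrev Alt (m n : ℕ) : Type := Model m [⋀^Fin n]→L[ℝ] ℂ

/-- The identification of `p + q` slots with `N` slots used in the wedge product. -/
def slots {p q N : ℕ} (h : p + q = N) : Fin p ⊕ Fin q ≃ Fin N :=
  finSumFinEquiv.trans (finCongr h)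

theorem slots_inl {p q N : ℕ} (h : p + q = N) (i : Fin p) : (slots h (.inl i) : ℕ) = i := by
  simp [slots]

theorem slots_inr {p q N : ℕ} (h : p + q = N) (i : Fin q) : (slots h (.inr i) : ℕ) = p + i := by
  simp [slots]

/-- The shuffles are replaced by all permutations, each shuffle being counted p! q! times.
Identities for the wedge product can then be proved by reindexing a sum over a group, after
multiplication by the nonzero constant p! q!. -/
theorem wedge_apply_eq_sum {p q N : ℕ} (h : p + q = N) (α : Alt m p) (β : Alt m q)
    (v : Fin N → Model m) :
    ((p.factorial * q.factorial : ℕ) : ℂ) * wedge h α β v =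
      ∑ σ : Equiv.Perm (Fin N), ((Equiv.Perm.sign σ : ℤ) : ℂ) *
        (α (fun i => v (σ (slots h (.inl i)))) * β (fun i => v (σ (slots h (.inr i))))) := by
  have key := MultilinearMap.domCoprod_alternization_eq α.toAlternatingMap β.toAlternatingMap
  have key2 := congrArg (fun f => LinearMap.mul' ℝ ℂ (f (v ∘ slots h))) key
  simp only [Fintype.card_fin, AlternatingMap.smul_apply, map_nsmul] at key2
  have h1 : wedge h α β v = (LinearMap.mul' ℝ ℂ)
    (α.toAlternatingMap.domCoprod β.toAlternatingMap (v ∘ slots h)) := rfl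
  rw [h1, ← nsmul_eq_mul, ← key2, MultilinearMap.alternatization_apply, map_sum,
    ← (Equiv.permCongr (slots h)).sum_comp]
  refine Finset.sum_congr rfl fun σ _ => ?_
  rw [Equiv.Perm.sign_permCongr]
  have : ∀ (z : ℤˣ) (x : ℂ ⊗[ℝ] ℂ), LinearMap.mul' ℝ ℂ (z • x) = ((z : ℤ) : ℂ) *
      LinearMap.mul' ℝ ℂ x := by
    intro z x
    rw [Units.smul_def, map_zsmul, zsmul_eq_mul]
  rw [this]
  simp [MultilinearMap.domCoprod_apply, Function.comp_def]

theorem fact_ne (p q : ℕ) : ((p.factorial * q.factorial : ℕ) : ℂ) ≠ 0 :=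
  Nat.cast_ne_zero.2 (mul_ne_zero p.factorial_ne_zero q.factorial_ne_zero)

theorem wedge_add_left {p q N : ℕ} (h : p + q = N) (α α' : Alt m p) (β : Alt m q) :
    wedge h (α + α') β = wedge h α β + wedge h α' β := by
  ext v
  apply mul_left_cancel₀ (fact_ne p q)
  rw [ContinuousAlternatingMap.add_apply, mul_add]
  simp only [wedge_apply_eq_sum, ← Finset.sum_add_distrib, ContinuousAlternatingMap.add_apply]
  exact Finset.sum_congr rfl fun _ _ => by ring

theorem wedge_add_right {p q N : ℕ} (h : p + q = N) (α : Alt m p) (β β' : Alt m q) :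
    wedge h α (β + β') = wedge h α β + wedge h α β' := by
  ext v
  apply mul_left_cancel₀ (fact_ne p q)
  rw [ContinuousAlternatingMap.add_apply, mul_add]
  simp only [wedge_apply_eq_sum, ← Finset.sum_add_distrib, ContinuousAlternatingMap.add_apply]
  exact Finset.sum_congr rfl fun _ _ => by ring

theorem wedge_smul_left {p q N : ℕ} (h : p + q = N) (c : ℂ) (α : Alt m p) (β : Alt m q) :
    wedge h (c • α) β = c • wedge h α β := by
  ext v
  apply mul_left_cancel₀ (fact_ne p q)
  rw [ContinuousAlternatingMap.smul_apply, smul_eq_mul, mul_left_comm]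
  simp only [wedge_apply_eq_sum, Finset.mul_sum, ContinuousAlternatingMap.smul_apply]
  exact Finset.sum_congr rfl fun _ _ => by simp only [smul_eq_mul]; ring

theorem wedge_smul_right {p q N : ℕ} (h : p + q = N) (c : ℂ) (α : Alt m p) (β : Alt m q) :
    wedge h α (c • β) = c • wedge h α β := by
  ext v
  apply mul_left_cancel₀ (fact_ne p q)
  rw [ContinuousAlternatingMap.smul_apply, smul_eq_mul, mul_left_comm]
  simp only [wedge_apply_eq_sum, Finset.mul_sum, ContinuousAlternatingMap.smul_apply]
  exact Finset.sum_congr rfl fun _ _ => by simp only [smul_eq_mul]; ring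

/-- The wedge product as a bilinear map over `ℂ`. -/
def wedgeL {p q N : ℕ} (h : p + q = N) : Alt m p →ₗ[ℂ] Alt m q →ₗ[ℂ] Alt m N :=
  LinearMap.mk₂ ℂ (wedge h) (wedge_add_left h) (wedge_smul_left h) (wedge_add_right h)
    (fun c α β => wedge_smul_right h c α β)

@[simp] theorem wedgeL_apply {p q N : ℕ} (h : p + q = N) (α : Alt m p) (β : Alt m q) :
    wedgeL h α β = wedge h α β := rfl

/-- After multiplication by p! q! r! both sides are the full antisymmetrisation of the product of α,
β and γ over all N slots. -/
theorem wedge_assoc {p q r a b N : ℕ} (h1 : p + q = a) (h2 : a + r = N) (h3 : q + r = b)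
    (h4 : p + b = N) (α : Alt m p) (β : Alt m q) (γ : Alt m r) :
    wedge h2 (wedge h1 α β) γ = wedge h4 α (wedge h3 β γ) := by
  ext v
  have hz : ((p.factorial * q.factorial * r.factorial : ℕ) : ℂ) ≠ 0 :=
    Nat.cast_ne_zero.2 (by positivity)
  apply mul_left_cancel₀ hz
  have hL : ((p.factorial * q.factorial * r.factorial : ℕ) : ℂ) * wedge h2 (wedge h1 α β) γ v =
      ∑ σ : Equiv.Perm (Fin N), ((Equiv.Perm.sign σ : ℤ) : ℂ) *
        (α (fun i => v (σ (slots h2 (.inl (slots h1 (.inl i)))))) *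
          β (fun i => v (σ (slots h2 (.inl (slots h1 (.inr i)))))) *
          γ (fun i => v (σ (slots h2 (.inr i))))) := by
    have ha : ((a.factorial : ℕ) : ℂ) ≠ 0 := Nat.cast_ne_zero.2 a.factorial_ne_zero
    apply mul_left_cancel₀ ha
    have e1 := wedge_apply_eq_sum h2 (wedge h1 α β) γ v
    calc _ = ((p.factorial * q.factorial : ℕ) : ℂ) * (((a.factorial * r.factorial : ℕ) : ℂ) *
          wedge h2 (wedge h1 α β) γ v) := by push_cast; ring
      _ = ∑ σ : Equiv.Perm (Fin N), ((Equiv.Perm.sign σ : ℤ) : ℂ) *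
          ((((p.factorial * q.factorial : ℕ) : ℂ) *
            wedge h1 α β (fun i => v (σ (slots h2 (.inl i))))) *
          γ (fun i => v (σ (slots h2 (.inr i))))) := by
        rw [e1, Finset.mul_sum]
        exact Finset.sum_congr rfl fun _ _ => by ring
      _ = ∑ τ : Equiv.Perm (Fin a), ∑ σ : Equiv.Perm (Fin N), ((Equiv.Perm.sign σ : ℤ) : ℂ) *
          (((Equiv.Perm.sign τ : ℤ) : ℂ) *
          (α (fun i => v (σ (slots h2 (.inl (τ (slots h1 (.inl i))))))) *
          β (fun i => v (σ (slots h2 (.inl (τ (slots h1 (.inr i))))))) *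
          γ (fun i => v (σ (slots h2 (.inr i)))))) := by
        rw [Finset.sum_comm]
        refine Finset.sum_congr rfl fun σ _ => ?_
        rw [wedge_apply_eq_sum, Finset.sum_mul, Finset.mul_sum]
        exact Finset.sum_congr rfl fun _ _ => by ring
      _ = ∑ τ : Equiv.Perm (Fin a), ∑ σ : Equiv.Perm (Fin N), ((Equiv.Perm.sign σ : ℤ) : ℂ) *
        (α (fun i => v (σ (slots h2 (.inl (slots h1 (.inl i)))))) *
          β (fun i => v (σ (slots h2 (.inl (slots h1 (.inr i)))))) *
          γ (fun i => v (σ (slots h2 (.inr i))))) := by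
        refine Finset.sum_congr rfl fun τ _ => ?_
        -- For fixed τ the translation σ ↦ σ (τ ⊕ id) absorbs τ. The sign of τ occurs twice and
        -- cancels, so the sum over τ consists of a! equal terms.
        conv_rhs => rw [← Equiv.sum_comp (Equiv.mulRight
          ((slots h2).permCongr (Equiv.sumCongr τ (Equiv.refl (Fin r)))))]
        refine Finset.sum_congr rfl fun σ _ => ?_
        simp only [Equiv.coe_mulRight, Equiv.Perm.sign_mul, Equiv.Perm.sign_permCongr,
          Equiv.Perm.sign_sumCongr, Equiv.Perm.sign_refl, mul_one, Units.val_mul, Int.cast_mul,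
          Equiv.Perm.mul_apply, Equiv.permCongr_apply, Equiv.symm_apply_apply,
          Equiv.sumCongr_apply, Sum.map_inl, Sum.map_inr, Equiv.refl_apply]
        ring
      _ = _ := by
        rw [Finset.sum_const, Finset.card_univ, Fintype.card_perm, Fintype.card_fin, nsmul_eq_mul]
  have hR : ((p.factorial * q.factorial * r.factorial : ℕ) : ℂ) * wedge h4 α (wedge h3 β γ) v =
      ∑ σ : Equiv.Perm (Fin N), ((Equiv.Perm.sign σ : ℤ) : ℂ) *
        (α (fun i => v (σ (slots h4 (.inl i)))) *
          β (fun i => v (σ (slots h4 (.inr (slots h3 (.inl i)))))) *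
          γ (fun i => v (σ (slots h4 (.inr (slots h3 (.inr i))))))) := by
    have hb : ((b.factorial : ℕ) : ℂ) ≠ 0 := Nat.cast_ne_zero.2 b.factorial_ne_zero
    apply mul_left_cancel₀ hb
    have e1 := wedge_apply_eq_sum h4 α (wedge h3 β γ) v
    calc _ = ((q.factorial * r.factorial : ℕ) : ℂ) * (((p.factorial * b.factorial : ℕ) : ℂ) *
          wedge h4 α (wedge h3 β γ) v) := by push_cast; ring
      _ = ∑ σ : Equiv.Perm (Fin N), ((Equiv.Perm.sign σ : ℤ) : ℂ) *
          (α (fun i => v (σ (slots h4 (.inl i)))) * (((q.factorial * r.factorial : ℕ) : ℂ) *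
            wedge h3 β γ (fun i => v (σ (slots h4 (.inr i)))))) := by
        rw [e1, Finset.mul_sum]
        exact Finset.sum_congr rfl fun _ _ => by ring
      _ = ∑ τ : Equiv.Perm (Fin b), ∑ σ : Equiv.Perm (Fin N), ((Equiv.Perm.sign σ : ℤ) : ℂ) *
          (((Equiv.Perm.sign τ : ℤ) : ℂ) *
          (α (fun i => v (σ (slots h4 (.inl i)))) *
          β (fun i => v (σ (slots h4 (.inr (τ (slots h3 (.inl i))))))) *
          γ (fun i => v (σ (slots h4 (.inr (τ (slots h3 (.inr i))))))))) := by
        rw [Finset.sum_comm]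
        refine Finset.sum_congr rfl fun σ _ => ?_
        rw [wedge_apply_eq_sum, Finset.mul_sum, Finset.mul_sum]
        exact Finset.sum_congr rfl fun _ _ => by ring
      _ = ∑ τ : Equiv.Perm (Fin b), ∑ σ : Equiv.Perm (Fin N), ((Equiv.Perm.sign σ : ℤ) : ℂ) *
        (α (fun i => v (σ (slots h4 (.inl i)))) *
          β (fun i => v (σ (slots h4 (.inr (slots h3 (.inl i)))))) *
          γ (fun i => v (σ (slots h4 (.inr (slots h3 (.inr i))))))) := by
        refine Finset.sum_congr rfl fun τ _ => ?_
        conv_rhs => rw [← Equiv.sum_comp (Equiv.mulRight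
          ((slots h4).permCongr (Equiv.sumCongr (Equiv.refl (Fin p)) τ)))]
        refine Finset.sum_congr rfl fun σ _ => ?_
        simp only [Equiv.coe_mulRight, Equiv.Perm.sign_mul, Equiv.Perm.sign_permCongr,
          Equiv.Perm.sign_sumCongr, Equiv.Perm.sign_refl, one_mul, Units.val_mul, Int.cast_mul,
          Equiv.Perm.mul_apply, Equiv.permCongr_apply, Equiv.symm_apply_apply,
          Equiv.sumCongr_apply, Sum.map_inl, Sum.map_inr, Equiv.refl_apply]
        ring
      _ = _ := by
        rw [Finset.sum_const, Finset.card_univ, Fintype.card_perm, Fintype.card_fin, nsmul_eq_mul]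
  rw [hL, hR]
  have i1 : ∀ i, slots h2 (.inl (slots h1 (.inl i))) = slots h4 (.inl i) := fun i => by
    ext; simp only [slots_inl]
  have i2 : ∀ i, slots h2 (.inl (slots h1 (.inr i))) = slots h4 (.inr (slots h3 (.inl i))) :=
    fun i => by ext; simp only [slots_inl, slots_inr]
  have i3 : ∀ i, slots h2 (.inr i) = slots h4 (.inr (slots h3 (.inr i))) :=
    fun i => by ext; simp only [slots_inr]; omega
  simp only [i1, i2, i3]

/-- The product of a `1`-form with a form, slot by slot. -/
theorem wedge_one_apply {q : ℕ} (h : 1 + q = q + 1) (θ : Alt m 1) (β : Alt m q)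
    (v : Fin (q + 1) → Model m) :
    wedge h θ β v = ∑ j : Fin (q + 1), (if j = 0 then 1 else -1) *
      (θ (fun _ => v j) * β (fun x => v (Equiv.swap 0 j x.succ))) := by
  apply mul_left_cancel₀ (fact_ne 1 q)
  -- A permutation of q + 1 slots is a transposition of 0 with some j times a permutation of the
  -- last q slots. The latter is absorbed by the antisymmetry of β and yields the factor q!.
  rw [wedge_apply_eq_sum, ← Equiv.Perm.decomposeFin.symm.sum_comp, Fintype.sum_prod_type,
    Finset.mul_sum]
  refine Finset.sum_congr rfl fun j _ => ?_
  have e0 : ∀ i, slots h (.inl i) = 0 := fun i => by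
    ext; rw [slots_inl]; simp
  have e1 : ∀ i, slots h (.inr i) = i.succ := fun i => by
    ext; rw [slots_inr]; simp [add_comm]
  simp only [e0, e1, Equiv.Perm.decomposeFin_symm_apply_zero,
    Equiv.Perm.decomposeFin_symm_apply_succ, Equiv.Perm.decomposeFin.symm_sign]
  have : ∀ e : Equiv.Perm (Fin q), β (fun i => v (Equiv.swap 0 j (e i).succ)) =
      ((Equiv.Perm.sign e : ℤ) : ℂ) * β (fun x => v (Equiv.swap 0 j x.succ)) := by
    intro e
    have := β.toAlternatingMap.map_perm (fun x => v (Equiv.swap 0 j x.succ)) e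
    rw [Units.smul_def, zsmul_eq_mul] at this
    exact this
  simp only [this]
  have hs : ∀ e : Equiv.Perm (Fin q), ((Equiv.Perm.sign e : ℤ) : ℂ) * (Equiv.Perm.sign e : ℤ) = 1 :=
    fun e => by rcases Int.units_eq_one_or (Equiv.Perm.sign e) with h | h <;> simp [h]
  calc _ = ∑ e : Equiv.Perm (Fin q), (((Equiv.Perm.sign e : ℤ) : ℂ) * (Equiv.Perm.sign e : ℤ)) *
        ((if j = 0 then 1 else -1) *
      (θ (fun _ => v j) * β (fun x => v (Equiv.swap 0 j x.succ)))) := by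
        refine Finset.sum_congr rfl fun e _ => ?_
        split_ifs <;> push_cast <;> ring
    _ = _ := by
      simp only [hs, one_mul]
      rw [Finset.sum_const, Finset.card_univ, Fintype.card_perm, Fintype.card_fin, nsmul_eq_mul]
      simp

/-- The interior product. -/
def inner {n : ℕ} (v : Model m) : Alt m (n + 1) →ₗ[ℂ] Alt m n where
  toFun α := α.curryLeft v
  map_add' α β := by ext; simp
  map_smul' c α := by ext; simp

theorem inner_apply {n : ℕ} (v : Model m) (α : Alt m (n + 1)) (w : Fin n → Model m) :
    inner v α w = α (Fin.cons v w) := rfl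

theorem curryLeft_eq_inner {n : ℕ} (v : Model m) (α : Alt m (n + 1)) : α.curryLeft v = inner v α :=
  rfl

theorem ext_inner {n : ℕ} {α β : Alt m (n + 1)} (h : ∀ v, inner v α = inner v β) : α = β := by
  ext w
  rw [← Fin.cons_self_tail w, ← inner_apply, ← inner_apply, h]

/-- The summand with j = 0 puts v into θ. In every other summand v sits in a slot of β, and moving
it to the front of β costs one transposition. -/
theorem inner_wedge_one {q : ℕ} (h : 1 + (q + 1) = q + 2) (h' : 1 + q = q + 1) (v : Model m)
    (θ : Alt m 1) (β : Alt m (q + 1)) :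
    inner v (wedge h θ β) = θ (fun _ => v) • β - wedge h' θ (inner v β) := by
  ext w
  rw [inner_apply, wedge_one_apply, Fin.sum_univ_succ, ContinuousAlternatingMap.sub_apply,
    ContinuousAlternatingMap.smul_apply, wedge_one_apply]
  simp only [if_true, one_mul, Equiv.swap_self, Equiv.refl_apply, Fin.cons_zero, Fin.cons_succ,
    Fin.succ_ne_zero, if_false, neg_mul, Finset.sum_neg_distrib, smul_eq_mul]
  rw [sub_eq_add_neg]
  congr 2
  refine Finset.sum_congr rfl fun j _ => ?_
  rw [inner_apply]
  have hc : ∀ x : Fin (q + 1), (Fin.cons v w : Fin (q + 2) → Model m)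
      (Equiv.swap 0 j.succ x.succ) = if x = j then v else w x := by
    intro x
    by_cases hx : x = j
    · subst hx; simp
    · rw [Equiv.swap_apply_of_ne_of_ne (Fin.succ_ne_zero x) (by simpa using hx), Fin.cons_succ,
        if_neg hx]
  simp only [hc]
  by_cases hj : j = 0
  · subst hj
    have : (fun x : Fin (q + 1) => if x = 0 then v else w x) =
        Fin.cons v fun x : Fin q => w x.succ := by
      ext x : 1
      refine Fin.cases ?_ (fun y => ?_) x <;> simp
    simp [this]
  · simp only [if_neg hj, neg_mul, one_mul]
    rw [← mul_neg]
    congr 1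
    have := β.toAlternatingMap.map_swap (fun x : Fin (q + 1) => if x = j then v else w x)
      (i := 0) (j := j) (Ne.symm hj)
    have h2 : ((fun x : Fin (q + 1) => if x = j then v else w x) ∘ Equiv.swap 0 j) =
        Fin.cons v fun x : Fin q => w (Equiv.swap 0 j x.succ) := by
      ext x : 1
      refine Fin.cases ?_ (fun y => ?_) x
      · simp
      · simp only [Function.comp_apply, Fin.cons_succ]
        rw [if_neg]
        intro h
        have := (Equiv.swap (0 : Fin (q + 1)) j).injective (h.trans (Equiv.swap_apply_left 0 j).symm)
        exact Fin.succ_ne_zero _ this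
    rw [h2] at this
    exact (neg_eq_iff_eq_neg.2 this).symm

theorem inner_wedge_one_zero (h : 1 + 0 = 1) (v : Model m) (θ : Alt m 1) (β : Alt m 0) :
    inner v (wedge h θ β) = θ (fun _ => v) • β := by
  ext w
  rw [inner_apply, wedge_one_apply]
  simp [Subsingleton.elim (fun x : Fin 0 => _) (Fin.elim0 : Fin 0 → Model m)]

end Forms

section Forms

variable {m : ℕ}

@[simp] theorem oneForm_apply (θ : Model m →L[ℝ] ℝ) (v : Fin 1 → Model m) :
    oneForm θ v = ((θ (v 0) : ℝ) : ℂ) := rfl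

@[simp] theorem dx_apply (i : Fin (2 * m + 1)) (v : Fin 1 → Model m) :
    dx i v = ((coord (v 0) i : ℝ) : ℂ) := rfl

theorem wedge_zero_left {q : ℕ} (h : 0 + q = q) (α : Alt m 0) (β : Alt m q) :
    wedge h α β = α Fin.elim0 • β := by
  ext v
  apply mul_left_cancel₀ (fact_ne 0 q)
  rw [wedge_apply_eq_sum]
  have e1 : ∀ i, slots h (.inr i) = i := fun i => by ext; rw [slots_inr]; simp
  have : ∀ σ : Equiv.Perm (Fin q), β (fun i => v (σ i)) = ((Equiv.Perm.sign σ : ℤ) : ℂ) * β v := by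
    intro σ
    have := β.toAlternatingMap.map_perm v σ
    rw [Units.smul_def, zsmul_eq_mul] at this
    exact this
  simp only [e1, this]
  have hs : ∀ e : Equiv.Perm (Fin q), ((Equiv.Perm.sign e : ℤ) : ℂ) * (Equiv.Perm.sign e : ℤ) = 1 :=
    fun e => by rcases Int.units_eq_one_or (Equiv.Perm.sign e) with h | h <;> simp [h]
  calc _ = ∑ σ : Equiv.Perm (Fin q), (((Equiv.Perm.sign σ : ℤ) : ℂ) * (Equiv.Perm.sign σ : ℤ)) *
        (α Fin.elim0 * β v) := by
        refine Finset.sum_congr rfl fun σ _ => ?_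
        rw [Subsingleton.elim (fun i : Fin 0 => v (σ (slots h (.inl i)))) Fin.elim0]; ring
    _ = _ := by
      simp only [hs, one_mul]
      rw [Finset.sum_const, Finset.card_univ, Fintype.card_perm, Fintype.card_fin, nsmul_eq_mul]
      simp

theorem wedge_zero_right {q : ℕ} (h : q + 0 = q) (α : Alt m q) (β : Alt m 0) :
    wedge h α β = β Fin.elim0 • α := by
  ext v
  apply mul_left_cancel₀ (fact_ne q 0)
  rw [wedge_apply_eq_sum]
  have e1 : ∀ i, slots h (.inl i) = i := fun i => by ext; rw [slots_inl]
  have : ∀ σ : Equiv.Perm (Fin q), α (fun i => v (σ i)) = ((Equiv.Perm.sign σ : ℤ) : ℂ) * α v := by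
    intro σ
    have := α.toAlternatingMap.map_perm v σ
    rw [Units.smul_def, zsmul_eq_mul] at this
    exact this
  simp only [e1, this]
  have hs : ∀ e : Equiv.Perm (Fin q), ((Equiv.Perm.sign e : ℤ) : ℂ) * (Equiv.Perm.sign e : ℤ) = 1 :=
    fun e => by rcases Int.units_eq_one_or (Equiv.Perm.sign e) with h | h <;> simp [h]
  calc _ = ∑ σ : Equiv.Perm (Fin q), (((Equiv.Perm.sign σ : ℤ) : ℂ) * (Equiv.Perm.sign σ : ℤ)) *
        (β Fin.elim0 * α v) := by
        refine Finset.sum_congr rfl fun σ _ => ?_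
        rw [Subsingleton.elim (fun i : Fin 0 => v (σ (slots h (.inr i)))) Fin.elim0]; ring
    _ = _ := by
      simp only [hs, one_mul]
      rw [Finset.sum_const, Finset.card_univ, Fintype.card_perm, Fintype.card_fin, nsmul_eq_mul]
      simp

theorem wedge_comp {p q N : ℕ} (h : p + q = N) (α : Alt m p) (β : Alt m q)
    (F : Model m →L[ℝ] Model m) :
    (wedge h α β).compContinuousLinearMap F =
      wedge h (α.compContinuousLinearMap F) (β.compContinuousLinearMap F) := by
  ext v
  apply mul_left_cancel₀ (fact_ne p q)
  rw [ContinuousAlternatingMap.compContinuousLinearMap_apply, wedge_apply_eq_sum,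
    wedge_apply_eq_sum]
  rfl

theorem wedge_zero {p q N : ℕ} (h : p + q = N) (α : Alt m p) : wedge h α (0 : Alt m q) = 0 :=
  map_zero (wedgeL h α)

theorem wedge_sum {p q N : ℕ} (h : p + q = N) {ι : Type*} (s : Finset ι) (α : Alt m p)
    (f : ι → Alt m q) : wedge h α (∑ i ∈ s, f i) = ∑ i ∈ s, wedge h α (f i) :=
  map_sum (wedgeL h α) f s

theorem sum_wedge {p q N : ℕ} (h : p + q = N) {ι : Type*} (s : Finset ι) (f : ι → Alt m p)
    (β : Alt m q) : wedge h (∑ i ∈ s, f i) β = ∑ i ∈ s, wedge h (f i) β :=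
  LinearMap.map_sum₂ (wedgeL h) s f β

theorem wedge_sub_right {p q N : ℕ} (h : p + q = N) (α : Alt m p) (β β' : Alt m q) :
    wedge h α (β - β') = wedge h α β - wedge h α β' :=
  map_sub (wedgeL h α) β β'

theorem wedge_neg_right {p q N : ℕ} (h : p + q = N) (α : Alt m p) (β : Alt m q) :
    wedge h α (-β) = -wedge h α β :=
  map_neg (wedgeL h α) β

theorem wedge_neg_left {p q N : ℕ} (h : p + q = N) (α : Alt m p) (β : Alt m q) :
    wedge h (-α) β = -wedge h α β :=
  LinearMap.map_neg₂ (wedgeL h) α β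

theorem wedge_one_one (h : 1 + 1 = 2) (θ η : Alt m 1) (v : Fin 2 → Model m) :
    wedge h θ η v = θ (fun _ => v 0) * η (fun _ => v 1) - θ (fun _ => v 1) * η (fun _ => v 0) := by
  rw [wedge_one_apply (q := 1) h]
  rw [Fin.sum_univ_two]
  have h1 : (fun x : Fin 1 => v (Equiv.swap 0 0 x.succ)) = fun _ => v 1 := by
    funext x; fin_cases x; simp
  have h2 : (fun x : Fin 1 => v (Equiv.swap 0 1 x.succ)) = fun _ => v 0 := by
    funext x; fin_cases x; simp
  rw [h1, h2]
  simp
  ring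

theorem wedge_one_anticomm (h : 1 + 1 = 2) (θ η : Alt m 1) : wedge h θ η = -wedge h η θ := by
  ext v
  rw [ContinuousAlternatingMap.neg_apply, wedge_one_one, wedge_one_one]
  ring

/-- The operator `∑ᵢ dxⁱ ∧ fᵢ`. -/
def dxSum {n : ℕ} : (Fin (2 * m + 1) → Alt m n) →ₗ[ℂ] Alt m (n + 1) where
  toFun f := ∑ i, wedge (Nat.add_comm 1 n) (dx i) (f i)
  map_add' f g := by simp only [Pi.add_apply, wedge_add_right, Finset.sum_add_distrib]
  map_smul' c f := by simp only [Pi.smul_apply, wedge_smul_right, Finset.smul_sum, RingHom.id_apply]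

theorem dxSum_apply {n : ℕ} (f : Fin (2 * m + 1) → Alt m n) :
    dxSum f = ∑ i, wedge (Nat.add_comm 1 n) (dx i) (f i) := rfl

theorem sum_coord_smul_e (v : Model m) : ∑ i, coord v i • (e i : Model m) = v := by
  ext j
  simp [e, coord, Pi.single_apply]

theorem coord_smul (c : ℝ) (v : Model m) (i : Fin (2 * m + 1)) :
    coord (c • v) i = c * coord v i := rfl

theorem coord_sum {ι : Type*} (s : Finset ι) (f : ι → Model m) (i : Fin (2 * m + 1)) :
    coord (∑ a ∈ s, f a) i = ∑ a ∈ s, coord (f a) i :=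
  map_sum (EuclideanSpace.proj i : Model m →L[ℝ] ℝ) f s

theorem inner_dxSum {n : ℕ} (v : Model m) (f : Fin (2 * m + 1) → Alt m (n + 1)) :
    inner v (dxSum f) = ∑ i, ((coord v i : ℝ) : ℂ) • f i - dxSum fun i => inner v (f i) := by
  rw [dxSum_apply, map_sum, dxSum_apply, ← Finset.sum_sub_distrib]
  refine Finset.sum_congr rfl fun i _ => ?_
  rw [inner_wedge_one _ (Nat.add_comm 1 n)]
  simp

theorem inner_dxSum_zero (v : Model m) (f : Fin (2 * m + 1) → Alt m 0) :
    inner v (dxSum f) = ∑ i, ((coord v i : ℝ) : ℂ) • f i := by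
  rw [dxSum_apply, map_sum]
  refine Finset.sum_congr rfl fun i _ => ?_
  rw [inner_wedge_one_zero]
  simp

theorem inner_linear {n : ℕ} (v : Model m) (α : Alt m (n + 1)) :
    inner v α = ∑ i, ((coord v i : ℝ) : ℂ) • inner (e i) α := by
  conv_lhs => rw [← sum_coord_smul_e v, ← curryLeft_eq_inner, map_sum]
  refine Finset.sum_congr rfl fun i _ => ?_
  rw [map_smul, curryLeft_eq_inner]
  exact (Complex.coe_smul (coord v i) (inner (e i) α)).symm

theorem inner_inner_neg {n : ℕ} (v w : Model m) (α : Alt m (n + 2)) :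
    inner v (inner w α) = -inner w (inner v α) := by
  ext z
  rw [ContinuousAlternatingMap.neg_apply]
  simp only [inner_apply]
  have := α.toAlternatingMap.map_swap (Fin.cons v (Fin.cons w z)) (i := 0) (j := 1) (by simp)
  have h2 : (Fin.cons v (Fin.cons w z) : Fin (n + 2) → Model m) ∘ Equiv.swap 0 1 =
      Fin.cons w (Fin.cons v z) := by
    ext x : 1
    refine Fin.cases ?_ (fun y => Fin.cases ?_ (fun z => ?_) y) x
    · simp
    · simp
    · rw [Function.comp_apply, Equiv.swap_apply_of_ne_of_ne (by simp) (by
        rw [← Fin.succ_zero_eq_one, Ne, Fin.succ_inj]; exact Fin.succ_ne_zero _)]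
      simp
  rw [h2] at this
  exact this

/-- The interior products recover the form up to its degree, by induction through contraction with a
vector. Every form of positive degree is thus a sum of products dxⁱ ∧ β, which allows induction on
the form degree. -/
theorem dxSum_inner {n : ℕ} (α : Alt m (n + 1)) :
    dxSum (fun i => inner (e i) α) = ((n : ℂ) + 1) • α := by
  induction n with
  | zero =>
    apply ext_inner
    intro v
    rw [inner_dxSum_zero, ← inner_linear, map_smul]
    simp
  | succ n ih =>
    apply ext_inner
    intro v
    rw [inner_dxSum, ← inner_linear, map_smul]
    have : (fun i => inner v (inner (e i) α)) = -fun i => inner (e i) (inner v α) := by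
      funext i
      rw [Pi.neg_apply, inner_inner_neg]
    rw [this, map_neg, ih]
    push_cast
    module

/-- By `dxSum_inner` a multiple of β is a sum of products dxⁱ ∧ βᵢ; then θ is exchanged with dxⁱ at
the cost of a sign and with βᵢ by induction. -/
theorem wedge_one_comm {q : ℕ} (h : 1 + q = q + 1) (h' : q + 1 = q + 1) (θ : Alt m 1)
    (β : Alt m q) : wedge h θ β = (-1 : ℂ) ^ q • wedge h' β θ := by
  induction q with
  | zero =>
    rw [wedge_zero_right, wedge_zero_left]
    simp
  | succ q ih =>
    have hne : (q : ℂ) + 1 ≠ 0 := Nat.cast_add_one_ne_zero q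
    apply smul_right_injective _ hne
    simp only
    rw [smul_comm, ← wedge_smul_right, ← wedge_smul_left, ← dxSum_inner, dxSum_apply, wedge_sum,
      sum_wedge, Finset.smul_sum]
    refine Finset.sum_congr rfl fun i _ => ?_
    rw [wedge_assoc (Nat.add_comm 1 q) _ rfl (Nat.add_comm 1 (q + 1)),
      ← wedge_assoc (rfl : 1 + 1 = 2) (by omega) (Nat.add_comm 1 q), wedge_one_anticomm,
      wedge_neg_left, wedge_assoc (rfl : 1 + 1 = 2) (by omega) (Nat.add_comm 1 q)
      (Nat.add_comm 1 (q + 1)), ih (Nat.add_comm 1 q) rfl, wedge_smul_right, pow_succ]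
    module

theorem wedge_comm {p q N : ℕ} (h : p + q = N) (h' : q + p = N) (α : Alt m p) (β : Alt m q) :
    wedge h α β = (-1 : ℂ) ^ (p * q) • wedge h' β α := by
  induction p generalizing N with
  | zero =>
    obtain rfl : q = N := by omega
    rw [wedge_zero_right, wedge_zero_left]
    simp
  | succ p ih =>
    obtain ⟨M, rfl⟩ : ∃ M, N = M + 1 := ⟨p + q, by omega⟩
    have hne : (p : ℂ) + 1 ≠ 0 := Nat.cast_add_one_ne_zero p
    apply smul_right_injective _ hne
    simp only
    rw [smul_comm, ← wedge_smul_left, ← wedge_smul_right, ← dxSum_inner, dxSum_apply, wedge_sum,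
      sum_wedge, Finset.smul_sum]
    refine Finset.sum_congr rfl fun i _ => ?_
    rw [wedge_assoc _ _ (by omega : p + q = M) (by omega), ih (by omega) (by omega : q + p = M),
      wedge_smul_right, ← wedge_assoc (Nat.add_comm 1 q) (by omega : (q + 1) + p = M + 1),
      wedge_one_comm _ rfl, wedge_smul_left, wedge_assoc _ _ (Nat.add_comm 1 p) (by omega),
      smul_smul, ← pow_add]
    congr 2
    ring

theorem dxSum_wedge_right {p q a : ℕ} (h1 : p + q = a) (h2 : p + (q + 1) = a + 1)
    (α : Alt m p) (f : Fin (2 * m + 1) → Alt m q) :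
    dxSum (fun i => wedge h1 α (f i)) = (-1 : ℂ) ^ p • wedge h2 α (dxSum f) := by
  rw [dxSum_apply, dxSum_apply, wedge_sum, Finset.smul_sum]
  refine Finset.sum_congr rfl fun i _ => ?_
  rw [← wedge_assoc (Nat.add_comm 1 p) (by omega), wedge_one_comm _ rfl, wedge_smul_left,
    wedge_assoc _ _ (Nat.add_comm 1 q) (by omega)]

/-- Since dxⁱ ∧ dxʲ is antisymmetric, only the commutators of the coefficients survive. For iterated
covariant derivatives these commutators are the curvature. -/
theorem dxSum_dxSum {n : ℕ} (f : Fin (2 * m + 1) → Fin (2 * m + 1) → Alt m n) :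
    dxSum (fun i => dxSum (f i)) = (1 / 2 : ℂ) • ∑ i, ∑ j,
      wedge (Nat.add_comm 2 n) (wedge rfl (dx i) (dx j)) (f i j - f j i) := by
  have h1 : dxSum (fun i => dxSum (f i)) = ∑ i, ∑ j,
      wedge (Nat.add_comm 2 n) (wedge rfl (dx i) (dx j)) (f i j) := by
    rw [dxSum_apply]
    refine Finset.sum_congr rfl fun i _ => ?_
    rw [dxSum_apply, wedge_sum]
    exact Finset.sum_congr rfl fun j _ => (wedge_assoc _ _ _ _ _ _ _).symm
  have h2 : ∑ i, ∑ j, wedge (Nat.add_comm 2 n) (wedge rfl (dx i) (dx j)) (f j i) =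
      -dxSum (fun i => dxSum (f i)) := by
    rw [h1, Finset.sum_comm, ← Finset.sum_neg_distrib]
    refine Finset.sum_congr rfl fun i _ => ?_
    rw [← Finset.sum_neg_distrib]
    refine Finset.sum_congr rfl fun j _ => ?_
    rw [wedge_one_anticomm, wedge_neg_left]
  simp only [wedge_sub_right, Finset.sum_sub_distrib]
  rw [h2, ← h1]
  module

/-- The sum of dxⁱ ⊗ eᵢ is the identity tensor and does not depend on the frame; this makes δ and
d_∇ natural. -/
theorem dxSum_comp {n : ℕ} (φ : Model m →ₗ[ℝ] Alt m n) (F : Model m →L[ℝ] Model m) :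
    (dxSum fun i => φ (e i)).compContinuousLinearMap F =
      dxSum fun i => (φ (F (e i))).compContinuousLinearMap F := by
  have hc : ∀ {k} (f : Fin (2 * m + 1) → Alt m k), (∑ i, f i).compContinuousLinearMap F =
      ∑ i, (f i).compContinuousLinearMap F := fun f =>
    map_sum (ContinuousAlternatingMap.compContinuousLinearMapₗ F) f _
  rw [dxSum_apply, dxSum_apply, hc]
  simp only [wedge_comp]
  have h1 : ∀ j, (dx j : Alt m 1).compContinuousLinearMap F =
      ∑ i, ((coord (F (e i)) j : ℝ) : ℂ) • dx i := by
    intro j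
    ext v
    rw [ContinuousAlternatingMap.compContinuousLinearMap_apply, ContinuousAlternatingMap.sum_apply]
    simp only [dx_apply, ContinuousAlternatingMap.smul_apply, smul_eq_mul]
    conv_lhs => rw [Function.comp_apply, ← sum_coord_smul_e (v 0), map_sum, coord_sum]
    push_cast
    refine Finset.sum_congr rfl fun i _ => ?_
    rw [map_smul, coord_smul]
    push_cast; ring
  have h2 : ∀ i, (φ (F (e i))).compContinuousLinearMap F =
      ∑ j, ((coord (F (e i)) j : ℝ) : ℂ) • (φ (e j)).compContinuousLinearMap F := by
    intro i
    conv_lhs => rw [← sum_coord_smul_e (F (e i)), map_sum, hc]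
    refine Finset.sum_congr rfl fun j _ => ?_
    rw [map_smul]; rfl
  simp only [h1, h2, sum_wedge, wedge_sum, wedge_smul_left, wedge_smul_right]
  rw [Finset.sum_comm]

/-- This identifies the operator with the alternation in `extDeriv`, so that the compatibility of
the exterior derivative with pullbacks becomes available. -/
theorem dxSum_eq_alternatizeUncurryFin {n : ℕ} (φ : Model m →L[ℝ] Alt m n) :
    dxSum (fun i => φ (e i)) = ContinuousAlternatingMap.alternatizeUncurryFin φ := by
  have h1 : ∀ v : Fin (n + 1) → Model m, dxSum (fun i => φ (e i)) v =
      ∑ j : Fin (n + 1), (if j = 0 then 1 else -1) * φ (v j) (fun x => v (Equiv.swap 0 j x.succ)) := by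
    intro v
    rw [dxSum_apply, ContinuousAlternatingMap.sum_apply]
    simp only [wedge_one_apply]
    rw [Finset.sum_comm]
    refine Finset.sum_congr rfl fun j _ => ?_
    rw [← Finset.mul_sum]
    congr 1
    conv_rhs => rw [← sum_coord_smul_e (v j), map_sum, ContinuousAlternatingMap.sum_apply]
    refine Finset.sum_congr rfl fun i _ => ?_
    rw [map_smul]
    simp
  ext v
  rw [h1, ContinuousAlternatingMap.alternatizeUncurryFin_apply]
  refine Finset.sum_congr rfl fun j _ => ?_
  refine Fin.cases ?_ (fun j => ?_) j
  · simp
    rfl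
  · simp only [Fin.succ_ne_zero, if_false]
    obtain ⟨k, rfl⟩ : ∃ k, n = k + 1 := ⟨n - 1, by have := j.2; omega⟩
    -- Exchanging slots 0 and j + 1 leaves v 0 in position j of the remaining slots. Moving it to
    -- the front costs (-1)^j, and with the sign of the transposition this gives (-1)^(j+1).
    have h2 : (fun x : Fin (k + 1) => v (Equiv.swap 0 j.succ x.succ)) =
        j.insertNth (v 0) (j.removeNth (Fin.tail v)) := by
      rw [Fin.insertNth_removeNth]
      funext x
      by_cases hx : x = j
      · subst hx; simp
      · rw [Equiv.swap_apply_of_ne_of_ne (Fin.succ_ne_zero x) (by simpa using hx),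
          Function.update_of_ne hx]
        rfl
    have h3 : j.succ.removeNth v = Fin.cons (v 0) (j.removeNth (Fin.tail v)) := by
      funext x
      refine Fin.cases ?_ (fun y => ?_) x
      · simp [Fin.removeNth]
      · simp [Fin.removeNth, Fin.tail]
    rw [h2, h3]
    have := (φ (v j.succ)).toAlternatingMap.map_insertNth j (v 0) (j.removeNth (Fin.tail v))
    have h4 : φ (v j.succ) (j.insertNth (v 0) (j.removeNth (Fin.tail v))) =
      (-1 : ℤ) ^ (j : ℕ) • φ (v j.succ) (Fin.cons (v 0) (j.removeNth (Fin.tail v))) := by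
      exact this
    rw [h4]
    simp only [Fin.val_succ, zsmul_eq_mul, pow_succ]
    simp [mul_comm]

/-- A form is determined by its values on basis vectors. Finite dimension makes linear and bilinear
operations on forms continuous, hence smooth. -/
instance finiteDimensional_alt (n : ℕ) : FiniteDimensional ℝ (Alt m n) := by
  let f : Alt m n →ₗ[ℝ] ((Fin n → Fin (2 * m + 1)) → ℂ) :=
    { toFun := fun α I => α fun i => e (I i)
      map_add' := fun α β => rfl
      map_smul' := fun c α => rfl }
  refine FiniteDimensional.of_injective f fun α β hab => ?_
  apply ContinuousAlternatingMap.toAlternatingMap_injective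
  refine Module.Basis.ext_alternating (EuclideanSpace.basisFun (Fin (2 * m + 1)) ℝ).toBasis
    fun I _ => ?_
  have := congrFun hab I
  simpa [f, e] using this

/-- The wedge product as a continuous bilinear map. -/
def wedgeCLM {p q N : ℕ} (h : p + q = N) : Alt m p →L[ℝ] Alt m q →L[ℝ] Alt m N :=
  LinearMap.toContinuousBilinearMap ((wedgeL (m := m) h).restrictScalars₁₂ ℝ ℝ)

@[simp] theorem wedgeCLM_apply {p q N : ℕ} (h : p + q = N) (α : Alt m p) (β : Alt m q) :
    wedgeCLM h α β = wedge h α β := rfl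

/-- The interior product as a continuous bilinear map. -/
def innerCLM (n : ℕ) : Model m →L[ℝ] Alt m (n + 1) →L[ℝ] Alt m n :=
  LinearMap.toContinuousBilinearMap (LinearMap.mk₂ ℝ (fun v α => inner v α)
    (fun v w α => map_add α.curryLeft v w) (fun c v α => map_smul α.curryLeft c v)
    (fun v α β => map_add (inner v) α β)
    (fun c v α => map_smul ((inner v).restrictScalars ℝ) c α))

@[simp] theorem innerCLM_apply {n : ℕ} (v : Model m) (α : Alt m (n + 1)) :
    innerCLM n v α = inner v α := rfl

end Forms

/-! ## The Wick product on a fibre -/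

section Contraction

variable {ι A B C AB BC ABC : Type*} [Fintype ι]
  [AddCommGroup A] [Module ℂ A] [AddCommGroup B] [Module ℂ B] [AddCommGroup C] [Module ℂ C]
  [AddCommGroup AB] [Module ℂ AB] [AddCommGroup BC] [Module ℂ BC]
  [AddCommGroup ABC] [Module ℂ ABC]
  (h : ι → ι → ℂ) (dA : ι → A →ₗ[ℂ] A) (dB : ι → B →ₗ[ℂ] B) (dC : ι → C →ₗ[ℂ] C)
  (dAB : ι → AB →ₗ[ℂ] AB) (dBC : ι → BC →ₗ[ℂ] BC)

/-- The `s`-fold contraction `μ ∘ (h^{ij} ∂_i ⊗ ∂_j)^s`. -/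
def contraction (μ : A →ₗ[ℂ] B →ₗ[ℂ] AB) : ℕ → (A →ₗ[ℂ] B →ₗ[ℂ] AB)
  | 0 => μ
  | s + 1 => ∑ i, ∑ j, h i j • (contraction μ s).compl₁₂ (dA i) (dB j)

variable (μ : A →ₗ[ℂ] B →ₗ[ℂ] AB)

theorem contraction_zero (f : A) (g : B) : contraction h dA dB μ 0 f g = μ f g := rfl

theorem contraction_succ (s : ℕ) (f : A) (g : B) :
    contraction h dA dB μ (s + 1) f g =
      ∑ i, ∑ j, h i j • contraction h dA dB μ s (dA i f) (dB j g) := by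
  simp [contraction, LinearMap.sum_apply]

/-- A derivation of the product that commutes with all partial derivatives passes through every
contraction. -/
theorem contraction_leibniz {eA : A →ₗ[ℂ] A} {eB : B →ₗ[ℂ] B} {eAB : AB →ₗ[ℂ] AB}
    (hμ : ∀ f g, eAB (μ f g) = μ (eA f) g + μ f (eB g))
    (hA : ∀ i f, eA (dA i f) = dA i (eA f)) (hB : ∀ i f, eB (dB i f) = dB i (eB f))
    (s : ℕ) (f : A) (g : B) :
    eAB (contraction h dA dB μ s f g) =
      contraction h dA dB μ s (eA f) g + contraction h dA dB μ s f (eB g) := by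
  induction s generalizing f g with
  | zero => exact hμ f g
  | succ s ih =>
    simp only [contraction_succ, map_sum, map_smul, ih, smul_add, Finset.sum_add_distrib, hA, hB]

/-- The symmetric threefold contraction. -/
def tripleContraction (ν : A → B → C → ABC) : ℕ → A → B → C → ABC
  | 0, f, g, k => ν f g k
  | n + 1, f, g, k => ∑ i, ∑ j, h i j • (tripleContraction ν n (dA i f) (dB j g) k +
      (tripleContraction ν n (dA i f) g (dC j k) + tripleContraction ν n f (dB i g) (dC j k)))

/-- By the Leibniz rule, contracting a product with a third factor is the sum P₁₃ + P₂₃ of the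
contractions with its two factors. With P₁₂ the contraction inside the product, the left side is the
binomial expansion of (P₁₂ + P₁₃ + P₂₃)ⁿ, which does not see the bracketing. -/
theorem sum_contraction_left (μ' : AB →ₗ[ℂ] C →ₗ[ℂ] ABC)
    (hs : ∀ i s f g, dAB i (contraction h dA dB μ s f g) =
      contraction h dA dB μ s (dA i f) g + contraction h dA dB μ s f (dB i g))
    (n : ℕ) (f : A) (g : B) (k : C) :
    ∑ x ∈ Finset.HasAntidiagonal.antidiagonal n, n.choose x.1 •
      contraction h dAB dC μ' x.2 (contraction h dA dB μ x.1 f g) k =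
      tripleContraction h dA dB dC (fun f g k => μ' (μ f g) k) n f g k := by
  induction n generalizing f g k with
  | zero => simp [tripleContraction, contraction_zero]
  | succ n ih =>
    -- Pascal's rule: one of the n + 1 contractions is split off and is either an outer or an inner
    -- one.
    rw [Finset.sum_antidiagonal_choose_succ_nsmul
      (fun s t => contraction h dAB dC μ' t (contraction h dA dB μ s f g) k), tripleContraction]
    simp only [← ih]
    have hsym : ∀ x ∈ Finset.HasAntidiagonal.antidiagonal n, n.choose x.2 = n.choose x.1 :=
      fun x hx => by
        rw [← Finset.HasAntidiagonal.mem_antidiagonal.1 hx, Nat.choose_symm_add]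
    have key : ∀ x ∈ Finset.HasAntidiagonal.antidiagonal n,
        n.choose x.1 • contraction h dAB dC μ' (x.2 + 1) (contraction h dA dB μ x.1 f g) k +
        n.choose x.2 • contraction h dAB dC μ' x.2 (contraction h dA dB μ (x.1 + 1) f g) k =
        ∑ i, ∑ j, h i j •
          (n.choose x.1 • contraction h dAB dC μ' x.2
            (contraction h dA dB μ x.1 (dA i f) (dB j g)) k +
          (n.choose x.1 • contraction h dAB dC μ' x.2
            (contraction h dA dB μ x.1 (dA i f) g) (dC j k) +
          n.choose x.1 • contraction h dAB dC μ' x.2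
            (contraction h dA dB μ x.1 f (dB i g)) (dC j k))) := by
      intro x hx
      rw [hsym x hx, ← smul_add]
      simp only [← smul_add, smul_comm (h _ _) (n.choose x.1), ← Finset.smul_sum]
      congr 1
      rw [contraction_succ, contraction_succ, LinearMap.map_sum₂, ← Finset.sum_add_distrib]
      refine Finset.sum_congr rfl fun i _ => ?_
      rw [LinearMap.map_sum₂, ← Finset.sum_add_distrib]
      refine Finset.sum_congr rfl fun j _ => ?_
      rw [LinearMap.map_smul₂, hs, LinearMap.map_add₂, ← smul_add]
      congr 1
      abel
    rw [← Finset.sum_add_distrib, Finset.sum_congr rfl key, Finset.sum_comm]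
    refine Finset.sum_congr rfl fun i _ => ?_
    rw [Finset.sum_comm]
    refine Finset.sum_congr rfl fun j _ => ?_
    rw [← Finset.smul_sum, Finset.sum_add_distrib, Finset.sum_add_distrib]

/-- The mirror image for the other bracketing: here P₂₃ is the inner contraction and P₁₂ + P₁₃ the
outer one, with the same total. -/
theorem sum_contraction_right (μ : B →ₗ[ℂ] C →ₗ[ℂ] BC) (μ' : A →ₗ[ℂ] BC →ₗ[ℂ] ABC)
    (hs : ∀ i s f g, dBC i (contraction h dB dC μ s f g) =
      contraction h dB dC μ s (dB i f) g + contraction h dB dC μ s f (dC i g))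
    (n : ℕ) (f : A) (g : B) (k : C) :
    ∑ x ∈ Finset.HasAntidiagonal.antidiagonal n, n.choose x.1 •
      contraction h dA dBC μ' x.2 f (contraction h dB dC μ x.1 g k) =
      tripleContraction h dA dB dC (fun f g k => μ' f (μ g k)) n f g k := by
  induction n generalizing f g k with
  | zero => simp [tripleContraction, contraction_zero]
  | succ n ih =>
    rw [Finset.sum_antidiagonal_choose_succ_nsmul
      (fun s t => contraction h dA dBC μ' t f (contraction h dB dC μ s g k)), tripleContraction]
    simp only [← ih]
    have hsym : ∀ x ∈ Finset.HasAntidiagonal.antidiagonal n, n.choose x.2 = n.choose x.1 :=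
      fun x hx => by
        rw [← Finset.HasAntidiagonal.mem_antidiagonal.1 hx, Nat.choose_symm_add]
    have key : ∀ x ∈ Finset.HasAntidiagonal.antidiagonal n,
        n.choose x.1 • contraction h dA dBC μ' (x.2 + 1) f (contraction h dB dC μ x.1 g k) +
        n.choose x.2 • contraction h dA dBC μ' x.2 f (contraction h dB dC μ (x.1 + 1) g k) =
        ∑ i, ∑ j, h i j •
          (n.choose x.1 • contraction h dA dBC μ' x.2 (dA i f)
            (contraction h dB dC μ x.1 (dB j g) k) +
          (n.choose x.1 • contraction h dA dBC μ' x.2 (dA i f)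
            (contraction h dB dC μ x.1 g (dC j k)) +
          n.choose x.1 • contraction h dA dBC μ' x.2 f
            (contraction h dB dC μ x.1 (dB i g) (dC j k)))) := by
      intro x hx
      rw [hsym x hx, ← smul_add]
      simp only [← smul_add, smul_comm (h _ _) (n.choose x.1), ← Finset.smul_sum]
      congr 1
      rw [contraction_succ, contraction_succ, map_sum, ← Finset.sum_add_distrib]
      refine Finset.sum_congr rfl fun i _ => ?_
      rw [map_sum, ← Finset.sum_add_distrib]
      refine Finset.sum_congr rfl fun j _ => ?_
      rw [map_smul, hs, map_add, ← smul_add]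
      congr 1
      abel
    rw [← Finset.sum_add_distrib, Finset.sum_congr rfl key, Finset.sum_comm]
    refine Finset.sum_congr rfl fun i _ => ?_
    rw [Finset.sum_comm]
    refine Finset.sum_congr rfl fun j _ => ?_
    rw [← Finset.smul_sum, Finset.sum_add_distrib, Finset.sum_add_distrib]

/-- The coefficient of `ν^s` in `exp((ν/2) h^{ij} ∂_i ⊗ ∂_j)`. -/
def expCoeff (s : ℕ) : ℂ := (1 / (s.factorial : ℂ)) * (1 / 2) ^ s

/-- The product of two exponential coefficients is a binomial multiple of a single one; this turns
the binomial identities into associativity of the exponential. -/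
theorem expCoeff_mul {n : ℕ} (x : ℕ × ℕ) (hx : x ∈ Finset.HasAntidiagonal.antidiagonal n) :
    expCoeff x.2 * expCoeff x.1 = expCoeff n * (n.choose x.1 : ℂ) := by
  rw [← Finset.HasAntidiagonal.mem_antidiagonal.1 hx, Nat.choose_symm_add, Nat.add_choose,
    Nat.cast_div (Nat.factorial_mul_factorial_dvd_factorial_add _ _)
      (by exact_mod_cast mul_ne_zero x.1.factorial_ne_zero x.2.factorial_ne_zero)]
  have h1 : (x.1.factorial : ℂ) ≠ 0 := Nat.cast_ne_zero.2 (Nat.factorial_ne_zero _)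
  have h2 : (x.2.factorial : ℂ) ≠ 0 := Nat.cast_ne_zero.2 (Nat.factorial_ne_zero _)
  have h3 : ((x.1 + x.2).factorial : ℂ) ≠ 0 := Nat.cast_ne_zero.2 (Nat.factorial_ne_zero _)
  unfold expCoeff
  push_cast
  field_simp
  ring

theorem contraction_assoc (μ₁ : A →ₗ[ℂ] B →ₗ[ℂ] AB) (μ₂ : AB →ₗ[ℂ] C →ₗ[ℂ] ABC)
    (μ₃ : B →ₗ[ℂ] C →ₗ[ℂ] BC) (μ₄ : A →ₗ[ℂ] BC →ₗ[ℂ] ABC)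
    (hμ : ∀ f g k, μ₂ (μ₁ f g) k = μ₄ f (μ₃ g k))
    (hs₁ : ∀ i s f g, dAB i (contraction h dA dB μ₁ s f g) =
      contraction h dA dB μ₁ s (dA i f) g + contraction h dA dB μ₁ s f (dB i g))
    (hs₃ : ∀ i s f g, dBC i (contraction h dB dC μ₃ s f g) =
      contraction h dB dC μ₃ s (dB i f) g + contraction h dB dC μ₃ s f (dC i g))
    (n : ℕ) (f : A) (g : B) (k : C) :
    ∑ x ∈ Finset.HasAntidiagonal.antidiagonal n, (expCoeff x.2 * expCoeff x.1) •
        contraction h dAB dC μ₂ x.2 (contraction h dA dB μ₁ x.1 f g) k =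
      ∑ x ∈ Finset.HasAntidiagonal.antidiagonal n, (expCoeff x.2 * expCoeff x.1) •
        contraction h dA dBC μ₄ x.2 f (contraction h dB dC μ₃ x.1 g k) := by
  have e1 := sum_contraction_left h dA dB dC dAB μ₁ μ₂ hs₁ n f g k
  have e2 := sum_contraction_right h dA dB dC dBC μ₃ μ₄ hs₃ n f g k
  simp only [hμ] at e1
  rw [← e2] at e1
  have e3 := congrArg (expCoeff n • ·) e1
  simp only [Finset.smul_sum, ← Nat.cast_smul_eq_nsmul ℂ, smul_smul] at e3
  rw [Finset.sum_congr rfl fun x hx => by rw [expCoeff_mul x hx], e3]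
  exact Finset.sum_congr rfl fun x hx => by rw [expCoeff_mul x hx]

end Contraction

/-! ### Smooth form-valued functions on a fibre and their contractions -/

section Fibre

variable {m : ℕ}

/-- Smooth functions on the model space with values in alternating forms. -/
def smoothForms (m n : ℕ) : Submodule ℂ (Model m → Alt m n) where
  carrier := {f | ContDiff ℝ ∞ f}
  add_mem' hf hg := by
    simp only [Set.mem_ofPred_eq] at hf hg ⊢
    exact hf.add hg
  zero_mem' := contDiff_zero_fun (𝕜 := ℝ) (n := ∞)
  smul_mem' c _ hf := by
    simp only [Set.mem_ofPred_eq] at hf ⊢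
    exact hf.const_smul c

/-- The type of smooth functions on the model space with values in alternating forms. -/
def Sm (m n : ℕ) : Type := smoothForms m n

namespace Sm

variable {n p q r : ℕ}

instance : AddCommGroup (Sm m n) := inferInstanceAs (AddCommGroup (smoothForms m n))

instance : Module ℂ (Sm m n) := inferInstanceAs (Module ℂ (smoothForms m n))

instance : CoeFun (Sm m n) fun _ => Model m → Alt m n := ⟨fun f => f.1⟩

theorem contDiff (f : Sm m n) : ContDiff ℝ ∞ (f : Model m → Alt m n) := f.2

theorem differentiable (f : Sm m n) : Differentiable ℝ (f : Model m → Alt m n) :=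
  (Sm.contDiff f).differentiable (by simp)

theorem ext {f g : Sm m n} (h : ∀ y, f y = g y) : f = g := Subtype.ext (funext h)

@[simp] theorem add_apply (f g : Sm m n) (y : Model m) : (f + g) y = f y + g y := rfl
@[simp] theorem sub_apply (f g : Sm m n) (y : Model m) : (f - g) y = f y - g y := rfl
@[simp] theorem neg_apply (f : Sm m n) (y : Model m) : (-f) y = -f y := rfl
@[simp] theorem zero_apply (y : Model m) : (0 : Sm m n) y = 0 := rfl
@[simp] theorem smul_apply (c : ℂ) (f : Sm m n) (y : Model m) : (c • f) y = c • f y := rfl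

/-- Evaluation at a point. -/
def eval (y : Model m) : Sm m n →ₗ[ℂ] Alt m n where
  toFun f := f y
  map_add' _ _ := rfl
  map_smul' _ _ := rfl

@[simp] theorem sum_apply {ι : Type*} (s : Finset ι) (f : ι → Sm m n) (y : Model m) :
    (∑ i ∈ s, f i) y = ∑ i ∈ s, f i y := map_sum (eval y) f s

/-- The derivative in the direction `v`. -/
def dir (v : Model m) : Sm m n →ₗ[ℂ] Sm m n where
  toFun f := ⟨fun y => fderiv ℝ f y v,
    ((Sm.contDiff f).fderiv_right (m := ∞) le_rfl).clm_apply contDiff_const⟩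
  map_add' f g := Sm.ext fun y => by
    change fderiv ℝ (fun y => f y + g y) y v = _
    rw [fderiv_fun_add (Sm.differentiable f y) (Sm.differentiable g y)]
    rfl
  map_smul' c f := Sm.ext fun y => by
    change fderiv ℝ (fun y => c • f y) y v = _
    rw [fderiv_fun_const_smul (Sm.differentiable f y)]
    rfl

theorem dir_apply (v : Model m) (f : Sm m n) (y : Model m) : dir v f y = fderiv ℝ f y v := rfl

/-- The partial derivative `∂/∂yⁱ`. -/
abbrev pd (i : Fin (2 * m + 1)) : Sm m n →ₗ[ℂ] Sm m n := dir (e i)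

theorem dir_comm (v w : Model m) (f : Sm m n) : dir v (dir w f) = dir w (dir v f) := by
  refine Sm.ext fun y => ?_
  have hd : DifferentiableAt ℝ (fderiv ℝ (f : Model m → Alt m n)) y :=
    ((Sm.contDiff f).fderiv_right (m := ∞) (by simp)).differentiable (by simp) y
  have h : ∀ a b, dir a (dir b f) y = fderiv ℝ (fderiv ℝ f) y a b := by
    intro a b
    change fderiv ℝ (fun z => fderiv ℝ f z b) y a = _
    rw [fderiv_clm_apply hd (differentiableAt_const b)]
    simp
  rw [h, h]
  exact ((Sm.contDiff f).contDiffAt.isSymmSndFDerivAt (by simpa using ENat.LEInfty.out)) v w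

/-- The pointwise wedge product. -/
def mul {N : ℕ} (h : p + q = N) : Sm m p →ₗ[ℂ] Sm m q →ₗ[ℂ] Sm m N :=
  LinearMap.mk₂ ℂ
    (fun f g => ⟨fun y => wedge h (f y) (g y),
      (wedgeCLM h).isBoundedBilinearMap.contDiff.comp ((Sm.contDiff f).prodMk (Sm.contDiff g))⟩)
    (fun _ _ _ => Sm.ext fun _ => wedge_add_left h _ _ _)
    (fun _ _ _ => Sm.ext fun _ => wedge_smul_left h _ _ _)
    (fun _ _ _ => Sm.ext fun _ => wedge_add_right h _ _ _)
    (fun _ _ _ => Sm.ext fun _ => wedge_smul_right h _ _ _)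

@[simp] theorem mul_apply {N : ℕ} (h : p + q = N) (f : Sm m p) (g : Sm m q) (y : Model m) :
    mul h f g y = wedge h (f y) (g y) := rfl

theorem dir_mul {N : ℕ} (h : p + q = N) (v : Model m) (f : Sm m p) (g : Sm m q) :
    dir v (mul h f g) = mul h (dir v f) g + mul h f (dir v g) := by
  refine Sm.ext fun y => ?_
  have := (wedgeCLM (m := m) h).fderiv_of_bilinear (Sm.differentiable f y) (Sm.differentiable g y)
  change fderiv ℝ (fun y => wedgeCLM h (f y) (g y)) y v = _
  rw [this]
  simp [dir_apply, add_comm]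

/-- The `s`-fold contraction `m ∘ (h^{ij} ∂_i ⊗ ∂_j)^s`. -/
def star (h : Fin (2 * m + 1) → Fin (2 * m + 1) → ℂ) {N : ℕ} (hN : p + q = N) (s : ℕ) :
    Sm m p →ₗ[ℂ] Sm m q →ₗ[ℂ] Sm m N :=
  contraction h (pd : _ → Sm m p →ₗ[ℂ] Sm m p) (pd : _ → Sm m q →ₗ[ℂ] Sm m q) (mul hN) s

variable (h : Fin (2 * m + 1) → Fin (2 * m + 1) → ℂ)

theorem star_zero {N : ℕ} (hN : p + q = N) (f : Sm m p) (g : Sm m q) :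
    star h hN 0 f g = mul hN f g := rfl

theorem star_succ {N : ℕ} (hN : p + q = N) (s : ℕ) (f : Sm m p) (g : Sm m q) :
    star h hN (s + 1) f g = ∑ i, ∑ j, h i j • star h hN s (pd i f) (pd j g) :=
  contraction_succ h (pd : _ → Sm m p →ₗ[ℂ] Sm m p) (pd : _ → Sm m q →ₗ[ℂ] Sm m q) (mul hN) s f g

theorem dir_star {N : ℕ} (hN : p + q = N) (s : ℕ) (v : Model m) (f : Sm m p) (g : Sm m q) :
    dir v (star h hN s f g) = star h hN s (dir v f) g + star h hN s f (dir v g) :=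
  contraction_leibniz h (pd : _ → Sm m p →ₗ[ℂ] Sm m p) (pd : _ → Sm m q →ₗ[ℂ] Sm m q) (mul hN) (dir_mul hN v) (fun i f => dir_comm v (e i) f)
    (fun i f => dir_comm v (e i) f) s f g

/-- Exchanging the factors transposes h, and the wedge product supplies the graded sign. A graded
commutator therefore only measures the difference between h and its transpose. -/
theorem star_comm {N : ℕ} (hN : p + q = N) (hN' : q + p = N) (s : ℕ) (f : Sm m p) (g : Sm m q) :
    star h hN' s g f = (-1 : ℂ) ^ (p * q) • star (fun i j => h j i) hN s f g := by
  induction s generalizing f g with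
  | zero =>
    refine Sm.ext fun y => ?_
    rw [star_zero, star_zero, mul_apply, smul_apply, mul_apply, wedge_comm hN' hN, mul_comm p q]
  | succ s ih =>
    rw [star_succ, star_succ, Finset.sum_comm, Finset.smul_sum]
    refine Finset.sum_congr rfl fun i _ => ?_
    rw [Finset.smul_sum]
    refine Finset.sum_congr rfl fun j _ => ?_
    rw [ih, smul_comm]

theorem star_assoc {a b N : ℕ} (h1 : p + q = a) (h2 : a + r = N) (h3 : q + r = b)
    (h4 : p + b = N) (n : ℕ) (f : Sm m p) (g : Sm m q) (k : Sm m r) :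
    ∑ x ∈ Finset.HasAntidiagonal.antidiagonal n, (expCoeff x.2 * expCoeff x.1) •
        star h h2 x.2 (star h h1 x.1 f g) k =
      ∑ x ∈ Finset.HasAntidiagonal.antidiagonal n, (expCoeff x.2 * expCoeff x.1) •
        star h h4 x.2 f (star h h3 x.1 g k) :=
  contraction_assoc h (pd : _ → Sm m p →ₗ[ℂ] Sm m p) (pd : _ → Sm m q →ₗ[ℂ] Sm m q)
    (pd : _ → Sm m r →ₗ[ℂ] Sm m r) (pd : _ → Sm m a →ₗ[ℂ] Sm m a) (pd : _ → Sm m b →ₗ[ℂ] Sm m b)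
    (mul h1) (mul h2) (mul h3) (mul h4)
    (fun f g k => Sm.ext fun _ => wedge_assoc h1 h2 h3 h4 _ _ _)
    (fun i s f g => dir_star h h1 s (e i) f g) (fun i s f g => dir_star h h3 s (e i) f g) n f g k

end Sm
end Fibre

/-! ### Reindexing of the sums over ν-degrees and y-degrees -/

section Antidiagonals

open Finset

variable {R : Type*} [AddCommMonoid R]

/-- In (a ∘ b) ∘ c let t and s be the numbers of outer and inner contractions. The new order places
s + t outermost and separates it from the ν-degrees k1, k2, k3 of the factors, because associativity
holds for each fixed value of s + t. -/
theorem sum_antidiagonal_split_left (k : ℕ) (G : ℕ → ℕ → ℕ → ℕ → ℕ → R) :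
    ∑ x ∈ HasAntidiagonal.antidiagonal k, ∑ y ∈ HasAntidiagonal.antidiagonal x.2,
      ∑ x' ∈ HasAntidiagonal.antidiagonal y.1, ∑ y' ∈ HasAntidiagonal.antidiagonal x'.2,
        G x.1 x'.1 y'.1 y'.2 y.2 =
    ∑ n ∈ HasAntidiagonal.antidiagonal k, ∑ u ∈ HasAntidiagonal.antidiagonal n.1,
      ∑ w ∈ HasAntidiagonal.antidiagonal n.2, ∑ w' ∈ HasAntidiagonal.antidiagonal w.1,
        G u.2 u.1 w'.1 w'.2 w.2 := by
  simp only [sum_sigma']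
  refine sum_nbij'
    (fun z => ⟨(z.2.2.1.1 + z.1.1, z.2.2.2.1 + z.2.2.2.2 + z.2.1.2), (z.2.2.1.1, z.1.1),
      (z.2.2.2.1 + z.2.2.2.2, z.2.1.2), (z.2.2.2.1, z.2.2.2.2)⟩)
    (fun z => ⟨(z.2.1.2, z.2.1.1 + z.2.2.2.1 + z.2.2.2.2 + z.2.2.1.2),
      (z.2.1.1 + z.2.2.2.1 + z.2.2.2.2, z.2.2.1.2), (z.2.1.1, z.2.2.2.1 + z.2.2.2.2),
      (z.2.2.2.1, z.2.2.2.2)⟩) ?_ ?_ ?_ ?_ ?_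
  · rintro ⟨⟨t, k'⟩, ⟨K, k3⟩, ⟨s, K'⟩, ⟨k1, k2⟩⟩ h
    simp only [mem_sigma, HasAntidiagonal.mem_antidiagonal, and_true] at h ⊢
    omega
  · rintro ⟨⟨t, k'⟩, ⟨K, k3⟩, ⟨s, K'⟩, ⟨k1, k2⟩⟩ h
    simp only [mem_sigma, HasAntidiagonal.mem_antidiagonal, and_true, true_and] at h ⊢
    omega
  · rintro ⟨⟨t, k'⟩, ⟨K, k3⟩, ⟨s, K'⟩, ⟨k1, k2⟩⟩ h
    simp only [mem_sigma, HasAntidiagonal.mem_antidiagonal] at h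
    obtain ⟨h1, h2, h3, h4⟩ := h
    subst h4 h3 h2 h1
    simp [add_assoc]
  · rintro ⟨⟨n, k'⟩, ⟨s, t⟩, ⟨P, k3⟩, ⟨k1, k2⟩⟩ h
    simp only [mem_sigma, HasAntidiagonal.mem_antidiagonal] at h
    obtain ⟨h1, h2, h3, h4⟩ := h
    subst h4 h3 h2 h1
    simp
  · intro _ _
    rfl

/-- The same target order for a ∘ (b ∘ c), so that the two bracketings can be compared term by term.
-/
theorem sum_antidiagonal_split_right (k : ℕ) (G : ℕ → ℕ → ℕ → ℕ → ℕ → R) :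
    ∑ x ∈ HasAntidiagonal.antidiagonal k, ∑ y ∈ HasAntidiagonal.antidiagonal x.2,
      ∑ x' ∈ HasAntidiagonal.antidiagonal y.2, ∑ y' ∈ HasAntidiagonal.antidiagonal x'.2,
        G x.1 x'.1 y.1 y'.1 y'.2 =
    ∑ n ∈ HasAntidiagonal.antidiagonal k, ∑ u ∈ HasAntidiagonal.antidiagonal n.1,
      ∑ w ∈ HasAntidiagonal.antidiagonal n.2, ∑ w' ∈ HasAntidiagonal.antidiagonal w.1,
        G u.2 u.1 w'.1 w'.2 w.2 := by
  simp only [sum_sigma']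
  refine sum_nbij'
    (fun z => ⟨(z.2.2.1.1 + z.1.1, z.2.1.1 + z.2.2.2.1 + z.2.2.2.2), (z.2.2.1.1, z.1.1),
      (z.2.1.1 + z.2.2.2.1, z.2.2.2.2), (z.2.1.1, z.2.2.2.1)⟩)
    (fun z => ⟨(z.2.1.2, z.2.2.2.1 + (z.2.1.1 + (z.2.2.2.2 + z.2.2.1.2))),
      (z.2.2.2.1, z.2.1.1 + (z.2.2.2.2 + z.2.2.1.2)), (z.2.1.1, z.2.2.2.2 + z.2.2.1.2),
      (z.2.2.2.2, z.2.2.1.2)⟩) ?_ ?_ ?_ ?_ ?_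
  · rintro ⟨⟨t, k'⟩, ⟨K, k3⟩, ⟨s, K'⟩, ⟨k1, k2⟩⟩ h
    simp only [mem_sigma, HasAntidiagonal.mem_antidiagonal, and_true] at h ⊢
    omega
  · rintro ⟨⟨t, k'⟩, ⟨K, k3⟩, ⟨s, K'⟩, ⟨k1, k2⟩⟩ h
    simp only [mem_sigma, HasAntidiagonal.mem_antidiagonal, and_true] at h ⊢
    omega
  · rintro ⟨⟨t, k'⟩, ⟨k1, K⟩, ⟨s, K'⟩, ⟨k2, k3⟩⟩ h
    simp only [mem_sigma, HasAntidiagonal.mem_antidiagonal] at h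
    obtain ⟨h1, h2, h3, h4⟩ := h
    subst h4 h3 h2 h1
    rfl
  · rintro ⟨⟨n, k'⟩, ⟨s, t⟩, ⟨P, k3⟩, ⟨k1, k2⟩⟩ h
    simp only [mem_sigma, HasAntidiagonal.mem_antidiagonal] at h
    obtain ⟨h1, h2, h3, h4⟩ := h
    subst h4 h3 h2 h1
    simp
  · intro _ _
    rfl

/-- Each contraction removes two powers of y, so an inner product of degree L comes from factors of
total degree L + 2s. The totals below 2s, which the right-hand side adds, contribute zero by `hF`.
-/
theorem sum_antidiagonal_shift_left (l s t : ℕ) (F : ℕ → ℕ → ℕ → R)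
    (hF : ∀ l1 l2 l3, l1 + l2 < 2 * s → F l1 l2 l3 = 0) :
    ∑ z ∈ HasAntidiagonal.antidiagonal (l + 2 * t),
      ∑ z' ∈ HasAntidiagonal.antidiagonal (z.1 + 2 * s), F z'.1 z'.2 z.2 =
    ∑ w ∈ HasAntidiagonal.antidiagonal (l + 2 * (s + t)),
      ∑ w' ∈ HasAntidiagonal.antidiagonal w.1, F w'.1 w'.2 w.2 := by
  simp only [sum_sigma']
  refine sum_of_injOn (fun z => ⟨(z.1.1 + 2 * s, z.1.2), z.2⟩) ?_ ?_ ?_ ?_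
  · rintro ⟨⟨L, l3⟩, ⟨l1, l2⟩⟩ - ⟨⟨L', l3'⟩, ⟨l1', l2'⟩⟩ - h
    simp only [Sigma.mk.injEq, Prod.mk.injEq, heq_eq_eq, Nat.add_right_cancel_iff] at h ⊢
    exact h
  · rintro ⟨⟨L, l3⟩, ⟨l1, l2⟩⟩ h
    simp only [mem_coe, mem_sigma, HasAntidiagonal.mem_antidiagonal] at h ⊢
    omega
  · rintro ⟨⟨L, l3⟩, ⟨l1, l2⟩⟩ h h'
    apply hF
    by_contra hlt
    apply h'
    simp only [mem_sigma, HasAntidiagonal.mem_antidiagonal] at h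
    refine ⟨⟨(L - 2 * s, l3), (l1, l2)⟩, ?_, ?_⟩
    · simp only [mem_coe, mem_sigma, HasAntidiagonal.mem_antidiagonal]
      dsimp only at *
      omega
    · simp only [Sigma.mk.injEq, Prod.mk.injEq, heq_eq_eq, and_true]
      dsimp only at *
      omega
  · intro _ _
    rfl

theorem sum_antidiagonal_shift_right (l s t : ℕ) (F : ℕ → ℕ → ℕ → R)
    (hF : ∀ l1 l2 l3, l2 + l3 < 2 * s → F l1 l2 l3 = 0) :
    ∑ z ∈ HasAntidiagonal.antidiagonal (l + 2 * t),
      ∑ z' ∈ HasAntidiagonal.antidiagonal (z.2 + 2 * s), F z.1 z'.1 z'.2 =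
    ∑ w ∈ HasAntidiagonal.antidiagonal (l + 2 * (s + t)),
      ∑ w' ∈ HasAntidiagonal.antidiagonal w.1, F w'.1 w'.2 w.2 := by
  simp only [sum_sigma']
  refine sum_of_injOn (fun z => ⟨(z.1.1 + z.2.1, z.2.2), (z.1.1, z.2.1)⟩) ?_ ?_ ?_ ?_
  · rintro ⟨⟨l1, L⟩, ⟨l2, l3⟩⟩ h0 ⟨⟨l1', L'⟩, ⟨l2', l3'⟩⟩ h0' h
    simp only [mem_coe, mem_sigma, HasAntidiagonal.mem_antidiagonal] at h0 h0'
    simp only [Sigma.mk.injEq, Prod.mk.injEq, heq_eq_eq] at h ⊢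
    omega
  · rintro ⟨⟨l1, L⟩, ⟨l2, l3⟩⟩ h
    simp only [mem_coe, mem_sigma, HasAntidiagonal.mem_antidiagonal, and_true] at h ⊢
    omega
  · rintro ⟨⟨L, l3⟩, ⟨l1, l2⟩⟩ h h'
    apply hF
    by_contra hlt
    apply h'
    simp only [mem_sigma, HasAntidiagonal.mem_antidiagonal] at h
    refine ⟨⟨(l1, l2 + l3 - 2 * s), (l2, l3)⟩, ?_, ?_⟩
    · simp only [mem_coe, mem_sigma, HasAntidiagonal.mem_antidiagonal]
      dsimp only at *
      omega
    · simp only [Sigma.mk.injEq, Prod.mk.injEq, heq_eq_eq, and_true]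
      dsimp only at *
      omega
  · intro _ _
    rfl

/-- An s-fold contraction needs y-degree at least s in each factor. Allowing all degrees of total l
+ 2s only adds vanishing terms and removes the shifts. -/
theorem sum_antidiagonal_add (l s : ℕ) (F : ℕ → ℕ → R)
    (hF : ∀ l1 l2, l1 < s ∨ l2 < s → F l1 l2 = 0) :
    ∑ z ∈ HasAntidiagonal.antidiagonal l, F (z.1 + s) (z.2 + s) =
      ∑ w ∈ HasAntidiagonal.antidiagonal (l + 2 * s), F w.1 w.2 := by
  refine sum_of_injOn (fun z => (z.1 + s, z.2 + s)) ?_ ?_ ?_ ?_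
  · rintro ⟨l1, l2⟩ - ⟨l1', l2'⟩ - h
    simpa using h
  · rintro ⟨l1, l2⟩ h
    simp only [mem_coe, HasAntidiagonal.mem_antidiagonal] at h ⊢
    omega
  · rintro ⟨l1, l2⟩ h h'
    apply hF
    by_contra hlt
    apply h'
    simp only [HasAntidiagonal.mem_antidiagonal] at h
    refine ⟨(l1 - s, l2 - s), ?_, ?_⟩
    · simp only [mem_coe, HasAntidiagonal.mem_antidiagonal]
      omega
    · simp only [Prod.mk.injEq]
      omega
  · intro _ _
    rfl

end Antidiagonals

/-! ### Homogeneity and associativity of the Wick product on a fibre -/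

section Fibre

variable {m : ℕ}

namespace Sm

variable {n p q r : ℕ}

/-- Homogeneity of degree `l`. -/
def Hom (l : ℕ) (f : Sm m n) : Prop := ∀ (t : ℝ) (y : Model m), f (t • y) = t ^ l • f y

theorem hom_zero (l : ℕ) : Hom l (0 : Sm m n) := fun t y => by
  ext
  simp

theorem Hom.add {l : ℕ} {f g : Sm m n} (hf : Hom l f) (hg : Hom l g) : Hom l (f + g) :=
  fun t y => by rw [add_apply, add_apply, hf, hg, smul_add]

theorem Hom.smul {l : ℕ} {f : Sm m n} (c : ℂ) (hf : Hom l f) : Hom l (c • f) :=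
  fun t y => by rw [smul_apply, smul_apply, hf, smul_comm]

theorem Hom.sum {l : ℕ} {ι : Type*} {s : Finset ι} {f : ι → Sm m n} (hf : ∀ i ∈ s, Hom l (f i)) :
    Hom l (∑ i ∈ s, f i) := fun t y => by
  rw [sum_apply, sum_apply, Finset.smul_sum]
  exact Finset.sum_congr rfl fun i hi => hf i hi t y

theorem Hom.dir_smul {l : ℕ} {f : Sm m n} (hf : Hom l f) (v y : Model m) (t : ℝ) :
    t • dir v f (t • y) = t ^ l • dir v f y := by
  have h1 : HasFDerivAt (fun z : Model m => f (t • z)) (t • fderiv ℝ f (t • y)) y := by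
    have h2 : HasFDerivAt (fun z : Model m => t • z) (t • ContinuousLinearMap.id ℝ (Model m)) y :=
      (hasFDerivAt_id y).fun_const_smul t
    exact ((Sm.differentiable f (t • y)).hasFDerivAt.comp y h2).congr_fderiv (by ext; simp)
  have h2 : HasFDerivAt (fun z : Model m => f (t • z)) (t ^ l • fderiv ℝ f y) y := by
    have : (fun z : Model m => f (t • z)) = fun z => t ^ l • f z := funext (hf t)
    rw [this]
    exact (Sm.differentiable f y).hasFDerivAt.fun_const_smul _
  exact congrArg (fun L => L v) (h1.unique h2)

theorem Hom.dir {l : ℕ} {f : Sm m n} (hf : Hom (l + 1) f) (v : Model m) : Hom l (dir v f) := by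
  intro t y
  have hcont : Continuous fun t : ℝ => Sm.dir v f (t • y) :=
    (Sm.contDiff (Sm.dir v f)).continuous.comp (by fun_prop)
  have hcont' : Continuous fun t : ℝ => t ^ l • Sm.dir v f y := by fun_prop
  -- Homogeneity of the derivative follows by cancelling t, which is possible only for t ≠ 0; the
  -- value at t = 0 is obtained by continuity.
  have hd : Dense ({0}ᶜ : Set ℝ) := dense_compl_singleton 0
  refine congrFun (Continuous.ext_on hd hcont hcont' fun t ht => ?_) t
  have h := hf.dir_smul v y t
  rw [pow_succ', mul_smul] at h
  exact smul_right_injective _ ht h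

theorem Hom.dir_zero {f : Sm m n} (hf : Hom 0 f) (v : Model m) : Sm.dir v f = 0 := by
  have : (f : Model m → Alt m n) = fun _ => f 0 := by
    funext y
    have := hf 0 y
    simpa using this.symm
  refine Sm.ext fun y => ?_
  rw [dir_apply, this]
  simp

theorem Hom.euler {l : ℕ} {f : Sm m n} (hf : Hom l f) (y : Model m) :
    fderiv ℝ f y y = l • f y := by
  have h1 : HasDerivAt (fun t : ℝ => f (t • y)) (fderiv ℝ f ((1 : ℝ) • y) ((1 : ℝ) • y)) 1 := by
    have h2 : HasDerivAt (fun t : ℝ => t • y) ((1 : ℝ) • y) 1 := (hasDerivAt_id 1).smul_const y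
    exact (Sm.differentiable f _).hasFDerivAt.comp_hasDerivAt _ h2
  have h2 : HasDerivAt (fun t : ℝ => f (t • y)) ((l * 1 ^ (l - 1) : ℝ) • f y) 1 := by
    have : (fun t : ℝ => f (t • y)) = fun t => t ^ l • f y := funext fun t => hf t y
    rw [this]
    exact (hasDerivAt_pow l 1).smul_const (f y)
  have := h1.unique h2
  rw [← Nat.cast_smul_eq_nsmul ℝ]
  simpa using this

theorem Hom.mul {N l1 l2 : ℕ} (hN : p + q = N) {f : Sm m p} {g : Sm m q} (hf : Hom l1 f)
    (hg : Hom l2 g) : Hom (l1 + l2) (Sm.mul hN f g) := by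
  intro t y
  rw [mul_apply, mul_apply, hf, hg, ← wedgeCLM_apply, ← wedgeCLM_apply]
  simp only [map_smul, _root_.smul_apply, smul_smul, ← pow_add]
  rw [add_comm l2 l1]

variable (h : Fin (2 * m + 1) → Fin (2 * m + 1) → ℂ)

theorem Hom.star {N : ℕ} (hN : p + q = N) {s l1 l2 : ℕ} {f : Sm m p} {g : Sm m q}
    (hf : Hom (l1 + s) f) (hg : Hom (l2 + s) g) : Hom (l1 + l2) (star h hN s f g) := by
  induction s generalizing f g with
  | zero => exact hf.mul hN hg
  | succ s ih =>
    rw [star_succ]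
    exact Hom.sum fun i _ => Hom.sum fun j _ => (ih (hf.dir _) (hg.dir _)).smul _

theorem Hom.star_eq_zero_left {N : ℕ} (hN : p + q = N) {s l : ℕ} {f : Sm m p} (g : Sm m q)
    (hf : Hom l f) (hl : l < s) : Sm.star h hN s f g = 0 := by
  induction s generalizing f g l with
  | zero => omega
  | succ s ih =>
    rw [star_succ]
    refine Finset.sum_eq_zero fun i _ => Finset.sum_eq_zero fun j _ => ?_
    rcases l with _ | l
    · rw [hf.dir_zero, map_zero, LinearMap.zero_apply, smul_zero]
    · rw [ih _ (hf.dir _) (by omega), smul_zero]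

theorem Hom.star_eq_zero_right {N : ℕ} (hN : p + q = N) {s l : ℕ} (f : Sm m p) {g : Sm m q}
    (hg : Hom l g) (hl : l < s) : Sm.star h hN s f g = 0 := by
  rw [star_comm h (by omega : q + p = N) hN, hg.star_eq_zero_left _ _ _ hl,
    smul_zero]

/-- The Wick product on a fibre. -/
def circ {N : ℕ} (hN : p + q = N) (a : ℕ → ℕ → Sm m p) (b : ℕ → ℕ → Sm m q) (k l : ℕ) : Sm m N :=
  ∑ x ∈ Finset.HasAntidiagonal.antidiagonal k, ∑ y ∈ Finset.HasAntidiagonal.antidiagonal x.2,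
    ∑ z ∈ Finset.HasAntidiagonal.antidiagonal (l + 2 * x.1),
      expCoeff x.1 • star h hN x.1 (a y.1 z.1) (b y.2 z.2)

theorem circ_eq {N : ℕ} (hN : p + q = N) {a : ℕ → ℕ → Sm m p} {b : ℕ → ℕ → Sm m q}
    (ha : ∀ k l, Hom l (a k l)) (hb : ∀ k l, Hom l (b k l)) (k l : ℕ) :
    circ h hN a b k l = ∑ s ∈ Finset.range (k + 1),
      ∑ ks ∈ Finset.HasAntidiagonal.antidiagonal (k - s),
      ∑ ls ∈ Finset.HasAntidiagonal.antidiagonal l,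
        expCoeff s • star h hN s (a ks.1 (ls.1 + s)) (b ks.2 (ls.2 + s)) := by
  rw [circ, Finset.Nat.sum_antidiagonal_eq_sum_range_succ_mk]
  refine Finset.sum_congr rfl fun s _ => Finset.sum_congr rfl fun ks _ => ?_
  refine (sum_antidiagonal_add l s
    (fun l1 l2 => expCoeff s • star h hN s (a ks.1 l1) (b ks.2 l2)) fun l1 l2 hl => ?_).symm
  rcases hl with hl | hl
  · rw [(ha ks.1 l1).star_eq_zero_left h hN _ hl, smul_zero]
  · rw [(hb ks.2 l2).star_eq_zero_right h hN _ hl, smul_zero]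

theorem hom_circ {N : ℕ} (hN : p + q = N) {a : ℕ → ℕ → Sm m p} {b : ℕ → ℕ → Sm m q}
    (ha : ∀ k l, Hom l (a k l)) (hb : ∀ k l, Hom l (b k l)) (k l : ℕ) :
    Hom l (circ h hN a b k l) := by
  rw [circ_eq h hN ha hb]
  refine Hom.sum fun s _ => Hom.sum fun ks _ => Hom.sum fun ls hls => Hom.smul _ ?_
  rw [← Finset.HasAntidiagonal.mem_antidiagonal.1 hls]
  exact (ha _ _).star h hN (hb _ _)

/-- Both bracketings are brought to a common order of summation. For fixed ν-degrees and y-degrees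
of the three factors, what remains is the sum over the inner and outer numbers of contractions,
which `star_assoc` compares. -/
theorem circ_assoc {α β N : ℕ} (h1 : p + q = α) (h2 : α + r = N) (h3 : q + r = β)
    (h4 : p + β = N) {a : ℕ → ℕ → Sm m p} {b : ℕ → ℕ → Sm m q} {c : ℕ → ℕ → Sm m r}
    (ha : ∀ k l, Hom l (a k l)) (hc : ∀ k l, Hom l (c k l)) (hb : ∀ k l, Hom l (b k l)) (k l : ℕ) :
    circ h h2 (circ h h1 a b) c k l = circ h h4 a (circ h h3 b c) k l := by
  have hL : circ h h2 (circ h h1 a b) c k l =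
      ∑ n ∈ Finset.HasAntidiagonal.antidiagonal k,
      ∑ u ∈ Finset.HasAntidiagonal.antidiagonal n.1,
      ∑ w ∈ Finset.HasAntidiagonal.antidiagonal n.2,
      ∑ w' ∈ Finset.HasAntidiagonal.antidiagonal w.1,
      ∑ z ∈ Finset.HasAntidiagonal.antidiagonal (l + 2 * (u.1 + u.2)),
      ∑ z' ∈ Finset.HasAntidiagonal.antidiagonal z.1, (expCoeff u.2 * expCoeff u.1) •
        star h h2 u.2 (star h h1 u.1 (a w'.1 z'.1) (b w'.2 z'.2)) (c w.2 z.2) := by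
    rw [← sum_antidiagonal_split_left k (fun t s k1 k2 k3 =>
      ∑ z ∈ Finset.HasAntidiagonal.antidiagonal (l + 2 * (s + t)),
      ∑ z' ∈ Finset.HasAntidiagonal.antidiagonal z.1, (expCoeff t * expCoeff s) •
        star h h2 t (star h h1 s (a k1 z'.1) (b k2 z'.2)) (c k3 z.2)), circ]
    refine Finset.sum_congr rfl fun x _ => Finset.sum_congr rfl fun y _ => ?_
    have e : ∀ z : ℕ × ℕ, expCoeff x.1 • star h h2 x.1 (circ h h1 a b y.1 z.1) (c y.2 z.2) =
        ∑ x' ∈ Finset.HasAntidiagonal.antidiagonal y.1,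
        ∑ y' ∈ Finset.HasAntidiagonal.antidiagonal x'.2,
        ∑ z' ∈ Finset.HasAntidiagonal.antidiagonal (z.1 + 2 * x'.1),
        (expCoeff x.1 * expCoeff x'.1) •
          star h h2 x.1 (star h h1 x'.1 (a y'.1 z'.1) (b y'.2 z'.2)) (c y.2 z.2) := by
      intro z
      simp only [circ, LinearMap.map_sum₂, LinearMap.map_smul₂, Finset.smul_sum, smul_smul]
    simp only [e]
    rw [Finset.sum_comm]
    refine Finset.sum_congr rfl fun x' _ => ?_
    rw [Finset.sum_comm]
    refine Finset.sum_congr rfl fun y' _ => ?_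
    refine sum_antidiagonal_shift_left l x'.1 x.1 (fun l1 l2 l3 => (expCoeff x.1 * expCoeff x'.1) •
          star h h2 x.1 (star h h1 x'.1 (a y'.1 l1) (b y'.2 l2)) (c y.2 l3)) fun l1 l2 l3 hl => ?_
    have : star h h1 x'.1 (a y'.1 l1) (b y'.2 l2) = 0 := by
      rcases Nat.lt_or_ge l1 x'.1 with hl' | hl'
      · exact (ha _ _).star_eq_zero_left h h1 _ hl'
      · exact (hb _ _).star_eq_zero_right h h1 _ (by omega)
    rw [this, LinearMap.map_zero₂, smul_zero]
  have hR : circ h h4 a (circ h h3 b c) k l =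
      ∑ n ∈ Finset.HasAntidiagonal.antidiagonal k,
      ∑ u ∈ Finset.HasAntidiagonal.antidiagonal n.1,
      ∑ w ∈ Finset.HasAntidiagonal.antidiagonal n.2,
      ∑ w' ∈ Finset.HasAntidiagonal.antidiagonal w.1,
      ∑ z ∈ Finset.HasAntidiagonal.antidiagonal (l + 2 * (u.1 + u.2)),
      ∑ z' ∈ Finset.HasAntidiagonal.antidiagonal z.1, (expCoeff u.2 * expCoeff u.1) •
        star h h4 u.2 (a w'.1 z'.1) (star h h3 u.1 (b w'.2 z'.2) (c w.2 z.2)) := by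
    rw [← sum_antidiagonal_split_right k (fun t s k1 k2 k3 =>
      ∑ z ∈ Finset.HasAntidiagonal.antidiagonal (l + 2 * (s + t)),
      ∑ z' ∈ Finset.HasAntidiagonal.antidiagonal z.1, (expCoeff t * expCoeff s) •
        star h h4 t (a k1 z'.1) (star h h3 s (b k2 z'.2) (c k3 z.2))), circ]
    refine Finset.sum_congr rfl fun x _ => Finset.sum_congr rfl fun y _ => ?_
    have e : ∀ z : ℕ × ℕ, expCoeff x.1 • star h h4 x.1 (a y.1 z.1) (circ h h3 b c y.2 z.2) =
        ∑ x' ∈ Finset.HasAntidiagonal.antidiagonal y.2,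
        ∑ y' ∈ Finset.HasAntidiagonal.antidiagonal x'.2,
        ∑ z' ∈ Finset.HasAntidiagonal.antidiagonal (z.2 + 2 * x'.1),
        (expCoeff x.1 * expCoeff x'.1) •
          star h h4 x.1 (a y.1 z.1) (star h h3 x'.1 (b y'.1 z'.1) (c y'.2 z'.2)) := by
      intro z
      simp only [circ, map_sum, map_smul, Finset.smul_sum, smul_smul]
    simp only [e]
    rw [Finset.sum_comm]
    refine Finset.sum_congr rfl fun x' _ => ?_
    rw [Finset.sum_comm]
    refine Finset.sum_congr rfl fun y' _ => ?_
    refine sum_antidiagonal_shift_right l x'.1 x.1 (fun l1 l2 l3 => (expCoeff x.1 * expCoeff x'.1) •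
          star h h4 x.1 (a y.1 l1) (star h h3 x'.1 (b y'.1 l2) (c y'.2 l3))) fun l1 l2 l3 hl => ?_
    have : star h h3 x'.1 (b y'.1 l2) (c y'.2 l3) = 0 := by
      rcases Nat.lt_or_ge l2 x'.1 with hl' | hl'
      · exact (hb _ _).star_eq_zero_left h h3 _ hl'
      · exact (hc _ _).star_eq_zero_right h h3 _ (by omega)
    rw [this, map_zero, smul_zero]
  rw [hL, hR]
  refine Finset.sum_congr rfl fun n _ => ?_
  -- The y-degree range depends on the numbers of contractions only through their sum, so the sum
  -- over these numbers can be moved inside.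
  have swap : ∀ F : ℕ → ℕ → ℕ × ℕ → ℕ × ℕ → ℕ × ℕ → ℕ × ℕ → Sm m N,
      ∑ u ∈ Finset.HasAntidiagonal.antidiagonal n.1,
      ∑ w ∈ Finset.HasAntidiagonal.antidiagonal n.2,
      ∑ w' ∈ Finset.HasAntidiagonal.antidiagonal w.1,
      ∑ z ∈ Finset.HasAntidiagonal.antidiagonal (l + 2 * (u.1 + u.2)),
      ∑ z' ∈ Finset.HasAntidiagonal.antidiagonal z.1, F u.1 u.2 w w' z z' =
      ∑ w ∈ Finset.HasAntidiagonal.antidiagonal n.2,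
      ∑ w' ∈ Finset.HasAntidiagonal.antidiagonal w.1,
      ∑ z ∈ Finset.HasAntidiagonal.antidiagonal (l + 2 * n.1),
      ∑ z' ∈ Finset.HasAntidiagonal.antidiagonal z.1,
      ∑ u ∈ Finset.HasAntidiagonal.antidiagonal n.1, F u.1 u.2 w w' z z' := by
    intro F
    rw [Finset.sum_congr rfl fun u hu => by rw [Finset.HasAntidiagonal.mem_antidiagonal.1 hu],
      Finset.sum_comm]
    refine Finset.sum_congr rfl fun w _ => ?_
    rw [Finset.sum_comm]
    refine Finset.sum_congr rfl fun w' _ => ?_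
    rw [Finset.sum_comm]
    refine Finset.sum_congr rfl fun z _ => ?_
    rw [Finset.sum_comm]
  rw [swap (fun s t w w' z z' => (expCoeff t * expCoeff s) •
        star h h2 t (star h h1 s (a w'.1 z'.1) (b w'.2 z'.2)) (c w.2 z.2)),
    swap (fun s t w w' z z' => (expCoeff t * expCoeff s) •
        star h h4 t (a w'.1 z'.1) (star h h3 s (b w'.2 z'.2) (c w.2 z.2)))]
  refine Finset.sum_congr rfl fun w _ => Finset.sum_congr rfl fun w' _ =>
    Finset.sum_congr rfl fun z _ => Finset.sum_congr rfl fun z' _ => ?_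
  exact star_assoc h h1 h2 h3 h4 n.1 _ _ _

end Sm
end Fibre

/-! ### Vertical vector fields, interior products, pullbacks and polynomials on a fibre -/

section Fibre

variable {m : ℕ}

instance (n : ℕ) : NormedAddCommGroup (Alt m n) := inferInstance

instance (n : ℕ) : NormedSpace ℝ (Alt m n) := inferInstance

instance (n : ℕ) : NormedAddCommGroup (Model m →L[ℝ] Alt m n) := inferInstance

instance (n : ℕ) : NormedSpace ℝ (Model m →L[ℝ] Alt m n) := inferInstance

namespace Sm

variable {n p q r : ℕ}

/-- A function as an element of `Sm m n`; zero if the function is not smooth. -/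
def ofFun (f : Model m → Alt m n) : Sm m n :=
  open Classical in if hf : ContDiff ℝ ∞ f then ⟨f, hf⟩ else 0

theorem ofFun_apply {f : Model m → Alt m n} (hf : ContDiff ℝ ∞ f) (y : Model m) :
    ofFun f y = f y :=
  congrArg (fun h : Sm m n => h y) (dif_pos hf : ofFun f = ⟨f, hf⟩)

theorem coe_ofFun {f : Model m → Alt m n} (hf : ContDiff ℝ ∞ f) :
    (ofFun f : Model m → Alt m n) = f := funext fun y => ofFun_apply hf y

theorem ofFun_coe (f : Sm m n) : ofFun (f : Model m → Alt m n) = f :=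
  Sm.ext fun y => ofFun_apply (Sm.contDiff f) y

/-- Composition with a linear map of the values. -/
def map {n' : ℕ} (L : Alt m n →ₗ[ℂ] Alt m n') : Sm m n →ₗ[ℂ] Sm m n' where
  toFun f := ⟨fun y => L (f y),
    (LinearMap.toContinuousLinearMap (L.restrictScalars ℝ)).contDiff.comp (Sm.contDiff f)⟩
  map_add' _ _ := Sm.ext fun _ => map_add L _ _
  map_smul' _ _ := Sm.ext fun _ => map_smul L _ _

@[simp] theorem map_apply {n' : ℕ} (L : Alt m n →ₗ[ℂ] Alt m n') (f : Sm m n) (y : Model m) :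
    map L f y = L (f y) := rfl

theorem dir_map {n' : ℕ} (L : Alt m n →ₗ[ℂ] Alt m n') (v : Model m) (f : Sm m n) :
    dir v (map L f) = map L (dir v f) := by
  refine Sm.ext fun y => ?_
  have := ((LinearMap.toContinuousLinearMap (L.restrictScalars ℝ)).hasFDerivAt.comp y
    (Sm.differentiable f y).hasFDerivAt).fderiv
  exact congrArg (fun A => A v) this

theorem Hom.map {n' l : ℕ} (L : Alt m n →ₗ[ℂ] Alt m n') {f : Sm m n} (hf : Hom l f) :
    Hom l (Sm.map L f) := fun t y => by
  rw [map_apply, map_apply, hf]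
  exact _root_.map_smul (L.restrictScalars ℝ) (t ^ l) (f y)

/-- Interior product with `P y` at `y`. -/
def ins (P : Model m →L[ℝ] Model m) : Sm m (n + 1) →ₗ[ℂ] Sm m n where
  toFun f := ⟨fun y => inner (P y) (f y),
    (innerCLM n).isBoundedBilinearMap.contDiff.comp (P.contDiff.prodMk (Sm.contDiff f))⟩
  map_add' _ _ := Sm.ext fun y => _root_.map_add (inner (P y)) _ _
  map_smul' _ _ := Sm.ext fun y => _root_.map_smul (inner (P y)) _ _

@[simp] theorem ins_apply (P : Model m →L[ℝ] Model m) (f : Sm m (n + 1)) (y : Model m) :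
    ins P f y = inner (P y) (f y) := rfl

theorem dir_ins (P : Model m →L[ℝ] Model m) (v : Model m) (f : Sm m (n + 1)) :
    dir v (ins P f) = ins P (dir v f) + map (inner (P v)) f := by
  refine Sm.ext fun y => ?_
  have := (innerCLM (m := m) n).fderiv_of_bilinear (P.differentiableAt (x := y))
    (Sm.differentiable f y)
  change fderiv ℝ (fun y => innerCLM n (P y) (f y)) y v = _
  rw [this]
  simp [dir_apply]

theorem Hom.ins {l : ℕ} (P : Model m →L[ℝ] Model m) {f : Sm m (n + 1)} (hf : Hom l f) :
    Hom (l + 1) (Sm.ins P f) := fun t y => by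
  rw [ins_apply, ins_apply, hf, ← innerCLM_apply, ← innerCLM_apply, _root_.map_smul,
    _root_.map_smul, _root_.map_smul, _root_.smul_apply, smul_smul, pow_succ]

/-- The derivative along the linear vector field `y ↦ B y`. -/
def vert (B : Model m →L[ℝ] Model m) : Sm m n →ₗ[ℂ] Sm m n where
  toFun f := ⟨fun y => fderiv ℝ f y (B y),
    ((Sm.contDiff f).fderiv_right (m := ∞) le_rfl).clm_apply B.contDiff⟩
  map_add' f g := Sm.ext fun y => by
    have := congrArg (eval y) (_root_.map_add (dir (B y)) f g)
    exact this
  map_smul' c f := Sm.ext fun y => by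
    have := congrArg (eval y) (_root_.map_smul (dir (B y)) c f)
    exact this

theorem vert_apply (B : Model m →L[ℝ] Model m) (f : Sm m n) (y : Model m) :
    vert B f y = fderiv ℝ f y (B y) := rfl

theorem vert_mul {N : ℕ} (h : p + q = N) (B : Model m →L[ℝ] Model m) (f : Sm m p) (g : Sm m q) :
    vert B (mul h f g) = mul h (vert B f) g + mul h f (vert B g) :=
  Sm.ext fun y => by
    have := congrArg (eval y) (dir_mul h (B y) f g)
    exact this

theorem fderiv_dir (v w : Model m) (f : Sm m n) (y : Model m) :
    fderiv ℝ (dir w f) y v = fderiv ℝ (fderiv ℝ f) y v w := by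
  have hd : DifferentiableAt ℝ (fderiv ℝ (f : Model m → Alt m n)) y :=
    ((Sm.contDiff f).fderiv_right (m := ∞) (by simp)).differentiable (by simp) y
  change fderiv ℝ (fun z => fderiv ℝ f z w) y v = _
  rw [fderiv_clm_apply hd (differentiableAt_const w)]
  simp

/-- The commutator of a constant vector field v with the linear field y ↦ B y is the constant field
B v. -/
theorem dir_vert (B : Model m →L[ℝ] Model m) (v : Model m) (f : Sm m n) :
    dir v (vert B f) = vert B (dir v f) + dir (B v) f := by
  refine Sm.ext fun y => ?_
  have hd : DifferentiableAt ℝ (fderiv ℝ (f : Model m → Alt m n)) y :=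
    ((Sm.contDiff f).fderiv_right (m := ∞) (by simp)).differentiable (by simp) y
  have h1 : dir v (vert B f) y = fderiv ℝ (fderiv ℝ f) y v (B y) + fderiv ℝ f y (B v) := by
    change fderiv ℝ (fun z => fderiv ℝ f z (B z)) y v = _
    rw [fderiv_clm_apply hd B.differentiableAt]
    simp [add_comm]
  rw [h1, add_apply, vert_apply, dir_apply, ← fderiv_dir]
  congr 1
  exact congrArg (fun k : Sm m n => k y) (dir_comm v (B y) f)

theorem dir_linear (f : Sm m n) (v : Model m) : dir v f = ∑ i, ((coord v i : ℝ) : ℂ) • pd i f := by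
  refine Sm.ext fun y => ?_
  rw [dir_apply, sum_apply]
  conv_lhs => rw [← sum_coord_smul_e v, map_sum]
  refine Finset.sum_congr rfl fun i _ => ?_
  rw [_root_.map_smul, smul_apply, dir_apply]
  exact (Complex.coe_smul _ _).symm

theorem vert_linear (B : Model m →L[ℝ] Model m) (f : Sm m n) (y : Model m) :
    vert B f y = ∑ i, ((coord (B y) i : ℝ) : ℂ) • pd i f y := by
  have := congrArg (fun k : Sm m n => k y) (dir_linear f (B y))
  rw [sum_apply] at this
  exact this

/-- Pullback of a form on a fibre by a linear map. -/
def pull (F : Model m →L[ℝ] Model m) : Sm m n →ₗ[ℂ] Sm m n where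
  toFun f := ⟨fun y => (f (F y)).compContinuousLinearMap F,
    (ContinuousAlternatingMap.compContinuousLinearMapCLM (𝕜 := ℝ) (F := ℂ) (ι := Fin n) F).contDiff.comp
      ((Sm.contDiff f).comp F.contDiff)⟩
  map_add' _ _ := Sm.ext fun _ => rfl
  map_smul' _ _ := Sm.ext fun _ => rfl

@[simp] theorem pull_apply (F : Model m →L[ℝ] Model m) (f : Sm m n) (y : Model m) :
    pull F f y = (f (F y)).compContinuousLinearMap F := rfl

theorem Hom.pull {l : ℕ} (F : Model m →L[ℝ] Model m) {f : Sm m n} (hf : Hom l f) :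
    Hom l (Sm.pull F f) := fun t y => by
  rw [pull_apply, pull_apply, _root_.map_smul, hf]
  rfl

theorem dir_pull (F : Model m →L[ℝ] Model m) (v : Model m) (f : Sm m n) :
    dir v (pull F f) = pull F (dir (F v) f) := by
  refine Sm.ext fun y => ?_
  have h1 := (Sm.differentiable f (F y)).hasFDerivAt.comp y F.hasFDerivAt
  have := ((ContinuousAlternatingMap.compContinuousLinearMapCLM (𝕜 := ℝ) (F := ℂ) (ι := Fin n) F).hasFDerivAt.comp y h1).fderiv
  exact congrArg (fun A => A v) this

theorem pull_mul {N : ℕ} (h : p + q = N) (F : Model m →L[ℝ] Model m) (f : Sm m p) (g : Sm m q) :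
    pull F (mul h f g) = mul h (pull F f) (pull F g) :=
  Sm.ext fun _ => wedge_comp h _ _ F

/-- If the tensor `h` is the image of `h'` under `F`, then `star` is compatible with the
pullback by `F`. -/
theorem pull_star {N : ℕ} (hN : p + q = N) (F : Model m →L[ℝ] Model m)
    (h h' : Fin (2 * m + 1) → Fin (2 * m + 1) → ℂ)
    (hh : ∀ i j, h i j = ∑ a, ∑ b, h' a b * (coord (F (e a)) i * coord (F (e b)) j : ℝ)) (s : ℕ)
    (f : Sm m p) (g : Sm m q) :
    pull F (star h hN s f g) = star h' hN s (pull F f) (pull F g) := by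
  induction s generalizing f g with
  | zero => exact pull_mul hN F f g
  | succ s ih =>
    rw [star_succ, star_succ]
    have e1 : ∀ a b : Fin (2 * m + 1), h' a b • star h' hN s (pd a (pull F f)) (pd b (pull F g)) =
        ∑ i, ∑ j, (h' a b * (coord (F (e a)) i * coord (F (e b)) j : ℝ)) •
          star h' hN s (pull F (pd i f)) (pull F (pd j g)) := by
      intro a b
      rw [dir_pull, dir_pull, dir_linear, dir_linear g]
      simp only [map_sum (pull F), _root_.map_smul (pull F)]
      rw [LinearMap.map_sum₂, Finset.smul_sum]
      simp only [LinearMap.map_smul₂]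
      simp only [map_sum, _root_.map_smul, Finset.smul_sum, smul_smul]
      refine Finset.sum_congr rfl fun i _ => Finset.sum_congr rfl fun j _ => ?_
      congr 1
      push_cast
      ring
    simp only [e1, map_sum, _root_.map_smul, ih, hh, Finset.sum_smul]
    calc ∑ i, ∑ j, ∑ a, ∑ b, (h' a b * (coord (F (e a)) i * coord (F (e b)) j : ℝ)) •
          star h' hN s (pull F (pd i f)) (pull F (pd j g)) =
        ∑ i, ∑ a, ∑ b, ∑ j, (h' a b * (coord (F (e a)) i * coord (F (e b)) j : ℝ)) •
          star h' hN s (pull F (pd i f)) (pull F (pd j g)) := by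
          refine Finset.sum_congr rfl fun i _ => ?_
          rw [Finset.sum_comm]
          refine Finset.sum_congr rfl fun a _ => ?_
          rw [Finset.sum_comm]
      _ = _ := by
          rw [Finset.sum_comm]
          refine Finset.sum_congr rfl fun a _ => ?_
          rw [Finset.sum_comm]

theorem pull_circ {N : ℕ} (hN : p + q = N) (F : Model m →L[ℝ] Model m)
    (h h' : Fin (2 * m + 1) → Fin (2 * m + 1) → ℂ)
    (hh : ∀ i j, h i j = ∑ a, ∑ b, h' a b * (coord (F (e a)) i * coord (F (e b)) j : ℝ))
    (a : ℕ → ℕ → Sm m p) (b : ℕ → ℕ → Sm m q) (k l : ℕ) :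
    pull F (circ h hN a b k l) =
      circ h' hN (fun k l => pull F (a k l)) (fun k l => pull F (b k l)) k l := by
  simp only [circ, map_sum, _root_.map_smul, pull_star hN F h h' hh]

/-- This unfolds the recursive contraction into the multi-index sum that defines the Wick product;
one recursion step appends one index to each multi-index. -/
theorem star_apply_eq_sum {N : ℕ} (hN : p + q = N) (h : Fin (2 * m + 1) → Fin (2 * m + 1) → ℂ)
    (s : ℕ) (f : Sm m p) (g : Sm m q) (y : Model m) :
    star h hN s f g y = ∑ I : Fin s → Fin (2 * m + 1), ∑ J : Fin s → Fin (2 * m + 1),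
      (∏ t, h (I t) (J t)) • wedge hN (iteratedFDeriv ℝ s f y fun t => e (I t))
        (iteratedFDeriv ℝ s g y fun t => e (J t)) := by
  have key : ∀ {n : ℕ} (s : ℕ) (f : Sm m n) (i : Fin (2 * m + 1))
      (v : Fin s → Model m), iteratedFDeriv ℝ s (pd i f) y v =
        iteratedFDeriv ℝ (s + 1) f y (Fin.snoc v (e i)) := by
    intro n s f i v
    rw [iteratedFDeriv_succ_apply_right, Fin.init_snoc, Fin.snoc_last]
    have := (ContinuousLinearMap.apply ℝ (Alt m n) (e i : Model m)).iteratedFDeriv_comp_left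
      (f := fderiv ℝ (f : Model m → Alt m n)) (x := y) (n := ∞) (i := s)
      ((Sm.contDiff f).fderiv_right (m := ∞) (by simp)).contDiffAt (by exact_mod_cast le_top)
    exact congrArg (fun A => A v) this
  induction s generalizing f g with
  | zero =>
    rw [star_zero, mul_apply, Fintype.sum_unique, Fintype.sum_unique]
    simp
  | succ s ih =>
    have snoc : ∀ G : (Fin (s + 1) → Fin (2 * m + 1)) → Alt m N,
        ∑ I, G I = ∑ i, ∑ I : Fin s → Fin (2 * m + 1), G (Fin.snoc I i) := by
      intro G
      rw [← Equiv.sum_comp (Fin.snocEquiv fun _ : Fin (s + 1) => Fin (2 * m + 1)),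
        Fintype.sum_prod_type]
      rfl
    have hsnoc : ∀ (I : Fin s → Fin (2 * m + 1)) (i : Fin (2 * m + 1)),
        (fun t => (e ((Fin.snoc I i : Fin (s + 1) → Fin (2 * m + 1)) t) : Model m)) =
          (Fin.snoc (fun t => e (I t)) (e i) : Fin (s + 1) → Model m) := by
      intro I i
      funext t
      refine Fin.lastCases ?_ (fun t => ?_) t <;> simp
    simp only [snoc, hsnoc, Fin.prod_univ_castSucc, Fin.snoc_castSucc, Fin.snoc_last]
    rw [star_succ]
    simp only [sum_apply, smul_apply, ih, key, Finset.smul_sum, smul_smul]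
    calc ∑ i, ∑ j, ∑ I : Fin s → Fin (2 * m + 1), ∑ J : Fin s → Fin (2 * m + 1),
          (h i j * ∏ t, h (I t) (J t)) • wedge hN
            (iteratedFDeriv ℝ (s + 1) f y (Fin.snoc (fun t => e (I t)) (e i)))
            (iteratedFDeriv ℝ (s + 1) g y (Fin.snoc (fun t => e (J t)) (e j))) =
        ∑ i, ∑ I : Fin s → Fin (2 * m + 1), ∑ j, ∑ J : Fin s → Fin (2 * m + 1),
          (h i j * ∏ t, h (I t) (J t)) • wedge hN
            (iteratedFDeriv ℝ (s + 1) f y (Fin.snoc (fun t => e (I t)) (e i)))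
            (iteratedFDeriv ℝ (s + 1) g y (Fin.snoc (fun t => e (J t)) (e j))) :=
          Finset.sum_congr rfl fun i _ => Finset.sum_comm
      _ = _ := by simp only [mul_comm (h _ _)]

/-- A homogeneous smooth function is a polynomial. -/
theorem exists_multilinear_iff {l : ℕ} {f : Model m → Alt m n} :
    (∃ A : ContinuousMultilinearMap ℝ (fun _ : Fin l => Model m) (Alt m n), ∀ y, f y = A fun _ => y)
      ↔ ContDiff ℝ ∞ f ∧ ∀ (t : ℝ) (y : Model m), f (t • y) = t ^ l • f y := by
  constructor
  · rintro ⟨A, hA⟩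
    obtain rfl : f = fun y => A fun _ => y := funext hA
    refine ⟨A.contDiff.comp (contDiff_pi.2 fun _ => contDiff_id), fun t y => ?_⟩
    have := A.map_smul_univ (fun _ => t) fun _ => y
    simpa using this
  · rintro ⟨hf, hl⟩
    -- The witness is the Taylor coefficient of order l at the origin. On the line through y the
    -- function is t^l f(y), so its l-th derivative at 0 is l! f(y).
    refine ⟨((l.factorial : ℝ)⁻¹) • iteratedFDeriv ℝ l f 0, fun y => ?_⟩
    have h1 := (ContinuousLinearMap.toSpanSingleton ℝ y).iteratedFDeriv_comp_right (n := ∞)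
      (f := f) hf (0 : ℝ) (i := l) (by exact_mod_cast le_top)
    have h2 : f ∘ (ContinuousLinearMap.toSpanSingleton ℝ y) = fun t : ℝ => t ^ l • f y := by
      funext t
      simp [hl]
    have h3 := congrArg (fun A => A fun _ => (1 : ℝ)) h1
    rw [h2] at h3
    have h4 : iteratedDeriv l (fun t : ℝ => t ^ l • f y) 0 = (l.factorial : ℝ) • f y := by
      have : (fun t : ℝ => t ^ l • f y) =
          (ContinuousLinearMap.toSpanSingleton ℝ (f y)) ∘ fun t : ℝ => t ^ l := by
        funext t
        simp
      rw [this, iteratedDeriv_eq_iteratedFDeriv,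
        (ContinuousLinearMap.toSpanSingleton ℝ (f y)).iteratedFDeriv_comp_left (n := ∞)
          (by fun_prop) (by exact_mod_cast le_top)]
      change (ContinuousLinearMap.toSpanSingleton ℝ (f y))
        (iteratedFDeriv ℝ l (fun t : ℝ => t ^ l) 0 fun _ => 1) = _
      rw [← iteratedDeriv_eq_iteratedFDeriv]
      simp [Nat.descFactorial_self]
    rw [iteratedDeriv_eq_iteratedFDeriv] at h4
    have h5 : iteratedFDeriv ℝ l f 0 (fun _ => y) = (l.factorial : ℝ) • f y := by
      rw [← h4]
      refine Eq.trans ?_ h3.symm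
      simp
    change f y = (l.factorial : ℝ)⁻¹ • iteratedFDeriv ℝ l f 0 fun _ => y
    rw [h5, inv_smul_smul₀ (Nat.cast_ne_zero.2 l.factorial_ne_zero)]

end Sm
end Fibre

/-! ### Brackets with forms that are constant, linear or quadratic in y -/

section Fibre

variable {m : ℕ}

theorem oneForm_eq_sum (α : Model m →L[ℝ] ℝ) :
    oneForm α = ∑ i, ((α (e i) : ℝ) : ℂ) • (dx i : Alt m 1) := by
  ext v
  rw [ContinuousAlternatingMap.sum_apply, oneForm_apply]
  conv_lhs => rw [← sum_coord_smul_e (v 0), map_sum, Complex.ofReal_sum]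
  refine Finset.sum_congr rfl fun i _ => ?_
  rw [ContinuousAlternatingMap.smul_apply, dx_apply, map_smul, smul_eq_mul, smul_eq_mul, Complex.ofReal_mul,
    mul_comm]

namespace Sm

variable {n p q r N : ℕ} (h : Fin (2 * m + 1) → Fin (2 * m + 1) → ℂ)

theorem circ_add_left (hN : p + q = N) (a a' : ℕ → ℕ → Sm m p) (b : ℕ → ℕ → Sm m q) :
    circ h hN (a + a') b = circ h hN a b + circ h hN a' b := by
  funext k l
  simp only [circ, Pi.add_apply, LinearMap.map_add₂, smul_add, Finset.sum_add_distrib]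

theorem circ_add_right (hN : p + q = N) (a : ℕ → ℕ → Sm m p) (b b' : ℕ → ℕ → Sm m q) :
    circ h hN a (b + b') = circ h hN a b + circ h hN a b' := by
  funext k l
  simp only [circ, Pi.add_apply, map_add, smul_add, Finset.sum_add_distrib]

theorem circ_smul_left (hN : p + q = N) (c : ℂ) (a : ℕ → ℕ → Sm m p) (b : ℕ → ℕ → Sm m q) :
    circ h hN (c • a) b = c • circ h hN a b := by
  funext k l
  simp only [circ, Pi.smul_apply, LinearMap.map_smul₂, Finset.smul_sum]
  simp only [smul_comm c]

theorem circ_smul_right (hN : p + q = N) (c : ℂ) (a : ℕ → ℕ → Sm m p) (b : ℕ → ℕ → Sm m q) :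
    circ h hN a (c • b) = c • circ h hN a b := by
  funext k l
  simp only [circ, Pi.smul_apply, map_smul, Finset.smul_sum]
  simp only [smul_comm c]

/-- The graded commutator for the fibrewise Wick product. -/
def gcomm (hN : p + q = N) (hN' : q + p = N) (a : ℕ → ℕ → Sm m p) (b : ℕ → ℕ → Sm m q) (k l : ℕ) :
    Sm m N :=
  circ h hN a b k l - (-1 : ℂ) ^ (p * q) • circ h hN' b a k l

/-- By `star_comm` the reversed product is the product for the transposed tensor, and the graded
sign disappears. The terms without contraction cancel, which is why commutators can be divided by ν.
-/
theorem gcomm_eq (hN : p + q = N) (hN' : q + p = N) (a : ℕ → ℕ → Sm m p) (b : ℕ → ℕ → Sm m q)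
    (k l : ℕ) : gcomm h hN hN' a b k l =
      ∑ x ∈ Finset.HasAntidiagonal.antidiagonal k, ∑ y ∈ Finset.HasAntidiagonal.antidiagonal x.2,
        ∑ z ∈ Finset.HasAntidiagonal.antidiagonal (l + 2 * x.1), expCoeff x.1 •
          (star h hN x.1 (a y.1 z.1) (b y.2 z.2)
            - star (fun i j => h j i) hN x.1 (a y.1 z.1) (b y.2 z.2)) := by
  rw [gcomm, circ, circ]
  simp only [smul_sub, Finset.sum_sub_distrib]
  congr 1
  rw [Finset.smul_sum]
  refine Finset.sum_congr rfl fun x _ => ?_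
  rw [Finset.smul_sum]
  refine Finset.Nat.sum_antidiagonal_swap.symm.trans (Finset.sum_congr rfl fun y _ => ?_)
  rw [Finset.smul_sum]
  refine Finset.Nat.sum_antidiagonal_swap.symm.trans (Finset.sum_congr rfl fun z _ => ?_)
  rw [star_comm h hN hN', smul_comm, smul_smul ((-1 : ℂ) ^ _), ← mul_pow]
  simp

theorem gcomm_zero (hN : p + q = N) (hN' : q + p = N) (a : ℕ → ℕ → Sm m p)
    (b : ℕ → ℕ → Sm m q) (l : ℕ) : gcomm h hN hN' a b 0 l = 0 := by
  rw [gcomm_eq]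
  refine Finset.sum_eq_zero fun x hx => Finset.sum_eq_zero fun y _ =>
    Finset.sum_eq_zero fun z _ => ?_
  have : x.1 = 0 := by
    have := Finset.HasAntidiagonal.mem_antidiagonal.1 hx
    omega
  rw [this, star_zero, star_zero, sub_self, smul_zero]

/-- The family whose only component is `f`, of order `0` in `ν` and of `y`-degree `L`. -/
def single (L : ℕ) (f : Sm m n) (k l : ℕ) : Sm m n := if k = 0 ∧ l = L then f else 0

theorem single_self (L : ℕ) (f : Sm m n) : single L f 0 L = f := if_pos ⟨rfl, rfl⟩

theorem single_of_ne {L : ℕ} (f : Sm m n) {k l : ℕ} (hkl : ¬(k = 0 ∧ l = L)) :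
    single L f k l = 0 := if_neg hkl

theorem Hom.single {L : ℕ} {f : Sm m n} (hf : Hom L f) (k l : ℕ) : Hom l (Sm.single L f k l) := by
  by_cases hkl : k = 0 ∧ l = L
  · obtain ⟨rfl, rfl⟩ := hkl
    rwa [single_self]
  · rw [single_of_ne f hkl]
    exact hom_zero l

/-- Terms without contraction cancel, and by `hs` so do those with at least two, leaving the Poisson
bracket. The subtraction in `l + 2 - L` is a genuine one since L ≤ 2. -/
theorem gcomm_single (hN : p + q = N) (hN' : q + p = N) {L : ℕ} (hL : L ≤ 2) (f : Sm m p)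
    (hs : ∀ s, 2 ≤ s → ∀ g : Sm m q, star h hN s f g = star (fun i j => h j i) hN s f g)
    (b : ℕ → ℕ → Sm m q) (k l : ℕ) :
    gcomm h hN hN' (single L f) b (k + 1) l = (1 / 2 : ℂ) • ∑ i, ∑ j, (h i j - h j i) •
      mul hN (pd i f) (pd j (b k (l + 2 - L))) := by
  rw [gcomm_eq, Finset.sum_eq_single (1, k), Finset.sum_eq_single (0, k),
    Finset.sum_eq_single (L, l + 2 - L)]
  · simp only [single_self, star_succ, star_zero, ← Finset.sum_sub_distrib, ← sub_smul]
    congr 1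
    simp [expCoeff]
  · rintro ⟨z1, z2⟩ hz hne
    rw [single_of_ne]
    · simp
    · rintro ⟨-, hz1⟩
      have := Finset.HasAntidiagonal.mem_antidiagonal.1 hz
      dsimp only at hz1 this
      exact hne (by rw [hz1] at this ⊢; congr 1; omega)
  · intro hn
    exact absurd (Finset.HasAntidiagonal.mem_antidiagonal.2 (by dsimp only; omega)) hn
  · rintro ⟨y1, y2⟩ hy hne
    refine Finset.sum_eq_zero fun z _ => ?_
    rw [single_of_ne]
    · simp
    · rintro ⟨hy1, -⟩
      have := Finset.HasAntidiagonal.mem_antidiagonal.1 hy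
      dsimp only at hy1 this
      exact hne (by rw [hy1] at this ⊢; congr 1; omega)
  · intro hn
    exact absurd (Finset.HasAntidiagonal.mem_antidiagonal.2 (by dsimp only; omega)) hn
  · rintro ⟨x1, x2⟩ hx hne
    refine Finset.sum_eq_zero fun y _ => Finset.sum_eq_zero fun z _ => ?_
    have hx' := Finset.HasAntidiagonal.mem_antidiagonal.1 hx
    dsimp only at hx' ⊢
    rcases (by omega : x1 = 0 ∨ x1 = 1 ∨ 2 ≤ x1) with h0 | h1 | h2
    · rw [h0, star_zero, star_zero, sub_self, smul_zero]
    · exact absurd (by rw [h1] at hx' ⊢; congr 1; omega) hne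
    · by_cases hyz : y.1 = 0 ∧ z.1 = L
      · rw [hyz.1, hyz.2, single_self, hs x1 h2, sub_self, smul_zero]
      · rw [single_of_ne f hyz]
        simp
  · intro hn
    exact absurd (Finset.HasAntidiagonal.mem_antidiagonal.2 (by dsimp only; omega)) hn

/-- Forms that do not depend on y are central. Applied to ω, this is the reason why Weyl curvature ω
makes the connection abelian. -/
theorem gcomm_single_zero (hN : p + q = N) (hN' : q + p = N) {f : Sm m p} (hf : Hom 0 f)
    (b : ℕ → ℕ → Sm m q) (k l : ℕ) : gcomm h hN hN' (single 0 f) b k l = 0 := by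
  rcases k with _ | k
  · exact gcomm_zero h hN hN' _ b l
  · rw [gcomm_single h hN hN' (by omega) f fun s hs g => by
      rw [hf.star_eq_zero_left _ _ _ (by omega), hf.star_eq_zero_left _ _ _ (by omega)]]
    simp [hf.dir_zero]

/-- The operator `δ` on functions. -/
def dl : Sm m n →ₗ[ℂ] Sm m (n + 1) :=
  ∑ i, map (wedgeL (Nat.add_comm 1 n) (dx i)) ∘ₗ pd i

theorem dl_eq_sum (f : Sm m n) :
    dl f = ∑ i, map (wedgeL (Nat.add_comm 1 n) (dx i)) (pd i f) := by
  simp [dl]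

theorem dl_apply (f : Sm m n) (y : Model m) : dl f y = dxSum fun i => pd i f y := by
  rw [dl_eq_sum, sum_apply, dxSum_apply]
  rfl

theorem Hom.dl {l : ℕ} {f : Sm m n} (hf : Hom (l + 1) f) : Hom l (Sm.dl f) := by
  rw [dl_eq_sum]
  exact Hom.sum fun i _ => (hf.dir _).map _

/-- The one-form `y ↦ w(y, ·)` with linear dependence on `y`. -/
def linearForm (w : Model m →L[ℝ] Model m →L[ℝ] ℝ) : Sm m 1 where
  val y := oneForm (w y)
  property := by
    have h1 : (fun y => oneForm (w y)) = fun y =>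
        ∑ i, (Complex.ofRealCLM (w y (e i))) • (dx i : Alt m 1) :=
      funext fun y => oneForm_eq_sum (w y)
    change ContDiff ℝ ∞ _
    rw [h1]
    refine ContDiff.sum fun i _ => ContDiff.fun_smul ?_ contDiff_const
    exact Complex.ofRealCLM.contDiff.comp (w.contDiff.clm_apply contDiff_const)

theorem linearForm_apply (w : Model m →L[ℝ] Model m →L[ℝ] ℝ) (y : Model m) :
    linearForm w y = oneForm (w y) := rfl

theorem hom_linearForm (w : Model m →L[ℝ] Model m →L[ℝ] ℝ) : Hom 1 (linearForm w) := fun t y => by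
  ext v
  simp [linearForm_apply, oneForm_apply]

theorem dir_linearForm (w : Model m →L[ℝ] Model m →L[ℝ] ℝ) (v y : Model m) :
    dir v (linearForm w) y = oneForm (w v) := by
  have h1 : ((linearForm w : Sm m 1) : Model m → Alt m 1) = fun y =>
        ∑ i, (Complex.ofRealCLM (w y (e i))) • (dx i : Alt m 1) :=
      funext fun y => oneForm_eq_sum (w y)
  have h2 : ∀ i, HasFDerivAt (fun y => (Complex.ofRealCLM (w y (e i))) • (dx i : Alt m 1))
      ((Complex.ofRealCLM ∘L (w.flip (e i))).smulRight (dx i : Alt m 1)) y := fun i =>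
    ((Complex.ofRealCLM ∘L (w.flip (e i))).hasFDerivAt).smul_const (dx i : Alt m 1)
  rw [dir_apply, h1, (HasFDerivAt.fun_sum fun i _ => h2 i).fderiv, oneForm_eq_sum]
  simp

/-- Contraction of the tensor `P` with `w` where `P` is inverse to `-w` on the kernel of `λ`. -/
theorem sum_contract {P : Fin (2 * m + 1) → Fin (2 * m + 1) → ℝ}
    {w : Model m →L[ℝ] Model m →L[ℝ] ℝ} {lam : Model m →L[ℝ] ℝ} {xi : Model m}
    (hP : ∀ v j, ∑ i, P i j * w (e i) v = -coord v j + coord xi j * lam v) (v : Model m)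
    {b : Sm m n} (hb : dir xi b = 0) :
    ∑ i, ∑ j, ((P i j * w (e i) v : ℝ) : ℂ) • pd j b = -dir v b := by
  rw [Finset.sum_comm]
  simp only [← Finset.sum_smul, ← Complex.ofReal_sum, hP]
  simp only [Complex.ofReal_add, Complex.ofReal_neg, add_smul, Finset.sum_add_distrib, neg_smul,
    Finset.sum_neg_distrib, ← dir_linear]
  rw [add_eq_left]
  simp only [Complex.ofReal_mul, mul_comm _ ((lam v : ℝ) : ℂ), mul_smul, ← Finset.smul_sum,
    ← dir_linear, hb, smul_zero]

section Poisson

variable {P : Fin (2 * m + 1) → Fin (2 * m + 1) → ℝ} {w : Model m →L[ℝ] Model m →L[ℝ] ℝ}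
  {lam : Model m →L[ℝ] ℝ} {xi : Model m}

/-- Only the antisymmetric part iP of h enters, and the scalar factor is i · ½ · 2i = -1.
Contracting P with w gives minus the identity up to a multiple of ξ, which does not act on b by
`hb`. -/
theorem bracket_linearForm (hN : 1 + q = q + 1) (hN' : q + 1 = q + 1)
    (hh : ∀ i j, h i j - h j i = 2 * Complex.I * P i j)
    (hP : ∀ v j, ∑ i, P i j * w (e i) v = -coord v j + coord xi j * lam v)
    {b : ℕ → ℕ → Sm m q} (hb : ∀ k l, dir xi (b k l) = 0) (k l : ℕ) :
    Complex.I • gcomm h hN hN' (single 1 (linearForm w)) b (k + 1) l = dl (b k (l + 1)) := by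
  rw [gcomm_single h hN hN' (by omega) _ fun s hs g => by
    rw [(hom_linearForm w).star_eq_zero_left _ _ _ (by omega),
      (hom_linearForm w).star_eq_zero_left _ _ _ (by omega)]]
  rw [show l + 2 - 1 = l + 1 by omega, smul_smul]
  refine Sm.ext fun y => ?_
  simp only [hh, smul_apply, sum_apply, mul_apply, dir_linearForm, oneForm_eq_sum (w _), sum_wedge,
    wedge_smul_left, Finset.smul_sum, smul_smul]
  rw [dl_apply, dxSum_apply]
  have e1 : ∀ i, wedge hN (dx i) (pd i (b k (l + 1)) y) = ∑ j, ∑ a,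
      (-((P j a * w (e j) (e i) : ℝ) : ℂ)) • wedge hN (dx i) (pd a (b k (l + 1)) y) := by
    intro i
    have := congrArg (eval y) (sum_contract hP (e i) (hb k (l + 1)))
    simp only [map_sum, map_smul, map_neg] at this
    have h2 : pd i (b k (l + 1)) y = -∑ j, ∑ a, ((P j a * w (e j) (e i) : ℝ) : ℂ) •
        pd a (b k (l + 1)) y := by
      rw [eq_neg_iff_add_eq_zero, add_comm, ← eq_neg_iff_add_eq_zero]
      exact this
    rw [h2]
    simp only [wedge_neg_right, wedge_sum, wedge_smul_right, neg_smul, Finset.sum_neg_distrib]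
  rw [Finset.sum_congr rfl fun i _ => e1 i]
  have hI := Complex.I_mul_I
  calc _ = ∑ j, ∑ a, ∑ i, (-((P j a * w (e j) (e i) : ℝ) : ℂ)) •
        wedge hN (dx i) (pd a (b k (l + 1)) y) := by
        refine Finset.sum_congr rfl fun j _ => Finset.sum_congr rfl fun a _ =>
          Finset.sum_congr rfl fun i _ => ?_
        congr 1
        push_cast
        linear_combination ((P j a : ℂ) * (w (e j) (e i) : ℂ)) * hI
    _ = ∑ j, ∑ i, ∑ a, (-((P j a * w (e j) (e i) : ℝ) : ℂ)) •
        wedge hN (dx i) (pd a (b k (l + 1)) y) :=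
        Finset.sum_congr rfl fun j _ => Finset.sum_comm
    _ = _ := Finset.sum_comm

/-- The two-form `∑ w(y, A_{ij} y) dxⁱ ∧ dxʲ`, with quadratic dependence on `y`. -/
def quadraticForm (w : Model m →L[ℝ] Model m →L[ℝ] ℝ)
    (A : Fin (2 * m + 1) → Fin (2 * m + 1) → Model m →L[ℝ] Model m) : Sm m 2 where
  val y := ∑ i, ∑ j, (Complex.ofRealCLM (w y (A i j y))) • wedge rfl (dx i) (dx j)
  property := show ContDiff ℝ ∞ (fun y => ∑ i, ∑ j,
      (Complex.ofRealCLM (w y (A i j y))) • (wedge rfl (dx i) (dx j) : Alt m 2)) from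
    ContDiff.sum fun i _ => ContDiff.sum fun j _ => ContDiff.fun_smul
    (Complex.ofRealCLM.contDiff.comp (w.contDiff.clm_apply (A i j).contDiff)) contDiff_const

theorem quadraticForm_apply (A : Fin (2 * m + 1) → Fin (2 * m + 1) → Model m →L[ℝ] Model m)
    (y : Model m) : quadraticForm w A y =
      ∑ i, ∑ j, ((w y (A i j y) : ℝ) : ℂ) • wedge rfl (dx i) (dx j) := rfl

theorem hom_quadraticForm (A : Fin (2 * m + 1) → Fin (2 * m + 1) → Model m →L[ℝ] Model m) :
    Hom 2 (quadraticForm w A) := fun t y => by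
  rw [quadraticForm_apply, quadraticForm_apply, Finset.smul_sum]
  refine Finset.sum_congr rfl fun i _ => ?_
  rw [Finset.smul_sum]
  refine Finset.sum_congr rfl fun j _ => ?_
  refine Eq.trans ?_ (Complex.coe_smul (t ^ 2) _)
  rw [smul_smul]
  congr 1
  simp
  ring

theorem dir_quadraticForm_apply (A : Fin (2 * m + 1) → Fin (2 * m + 1) → Model m →L[ℝ] Model m)
    (v y : Model m) : dir v (quadraticForm w A) y =
      ∑ i, ∑ j, ((w y (A i j v) + w v (A i j y) : ℝ) : ℂ) • wedge rfl (dx i) (dx j) := by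
  have h2 : ∀ i j, HasFDerivAt
      (fun y => (Complex.ofRealCLM (w y (A i j y))) • (wedge rfl (dx i) (dx j) : Alt m 2))
      ((Complex.ofRealCLM ∘L ((w y).comp (A i j) + w.flip (A i j y))).smulRight
        (wedge rfl (dx i) (dx j) : Alt m 2)) y := fun i j =>
    (Complex.ofRealCLM.hasFDerivAt.comp y
      (w.hasFDerivAt.clm_apply (A i j).hasFDerivAt)).smul_const _
  change fderiv ℝ (fun y => ∑ i, ∑ j,
    (Complex.ofRealCLM (w y (A i j y))) • (wedge rfl (dx i) (dx j) : Alt m 2)) y v = _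
  rw [(HasFDerivAt.fun_sum fun i _ => HasFDerivAt.fun_sum fun j _ => h2 i j).fderiv]
  simp only [_root_.sum_apply, ContinuousLinearMap.smulRight_apply, ContinuousLinearMap.comp_apply,
    _root_.add_apply, ContinuousLinearMap.flip_apply, Complex.ofRealCLM_apply]

theorem dir_quadraticForm {A : Fin (2 * m + 1) → Fin (2 * m + 1) → Model m →L[ℝ] Model m}
    (hA : ∀ i j x y, w x (A i j y) = w y (A i j x)) (v y : Model m) :
    dir v (quadraticForm w A) y =
      ∑ i, ∑ j, ((2 * w v (A i j y) : ℝ) : ℂ) • wedge rfl (dx i) (dx j) := by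
  rw [dir_quadraticForm_apply]
  refine Finset.sum_congr rfl fun i _ => Finset.sum_congr rfl fun j _ => ?_
  have h2 : w v (A i j y) + w v (A i j y) = 2 * w v (A i j y) := (two_mul _).symm
  rw [hA i j y v, h2]

/-- The second-order contraction is governed by the constant Hessian of the quadratic form. The
hypothesis `hh` says that contracting this Hessian with h ⊗ h or with its transpose gives the same
result, so no second-order term is left in the commutator. -/
theorem star_two_quadraticForm (hN : 2 + q = N)
    {A : Fin (2 * m + 1) → Fin (2 * m + 1) → Model m →L[ℝ] Model m}
    (hA : ∀ i j x y, w x (A i j y) = w y (A i j x))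
    (hh : ∀ a b j l, ∑ i, ∑ k, (h i j * h k l - h j i * h l k) * (w (e i) (A a b (e k)) : ℂ) = 0)
    (g : Sm m q) :
    star h hN 2 (quadraticForm w A) g = star (fun i j => h j i) hN 2 (quadraticForm w A) g := by
  have hd : ∀ i k y, pd k (pd i (quadraticForm w A)) y =
      ∑ a, ∑ b, ((2 * w (e i) (A a b (e k)) : ℝ) : ℂ) • wedge rfl (dx a) (dx b) := by
    intro i k y
    have h2 : ∀ a b, HasFDerivAt (fun y => (Complex.ofRealCLM (2 * w (e i) (A a b y))) •
        (wedge rfl (dx a) (dx b) : Alt m 2))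
        ((Complex.ofRealCLM ∘L ((2 : ℝ) • (w (e i)).comp (A a b))).smulRight
          (wedge rfl (dx a) (dx b) : Alt m 2)) y := fun a b =>
      (Complex.ofRealCLM ∘L ((2 : ℝ) • (w (e i)).comp (A a b))).hasFDerivAt.smul_const _
    rw [dir_apply]
    have h1 : ((pd i (quadraticForm w A) : Sm m 2) : Model m → Alt m 2) = fun y =>
        ∑ a, ∑ b, (Complex.ofRealCLM (2 * w (e i) (A a b y))) •
          (wedge rfl (dx a) (dx b) : Alt m 2) := funext fun y => dir_quadraticForm hA (e i) y
    rw [h1, (HasFDerivAt.fun_sum fun i _ => HasFDerivAt.fun_sum fun j _ => h2 i j).fderiv]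
    simp
  have hs : ∀ h' : Fin (2 * m + 1) → Fin (2 * m + 1) → ℂ, ∀ y,
      star h' hN 2 (quadraticForm w A) g y = ∑ a, ∑ b, ∑ j, ∑ l,
        (2 * ∑ i, ∑ k, h' i j * h' k l * (w (e i) (A a b (e k)) : ℂ)) •
          wedge hN (wedge rfl (dx a) (dx b)) (pd l (pd j g) y) := by
    intro h' y
    simp only [star_succ, star_zero, sum_apply, smul_apply, mul_apply, hd, sum_wedge,
      wedge_smul_left, Finset.smul_sum, smul_smul, Finset.mul_sum, Finset.sum_smul]
    calc _ = ∑ i, ∑ j, ∑ a, ∑ b, ∑ k, ∑ l, (2 * (h' i j * h' k l * (w (e i) (A a b (e k)) : ℂ))) •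
          wedge hN (wedge rfl (dx a) (dx b)) (pd l (pd j g) y) := by
          refine Finset.sum_congr rfl fun i _ => Finset.sum_congr rfl fun j _ => ?_
          rw [Finset.sum_congr rfl fun k _ => Finset.sum_comm, Finset.sum_comm]
          refine Finset.sum_congr rfl fun a _ => ?_
          rw [Finset.sum_congr rfl fun k _ => Finset.sum_comm, Finset.sum_comm]
          refine Finset.sum_congr rfl fun b _ => Finset.sum_congr rfl fun k _ =>
            Finset.sum_congr rfl fun l _ => ?_
          congr 1
          push_cast
          ring
      _ = ∑ a, ∑ b, ∑ i, ∑ j, ∑ k, ∑ l, (2 * (h' i j * h' k l * (w (e i) (A a b (e k)) : ℂ))) •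
          wedge hN (wedge rfl (dx a) (dx b)) (pd l (pd j g) y) := by
          rw [Finset.sum_congr rfl fun k _ => Finset.sum_comm, Finset.sum_comm]
          refine Finset.sum_congr rfl fun a _ => ?_
          rw [Finset.sum_congr rfl fun k _ => Finset.sum_comm, Finset.sum_comm]
      _ = _ := by
          refine Finset.sum_congr rfl fun a _ => Finset.sum_congr rfl fun b _ => ?_
          rw [Finset.sum_comm]
          refine Finset.sum_congr rfl fun j _ => ?_
          rw [Finset.sum_congr rfl fun k _ => Finset.sum_comm, Finset.sum_comm]
  refine Sm.ext fun y => ?_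
  rw [hs, hs, ← sub_eq_zero, ← Finset.sum_sub_distrib]
  refine Finset.sum_eq_zero fun a _ => ?_
  rw [← Finset.sum_sub_distrib]
  refine Finset.sum_eq_zero fun b _ => ?_
  rw [← Finset.sum_sub_distrib]
  refine Finset.sum_eq_zero fun j _ => ?_
  rw [← Finset.sum_sub_distrib]
  refine Finset.sum_eq_zero fun l _ => ?_
  rw [← sub_smul, ← mul_sub, ← Finset.sum_sub_distrib]
  simp only [← Finset.sum_sub_distrib, ← sub_mul, hh, mul_zero, zero_smul]

/-- A quadratic Hamiltonian generates the linear vector field of its endomorphism. The factor 2 is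
that of the derivative of a symmetric quadratic form. -/
theorem bracket_quadraticForm (hN : 2 + q = N) (hN' : q + 2 = N)
    (hh : ∀ i j, h i j - h j i = 2 * Complex.I * P i j)
    (hP : ∀ v j, ∑ i, P i j * w (e i) v = -coord v j + coord xi j * lam v)
    {A : Fin (2 * m + 1) → Fin (2 * m + 1) → Model m →L[ℝ] Model m}
    (hA : ∀ i j x y, w x (A i j y) = w y (A i j x))
    (hhA : ∀ a b j l, ∑ i, ∑ k, (h i j * h k l - h j i * h l k) * (w (e i) (A a b (e k)) : ℂ) = 0)
    {b : ℕ → ℕ → Sm m q} (hb : ∀ k l, dir xi (b k l) = 0) (k l : ℕ) :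
    Complex.I • gcomm h hN hN' (single 2 (quadraticForm w A)) b (k + 1) l =
      (2 : ℂ) • ∑ i, ∑ j, map (wedgeL hN (wedge rfl (dx i) (dx j))) (vert (A i j) (b k l)) := by
  rw [gcomm_single h hN hN' le_rfl _ fun s hs g => by
    rcases hs.eq_or_lt with rfl | hs
    · exact star_two_quadraticForm h hN hA hhA g
    · rw [(hom_quadraticForm A).star_eq_zero_left _ _ _ hs,
      (hom_quadraticForm A).star_eq_zero_left _ _ _ hs]]
  rw [show l + 2 - 2 = l by omega, smul_smul]
  refine Sm.ext fun y => ?_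
  simp only [hh, smul_apply, sum_apply, mul_apply, dir_quadraticForm hA, sum_wedge,
    wedge_smul_left, Finset.smul_sum, smul_smul, map_apply, wedgeL_apply]
  have e1 : ∀ i j, vert (A i j) (b k l) y = ∑ c, ∑ d,
      (-((P c d * w (e c) (A i j y) : ℝ) : ℂ)) • pd d (b k l) y := by
    intro i j
    have := congrArg (eval y) (sum_contract hP (A i j y) (hb k l))
    simp only [map_sum, map_smul, map_neg] at this
    have h2 : vert (A i j) (b k l) y = -∑ c, ∑ d, ((P c d * w (e c) (A i j y) : ℝ) : ℂ) •
        pd d (b k l) y := by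
      rw [eq_neg_iff_add_eq_zero, add_comm, ← eq_neg_iff_add_eq_zero]
      exact this
    rw [h2]
    simp only [neg_smul, Finset.sum_neg_distrib]
  simp only [e1, wedge_sum, wedge_smul_right, Finset.smul_sum, smul_smul]
  have hI := Complex.I_mul_I
  calc _ = ∑ c, ∑ d, ∑ i, ∑ j, (2 * -((P c d * w (e c) (A i j y) : ℝ) : ℂ)) •
        wedge hN (wedge rfl (dx i) (dx j)) (pd d (b k l) y) := by
        refine Finset.sum_congr rfl fun c _ => Finset.sum_congr rfl fun d _ =>
          Finset.sum_congr rfl fun i _ => Finset.sum_congr rfl fun j _ => ?_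
        congr 1
        push_cast
        linear_combination (2 * (P c d : ℂ) * (w (e c) (A i j y) : ℂ)) * hI
    _ = _ := by
        rw [Finset.sum_congr rfl fun c _ => Finset.sum_comm, Finset.sum_comm]
        refine Finset.sum_congr rfl fun i _ => ?_
        rw [Finset.sum_congr rfl fun c _ => Finset.sum_comm, Finset.sum_comm]

/-- For an odd element the square is half of the graded commutator with itself, so the case b = s of
`bracket_linearForm` applies. -/
theorem circ_linearForm_self
    (hh : ∀ i j, h i j - h j i = 2 * Complex.I * P i j)
    (hP : ∀ v j, ∑ i, P i j * w (e i) v = -coord v j + coord xi j * lam v)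
    (hw : w xi = 0) (k l : ℕ) :
    Complex.I • circ h rfl (single 1 (linearForm w)) (single 1 (linearForm w)) (k + 1) l =
      single 0 ((1 / 2 : ℂ) • dl (linearForm w)) k l := by
  have h1 : ∀ k l, dir xi (single 1 (linearForm w) k l) = 0 := by
    intro k l
    by_cases hkl : k = 0 ∧ l = 1
    · obtain ⟨rfl, rfl⟩ := hkl
      rw [single_self]
      refine Sm.ext fun y => ?_
      rw [dir_linearForm, hw]
      ext v
      simp [oneForm_apply]
    · rw [single_of_ne _ hkl, map_zero]
  have h2 := bracket_linearForm h rfl rfl hh hP h1 k l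
  have h4 : ∀ c : Sm m 2, c - (-1 : ℂ) ^ (1 * 1) • c = (2 : ℂ) • c := fun c => by
    rw [mul_one, pow_one, neg_one_smul, sub_neg_eq_add, two_smul]
  rw [gcomm, h4, smul_comm] at h2
  have h3 : Complex.I • circ h rfl (single 1 (linearForm w)) (single 1 (linearForm w)) (k + 1) l =
      (1 / 2 : ℂ) • dl (single 1 (linearForm w) k (l + 1)) := by
    rw [← h2, smul_smul]
    norm_num
  rw [h3]
  by_cases hkl : k = 0 ∧ l = 0
  · obtain ⟨rfl, rfl⟩ := hkl
    rw [single_self, single_self]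
  · rw [single_of_ne _ hkl, single_of_ne _ (by omega), map_zero, smul_zero]

end Poisson

end Sm
end Fibre

/-! ### Degree filtration, division by ν and the graded Jacobi identity -/

section Fibre

variable {m : ℕ}

namespace Sm

variable {n p q r N : ℕ} (h : Fin (2 * m + 1) → Fin (2 * m + 1) → ℂ)

/-- The families all of whose terms have degree at least `d`. -/
def Filt (d : ℕ) (a : ℕ → ℕ → Sm m n) : Prop := ∀ k l, 2 * k + l < d → a k l = 0

/-- A contraction removes two powers of y and contributes one ν, which has degree two; the product
therefore respects the total degree. -/
theorem Filt.circ (hN : p + q = N) {d d' : ℕ} {a : ℕ → ℕ → Sm m p} {b : ℕ → ℕ → Sm m q}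
    (ha : Filt d a) (hb : Filt d' b) : Filt (d + d') (Sm.circ h hN a b) := by
  intro k l hkl
  refine Finset.sum_eq_zero fun x hx => Finset.sum_eq_zero fun y hy =>
    Finset.sum_eq_zero fun z hz => ?_
  have hx := Finset.HasAntidiagonal.mem_antidiagonal.1 hx
  have hy := Finset.HasAntidiagonal.mem_antidiagonal.1 hy
  have hz := Finset.HasAntidiagonal.mem_antidiagonal.1 hz
  by_cases h1 : 2 * y.1 + z.1 < d
  · rw [ha _ _ h1, LinearMap.map_zero₂, smul_zero]
  · rw [hb y.2 z.2 (by omega), map_zero, smul_zero]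

/-- Multiplication by `ν`. -/
def nu (a : ℕ → ℕ → Sm m n) : ℕ → ℕ → Sm m n
  | 0, _ => 0
  | k + 1, l => a k l

/-- Division by `ν`. -/
def dn (a : ℕ → ℕ → Sm m n) (k : ℕ) : ℕ → Sm m n := a (k + 1)

theorem nu_dn {a : ℕ → ℕ → Sm m n} (ha : ∀ l, a 0 l = 0) : nu (dn a) = a := by
  funext k l
  rcases k with _ | k
  · exact (ha l).symm
  · rfl

theorem circ_nu_left (hN : p + q = N) (a : ℕ → ℕ → Sm m p) (b : ℕ → ℕ → Sm m q) :
    circ h hN (nu a) b = nu (circ h hN a b) := by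
  funext k l
  rcases k with _ | k
  · simp [circ, nu]
  · rw [circ, Finset.Nat.sum_antidiagonal_succ']
    simp only [Finset.Nat.sum_antidiagonal_succ, Finset.Nat.antidiagonal_zero,
      Finset.sum_singleton]
    simp [nu, circ]

theorem circ_nu_right (hN : p + q = N) (a : ℕ → ℕ → Sm m p) (b : ℕ → ℕ → Sm m q) :
    circ h hN a (nu b) = nu (circ h hN a b) := by
  funext k l
  rcases k with _ | k
  · simp [circ, nu]
  · rw [circ, Finset.Nat.sum_antidiagonal_succ']
    simp only [Finset.Nat.sum_antidiagonal_succ', Finset.Nat.antidiagonal_zero,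
      Finset.sum_singleton]
    simp [nu, circ]

/-- `dn` forgets the coefficient at ν⁰, so it commutes with the product on elements for which this
coefficient vanishes. -/
theorem circ_dn_left (hN : p + q = N) {a : ℕ → ℕ → Sm m p} (ha : ∀ l, a 0 l = 0)
    (b : ℕ → ℕ → Sm m q) : circ h hN (dn a) b = dn (circ h hN a b) := by
  conv_rhs => rw [← nu_dn ha, circ_nu_left]
  rfl

theorem circ_dn_right (hN : p + q = N) (a : ℕ → ℕ → Sm m p) {b : ℕ → ℕ → Sm m q}
    (hb : ∀ l, b 0 l = 0) : circ h hN a (dn b) = dn (circ h hN a b) := by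
  conv_rhs => rw [← nu_dn hb, circ_nu_right]
  rfl

theorem circ_sub_left (hN : p + q = N) (a a' : ℕ → ℕ → Sm m p) (b : ℕ → ℕ → Sm m q) :
    circ h hN (a - a') b = circ h hN a b - circ h hN a' b := by
  funext k l
  simp only [circ, Pi.sub_apply, LinearMap.map_sub₂, smul_sub, Finset.sum_sub_distrib]

theorem circ_sub_right (hN : p + q = N) (a : ℕ → ℕ → Sm m p) (b b' : ℕ → ℕ → Sm m q) :
    circ h hN a (b - b') = circ h hN a b - circ h hN a b' := by
  funext k l
  simp only [circ, Pi.sub_apply, map_sub, smul_sub, Finset.sum_sub_distrib]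

theorem gcomm_def (hN : p + q = N) (hN' : q + p = N) (a : ℕ → ℕ → Sm m p) (b : ℕ → ℕ → Sm m q) :
    gcomm h hN hN' a b = circ h hN a b - (-1 : ℂ) ^ (p * q) • circ h hN' b a := rfl

theorem gcomm_add_left (hN : p + q = N) (hN' : q + p = N) (a a' : ℕ → ℕ → Sm m p)
    (b : ℕ → ℕ → Sm m q) : gcomm h hN hN' (a + a') b = gcomm h hN hN' a b + gcomm h hN hN' a' b := by
  simp only [gcomm_def, circ_add_left, circ_add_right, smul_add]
  abel

theorem gcomm_add_right (hN : p + q = N) (hN' : q + p = N) (a : ℕ → ℕ → Sm m p)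
    (b b' : ℕ → ℕ → Sm m q) :
    gcomm h hN hN' a (b + b') = gcomm h hN hN' a b + gcomm h hN hN' a b' := by
  simp only [gcomm_def, circ_add_left, circ_add_right, smul_add]
  abel

theorem gcomm_sub_left (hN : p + q = N) (hN' : q + p = N) (a a' : ℕ → ℕ → Sm m p)
    (b : ℕ → ℕ → Sm m q) : gcomm h hN hN' (a - a') b = gcomm h hN hN' a b - gcomm h hN hN' a' b := by
  simp only [gcomm_def, circ_sub_left, circ_sub_right, smul_sub]
  abel

theorem gcomm_smul_left (hN : p + q = N) (hN' : q + p = N) (c : ℂ) (a : ℕ → ℕ → Sm m p)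
    (b : ℕ → ℕ → Sm m q) : gcomm h hN hN' (c • a) b = c • gcomm h hN hN' a b := by
  simp only [gcomm_def, circ_smul_left, circ_smul_right, smul_sub, smul_comm c]

theorem gcomm_smul_right (hN : p + q = N) (hN' : q + p = N) (c : ℂ) (a : ℕ → ℕ → Sm m p)
    (b : ℕ → ℕ → Sm m q) : gcomm h hN hN' a (c • b) = c • gcomm h hN hN' a b := by
  simp only [gcomm_def, circ_smul_left, circ_smul_right, smul_sub, smul_comm c]

theorem gcomm_dn_left (hN : p + q = N) (hN' : q + p = N) {a : ℕ → ℕ → Sm m p}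
    (ha : ∀ l, a 0 l = 0) (b : ℕ → ℕ → Sm m q) :
    gcomm h hN hN' (dn a) b = dn (gcomm h hN hN' a b) := by
  rw [gcomm_def, circ_dn_left h hN ha, circ_dn_right h hN' b ha]
  rfl

theorem gcomm_dn_right (hN : p + q = N) (hN' : q + p = N) (a : ℕ → ℕ → Sm m p)
    {b : ℕ → ℕ → Sm m q} (hb : ∀ l, b 0 l = 0) :
    gcomm h hN hN' a (dn b) = dn (gcomm h hN hN' a b) := by
  rw [gcomm_def, circ_dn_right h hN a hb, circ_dn_left h hN' hb]
  rfl

/-- The operator `(i/ν) [b, ·]`. -/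
def br (hN : p + q = N) (hN' : q + p = N) (b : ℕ → ℕ → Sm m p) (a : ℕ → ℕ → Sm m q) :
    ℕ → ℕ → Sm m N := Complex.I • dn (gcomm h hN hN' b a)

/-- The element `(i/ν) b ∘ b`. -/
def sq (b : ℕ → ℕ → Sm m 1) : ℕ → ℕ → Sm m 2 := Complex.I • dn (circ h rfl b b)

theorem br_add_left (hN : p + q = N) (hN' : q + p = N) (a a' : ℕ → ℕ → Sm m p)
    (b : ℕ → ℕ → Sm m q) : br h hN hN' (a + a') b = br h hN hN' a b + br h hN hN' a' b := by
  rw [br, gcomm_add_left]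
  exact smul_add _ _ _

theorem br_add_right (hN : p + q = N) (hN' : q + p = N) (a : ℕ → ℕ → Sm m p)
    (b b' : ℕ → ℕ → Sm m q) : br h hN hN' a (b + b') = br h hN hN' a b + br h hN hN' a b' := by
  rw [br, gcomm_add_right]
  exact smul_add _ _ _

theorem br_sub_left (hN : p + q = N) (hN' : q + p = N) (a a' : ℕ → ℕ → Sm m p)
    (b : ℕ → ℕ → Sm m q) : br h hN hN' (a - a') b = br h hN hN' a b - br h hN hN' a' b := by
  rw [br, gcomm_sub_left]
  exact smul_sub _ _ _

theorem gcomm_self (b : ℕ → ℕ → Sm m 1) :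
    gcomm h rfl rfl b b = (2 : ℂ) • circ h rfl b b := by
  have h4 : ∀ c : ℕ → ℕ → Sm m 2, c - (-1 : ℂ) ^ (1 * 1) • c = (2 : ℂ) • c := fun c => by
    rw [mul_one, pow_one, neg_one_smul, sub_neg_eq_add, two_smul]
  exact h4 _

theorem circ_self_zero (b : ℕ → ℕ → Sm m 1) (l : ℕ) : circ h rfl b b 0 l = 0 := by
  have h1 : (2 : ℂ) • circ h rfl b b 0 l = 0 := by
    rw [← gcomm_zero h rfl rfl b b l, gcomm_self]
    rfl
  simpa using h1

/-- This is the graded Jacobi identity for an odd element b: in the double commutator the two mixed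
terms b ∘ a ∘ b cancel by associativity, and the commutator with b ∘ b remains. -/
theorem gcomm_gcomm (hN : 1 + q = q + 1) (hN' : q + 1 = q + 1) (h2 : 1 + (q + 1) = q + 2)
    (h2' : q + 1 + 1 = q + 2) (h3 : 2 + q = q + 2) (h3' : q + 2 = q + 2)
    {b : ℕ → ℕ → Sm m 1} {a : ℕ → ℕ → Sm m q} (hb : ∀ k l, Hom l (b k l))
    (ha : ∀ k l, Hom l (a k l)) :
    gcomm h h2 h2' b (gcomm h hN hN' b a) = gcomm h h3 h3' (circ h rfl b b) a := by
  have e1 : circ h h2 b (circ h hN b a) = circ h h3 (circ h rfl b b) a := by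
    funext k l
    exact (circ_assoc h rfl h3 hN h2 hb ha hb k l).symm
  have e2 : circ h h2 b (circ h hN' a b) = circ h h2' (circ h hN b a) b := by
    funext k l
    exact (circ_assoc h hN h2' hN' h2 hb hb ha k l).symm
  have e3 : circ h h2' (circ h hN' a b) b = circ h h3' a (circ h rfl b b) := by
    funext k l
    exact circ_assoc h hN' h2' rfl h3' ha hb hb k l
  simp only [gcomm_def, circ_sub_left, circ_sub_right, circ_smul_left, circ_smul_right, e1, e2, e3,
    smul_sub, smul_smul, ← pow_add]
  have e4 : ((-1 : ℂ)) ^ (1 * (q + 1) + 1 * q) = -1 :=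
    Odd.neg_one_pow ⟨q, by ring⟩
  have e5 : ((-1 : ℂ)) ^ (2 * q) = 1 := Even.neg_one_pow ⟨q, by ring⟩
  have e6 : ((-1 : ℂ)) ^ (1 * (q + 1)) = -(-1 : ℂ) ^ (1 * q) := by
    rw [one_mul, one_mul, pow_succ, mul_neg_one]
  rw [e4, e5, e6]
  module

theorem br_br (hN : 1 + q = q + 1) (hN' : q + 1 = q + 1) (h2 : 1 + (q + 1) = q + 2)
    (h2' : q + 1 + 1 = q + 2) (h3 : 2 + q = q + 2) (h3' : q + 2 = q + 2)
    {b : ℕ → ℕ → Sm m 1} {a : ℕ → ℕ → Sm m q} (hb : ∀ k l, Hom l (b k l))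
    (ha : ∀ k l, Hom l (a k l)) :
    br h h2 h2' b (br h hN hN' b a) = br h h3 h3' (sq h b) a := by
  rw [br, br, br, sq, gcomm_smul_right, gcomm_smul_left,
    gcomm_dn_right h h2 h2' b (gcomm_zero h hN hN' b a),
    gcomm_dn_left h h3 h3' (circ_self_zero h b), gcomm_gcomm h hN hN' h2 h2' h3 h3' hb ha]

/-- By associativity b commutes with b ∘ b. -/
theorem br_sq (h2 : 1 + 2 = 3) (h2' : 2 + 1 = 3) {b : ℕ → ℕ → Sm m 1}
    (hb : ∀ k l, Hom l (b k l)) : br h h2 h2' b (sq h b) = 0 := by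
  have h1 : gcomm h h2 h2' b (circ h rfl b b) = 0 := by
    have e1 : circ h h2 b (circ h rfl b b) = circ h h2' (circ h rfl b b) b := by
      funext k l
      exact (circ_assoc h rfl h2' rfl h2 hb hb hb k l).symm
    rw [gcomm_def, e1]
    norm_num
  rw [br, sq, gcomm_smul_right, gcomm_dn_right h h2 h2' b (circ_self_zero h b), h1]
  funext k l
  change Complex.I • Complex.I • (0 : Sm m 3) = 0
  rw [smul_zero, smul_zero]

theorem sq_sub (b c : ℕ → ℕ → Sm m 1) :
    sq h (b - c) = sq h b - br h rfl rfl c b + sq h c := by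
  have e : (-1 : ℂ) ^ (1 * 1) = -1 := by norm_num
  have h1 : circ h rfl (b - c) (b - c) = circ h rfl b b - gcomm h rfl rfl c b + circ h rfl c c := by
    rw [gcomm_def, circ_sub_left, circ_sub_right, circ_sub_right, e]
    module
  rw [sq, h1, sq, sq, br, ← smul_sub, ← smul_add]
  rfl

/-- In this form every term contains the difference b - c, so its filtration degree passes to the
difference of the squares. -/
theorem sq_sub_sq (b c : ℕ → ℕ → Sm m 1) :
    sq h b - sq h c = Complex.I • dn (circ h rfl b (b - c) + circ h rfl (b - c) c) := by
  rw [sq, sq, circ_sub_left, circ_sub_right, sub_add_sub_cancel, ← smul_sub]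
  rfl

theorem Filt.dn {d : ℕ} {a : ℕ → ℕ → Sm m n} (ha : Filt (d + 2) a) : Filt d (Sm.dn a) :=
  fun k l hkl => ha (k + 1) l (by omega)

theorem Filt.mono {d d' : ℕ} (hd : d' ≤ d) {a : ℕ → ℕ → Sm m n} (ha : Filt d a) : Filt d' a :=
  fun k l hkl => ha k l (by omega)

theorem Filt.add {d : ℕ} {a b : ℕ → ℕ → Sm m n} (ha : Filt d a) (hb : Filt d b) :
    Filt d (a + b) := fun k l hkl => by
  rw [Pi.add_apply, Pi.add_apply, ha k l hkl, hb k l hkl, add_zero]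

theorem Filt.sub {d : ℕ} {a b : ℕ → ℕ → Sm m n} (ha : Filt d a) (hb : Filt d b) :
    Filt d (a - b) := fun k l hkl => by
  rw [Pi.sub_apply, Pi.sub_apply, ha k l hkl, hb k l hkl, sub_zero]

theorem Filt.smul {d : ℕ} (c : ℂ) {a : ℕ → ℕ → Sm m n} (ha : Filt d a) :
    Filt d (c • a) := fun k l hkl => by
  rw [Pi.smul_apply, Pi.smul_apply, ha k l hkl, smul_zero]

section Transverse

variable {v : Model m}

theorem dir_circ (hN : p + q = N) {a : ℕ → ℕ → Sm m p} {b : ℕ → ℕ → Sm m q}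
    (ha : ∀ k l, dir v (a k l) = 0) (hb : ∀ k l, dir v (b k l) = 0) (k l : ℕ) :
    dir v (circ h hN a b k l) = 0 := by
  simp only [circ, map_sum, map_smul, dir_star, ha, hb, map_zero, LinearMap.zero_apply,
    add_zero, smul_zero, Finset.sum_const_zero]

end Transverse

/-! ### Hodge decomposition for δ on ξ-transverse forms -/

section Hodge

variable {lam : Model m →L[ℝ] ℝ} {xi : Model m}

/-- The map `α ↦ λ ∧ i_ξ α`. -/
def lamL (lam : Model m →L[ℝ] ℝ) (xi : Model m) : Alt m (n + 1) →ₗ[ℂ] Alt m (n + 1) :=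
  wedgeL (Nat.add_comm 1 n) (oneForm lam) ∘ₗ inner xi

theorem lamL_apply (α : Alt m (n + 1)) :
    lamL lam xi α = wedge (Nat.add_comm 1 n) (oneForm lam) (inner xi α) := rfl

/-- The projection to `ker λ` along `ξ`. -/
def projL (lam : Model m →L[ℝ] ℝ) (xi : Model m) : Model m →L[ℝ] Model m :=
  ContinuousLinearMap.id ℝ (Model m) - lam.smulRight xi

theorem projL_apply (y : Model m) : projL lam xi y = y - lam y • xi := rfl

theorem inner_inner_self (v : Model m) (α : Alt m (n + 2)) : inner v (inner v α) = 0 := by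
  have := inner_inner_neg v v α
  have h2 : (2 : ℂ) • inner v (inner v α) = 0 := by
    rw [two_smul]
    nth_rewrite 2 [this]
    exact add_neg_cancel _
  simpa using h2

theorem lam_projL (hlam : lam xi = 1) (y : Model m) : lam (projL lam xi y) = 0 := by
  rw [projL_apply, map_sub, map_smul, hlam, smul_eq_mul, mul_one, sub_self]

theorem lamL_lamL (hlam : lam xi = 1) (α : Alt m (n + 1)) :
    lamL lam xi (lamL lam xi α) = lamL lam xi α := by
  rw [lamL_apply, lamL_apply]
  congr 1
  rcases n with _ | n
  · rw [inner_wedge_one_zero, oneForm_apply, hlam, Complex.ofReal_one, one_smul]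
  · rw [inner_wedge_one _ (Nat.add_comm 1 n), oneForm_apply, hlam, inner_inner_self, wedge_zero,
      Complex.ofReal_one, one_smul, sub_zero]

theorem inner_lamL_zero {v : Model m} (hv : lam v = 0) (α : Alt m 1) :
    inner v (lamL lam xi α) = 0 := by
  rw [lamL_apply, inner_wedge_one_zero, oneForm_apply, hv, Complex.ofReal_zero, zero_smul]

theorem inner_lamL {v : Model m} (hv : lam v = 0) (α : Alt m (n + 2)) :
    inner v (lamL lam xi α) = lamL lam xi (inner v α) := by
  rw [lamL_apply, inner_wedge_one _ (Nat.add_comm 1 n), oneForm_apply, hv, Complex.ofReal_zero,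
    zero_smul, zero_sub, inner_inner_neg, wedge_neg_right, neg_neg, lamL_apply]

theorem map_lamL_map_lamL (hlam : lam xi = 1) (f : Sm m (n + 1)) :
    map (lamL lam xi) (map (lamL lam xi) f) = map (lamL lam xi) f :=
  Sm.ext fun _ => lamL_lamL hlam _

theorem dxSum_coord (v : Model m →L[ℝ] ℝ) (α : Alt m n) :
    dxSum (fun i => ((v (e i) : ℝ) : ℂ) • α) = wedge (Nat.add_comm 1 n) (oneForm v) α := by
  rw [dxSum_apply, oneForm_eq_sum, sum_wedge]
  exact Finset.sum_congr rfl fun i _ => by rw [wedge_smul_right, wedge_smul_left]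

theorem ins_map_lamL_zero (hlam : lam xi = 1) (f : Sm m 1) :
    ins (projL lam xi) (map (lamL lam xi) f) = 0 :=
  Sm.ext fun y => inner_lamL_zero (lam_projL hlam y) _

theorem ins_map_lamL (hlam : lam xi = 1) (f : Sm m (n + 2)) :
    ins (projL lam xi) (map (lamL lam xi) f) = map (lamL lam xi) (ins (projL lam xi) f) :=
  Sm.ext fun y => inner_lamL (lam_projL hlam y) _

theorem ins_ins (B : Model m →L[ℝ] Model m) (f : Sm m (n + 2)) : ins B (ins B f) = 0 :=
  Sm.ext fun _ => inner_inner_self _ _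

/-- Cartan's formula for `δ` and the interior product with the Euler field of `ker λ`. -/
theorem dl_ins_add_ins_dl {l : ℕ} {f : Sm m (n + 1)} (hf : Hom l f) (hxi : dir xi f = 0) :
    dl (ins (projL lam xi) f) + ins (projL lam xi) (dl f) =
      ((l : ℂ) + n + 1) • f - map (lamL lam xi) f := by
  refine Sm.ext fun y => ?_
  simp only [add_apply, sub_apply, smul_apply, map_apply, ins_apply, dl_apply, dir_ins]
  have e1 : (dxSum fun i => inner (projL lam xi y) (pd i f y) + inner (projL lam xi (e i)) (f y)) =
      dxSum (fun i => inner (projL lam xi y) (pd i f y)) +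
        dxSum (fun i => inner (projL lam xi (e i)) (f y)) := map_add dxSum _ _
  -- The derivative of the field P y in the direction eᵢ is P eᵢ = eᵢ - λᵢ ξ. The first part counts
  -- the form degree, and the second gives -λ ∧ i_ξ.
  have e2 : dxSum (fun i => inner (projL lam xi (e i)) (f y)) =
      ((n : ℂ) + 1) • f y - lamL lam xi (f y) := by
    rw [← dxSum_inner, lamL_apply, ← dxSum_coord, ← map_sub]
    congr 1
    funext i
    rw [projL_apply, ← curryLeft_eq_inner, map_sub, _root_.map_smul]
    rfl
  -- P y differs from y by a multiple of ξ, along which f is constant, so Euler's identity applies.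
  have e3 : ∑ i, ((coord (projL lam xi y) i : ℝ) : ℂ) • pd i f y = (l : ℂ) • f y := by
    have h1 := congrArg (eval y) (dir_linear f (projL lam xi y))
    rw [map_sum] at h1
    have h2 : fderiv ℝ f y (projL lam xi y) = l • f y := by
      rw [projL_apply, map_sub, hf.euler, _root_.map_smul]
      have : fderiv ℝ f y xi = 0 := congrArg (eval y) hxi
      rw [this, smul_zero, sub_zero]
    refine h1.symm.trans (h2.trans ?_)
    rw [← Nat.cast_smul_eq_nsmul ℂ]
  rw [e1, e2, inner_dxSum, e3]
  module

/-- In i_ξ δf the term without dxⁱ is the derivative of f along ξ, which vanishes. What remains are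
two anticommutations, of δ with i_ξ and of dxⁱ with λ. -/
theorem dl_map_lamL {f : Sm m (n + 1)} (hxi : dir xi f = 0) :
    dl (map (lamL lam xi) f) = map (lamL lam xi) (dl f) := by
  refine Sm.ext fun y => ?_
  rw [map_apply, dl_apply, dl_apply, lamL_apply, inner_dxSum]
  simp only [dir_map, map_apply, lamL_apply]
  have e1 : ∑ i, ((coord xi i : ℝ) : ℂ) • pd i f y = 0 := by
    have h1 := congrArg (eval y) (dir_linear f xi)
    rw [map_sum, hxi] at h1
    exact h1.symm
  rw [e1, zero_sub, wedge_neg_right,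
    dxSum_wedge_right (p := 1) (q := n) (Nat.add_comm 1 n) (Nat.add_comm 1 (n + 1))]
  rw [pow_one, neg_one_smul]

/-- The operator `δ⁻¹` on the part of `y`-degree `l`. -/
def dlInv (lam : Model m →L[ℝ] ℝ) (xi : Model m) (l : ℕ) : Sm m (n + 1) →ₗ[ℂ] Sm m n :=
  ((l : ℂ) + n + 1)⁻¹ • (ins (projL lam xi) ∘ₗ (LinearMap.id - map (lamL lam xi)))
    + ((l : ℂ) + n)⁻¹ • (ins (projL lam xi) ∘ₗ map (lamL lam xi))

theorem dlInv_eq (l : ℕ) (f : Sm m (n + 1)) : dlInv lam xi l f =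
    ((l : ℂ) + n + 1)⁻¹ • ins (projL lam xi) (f - map (lamL lam xi) f)
      + ((l : ℂ) + n)⁻¹ • ins (projL lam xi) (map (lamL lam xi) f) := rfl

theorem dlInv_dlInv (hlam : lam xi = 1) (l l' : ℕ) (f : Sm m (n + 2)) :
    dlInv lam xi l (dlInv lam xi l' f) = 0 := by
  have h1 : ins (projL lam xi) (dlInv lam xi l' f) = 0 := by
    rw [dlInv_eq, map_add, map_smul, map_smul, ins_ins, ins_ins, smul_zero, smul_zero, add_zero]
  have h2 : ins (projL lam xi) (map (lamL lam xi) (dlInv lam xi l' f)) = 0 := by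
    rcases n with _ | n
    · exact ins_map_lamL_zero hlam _
    · rw [ins_map_lamL hlam, h1, map_zero]
  rw [dlInv_eq l, map_sub, h1, h2, sub_zero, smul_zero, smul_zero, add_zero]

theorem Hom.dlInv (l' : ℕ) {l : ℕ} {f : Sm m (n + 1)} (hf : Hom l f) :
    Hom (l + 1) (dlInv lam xi l' f) := by
  rw [dlInv_eq]
  refine ((Hom.ins _ ?_).smul _).add (((hf.map _).ins _).smul _)
  rw [sub_eq_add_neg, ← neg_one_smul ℂ (Sm.map _ f)]
  exact hf.add ((hf.map _).smul _)

theorem dir_dlInv (hlam : lam xi = 1) (l : ℕ) {f : Sm m (n + 1)} (hf : dir xi f = 0) :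
    dir xi (dlInv lam xi l f) = 0 := by
  have h0 : projL lam xi xi = 0 := by rw [projL_apply, hlam, one_smul, sub_self]
  have h1 : map (inner (0 : Model m)) = (0 : Sm m (n + 1) →ₗ[ℂ] Sm m n) := by
    refine LinearMap.ext fun g => Sm.ext fun y => ?_
    rw [map_apply, ← curryLeft_eq_inner, map_zero]
    rfl
  rw [dlInv_eq, map_add, map_smul, map_smul, dir_ins, dir_ins, map_sub, dir_map, hf, h0, h1]
  simp

/-- The Hodge decomposition, in positive `y`-degree. -/
theorem dl_dlInv_add_dlInv_dl (hlam : lam xi = 1) {l : ℕ} {f : Sm m (n + 1)} (hf : Hom (l + 1) f)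
    (hxi : dir xi f = 0) :
    dl (dlInv lam xi (l + 1) f) + dlInv lam xi l (dl f) = f := by
  -- Cartan's formula is scalar on each summand: the sum of y-degree and form degree on the part
  -- without λ, and one less on the λ-part. The weights of δ⁻¹ are the inverses; they are the same
  -- before and after δ, which lowers the y-degree and raises the form degree.
  have h1 := dl_ins_add_ins_dl (lam := lam) hf hxi
  have hxi' : dir xi (map (lamL lam xi) f) = 0 := by rw [dir_map, hxi, map_zero]
  have h2 := dl_ins_add_ins_dl (lam := lam) (hf.map (lamL lam xi)) hxi'
  rw [dl_map_lamL hxi, map_lamL_map_lamL hlam] at h2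
  rw [dlInv_eq, dlInv_eq, map_add, map_smul, map_smul, map_sub, map_sub, map_sub,
    eq_sub_of_add_eq h1, eq_sub_of_add_eq h2]
  have hA : (l : ℂ) + n + 2 ≠ 0 := by exact_mod_cast (by omega : l + n + 2 ≠ 0)
  have hB : (l : ℂ) + n + 1 ≠ 0 := by exact_mod_cast (by omega : l + n + 1 ≠ 0)
  have e1 : ((l + 1 : ℕ) : ℂ) + n + 1 = (l : ℂ) + n + 2 := by push_cast; ring
  have e2 : ((l + 1 : ℕ) : ℂ) + n = (l : ℂ) + n + 1 := by push_cast; ring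
  have e3 : (l : ℂ) + (n + 1 : ℕ) + 1 = (l : ℂ) + n + 2 := by push_cast; ring
  have e4 : (l : ℂ) + (n + 1 : ℕ) = (l : ℂ) + n + 1 := by push_cast; ring
  rw [e1, e2, e3, e4]
  match_scalars <;> field_simp <;> ring

/-- The Hodge decomposition, in `y`-degree zero. -/
theorem dl_dlInv_zero (hlam : lam xi = 1) {f : Sm m (n + 1)} (hf : Hom 0 f)
    (h0 : n = 0 → map (lamL lam xi) f = 0) : dl (dlInv lam xi 0 f) = f := by
  have hdl : ∀ g : Sm m (n + 1), Hom 0 g → dl g = 0 := fun g hg => by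
    rw [dl_eq_sum]
    exact Finset.sum_eq_zero fun i _ => by rw [hg.dir_zero, map_zero]
  have h1 := dl_ins_add_ins_dl (lam := lam) hf (hf.dir_zero xi)
  have h2 := dl_ins_add_ins_dl (lam := lam) (hf.map (lamL lam xi)) ((hf.map _).dir_zero xi)
  rw [hdl _ hf, map_zero, add_zero] at h1
  rw [hdl _ (hf.map _), map_zero, add_zero, map_lamL_map_lamL hlam] at h2
  rw [dlInv_eq, map_add, map_smul, map_smul, map_sub, map_sub, h1, h2]
  have hB : (n : ℂ) + 1 ≠ 0 := by exact_mod_cast n.succ_ne_zero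
  -- For one-forms of y-degree zero the weight of the λ-part is 0, and its inverse is read as 0; the
  -- decomposition then holds because `h0` excludes this part.
  rcases Nat.eq_zero_or_pos n with rfl | hn
  · rw [h0 rfl]
    simp
  · have hA : (n : ℂ) ≠ 0 := by exact_mod_cast hn.ne'
    rw [Nat.cast_zero, zero_add]
    match_scalars <;> field_simp <;> ring

end Hodge
end Sm
end Fibre

/-! ### Covariant differentiation of fibre functions over a coordinate domain -/

section LocalConnection

variable {m : ℕ} {n p q : ℕ}

namespace Sm

/-- Smooth dependence of a family of functions on its parameter. -/
def SOn (U : Set (Model m)) (f : Model m → Sm m n) : Prop :=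
  ContDiffOn ℝ ∞ (fun z : Model m × Model m => f z.1 z.2) (U ×ˢ Set.univ)

variable {U : Set (Model m)} (hU : IsOpen U) {f : Model m → Sm m n} {u : Model m}

include hU in
theorem SOn.contDiffAt (hf : SOn U f) (hu : u ∈ U) (y : Model m) :
    ContDiffAt ℝ ∞ (fun z : Model m × Model m => f z.1 z.2) (u, y) :=
  ContDiffOn.contDiffAt hf ((hU.prod isOpen_univ).mem_nhds ⟨hu, trivial⟩)

include hU in
theorem SOn.hasFDerivAt (hf : SOn U f) (hu : u ∈ U) (y : Model m) :
    HasFDerivAt (fun z : Model m × Model m => f z.1 z.2)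
      (fderiv ℝ (fun z : Model m × Model m => f z.1 z.2) (u, y)) (u, y) :=
  ((SOn.contDiffAt hU hf hu y).differentiableAt (by simp)).hasFDerivAt

include hU in
theorem SOn.hasFDerivAt_base (hf : SOn U f) (hu : u ∈ U) (y : Model m) :
    HasFDerivAt (fun u => f u y)
      (fderiv ℝ (fun z : Model m × Model m => f z.1 z.2) (u, y) ∘L
        ContinuousLinearMap.inl ℝ (Model m) (Model m)) u :=
  HasFDerivAt.comp (g := fun z : Model m × Model m => f z.1 z.2) (f := fun u => (u, y)) u
    (SOn.hasFDerivAt hU hf hu y) (hasFDerivAt_prodMk_left u y)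

include hU in
theorem SOn.fderiv_base (hf : SOn U f) (hu : u ∈ U) (v y : Model m) :
    fderiv ℝ (fun u => f u y) u v =
      fderiv ℝ (fun z : Model m × Model m => f z.1 z.2) (u, y) (v, 0) := by
  rw [(SOn.hasFDerivAt_base hU hf hu y).fderiv]
  rfl

include hU in
theorem SOn.differentiableAt (hf : SOn U f) (hu : u ∈ U) (y : Model m) :
    DifferentiableAt ℝ (fun u => f u y) u :=
  (SOn.hasFDerivAt_base hU hf hu y).differentiableAt

include hU in
theorem SOn.fderiv_fibre (hf : SOn U f) (hu : u ∈ U) (v y : Model m) :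
    fderiv ℝ (f u) y v =
      fderiv ℝ (fun z : Model m × Model m => f z.1 z.2) (u, y) (0, v) := by
  have h1 := HasFDerivAt.comp (g := fun z : Model m × Model m => f z.1 z.2) (f := fun y => (u, y)) y
    (SOn.hasFDerivAt hU hf hu y) (hasFDerivAt_prodMk_right u y)
  exact congrArg (fun A => A v) h1.fderiv

include hU in
theorem SOn.contDiffOn_fderiv (hf : SOn U f) :
    ContDiffOn ℝ ∞ (fderiv ℝ (fun z : Model m × Model m => f z.1 z.2)) (U ×ˢ Set.univ) :=
  ContDiffOn.fderiv_of_isOpen hf (hU.prod isOpen_univ) (by simp)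

include hU in
theorem SOn.fderiv_fderiv (hf : SOn U f) (hu : u ∈ U) (y : Model m) (b : Model m × Model m) :
    HasFDerivAt (fun z => fderiv ℝ (fun z : Model m × Model m => f z.1 z.2) z b)
      ((fderiv ℝ (fderiv ℝ (fun z : Model m × Model m => f z.1 z.2)) (u, y)).flip b) (u, y) := by
  have h1 := (((SOn.contDiffOn_fderiv hU hf).contDiffAt
    ((hU.prod isOpen_univ).mem_nhds ⟨hu, trivial⟩)).differentiableAt (by simp)
      : DifferentiableAt ℝ _ (u, y)).hasFDerivAt
  have := h1.clm_apply (hasFDerivAt_const b (u, y))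
  exact this.congr_fderiv (ContinuousLinearMap.ext fun x => by simp)

include hU in
theorem SOn.symm (hf : SOn U f) (hu : u ∈ U) (y : Model m) (a b : Model m × Model m) :
    fderiv ℝ (fderiv ℝ (fun z : Model m × Model m => f z.1 z.2)) (u, y) a b =
      fderiv ℝ (fderiv ℝ (fun z : Model m × Model m => f z.1 z.2)) (u, y) b a :=
  (SOn.contDiffAt hU hf hu y).isSymmSndFDerivAt (by simpa using ENat.LEInfty.out) a b

/-- The derivative of a family with respect to its parameter. -/
def ud (v : Model m) (f : Model m → Sm m n) (u : Model m) : Sm m n :=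
  ofFun fun y => fderiv ℝ (fun u => f u y) u v

include hU in
-- `ofFun` returns zero on functions that are not smooth; joint smoothness in (u, y) keeps the
-- derivative in u smooth in y, so the intended value is taken.
theorem ud_apply (hf : SOn U f) (hu : u ∈ U) (v y : Model m) :
    ud v f u y = fderiv ℝ (fun u => f u y) u v := by
  refine ofFun_apply ?_ y
  have h1 : (fun y => fderiv ℝ (fun u => f u y) u v) = fun y =>
      fderiv ℝ (fun z : Model m × Model m => f z.1 z.2) (u, y) (v, 0) :=
    funext fun y => SOn.fderiv_base hU hf hu v y
  rw [h1, ← contDiffOn_univ]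
  have h2 : ContDiffOn ℝ ∞ (fun y : Model m => (u, y)) Set.univ := by fun_prop
  exact ((SOn.contDiffOn_fderiv hU hf).comp h2 fun y _ => ⟨hu, trivial⟩).clm_apply contDiffOn_const

include hU in
theorem ud_apply_fderiv (hf : SOn U f) (hu : u ∈ U) (v y : Model m) :
    ud v f u y = fderiv ℝ (fun z : Model m × Model m => f z.1 z.2) (u, y) (v, 0) := by
  rw [ud_apply hU hf hu, SOn.fderiv_base hU hf hu]

include hU in
theorem SOn.ud (hf : SOn U f) (v : Model m) : SOn U (ud v f) :=
  ((SOn.contDiffOn_fderiv hU hf).clm_apply contDiffOn_const).congr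
    fun z hz => ud_apply_fderiv hU hf hz.1 v z.2

include hU in
theorem SOn.vert (hf : SOn U f) {B : Model m → Model m →L[ℝ] Model m} (hB : ContDiffOn ℝ ∞ B U) :
    SOn U (fun u => vert (B u) (f u)) := by
  have h1 : ContDiffOn ℝ ∞ (fun z : Model m × Model m => ((0 : Model m), B z.1 z.2))
      (U ×ˢ Set.univ) :=
    contDiffOn_const.prodMk ((hB.comp contDiffOn_fst fun _ hz => hz.1).clm_apply contDiffOn_snd)
  exact ((SOn.contDiffOn_fderiv hU hf).clm_apply h1).congr
    fun z hz => SOn.fderiv_fibre hU hf hz.1 _ z.2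

include hU in
theorem SOn.dir (hf : SOn U f) (v : Model m) : SOn U (fun u => dir v (f u)) :=
  ((SOn.contDiffOn_fderiv hU hf).clm_apply contDiffOn_const).congr
    fun z hz => SOn.fderiv_fibre hU hf hz.1 _ z.2

theorem SOn.const (f : Sm m n) : SOn U (fun _ => f) :=
  (Sm.contDiff f).contDiffOn.comp contDiffOn_snd fun _ _ => Set.mem_univ _

theorem SOn.add {g : Model m → Sm m n} (hf : SOn U f) (hg : SOn U g) :
    SOn U (fun u => f u + g u) := ContDiffOn.add hf hg

theorem SOn.smul_fun {c : Model m → ℂ} (hc : ContDiffOn ℝ ∞ c U) (hf : SOn U f) :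
    SOn U (fun u => c u • f u) :=
  ContDiffOn.smul (hc.comp contDiffOn_fst fun _ hz => hz.1) hf

theorem SOn.smul (c : ℂ) (hf : SOn U f) : SOn U (fun u => c • f u) :=
  SOn.smul_fun contDiffOn_const hf

theorem SOn.sub {g : Model m → Sm m n} (hf : SOn U f) (hg : SOn U g) :
    SOn U (fun u => f u - g u) := ContDiffOn.sub hf hg

theorem SOn.sum {ι : Type*} {s : Finset ι} {F : ι → Model m → Sm m n}
    (hF : ∀ i ∈ s, SOn U (F i)) : SOn U (fun u => ∑ i ∈ s, F i u) := by
  have : (fun z : Model m × Model m => ((∑ i ∈ s, F i z.1 : Sm m n) : Model m → Alt m n) z.2) =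
      fun z => ∑ i ∈ s, F i z.1 z.2 := funext fun z => sum_apply _ _ _
  rw [SOn, this]
  exact ContDiffOn.sum hF

theorem SOn.map {n' : ℕ} (L : Alt m n →ₗ[ℂ] Alt m n') (hf : SOn U f) :
    SOn U (fun u => map L (f u)) :=
  (LinearMap.toContinuousLinearMap (L.restrictScalars ℝ)).contDiff.comp_contDiffOn hf

theorem SOn.mul {N : ℕ} (hN : p + q = N) {f : Model m → Sm m p} {g : Model m → Sm m q}
    (hf : SOn U f) (hg : SOn U g) : SOn U (fun u => mul hN (f u) (g u)) := by
  have h1 : ContDiffOn ℝ ∞ (fun z : Model m × Model m => wedgeCLM (m := m) hN (f z.1 z.2))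
      (U ×ˢ Set.univ) := (wedgeCLM (m := m) hN).contDiff.comp_contDiffOn hf
  exact h1.clm_apply hg

include hU in
theorem SOn.star {h : Model m → Fin (2 * m + 1) → Fin (2 * m + 1) → ℂ}
    (hh : ∀ i j, ContDiffOn ℝ ∞ (fun u => h u i j) U) {N : ℕ} (hN : p + q = N) (s : ℕ)
    {f : Model m → Sm m p} {g : Model m → Sm m q} (hf : SOn U f) (hg : SOn U g) :
    SOn U (fun u => star (h u) hN s (f u) (g u)) := by
  induction s generalizing f g with
  | zero => exact SOn.mul hN hf hg
  | succ s ih =>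
    simp only [star_succ]
    exact SOn.sum fun i _ => SOn.sum fun j _ => SOn.smul_fun (hh i j)
      (ih (SOn.dir hU hf _) (SOn.dir hU hg _))

include hU in
theorem ud_add {g : Model m → Sm m n} (hf : SOn U f) (hg : SOn U g) (hu : u ∈ U) (v : Model m) :
    ud v (fun u => f u + g u) u = ud v f u + ud v g u := by
  refine Sm.ext fun y => ?_
  rw [add_apply, ud_apply hU (SOn.add hf hg) hu, ud_apply hU hf hu, ud_apply hU hg hu]
  change fderiv ℝ (fun u => f u y + g u y) u v = _
  rw [fderiv_fun_add (SOn.differentiableAt hU hf hu y) (SOn.differentiableAt hU hg hu y)]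
  rfl

include hU in
theorem ud_sub {g : Model m → Sm m n} (hf : SOn U f) (hg : SOn U g) (hu : u ∈ U) (v : Model m) :
    ud v (fun u => f u - g u) u = ud v f u - ud v g u := by
  refine Sm.ext fun y => ?_
  rw [sub_apply, ud_apply hU (SOn.sub hf hg) hu, ud_apply hU hf hu, ud_apply hU hg hu]
  change fderiv ℝ (fun u => f u y - g u y) u v = _
  rw [fderiv_fun_sub (SOn.differentiableAt hU hf hu y) (SOn.differentiableAt hU hg hu y)]
  rfl

include hU in
theorem ud_smul_fun {c : Model m → ℂ} (hc : ContDiffOn ℝ ∞ c U) (hf : SOn U f) (hu : u ∈ U)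
    (v : Model m) :
    ud v (fun u => c u • f u) u = c u • ud v f u + (fderiv ℝ c u v) • f u := by
  refine Sm.ext fun y => ?_
  rw [add_apply, smul_apply, smul_apply, ud_apply hU (SOn.smul_fun hc hf) hu, ud_apply hU hf hu]
  change fderiv ℝ (fun u => c u • f u y) u v = _
  have h1 : DifferentiableAt ℝ c u :=
    (hc.contDiffAt (hU.mem_nhds hu)).differentiableAt (by simp)
  rw [fderiv_fun_smul h1 (SOn.differentiableAt hU hf hu y)]
  rfl

include hU in
theorem ud_smul (c : ℂ) (hf : SOn U f) (hu : u ∈ U) (v : Model m) :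
    ud v (fun u => c • f u) u = c • ud v f u := by
  rw [ud_smul_fun hU contDiffOn_const hf hu]
  simp

include hU in
theorem ud_sum {ι : Type*} {s : Finset ι} {F : ι → Model m → Sm m n} (hF : ∀ i ∈ s, SOn U (F i))
    (hu : u ∈ U) (v : Model m) : ud v (fun u => ∑ i ∈ s, F i u) u = ∑ i ∈ s, ud v (F i) u := by
  refine Sm.ext fun y => ?_
  rw [sum_apply, ud_apply hU (SOn.sum hF) hu]
  simp only [sum_apply]
  rw [fderiv_fun_sum fun i hi => SOn.differentiableAt hU (hF i hi) hu y, _root_.sum_apply]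
  exact Finset.sum_congr rfl fun i hi => (ud_apply hU (hF i hi) hu v y).symm

include hU in
theorem ud_map {n' : ℕ} (L : Alt m n →ₗ[ℂ] Alt m n') (hf : SOn U f) (hu : u ∈ U) (v : Model m) :
    ud v (fun u => map L (f u)) u = map L (ud v f u) := by
  refine Sm.ext fun y => ?_
  rw [map_apply, ud_apply hU (SOn.map L hf) hu, ud_apply hU hf hu]
  have := ((LinearMap.toContinuousLinearMap (L.restrictScalars ℝ)).hasFDerivAt.comp u
    (SOn.differentiableAt hU hf hu y).hasFDerivAt).fderiv
  exact congrArg (fun A => A v) this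

include hU in
theorem ud_mul {N : ℕ} (hN : p + q = N) {f : Model m → Sm m p} {g : Model m → Sm m q}
    (hf : SOn U f) (hg : SOn U g) (hu : u ∈ U) (v : Model m) :
    ud v (fun u => mul hN (f u) (g u)) u = mul hN (ud v f u) (g u) + mul hN (f u) (ud v g u) := by
  refine Sm.ext fun y => ?_
  rw [add_apply, mul_apply, mul_apply, ud_apply hU (SOn.mul hN hf hg) hu, ud_apply hU hf hu,
    ud_apply hU hg hu]
  have := (wedgeCLM (m := m) hN).fderiv_of_bilinear (SOn.differentiableAt hU hf hu y)
    (SOn.differentiableAt hU hg hu y)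
  change fderiv ℝ (fun u => wedgeCLM hN (f u y) (g u y)) u v = _
  rw [this]
  simp [add_comm]

include hU in
-- Both sides are mixed second derivatives of the jointly smooth function (u, y) ↦ f u y.
theorem ud_dir (hf : SOn U f) (hu : u ∈ U) (v w : Model m) :
    ud v (fun u => dir w (f u)) u = dir w (ud v f u) := by
  refine Sm.ext fun y => ?_
  rw [ud_apply_fderiv hU (SOn.dir hU hf w) hu, dir_apply,
    SOn.fderiv_fibre hU (SOn.ud hU hf v) hu]
  have h1 : (fun z : Model m × Model m => dir w (f z.1) z.2) =ᶠ[𝓝 (u, y)]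
      fun z => fderiv ℝ (fun z : Model m × Model m => f z.1 z.2) z (0, w) := by
    filter_upwards [(hU.prod isOpen_univ).mem_nhds (⟨hu, trivial⟩ : (u, y) ∈ U ×ˢ Set.univ)]
      with z hz
    exact SOn.fderiv_fibre hU hf hz.1 _ _
  have h2 : (fun z : Model m × Model m => Sm.ud v f z.1 z.2) =ᶠ[𝓝 (u, y)]
      fun z => fderiv ℝ (fun z : Model m × Model m => f z.1 z.2) z (v, 0) := by
    filter_upwards [(hU.prod isOpen_univ).mem_nhds (⟨hu, trivial⟩ : (u, y) ∈ U ×ˢ Set.univ)]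
      with z hz
    exact ud_apply_fderiv hU hf hz.1 _ _
  rw [h1.fderiv_eq, h2.fderiv_eq, (SOn.fderiv_fderiv hU hf hu y _).fderiv,
    (SOn.fderiv_fderiv hU hf hu y _).fderiv]
  exact SOn.symm hU hf hu y _ _

include hU in
theorem ud_comm (hf : SOn U f) (hu : u ∈ U) (v w : Model m) :
    ud v (ud w f) u = ud w (ud v f) u := by
  have h : ∀ v w y, ud v (ud w f) u y =
      fderiv ℝ (fderiv ℝ (fun z : Model m × Model m => f z.1 z.2)) (u, y) (v, 0) (w, 0) := by
    intro v w y
    rw [ud_apply_fderiv hU (SOn.ud hU hf w) hu]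
    have h2 : (fun z : Model m × Model m => Sm.ud w f z.1 z.2) =ᶠ[𝓝 (u, y)]
        fun z => fderiv ℝ (fun z : Model m × Model m => f z.1 z.2) z (w, 0) := by
      filter_upwards [(hU.prod isOpen_univ).mem_nhds (⟨hu, trivial⟩ : (u, y) ∈ U ×ˢ Set.univ)]
        with z hz
      exact ud_apply_fderiv hU hf hz.1 _ _
    rw [h2.fderiv_eq, (SOn.fderiv_fderiv hU hf hu y _).fderiv]
    rfl
  exact Sm.ext fun y => by rw [h, h, SOn.symm hU hf hu]

include hU in
theorem ud_vert (hf : SOn U f) {B : Model m → Model m →L[ℝ] Model m} (hB : ContDiffOn ℝ ∞ B U)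
    (hu : u ∈ U) (v : Model m) :
    ud v (fun u => vert (B u) (f u)) u = vert (B u) (ud v f u) + vert (fderiv ℝ B u v) (f u) := by
  refine Sm.ext fun y => ?_
  rw [ud_apply hU (SOn.vert hU hf hB) hu, add_apply]
  have hB' : ∀ i, ContDiffOn ℝ ∞ (fun u => ((coord (B u y) i : ℝ) : ℂ)) U := fun i =>
    (Complex.ofRealCLM ∘L (EuclideanSpace.proj i : Model m →L[ℝ] ℝ)).contDiff.comp_contDiffOn
      (hB.clm_apply contDiffOn_const)
  have hd : ∀ i, fderiv ℝ (fun u => ((coord (B u y) i : ℝ) : ℂ)) u v =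
      ((coord (fderiv ℝ B u v y) i : ℝ) : ℂ) := by
    intro i
    have h1 : HasFDerivAt B (fderiv ℝ B u) u :=
      ((hB.contDiffAt (hU.mem_nhds hu)).differentiableAt (by simp)).hasFDerivAt
    have h2 := (Complex.ofRealCLM ∘L (EuclideanSpace.proj i : Model m →L[ℝ] ℝ)).hasFDerivAt.comp u
      (h1.clm_apply (hasFDerivAt_const y u))
    have h3 : fderiv ℝ (fun u => ((coord (B u y) i : ℝ) : ℂ)) u v = _ :=
      congrArg (fun A => A v) h2.fderiv
    rw [h3]
    simp [coord]
  -- Expanding the vertical field in coordinates reduces the claim to the Leibniz rule for scalar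
  -- coefficients.
  have h1 : (fun u => Sm.vert (B u) (f u) y) = fun u =>
      (∑ i, ((coord (B u y) i : ℝ) : ℂ) • pd i (f u) : Sm m n) y := by
    funext u
    rw [vert_linear, sum_apply]
    rfl
  have h2 := ud_apply hU (SOn.sum fun i _ => SOn.smul_fun (hB' i) (SOn.dir hU hf (e i)) :
    SOn U fun u => (∑ i, ((coord (B u y) i : ℝ) : ℂ) • pd i (f u) : Sm m n)) hu v y
  rw [h1, ← h2, ud_sum hU (fun i _ => SOn.smul_fun (hB' i) (SOn.dir hU hf (e i))) hu, sum_apply,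
    vert_linear, vert_linear, ← Finset.sum_add_distrib]
  refine Finset.sum_congr rfl fun i _ => ?_
  rw [ud_smul_fun hU (hB' i) (SOn.dir hU hf (e i)) hu, ud_dir hU hf hu, hd]
  rfl

/-- The covariant derivative in the direction `v` of a family of functions on the fibres, for the
connection with coefficients `Γ`. -/
def hd (Γ : Model m → Model m →L[ℝ] Model m →L[ℝ] Model m) (v : Model m) (f : Model m → Sm m n)
    (u : Model m) : Sm m n := ud v f u - vert (Γ u v) (f u)

/-- The exterior covariant derivative for the connection with coefficients `Γ`. -/
def nabla (Γ : Model m → Model m →L[ℝ] Model m →L[ℝ] Model m) (f : Model m → Sm m n)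
    (u : Model m) : Sm m (n + 1) :=
  ∑ i, map (wedgeL (Nat.add_comm 1 n) (dx i)) (hd Γ (e i) f u)

variable {Γ : Model m → Model m →L[ℝ] Model m →L[ℝ] Model m}

theorem nabla_apply (f : Model m → Sm m n) (u y : Model m) :
    nabla Γ f u y = dxSum fun i => hd Γ (e i) f u y := by
  rw [nabla, sum_apply, dxSum_apply]
  rfl

theorem vert_map {n' : ℕ} (L : Alt m n →ₗ[ℂ] Alt m n') (B : Model m →L[ℝ] Model m) (f : Sm m n) :
    vert B (map L f) = map L (vert B f) :=
  Sm.ext fun y => congrArg (eval y) (dir_map L (B y) f)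

section
include hU

theorem SOn.hd (hΓ : ContDiffOn ℝ ∞ Γ U) (hf : SOn U f) (v : Model m) : SOn U (hd Γ v f) :=
  SOn.sub (SOn.ud hU hf v) (SOn.vert hU hf (hΓ.clm_apply contDiffOn_const))

theorem SOn.nabla (hΓ : ContDiffOn ℝ ∞ Γ U) (hf : SOn U f) : SOn U (nabla Γ f) :=
  SOn.sum fun i _ => SOn.map _ (SOn.hd hU hΓ hf (e i))

theorem hd_add {g : Model m → Sm m n} (hf : SOn U f) (hg : SOn U g) (hu : u ∈ U) (v : Model m) :
    hd Γ v (fun u => f u + g u) u = hd Γ v f u + hd Γ v g u := by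
  rw [Sm.hd, ud_add hU hf hg hu, map_add, Sm.hd, Sm.hd]
  abel

theorem hd_smul_fun {c : Model m → ℂ} (hc : ContDiffOn ℝ ∞ c U) (hf : SOn U f) (hu : u ∈ U)
    (v : Model m) :
    hd Γ v (fun u => c u • f u) u = c u • hd Γ v f u + (fderiv ℝ c u v) • f u := by
  rw [Sm.hd, ud_smul_fun hU hc hf hu, map_smul, Sm.hd, smul_sub]
  abel

theorem hd_smul (c : ℂ) (hf : SOn U f) (hu : u ∈ U) (v : Model m) :
    hd Γ v (fun u => c • f u) u = c • hd Γ v f u := by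
  rw [Sm.hd, ud_smul hU c hf hu, map_smul, Sm.hd, smul_sub]

theorem hd_sum {ι : Type*} {s : Finset ι} {F : ι → Model m → Sm m n} (hF : ∀ i ∈ s, SOn U (F i))
    (hu : u ∈ U) (v : Model m) : hd Γ v (fun u => ∑ i ∈ s, F i u) u = ∑ i ∈ s, hd Γ v (F i) u := by
  rw [Sm.hd, ud_sum hU hF hu, map_sum, ← Finset.sum_sub_distrib]
  rfl

theorem hd_map {n' : ℕ} (L : Alt m n →ₗ[ℂ] Alt m n') (hf : SOn U f) (hu : u ∈ U) (v : Model m) :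
    hd Γ v (fun u => map L (f u)) u = map L (hd Γ v f u) := by
  rw [Sm.hd, ud_map hU L hf hu, vert_map, ← map_sub]
  rfl

theorem hd_mul {N : ℕ} (hN : p + q = N) {f : Model m → Sm m p} {g : Model m → Sm m q}
    (hf : SOn U f) (hg : SOn U g) (hu : u ∈ U) (v : Model m) :
    hd Γ v (fun u => mul hN (f u) (g u)) u = mul hN (hd Γ v f u) (g u) + mul hN (f u) (hd Γ v g u) := by
  rw [Sm.hd, ud_mul hU hN hf hg hu, vert_mul, Sm.hd, Sm.hd, LinearMap.map_sub₂, map_sub]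
  abel

/-- A constant vector in the fibre is not parallel; the correction is its covariant derivative, from
the commutator with the linear vertical field. -/
theorem hd_dir (hf : SOn U f) (hu : u ∈ U) (v w : Model m) :
    hd Γ v (fun u => dir w (f u)) u = dir w (hd Γ v f u) + dir (Γ u v w) (f u) := by
  rw [Sm.hd, ud_dir hU hf hu, Sm.hd, map_sub, dir_vert]
  abel

/-- The covariant derivative is a derivation of the contractions with a parallel tensor. -/
theorem hd_star {h : Model m → Fin (2 * m + 1) → Fin (2 * m + 1) → ℂ}
    (hh : ∀ i j, ContDiffOn ℝ ∞ (fun u => h u i j) U)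
    (hpar : ∀ u ∈ U, ∀ v i j, fderiv ℝ (fun u => h u i j) u v +
      ∑ c, ((coord (Γ u v (e c)) i : ℝ) : ℂ) * h u c j +
      ∑ c, ((coord (Γ u v (e c)) j : ℝ) : ℂ) * h u i c = 0)
    {N : ℕ} (hN : p + q = N) (s : ℕ) {f : Model m → Sm m p} {g : Model m → Sm m q}
    (hf : SOn U f) (hg : SOn U g) (hu : u ∈ U) (v : Model m) :
    hd Γ v (fun u => star (h u) hN s (f u) (g u)) u =
      star (h u) hN s (hd Γ v f u) (g u) + star (h u) hN s (f u) (hd Γ v g u) := by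
  induction s generalizing f g with
  | zero => exact hd_mul hU hN hf hg hu v
  | succ s ih =>
    simp only [star_succ]
    have hs : ∀ i j, SOn U fun u => star (h u) hN s (pd i (f u)) (pd j (g u)) := fun i j =>
      SOn.star hU hh hN s (SOn.dir hU hf _) (SOn.dir hU hg _)
    rw [hd_sum hU (fun i _ => SOn.sum fun j _ => SOn.smul_fun (hh i j) (hs i j)) hu]
    simp only [hd_sum hU (fun j _ => SOn.smul_fun (hh _ j) (hs _ j)) hu,
      hd_smul_fun hU (hh _ _) (hs _ _) hu, ih (SOn.dir hU hf _) (SOn.dir hU hg _),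
      hd_dir hU hf hu, hd_dir hU hg hu]
    have e1 : ∀ i j, star (h u) hN s (dir (Γ u v (e i)) (f u)) (pd j (g u)) =
        ∑ c, ((coord (Γ u v (e i)) c : ℝ) : ℂ) • star (h u) hN s (pd c (f u)) (pd j (g u)) := by
      intro i j
      rw [dir_linear, LinearMap.map_sum₂]
      simp only [LinearMap.map_smul₂]
    have e2 : ∀ i j, star (h u) hN s (pd i (f u)) (dir (Γ u v (e j)) (g u)) =
        ∑ c, ((coord (Γ u v (e j)) c : ℝ) : ℂ) • star (h u) hN s (pd i (f u)) (pd c (g u)) := by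
      intro i j
      rw [dir_linear (g u) (Γ u v (e j)), map_sum]
      simp only [map_smul]
    -- The terms in which the derivative hits h, or in which Γ arises from passing a partial
    -- derivative, assemble into the covariant derivative of h, which vanishes by `hpar`.
    have e3 : ∑ i, ∑ j, (fderiv ℝ (fun u => h u i j) u v) •
          star (h u) hN s (pd i (f u)) (pd j (g u)) +
        ∑ i, ∑ j, h u i j • star (h u) hN s (dir (Γ u v (e i)) (f u)) (pd j (g u)) +
        ∑ i, ∑ j, h u i j • star (h u) hN s (pd i (f u)) (dir (Γ u v (e j)) (g u)) = 0 := by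
      have e4 : ∑ i, ∑ j, h u i j • star (h u) hN s (dir (Γ u v (e i)) (f u)) (pd j (g u)) =
          ∑ i, ∑ j, (∑ c, ((coord (Γ u v (e c)) i : ℝ) : ℂ) * h u c j) •
            star (h u) hN s (pd i (f u)) (pd j (g u)) := by
        simp only [e1, Finset.smul_sum, smul_smul, Finset.sum_smul]
        rw [Finset.sum_congr rfl fun i _ => Finset.sum_comm, Finset.sum_comm]
        refine Finset.sum_congr rfl fun i _ => ?_
        rw [Finset.sum_comm]
        simp only [mul_comm]
      have e5 : ∑ i, ∑ j, h u i j • star (h u) hN s (pd i (f u)) (dir (Γ u v (e j)) (g u)) =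
          ∑ i, ∑ j, (∑ c, ((coord (Γ u v (e c)) j : ℝ) : ℂ) * h u i c) •
            star (h u) hN s (pd i (f u)) (pd j (g u)) := by
        simp only [e2, Finset.smul_sum, smul_smul, Finset.sum_smul]
        refine Finset.sum_congr rfl fun i _ => ?_
        rw [Finset.sum_comm]
        simp only [mul_comm]
      rw [e4, e5, ← Finset.sum_add_distrib, ← Finset.sum_add_distrib]
      refine Finset.sum_eq_zero fun i _ => ?_
      rw [← Finset.sum_add_distrib, ← Finset.sum_add_distrib]
      refine Finset.sum_eq_zero fun j _ => ?_
      rw [← add_smul, ← add_smul, hpar u hu, zero_smul]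
    simp only [LinearMap.map_add₂]
    simp only [map_add, smul_add, Finset.sum_add_distrib]
    rw [← sub_eq_zero, ← e3]
    abel

end

end Sm
end LocalConnection

/-! ### Curvature of a connection form with values in an algebra, and its Bianchi identity -/

section Curvature

variable {E A : Type*} [NormedAddCommGroup E] [NormedSpace ℝ E] [NormedRing A] [NormedAlgebra ℝ A]
  {U : Set E} {u : E}

theorem fderiv_fderiv_symm {F : Type*} [NormedAddCommGroup F] [NormedSpace ℝ F] {G : E → F}
    (hG : ContDiffAt ℝ ∞ G u) (a b : E) :
    fderiv ℝ (fun u => fderiv ℝ G u b) u a = fderiv ℝ (fun u => fderiv ℝ G u a) u b := by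
  have h2 : HasFDerivAt (fderiv ℝ G) (fderiv ℝ (fderiv ℝ G) u) u :=
    ((hG.fderiv_right (m := ∞) (by simp)).differentiableAt (by simp)).hasFDerivAt
  have h : ∀ a b, fderiv ℝ (fun u => fderiv ℝ G u b) u a = fderiv ℝ (fderiv ℝ G) u a b := by
    intro a b
    rw [(h2.clm_apply (hasFDerivAt_const b u)).fderiv]
    simp
  rw [h, h]
  exact hG.isSymmSndFDerivAt (by simpa using ENat.LEInfty.out) a b

/-- The curvature of the connection with coefficients `Γ`. -/
def curvature (Γ : E → E → A) (u v w : E) : A :=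
  fderiv ℝ (fun u => Γ u w) u v - fderiv ℝ (fun u => Γ u v) u w + Γ u v * Γ u w - Γ u w * Γ u v

theorem contDiffOn_fderiv_apply {F : Type*} [NormedAddCommGroup F] [NormedSpace ℝ F] {G : E → F}
    (hU : IsOpen U) (hG : ContDiffOn ℝ ∞ G U) (v : E) :
    ContDiffOn ℝ ∞ (fun u => fderiv ℝ G u v) U :=
  (hG.fderiv_of_isOpen hU (by simp)).clm_apply contDiffOn_const

theorem contDiffOn_curvature {Γ : E → E → A} (hU : IsOpen U)
    (hΓ : ∀ v, ContDiffOn ℝ ∞ (fun u => Γ u v) U) (v w : E) :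
    ContDiffOn ℝ ∞ (fun u => curvature Γ u v w) U :=
  (((contDiffOn_fderiv_apply hU (hΓ w) v).sub (contDiffOn_fderiv_apply hU (hΓ v) w)).add
    ((hΓ v).mul (hΓ w))).sub ((hΓ w).mul (hΓ v))

/-- The second Bianchi identity. -/
theorem bianchi {Γ : E → E → A} (hU : IsOpen U)
    (hΓ : ∀ v, ContDiffOn ℝ ∞ (fun u => Γ u v) U) (hu : u ∈ U) (x y z : E) :
    (fderiv ℝ (fun u => curvature Γ u y z) u x + Γ u x * curvature Γ u y z
        - curvature Γ u y z * Γ u x) +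
    (fderiv ℝ (fun u => curvature Γ u z x) u y + Γ u y * curvature Γ u z x
        - curvature Γ u z x * Γ u y) +
    (fderiv ℝ (fun u => curvature Γ u x y) u z + Γ u z * curvature Γ u x y
        - curvature Γ u x y * Γ u z) = 0 := by
  have hc : ∀ v, ContDiffAt ℝ ∞ (fun u => Γ u v) u := fun v => (hΓ v).contDiffAt (hU.mem_nhds hu)
  have g1 : ∀ b, HasFDerivAt (fun u => Γ u b) (fderiv ℝ (fun u => Γ u b) u) u := fun b =>
    ((hc b).differentiableAt (by simp)).hasFDerivAt
  have g2 : ∀ b c, HasFDerivAt (fun u => fderiv ℝ (fun u => Γ u c) u b)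
      (fderiv ℝ (fun u => fderiv ℝ (fun u => Γ u c) u b) u) u := fun b c =>
    (((contDiffOn_fderiv_apply hU (hΓ c) b).contDiffAt (hU.mem_nhds hu)).differentiableAt
      (by simp)).hasFDerivAt
  have h3 : ∀ a b c, fderiv ℝ (fun u => curvature Γ u b c) u a =
      fderiv ℝ (fun u => fderiv ℝ (fun u => Γ u c) u b) u a
        - fderiv ℝ (fun u => fderiv ℝ (fun u => Γ u b) u c) u a +
      (Γ u b * fderiv ℝ (fun u => Γ u c) u a + fderiv ℝ (fun u => Γ u b) u a * Γ u c) -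
      (Γ u c * fderiv ℝ (fun u => Γ u b) u a + fderiv ℝ (fun u => Γ u c) u a * Γ u b) := by
    intro a b c
    have g3 := (((g2 b c).fun_sub (g2 c b)).fun_add ((g1 b).mul' (g1 c))).fun_sub
      ((g1 c).mul' (g1 b))
    have g4 : fderiv ℝ (fun u => curvature Γ u b c) u a = _ := congrArg (fun A => A a) g3.fderiv
    rw [g4]
    simp
  -- Second derivatives of Γ cancel in pairs by symmetry; everything else is noncommutative algebra
  -- in Γ and its first derivatives.
  rw [h3, h3, h3, fderiv_fderiv_symm (hc x) y z, fderiv_fderiv_symm (hc y) x z,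
    fderiv_fderiv_symm (hc z) x y]
  simp only [curvature]
  noncomm_ring

end Curvature

/-! ### The exterior covariant derivative: derivation rule, square, special forms -/

section LocalConnection

variable {m : ℕ} {n p q N : ℕ}

namespace Sm

theorem star_map_left (h : Fin (2 * m + 1) → Fin (2 * m + 1) → ℂ) (θ : Alt m 1) (h1 : 1 + p = p + 1)
    (hN : p + q = N) (h2 : p + 1 + q = N + 1) (h3 : 1 + N = N + 1) (s : ℕ) (f : Sm m p)
    (g : Sm m q) :
    star h h2 s (map (wedgeL h1 θ) f) g = map (wedgeL h3 θ) (star h hN s f g) := by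
  induction s generalizing f g with
  | zero => exact Sm.ext fun y => wedge_assoc h1 h2 hN h3 θ (f y) (g y)
  | succ s ih =>
    rw [star_succ, star_succ]
    simp only [map_sum, map_smul, dir_map, ih]

/-- Bringing θ to the front moves it past the p-form f, hence the sign. -/
theorem star_map_right (h : Fin (2 * m + 1) → Fin (2 * m + 1) → ℂ) (θ : Alt m 1)
    (h1 : 1 + q = q + 1) (hN : p + q = N) (h2 : p + (q + 1) = N + 1) (h3 : 1 + N = N + 1) (s : ℕ)
    (f : Sm m p) (g : Sm m q) :
    star h h2 s f (map (wedgeL h1 θ) g) = (-1 : ℂ) ^ p • map (wedgeL h3 θ) (star h hN s f g) := by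
  induction s generalizing f g with
  | zero =>
    refine Sm.ext fun y => ?_
    change wedge h2 (f y) (wedge h1 θ (g y)) = (-1 : ℂ) ^ p • wedge h3 θ (wedge hN (f y) (g y))
    have h4 : p + 1 = p + 1 := rfl
    have h5 : 1 + p = p + 1 := Nat.add_comm 1 p
    rw [← wedge_assoc h4 (by omega) h1 h2, wedge_comm h4 h5, wedge_smul_left,
      wedge_assoc h5 (by omega) hN h3, mul_one]
  | succ s ih =>
    rw [star_succ, star_succ]
    simp only [map_sum, map_smul, dir_map, ih, Finset.smul_sum]
    refine Finset.sum_congr rfl fun i _ => Finset.sum_congr rfl fun j _ => ?_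
    rw [smul_comm]

variable {U : Set (Model m)} (hU : IsOpen U) {f : Model m → Sm m n} {u : Model m}
  {Γ : Model m → Model m →L[ℝ] Model m →L[ℝ] Model m}

section
include hU

theorem nabla_add {g : Model m → Sm m n} (hf : SOn U f) (hg : SOn U g) (hu : u ∈ U) :
    nabla Γ (fun u => f u + g u) u = nabla Γ f u + nabla Γ g u := by
  simp only [nabla, hd_add hU hf hg hu, map_add, Finset.sum_add_distrib]

theorem nabla_smul (c : ℂ) (hf : SOn U f) (hu : u ∈ U) :
    nabla Γ (fun u => c • f u) u = c • nabla Γ f u := by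
  simp only [nabla, hd_smul hU c hf hu, map_smul, Finset.smul_sum]

theorem nabla_sum {ι : Type*} {s : Finset ι} {F : ι → Model m → Sm m n}
    (hF : ∀ i ∈ s, SOn U (F i)) (hu : u ∈ U) :
    nabla Γ (fun u => ∑ i ∈ s, F i u) u = ∑ i ∈ s, nabla Γ (F i) u := by
  simp only [nabla, hd_sum hU hF hu, map_sum]
  exact Finset.sum_comm

/-- The exterior covariant derivative is a graded derivation of the contractions with a parallel
tensor. -/
theorem nabla_star {h : Model m → Fin (2 * m + 1) → Fin (2 * m + 1) → ℂ}
    (hh : ∀ i j, ContDiffOn ℝ ∞ (fun u => h u i j) U)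
    (hpar : ∀ u ∈ U, ∀ v i j, fderiv ℝ (fun u => h u i j) u v +
      ∑ c, ((coord (Γ u v (e c)) i : ℝ) : ℂ) * h u c j +
      ∑ c, ((coord (Γ u v (e c)) j : ℝ) : ℂ) * h u i c = 0)
    (hN : p + q = N) (hl : p + 1 + q = N + 1) (hr : p + (q + 1) = N + 1) (s : ℕ)
    {f : Model m → Sm m p} {g : Model m → Sm m q} (hf : SOn U f) (hg : SOn U g) (hu : u ∈ U) :
    nabla Γ (fun u => star (h u) hN s (f u) (g u)) u =
      star (h u) hl s (nabla Γ f u) (g u) + (-1 : ℂ) ^ p • star (h u) hr s (f u) (nabla Γ g u) := by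
  have h1 : ((-1 : ℂ) ^ p * (-1) ^ p) = 1 := by rw [← mul_pow]; simp
  have e1 : ∀ i, star (h u) hl s (map (wedgeL (Nat.add_comm 1 p) (dx i)) (hd Γ (e i) f u)) (g u) =
      map (wedgeL (Nat.add_comm 1 N) (dx i)) (star (h u) hN s (hd Γ (e i) f u) (g u)) := fun i =>
    star_map_left (h u) (dx i) _ hN hl _ s _ _
  have e2 : ∀ i, star (h u) hr s (f u) (map (wedgeL (Nat.add_comm 1 q) (dx i)) (hd Γ (e i) g u)) =
      (-1 : ℂ) ^ p • map (wedgeL (Nat.add_comm 1 N) (dx i))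
        (star (h u) hN s (f u) (hd Γ (e i) g u)) := fun i =>
    star_map_right (h u) (dx i) _ hN hr _ s _ _
  rw [nabla, nabla, nabla, LinearMap.map_sum₂, map_sum]
  simp only [hd_star hU hh hpar hN s hf hg hu, e1, e2, map_add, Finset.sum_add_distrib,
    Finset.smul_sum, smul_smul, h1, one_smul]

theorem SOn.circ {h : Model m → Fin (2 * m + 1) → Fin (2 * m + 1) → ℂ}
    (hh : ∀ i j, ContDiffOn ℝ ∞ (fun u => h u i j) U) (hN : p + q = N)
    {a : Model m → ℕ → ℕ → Sm m p} {b : Model m → ℕ → ℕ → Sm m q}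
    (ha : ∀ k l, SOn U fun u => a u k l) (hb : ∀ k l, SOn U fun u => b u k l) (k l : ℕ) :
    SOn U fun u => circ (h u) hN (a u) (b u) k l :=
  SOn.sum fun _ _ => SOn.sum fun _ _ => SOn.sum fun _ _ =>
    SOn.smul _ (SOn.star hU hh hN _ (ha _ _) (hb _ _))

theorem nabla_circ {h : Model m → Fin (2 * m + 1) → Fin (2 * m + 1) → ℂ}
    (hh : ∀ i j, ContDiffOn ℝ ∞ (fun u => h u i j) U)
    (hpar : ∀ u ∈ U, ∀ v i j, fderiv ℝ (fun u => h u i j) u v +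
      ∑ c, ((coord (Γ u v (e c)) i : ℝ) : ℂ) * h u c j +
      ∑ c, ((coord (Γ u v (e c)) j : ℝ) : ℂ) * h u i c = 0)
    (hN : p + q = N) (hl : p + 1 + q = N + 1) (hr : p + (q + 1) = N + 1)
    {a : Model m → ℕ → ℕ → Sm m p} {b : Model m → ℕ → ℕ → Sm m q}
    (ha : ∀ k l, SOn U fun u => a u k l) (hb : ∀ k l, SOn U fun u => b u k l) (hu : u ∈ U)
    (k l : ℕ) :
    nabla Γ (fun u => Sm.circ (h u) hN (a u) (b u) k l) u =
      Sm.circ (h u) hl (fun k l => nabla Γ (fun u => a u k l) u) (b u) k l +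
        (-1 : ℂ) ^ p • Sm.circ (h u) hr (a u) (fun k l => nabla Γ (fun u => b u k l) u) k l := by
  have hs : ∀ s k1 l1 k2 l2, SOn U fun u => star (h u) hN s (a u k1 l1) (b u k2 l2) :=
    fun s k1 l1 k2 l2 => SOn.star hU hh hN s (ha _ _) (hb _ _)
  have hs1 : ∀ s k1 l1 k2 l2, SOn U fun u => expCoeff s •
      star (h u) hN s (a u k1 l1) (b u k2 l2) := fun s k1 l1 k2 l2 => SOn.smul _ (hs _ _ _ _ _)
  simp only [Sm.circ]
  rw [nabla_sum hU (fun _ _ => SOn.sum fun _ _ => SOn.sum fun _ _ => hs1 _ _ _ _ _) hu,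
    Finset.smul_sum, ← Finset.sum_add_distrib]
  refine Finset.sum_congr rfl fun x _ => ?_
  rw [nabla_sum hU (fun _ _ => SOn.sum fun _ _ => hs1 _ _ _ _ _) hu, Finset.smul_sum,
    ← Finset.sum_add_distrib]
  refine Finset.sum_congr rfl fun y _ => ?_
  rw [nabla_sum hU (fun _ _ => hs1 _ _ _ _ _) hu, Finset.smul_sum, ← Finset.sum_add_distrib]
  refine Finset.sum_congr rfl fun z _ => ?_
  rw [nabla_smul hU _ (hs _ _ _ _ _) hu, nabla_star hU hh hpar hN hl hr _ (ha _ _) (hb _ _) hu,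
    smul_add, smul_comm (expCoeff x.1)]

end

/-- The curvature of the connection with coefficients `Γ`. -/
def curv (Γ : Model m → Model m →L[ℝ] Model m →L[ℝ] Model m) (u v w : Model m) :
    Model m →L[ℝ] Model m :=
  curvature (fun u v => Γ u v) u v w

/-- Linear vector fields act on functions, so the order of composition is reversed. -/
theorem vert_vert (B C : Model m →L[ℝ] Model m) (f : Sm m n) :
    vert B (vert C f) - vert C (vert B f) = vert (C * B - B * C) f := by
  have h1 : ∀ (B C : Model m →L[ℝ] Model m) y,
      vert B (vert C f) y = dir (C y) (dir (B y) f) y + fderiv ℝ f y (C (B y)) := by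
    intro B C y
    exact congrArg (eval y) (dir_vert C (B y) f)
  refine Sm.ext fun y => ?_
  rw [sub_apply, h1, h1, dir_comm, vert_apply, _root_.sub_apply, map_sub, add_sub_add_left_eq_sub]
  rfl

theorem vert_add_left (B C : Model m →L[ℝ] Model m) (f : Sm m n) :
    vert (B + C) f = vert B f + vert C f :=
  Sm.ext fun y => map_add (fderiv ℝ f y) (B y) (C y)

theorem vert_sub_left (B C : Model m →L[ℝ] Model m) (f : Sm m n) :
    vert (B - C) f = vert B f - vert C f :=
  Sm.ext fun y => map_sub (fderiv ℝ f y) (B y) (C y)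

section
include hU

/-- The derivatives in the base commute, and the derivatives of Γ together with the commutator from
`vert_vert` form the curvature. The minus sign reflects the dual action on functions of y. -/
theorem hd_hd (hΓ : ContDiffOn ℝ ∞ Γ U) (hf : SOn U f) (hu : u ∈ U) (v w : Model m) :
    hd Γ v (hd Γ w f) u - hd Γ w (hd Γ v f) u = -vert (curv Γ u v w) (f u) := by
  have hΓ' : ∀ w, ContDiffOn ℝ ∞ (fun u => Γ u w) U := fun w => hΓ.clm_apply contDiffOn_const
  have h1 : ∀ v w, hd Γ v (hd Γ w f) u = ud v (ud w f) u - (vert (Γ u w) (ud v f u) +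
      vert (fderiv ℝ (fun u => Γ u w) u v) (f u)) - (vert (Γ u v) (ud w f u) -
        vert (Γ u v) (vert (Γ u w) (f u))) := by
    intro v w
    have : hd Γ v (hd Γ w f) u = ud v (fun u => ud w f u - vert (Γ u w) (f u)) u -
      vert (Γ u v) (ud w f u - vert (Γ u w) (f u)) := rfl
    rw [this, ud_sub hU (SOn.ud hU hf w) (SOn.vert hU hf (hΓ' w)) hu, map_sub,
      ud_vert hU hf (hΓ' w) hu]
  have h2 := vert_vert (Γ u v) (Γ u w) (f u)
  rw [vert_sub_left] at h2
  rw [h1, h1, ud_comm hU hf hu v w, curv, curvature, vert_sub_left, vert_add_left, vert_sub_left]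
  rw [← sub_eq_zero] at h2 ⊢
  rw [← h2]
  abel

/-- The square of the exterior covariant derivative. -/
theorem nabla_nabla (hΓ : ContDiffOn ℝ ∞ Γ U) (hf : SOn U f) (hu : u ∈ U) :
    nabla Γ (nabla Γ f) u = (-1 / 2 : ℂ) • ∑ i, ∑ j,
      map (wedgeL (Nat.add_comm 2 n) (wedge rfl (dx i) (dx j)))
        (vert (curv Γ u (e i) (e j)) (f u)) := by
  refine Sm.ext fun y => ?_
  have h1 : ∀ i, hd Γ (e i) (nabla Γ f) u y = dxSum fun j => hd Γ (e i) (hd Γ (e j) f) u y := by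
    intro i
    have : hd Γ (e i) (nabla Γ f) u =
        ∑ j, map (wedgeL (Nat.add_comm 1 n) (dx j)) (hd Γ (e i) (hd Γ (e j) f) u) := by
      refine (hd_sum hU (fun j _ => SOn.map _ (SOn.hd hU hΓ hf (e j))) hu (e i)).trans ?_
      exact Finset.sum_congr rfl fun j _ => hd_map hU _ (SOn.hd hU hΓ hf (e j)) hu _
    rw [this, sum_apply]
    rfl
  rw [nabla_apply]
  simp only [h1]
  rw [dxSum_dxSum, smul_apply, sum_apply]
  have h2 : ∀ i j, hd Γ (e i) (hd Γ (e j) f) u y - hd Γ (e j) (hd Γ (e i) f) u y =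
      -vert (curv Γ u (e i) (e j)) (f u) y := fun i j =>
    congrArg (eval y) (hd_hd hU hΓ hf hu (e i) (e j))
  simp only [h2, wedge_neg_right, Finset.sum_neg_distrib, sum_apply, map_apply, wedgeL_apply,
    smul_neg, ← neg_smul]
  norm_num

end

theorem SOn.quadraticForm {w : Model m → Model m →L[ℝ] Model m →L[ℝ] ℝ} (hw : ContDiffOn ℝ ∞ w U)
    {A : Model m → Fin (2 * m + 1) → Fin (2 * m + 1) → Model m →L[ℝ] Model m}
    (hA : ∀ i j, ContDiffOn ℝ ∞ (fun u => A u i j) U) :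
    SOn U fun u => quadraticForm (w u) (A u) := by
  have h1 : ContDiffOn ℝ ∞ (fun z : Model m × Model m => w z.1) (U ×ˢ Set.univ) :=
    hw.comp contDiffOn_fst fun _ hz => hz.1
  have h2 : ∀ i j, ContDiffOn ℝ ∞ (fun z : Model m × Model m => A z.1 i j) (U ×ˢ Set.univ) :=
    fun i j => (hA i j).comp contDiffOn_fst fun _ hz => hz.1
  change ContDiffOn ℝ ∞ (fun z : Model m × Model m => ∑ i, ∑ j,
      (Complex.ofRealCLM (w z.1 z.2 (A z.1 i j z.2))) • (wedge rfl (dx i) (dx j) : Alt m 2)) _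
  exact ContDiffOn.sum fun i _ => ContDiffOn.sum fun j _ => ContDiffOn.fun_smul
    (Complex.ofRealCLM.contDiff.comp_contDiffOn
      ((h1.clm_apply contDiffOn_snd).clm_apply ((h2 i j).clm_apply contDiffOn_snd)))
    contDiffOn_const

theorem SOn.linearForm {w : Model m → Model m →L[ℝ] Model m →L[ℝ] ℝ} (hw : ContDiffOn ℝ ∞ w U) :
    SOn U fun u => linearForm (w u) := by
  have h1 : ContDiffOn ℝ ∞ (fun z : Model m × Model m => w z.1) (U ×ˢ Set.univ) :=
    hw.comp contDiffOn_fst fun _ hz => hz.1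
  have h2 : ContDiffOn ℝ ∞ (fun z : Model m × Model m => ∑ i,
      (Complex.ofRealCLM (w z.1 z.2 (e i))) • (dx i : Alt m 1)) (U ×ˢ Set.univ) :=
    ContDiffOn.sum fun i _ => ContDiffOn.fun_smul (Complex.ofRealCLM.contDiff.comp_contDiffOn
      ((h1.clm_apply contDiffOn_snd).clm_apply contDiffOn_const)) contDiffOn_const
  exact h2.congr fun z _ => oneForm_eq_sum (w z.1 z.2)

section
include hU

theorem hasFDerivAt_form {w : Model m → Model m →L[ℝ] Model m →L[ℝ] ℝ} (hw : ContDiffOn ℝ ∞ w U)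
    (hu : u ∈ U) (x : Model m) :
    HasFDerivAt (fun u => w u x) (fderiv ℝ (fun u => w u x) u) u :=
  (((hw.clm_apply contDiffOn_const).contDiffAt (hU.mem_nhds hu)).differentiableAt
    (by simp)).hasFDerivAt

theorem fderiv_form_apply {w : Model m → Model m →L[ℝ] Model m →L[ℝ] ℝ} (hw : ContDiffOn ℝ ∞ w U)
    (hu : u ∈ U) (v x y : Model m) :
    fderiv ℝ (fun u => w u x) u v y = fderiv ℝ (fun u => w u x y) u v := by
  rw [((hasFDerivAt_form hU hw hu x).clm_apply (hasFDerivAt_const y u)).fderiv]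
  simp

/-- As w is parallel, the derivative falls on the endomorphism A alone and appears as the covariant
derivative of A, with its commutator with Γ. -/
theorem hd_quadraticForm {w : Model m → Model m →L[ℝ] Model m →L[ℝ] ℝ} (hw : ContDiffOn ℝ ∞ w U)
    (hpar : ∀ u ∈ U, ∀ v x y,
      fderiv ℝ (fun u => w u x y) u v = w u (Γ u v x) y + w u x (Γ u v y))
    {A : Model m → Fin (2 * m + 1) → Fin (2 * m + 1) → Model m →L[ℝ] Model m}
    (hA : ∀ i j, ContDiffOn ℝ ∞ (fun u => A u i j) U) (hu : u ∈ U) (v y : Model m) :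
    hd Γ v (fun u => quadraticForm (w u) (A u)) u y = ∑ i, ∑ j,
      ((w u y ((fderiv ℝ (fun u => A u i j) u v + Γ u v * A u i j - A u i j * Γ u v) y) : ℝ) : ℂ) •
        wedge rfl (dx i) (dx j) := by
  have hA' : ∀ i j, HasFDerivAt (fun u => A u i j) (fderiv ℝ (fun u => A u i j) u) u :=
    fun i j => (((hA i j).contDiffAt (hU.mem_nhds hu)).differentiableAt (by simp)).hasFDerivAt
  have h1 : ∀ i j, HasFDerivAt (fun u => w u y (A u i j y)) _ u := fun i j =>
    (hasFDerivAt_form hU hw hu y).clm_apply ((hA' i j).clm_apply (hasFDerivAt_const y u))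
  have h2 : ∀ i j, HasFDerivAt (fun u => (Complex.ofRealCLM (w u y (A u i j y))) •
      (wedge rfl (dx i) (dx j) : Alt m 2)) _ u := fun i j =>
    (Complex.ofRealCLM.hasFDerivAt.comp u (h1 i j)).smul_const _
  have h3 : ud v (fun u => Sm.quadraticForm (w u) (A u)) u y = fderiv ℝ (fun u => ∑ i, ∑ j,
      (Complex.ofRealCLM (w u y (A u i j y))) • (wedge rfl (dx i) (dx j) : Alt m 2)) u v :=
    ud_apply hU (SOn.quadraticForm hw hA) hu v y
  rw [hd, sub_apply, h3, (HasFDerivAt.fun_sum fun i _ => HasFDerivAt.fun_sum fun j _ =>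
    h2 i j).fderiv]
  have h4 : vert (Γ u v) (Sm.quadraticForm (w u) (A u)) y =
      dir (Γ u v y) (Sm.quadraticForm (w u) (A u)) y := rfl
  rw [h4, dir_quadraticForm_apply]
  simp only [_root_.sum_apply, ← Finset.sum_sub_distrib]
  refine Finset.sum_congr rfl fun i _ => Finset.sum_congr rfl fun j _ => ?_
  rw [ContinuousLinearMap.smulRight_apply, ← sub_smul]
  congr 1
  have h5 := fderiv_form_apply hU hw hu v y (A u i j y)
  rw [hpar u hu] at h5
  simp only [ContinuousLinearMap.comp_apply, _root_.add_apply, ContinuousLinearMap.flip_apply,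
    Complex.ofRealCLM_apply, h5, _root_.sub_apply, map_add, map_sub, mul_apply_eq_comp,
    _root_.zero_apply, map_zero]
  push_cast
  ring

end

/-- The three-form dxᵏ ∧ dxⁱ ∧ dxʲ is invariant under cyclic permutations. Three times the sum is
therefore the sum with cyclically summed coefficients. -/
theorem dxSum_cyclic {c : Fin (2 * m + 1) → Fin (2 * m + 1) → Fin (2 * m + 1) → ℂ}
    (hc : ∀ i j k, c i j k + c j k i + c k i j = 0) :
    dxSum (fun k => ∑ i, ∑ j, c k i j • (wedge rfl (dx i) (dx j) : Alt m 2)) = 0 := by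
  have h12 : (1 : ℕ) + 2 = 3 := rfl
  have h21 : (2 : ℕ) + 1 = 3 := rfl
  have rot : ∀ i j k : Fin (2 * m + 1), wedge h12 (dx k) (wedge rfl (dx i) (dx j)) =
      wedge h12 (dx i) (wedge rfl (dx j) (dx k)) := by
    intro i j k
    rw [wedge_comm h12 h21, wedge_assoc rfl h21 rfl h12]
    norm_num
  have h1 : dxSum (fun k => ∑ i, ∑ j, c k i j • (wedge rfl (dx i) (dx j) : Alt m 2)) =
      ∑ k, ∑ i, ∑ j, c k i j • wedge h12 (dx k) (wedge rfl (dx i) (dx j)) := by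
    rw [dxSum_apply]
    simp only [wedge_sum, wedge_smul_right]
  have cyc : ∀ F : Fin (2 * m + 1) → Fin (2 * m + 1) → Fin (2 * m + 1) → Alt m 3,
      ∑ k, ∑ i, ∑ j, F k i j = ∑ k, ∑ i, ∑ j, F i j k := by
    intro F
    refine Eq.symm (Finset.sum_comm.trans (Finset.sum_congr rfl fun i _ => Finset.sum_comm))
  have h2 : ∑ k, ∑ i, ∑ j, c k i j • wedge h12 (dx k) (wedge rfl (dx i) (dx j)) =
      ∑ k, ∑ i, ∑ j, c i j k • wedge h12 (dx k) (wedge rfl (dx i) (dx j)) := by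
    refine (cyc _).trans ?_
    refine Finset.sum_congr rfl fun k _ => Finset.sum_congr rfl fun i _ =>
      Finset.sum_congr rfl fun j _ => ?_
    rw [rot i j k]
  have h3 : ∑ k, ∑ i, ∑ j, c k i j • wedge h12 (dx k) (wedge rfl (dx i) (dx j)) =
      ∑ k, ∑ i, ∑ j, c j k i • wedge h12 (dx k) (wedge rfl (dx i) (dx j)) := by
    refine h2.trans ((cyc fun k i j => c i j k • wedge h12 (dx k)
      (wedge rfl (dx i) (dx j))).trans ?_)
    refine Finset.sum_congr rfl fun k _ => Finset.sum_congr rfl fun i _ =>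
      Finset.sum_congr rfl fun j _ => ?_
    rw [rot i j k]
  rw [h1]
  have three : ∀ {S A B : Alt m 3}, S = A → S = B → (3 : ℂ) • S = S + A + B := by
    rintro S A B rfl rfl
    rw [show (3 : ℂ) = 1 + 1 + 1 by norm_num, add_smul, add_smul, one_smul]
  have h4 : (3 : ℂ) • ∑ k, ∑ i, ∑ j, c k i j • wedge h12 (dx k) (wedge rfl (dx i) (dx j)) = 0 := by
    rw [three h2 h3]
    simp only [← Finset.sum_add_distrib, ← add_smul, hc, zero_smul, Finset.sum_const_zero]
  exact (smul_eq_zero.1 h4).resolve_left (by norm_num)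

section
include hU

/-- The quadratic form of a parallel two-form and the curvature is covariantly closed. -/
theorem nabla_quadraticForm (hΓ : ContDiffOn ℝ ∞ Γ U) {w : Model m → Model m →L[ℝ] Model m →L[ℝ] ℝ}
    (hw : ContDiffOn ℝ ∞ w U)
    (hpar : ∀ u ∈ U, ∀ v x y,
      fderiv ℝ (fun u => w u x y) u v = w u (Γ u v x) y + w u x (Γ u v y))
    (hu : u ∈ U) :
    nabla Γ (fun u => quadraticForm (w u) fun i j => curv Γ u (e i) (e j)) u = 0 := by
  have hΓ' : ∀ v, ContDiffOn ℝ ∞ (fun u => Γ u v) U := fun v => hΓ.clm_apply contDiffOn_const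
  refine Sm.ext fun y => ?_
  rw [nabla_apply]
  have hq : ∀ v, hd Γ v (fun u => Sm.quadraticForm (w u) fun i j => curv Γ u (e i) (e j)) u y = _ :=
    fun v => hd_quadraticForm hU hw hpar (A := fun u i j => curv Γ u (e i) (e j))
      (fun i j => contDiffOn_curvature hU hΓ' (e i) (e j)) hu v y
  simp only [hq]
  -- The coefficients are linear in the covariant derivative of the curvature, so their cyclic sum
  -- vanishes by the second Bianchi identity.
  refine dxSum_cyclic fun k i j => ?_
  have := bianchi hU hΓ' hu (e k) (e i) (e j)
  rw [← Complex.ofReal_add, ← Complex.ofReal_add, ← map_add, ← map_add, ← _root_.add_apply,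
    ← _root_.add_apply]
  refine (congrArg (fun B : Model m →L[ℝ] Model m => ((w u y (B y) : ℝ) : ℂ)) this).trans ?_
  simp

/-- Since w is parallel, differentiating w(y, ·) leaves w(y, Γ(v, ·)). The wedge product
antisymmetrises Γ, and its antisymmetric part is the torsion. -/
theorem nabla_linearForm {w : Model m → Model m →L[ℝ] Model m →L[ℝ] ℝ} (hw : ContDiffOn ℝ ∞ w U)
    (hpar : ∀ u ∈ U, ∀ v x y,
      fderiv ℝ (fun u => w u x y) u v = w u (Γ u v x) y + w u x (Γ u v y))
    (hu : u ∈ U) (y : Model m) :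
    nabla Γ (fun u => linearForm (w u)) u y =
      (1 / 2 : ℂ) • ∑ i, ∑ j, ((w u y (Γ u (e i) (e j) - Γ u (e j) (e i)) : ℝ) : ℂ) •
        wedge rfl (dx i) (dx j) := by
  have h1 : ∀ v, hd Γ v (fun u => linearForm (w u)) u y =
      ∑ j, ((w u y (Γ u v (e j)) : ℝ) : ℂ) • (dx j : Alt m 1) := by
    intro v
    have h2 : ∀ j, HasFDerivAt (fun u => (Complex.ofRealCLM (w u y (e j))) • (dx j : Alt m 1)) _ u :=
      fun j => (Complex.ofRealCLM.hasFDerivAt.comp u ((hasFDerivAt_form hU hw hu y).clm_apply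
        (hasFDerivAt_const (e j) u))).smul_const _
    have h3 : ud v (fun u => Sm.linearForm (w u)) u y = fderiv ℝ (fun u => ∑ j,
        (Complex.ofRealCLM (w u y (e j))) • (dx j : Alt m 1)) u v := by
      rw [ud_apply hU (SOn.linearForm hw) hu v y]
      congr 2
      funext u
      exact oneForm_eq_sum _
    have h4 : vert (Γ u v) (Sm.linearForm (w u)) y = dir (Γ u v y) (Sm.linearForm (w u)) y := rfl
    rw [hd, sub_apply, h3, (HasFDerivAt.fun_sum fun j _ => h2 j).fderiv, h4, dir_linearForm,
      oneForm_eq_sum, _root_.sum_apply, ← Finset.sum_sub_distrib]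
    refine Finset.sum_congr rfl fun j _ => ?_
    rw [ContinuousLinearMap.smulRight_apply, ← sub_smul]
    congr 1
    have h5 := fderiv_form_apply hU hw hu v y (e j)
    rw [hpar u hu] at h5
    simp [h5]
  rw [nabla_apply]
  simp only [h1]
  rw [dxSum_apply]
  simp only [wedge_sum, wedge_smul_right, map_sub, Complex.ofReal_sub, sub_smul,
    Finset.sum_sub_distrib]
  have h6 : ∑ i, ∑ j, ((w u y (Γ u (e j) (e i)) : ℝ) : ℂ) • wedge rfl (dx i) (dx j) =
      -∑ i, ∑ j, ((w u y (Γ u (e i) (e j)) : ℝ) : ℂ) • (wedge rfl (dx i) (dx j) : Alt m 2) := by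
    rw [Finset.sum_comm, ← Finset.sum_neg_distrib]
    refine Finset.sum_congr rfl fun i _ => ?_
    rw [← Finset.sum_neg_distrib]
    refine Finset.sum_congr rfl fun j _ => ?_
    rw [wedge_one_anticomm, smul_neg]
  have h7 : ∀ c : Alt m 2, c = (1 / 2 : ℂ) • (c + c) := by
    intro c
    rw [smul_add, ← add_smul, show (1 / 2 + 1 / 2 : ℂ) = 1 by norm_num, one_smul]
  rw [h6, sub_neg_eq_add]
  exact h7 _

end

end Sm
end LocalConnection

/-! ### Coordinate frames and transition maps -/

section Frames

variable {m : ℕ} {M : Type*} [TopologicalSpace M] [ChartedSpace (Model m) M]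
  [IsManifold (𝓡 (2 * m + 1)) ∞ M] {x p q : M}

/-- The components, in the preferred chart at `x`, of tangent vectors at `p`. -/
def coframe (x p : M) : Model m →L[ℝ] Model m :=
  (trivializationAt (Model m) (TangentSpace (𝓡 (2 * m + 1)) : M → Type _) x).continuousLinearMapAt
    ℝ p

theorem coframe_apply (hp : p ∈ (extChartAt (𝓡 (2 * m + 1)) x).source)
    (v : TangentSpace (𝓡 (2 * m + 1)) p) : coframe x p v =
      (trivializationAt (Model m) (TangentSpace (𝓡 (2 * m + 1)) : M → Type _) x ⟨p, v⟩).2 := by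
  rw [extChartAt_source] at hp
  exact Trivialization.continuousLinearMapAt_apply_of_mem (R := ℝ) _ hp v

theorem coframe_frameMap (hp : p ∈ (extChartAt (𝓡 (2 * m + 1)) x).source) (v : Model m) :
    coframe x p (frameMap x p v) = v := by
  rw [extChartAt_source] at hp
  exact (trivializationAt (Model m) (TangentSpace (𝓡 (2 * m + 1)) : M → Type _)
    x).continuousLinearMapAt_symmL (R := ℝ) hp v

theorem frameMap_coframe (hp : p ∈ (extChartAt (𝓡 (2 * m + 1)) x).source) (v : Model m) :
    frameMap x p (coframe x p v) = v := by
  rw [extChartAt_source] at hp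
  exact (trivializationAt (Model m) (TangentSpace (𝓡 (2 * m + 1)) : M → Type _)
    x).symmL_continuousLinearMapAt (R := ℝ) hp v

theorem coframe_eq_mfderiv (hp : p ∈ (extChartAt (𝓡 (2 * m + 1)) x).source) :
    coframe x p = mfderiv (𝓡 (2 * m + 1)) 𝓘(ℝ, Model m) (extChartAt (𝓡 (2 * m + 1)) x) p := by
  rw [extChartAt_source] at hp
  exact TangentBundle.continuousLinearMapAt_trivializationAt hp

theorem frameMap_eq_mfderiv (hp : p ∈ (extChartAt (𝓡 (2 * m + 1)) x).source) :
    frameMap x p = mfderiv 𝓘(ℝ, Model m) (𝓡 (2 * m + 1)) (extChartAt (𝓡 (2 * m + 1)) x).symm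
      (extChartAt (𝓡 (2 * m + 1)) x p) := by
  rw [extChartAt_source] at hp
  have h := TangentBundle.symmL_trivializationAt (I := 𝓡 (2 * m + 1)) hp
  rw [ModelWithCorners.range_eq_univ, mfderivWithin_univ] at h
  exact h

theorem mdifferentiableAt_chart (hp : p ∈ (extChartAt (𝓡 (2 * m + 1)) x).source) :
    MDifferentiableAt (𝓡 (2 * m + 1)) 𝓘(ℝ, Model m) (extChartAt (𝓡 (2 * m + 1)) x) p := by
  rw [extChartAt_source] at hp
  exact mdifferentiableAt_extChartAt hp

theorem mdifferentiableAt_chart_symm {u : Model m}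
    (hu : u ∈ (extChartAt (𝓡 (2 * m + 1)) x).target) :
    MDifferentiableAt 𝓘(ℝ, Model m) (𝓡 (2 * m + 1)) (extChartAt (𝓡 (2 * m + 1)) x).symm u := by
  have h := mdifferentiableWithinAt_extChartAt_symm (I := 𝓡 (2 * m + 1)) hu
  rwa [ModelWithCorners.range_eq_univ, mdifferentiableWithinAt_univ] at h

/-- A real or vector valued function is differentiated along a coordinate vector field by
differentiating its local expression. -/
theorem mvfderiv_frameMap {F : Type*} [NormedAddCommGroup F] [NormedSpace ℝ F] {f : M → F}
    (hp : p ∈ (extChartAt (𝓡 (2 * m + 1)) x).source)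
    (hf : MDifferentiableAt (𝓡 (2 * m + 1)) 𝓘(ℝ, F) f p) (v : Model m) :
    mvfderiv (𝓡 (2 * m + 1)) f p (frameMap x p v) =
      fderiv ℝ (fun u => f ((extChartAt (𝓡 (2 * m + 1)) x).symm u))
        (extChartAt (𝓡 (2 * m + 1)) x p) v := by
  have h1 := mdifferentiableAt_chart_symm ((extChartAt (𝓡 (2 * m + 1)) x).map_source hp)
  have h2 := mfderiv_comp_of_eq (f := (extChartAt (𝓡 (2 * m + 1)) x).symm) (g := f) hf h1
    ((extChartAt (𝓡 (2 * m + 1)) x).left_inv hp)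
  rw [mfderiv_eq_fderiv] at h2
  have h3 := congrArg (fun L => L v) h2
  refine Eq.trans ?_ h3.symm
  rw [frameMap_eq_mfderiv hp]
  rw [(extChartAt (𝓡 (2 * m + 1)) x).left_inv hp]
  rfl

/-- The tangent space at x is identified with the model space by the preferred chart at x itself, so
the frame of this chart is trivial at its centre. -/
theorem frameMap_self (x : M) (v : Model m) : frameMap x x v = v := by
  have h0 : x ∈ (chartAt (Model m) x).source := mem_chart_source _ x
  have h1 := TangentBundle.symmL_trivializationAt_eq_core (I := 𝓡 (2 * m + 1)) h0
  have h2 := congrArg (fun L => L v) h1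
  refine h2.trans ?_
  exact (tangentBundleCore (𝓡 (2 * m + 1)) M).coordChange_self (achart (Model m) x) x h0 v

theorem coframe_self (x : M) (v : Model m) : coframe x x v = v := by
  have := coframe_frameMap (mem_extChartAt_source (I := 𝓡 (2 * m + 1)) x) v
  rwa [frameMap_self] at this

/-- The transition map from the preferred chart at `x` to the one at `p`. -/
def transition (x p : M) (u : Model m) : Model m :=
  extChartAt (𝓡 (2 * m + 1)) p ((extChartAt (𝓡 (2 * m + 1)) x).symm u)

/-- The domain, in the preferred chart at `x`, of the transition map to the chart at `p`. -/
def overlap (x p : M) : Set (Model m) :=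
  (extChartAt (𝓡 (2 * m + 1)) x).target ∩
    (extChartAt (𝓡 (2 * m + 1)) x).symm ⁻¹' (extChartAt (𝓡 (2 * m + 1)) p).source

omit [IsManifold (𝓡 (2 * m + 1)) ∞ M] in
theorem isOpen_overlap (x p : M) : IsOpen (overlap x p : Set (Model m)) :=
  (continuousOn_extChartAt_symm x).isOpen_inter_preimage (isOpen_extChartAt_target x)
    (isOpen_extChartAt_source p)

theorem contDiffOn_transition (x p : M) :
    ContDiffOn ℝ ∞ (transition x p : Model m → Model m) (overlap x p) := by
  refine (contDiffOn_ext_coord_change (I := 𝓡 (2 * m + 1)) (n := ∞) p x).congr_mono ?_ ?_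
  · intro u _; rfl
  · intro u hu
    rw [PartialEquiv.trans_source, PartialEquiv.symm_source]
    exact hu

/-- The derivative of a coordinate change is the change between the two coordinate frames, by the
chain rule for the manifold derivative. -/
theorem fderiv_transition {u : Model m} (hu : u ∈ (overlap x p : Set (Model m))) (v : Model m) :
    fderiv ℝ (transition x p) u v = coframe p ((extChartAt (𝓡 (2 * m + 1)) x).symm u)
      (frameMap x ((extChartAt (𝓡 (2 * m + 1)) x).symm u) v) := by
  have h1 := mdifferentiableAt_chart_symm hu.1
  have h2 := mdifferentiableAt_chart hu.2
  have h3 := mfderiv_comp u h2 h1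
  rw [mfderiv_eq_fderiv] at h3
  refine (congrArg (fun L => L v) h3).trans ?_
  rw [frameMap_eq_mfderiv ((extChartAt (𝓡 (2 * m + 1)) x).map_target hu.1),
    (extChartAt (𝓡 (2 * m + 1)) x).right_inv hu.1, coframe_eq_mfderiv hu.2]
  rfl

theorem frameMap_fderiv_transition {u : Model m} (hu : u ∈ (overlap x p : Set (Model m)))
    (v : Model m) :
    frameMap p ((extChartAt (𝓡 (2 * m + 1)) x).symm u) (fderiv ℝ (transition x p) u v) =
      frameMap x ((extChartAt (𝓡 (2 * m + 1)) x).symm u) v := by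
  rw [fderiv_transition hu, frameMap_coframe hu.2]

/-- The vector field with components `Z` in the preferred chart at `x`. -/
def framed (x : M) (Z : Model m → Model m) : Π p : M, TangentSpace (𝓡 (2 * m + 1)) p :=
  fun p => frameMap x p (Z (extChartAt (𝓡 (2 * m + 1)) x p))

theorem trivialization_framed (hp : p ∈ (extChartAt (𝓡 (2 * m + 1)) x).source) (v : Model m) :
    (trivializationAt (Model m) (TangentSpace (𝓡 (2 * m + 1)) : M → Type _) x
      ⟨p, frameMap x p v⟩).2 = v :=
  (coframe_apply hp _).symm.trans (coframe_frameMap hp v)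

theorem diffAt_framed {Z : Model m → Model m} (hp : p ∈ (extChartAt (𝓡 (2 * m + 1)) x).source)
    (hZ : DifferentiableAt ℝ Z (extChartAt (𝓡 (2 * m + 1)) x p)) : DiffAt (framed x Z) p := by
  have h0 : p ∈ (trivializationAt (Model m) (TangentSpace (𝓡 (2 * m + 1)) : M → Type _)
      x).baseSet := by rwa [extChartAt_source] at hp
  refine (Trivialization.mdifferentiableAt_section_iff (𝓡 (2 * m + 1)) (trivializationAt (Model m)
    (TangentSpace (𝓡 (2 * m + 1)) : M → Type _) x) (framed x Z) h0).2 ?_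
  have h1 : MDifferentiableAt (𝓡 (2 * m + 1)) 𝓘(ℝ, Model m)
      (fun p => Z (extChartAt (𝓡 (2 * m + 1)) x p)) p :=
    hZ.mdifferentiableAt.comp p (mdifferentiableAt_chart hp)
  refine h1.congr_of_eventuallyEq ?_
  filter_upwards [(isOpen_extChartAt_source (I := 𝓡 (2 * m + 1)) x).mem_nhds hp] with q hq
  exact trivialization_framed hq _

theorem contMDiffOn_framed {Z : Model m → Model m}
    (hZ : ContDiffOn ℝ ∞ Z (extChartAt (𝓡 (2 * m + 1)) x).target) :
    ContMDiffOn (𝓡 (2 * m + 1)) ((𝓡 (2 * m + 1)).prod 𝓘(ℝ, Model m)) ∞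
      (fun p => TotalSpace.mk' (Model m) (E := fun p => TangentSpace (𝓡 (2 * m + 1)) p) p
        (framed x Z p)) (extChartAt (𝓡 (2 * m + 1)) x).source := by
  refine (Trivialization.contMDiffOn_section_iff (trivializationAt (Model m)
    (TangentSpace (𝓡 (2 * m + 1)) : M → Type _) x) (isOpen_extChartAt_source x)
      (by rw [extChartAt_source]; rfl)).2 ?_
  have h1 : ContMDiffOn (𝓡 (2 * m + 1)) 𝓘(ℝ, Model m) ∞
      (fun p => Z (extChartAt (𝓡 (2 * m + 1)) x p)) (extChartAt (𝓡 (2 * m + 1)) x).source := by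
    refine (hZ.contMDiffOn).comp ?_ fun p hp => (extChartAt (𝓡 (2 * m + 1)) x).map_source hp
    rw [extChartAt_source]
    exact contMDiffOn_extChartAt
  exact h1.congr fun q hq => trivialization_framed hq _

/-- Components of a smooth vector field in the preferred chart at `x` are smooth. -/
theorem contDiffOn_coframe {Y : Π p : M, TangentSpace (𝓡 (2 * m + 1)) p}
    (hY : ContMDiffOn (𝓡 (2 * m + 1)) ((𝓡 (2 * m + 1)).prod 𝓘(ℝ, Model m)) ∞
      (fun p => TotalSpace.mk' (Model m) (E := fun p => TangentSpace (𝓡 (2 * m + 1)) p) p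
        (Y p)) (extChartAt (𝓡 (2 * m + 1)) x).source) :
    ContDiffOn ℝ ∞ (fun u => coframe x ((extChartAt (𝓡 (2 * m + 1)) x).symm u)
      (Y ((extChartAt (𝓡 (2 * m + 1)) x).symm u))) (extChartAt (𝓡 (2 * m + 1)) x).target := by
  have h1 := (Trivialization.contMDiffOn_section_iff (trivializationAt (Model m)
    (TangentSpace (𝓡 (2 * m + 1)) : M → Type _) x) (isOpen_extChartAt_source x)
      (by rw [extChartAt_source]; rfl)).1 hY
  have h2 : ContMDiffOn 𝓘(ℝ, Model m) 𝓘(ℝ, Model m) ∞ _ (extChartAt (𝓡 (2 * m + 1)) x).target :=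
    h1.comp (contMDiffOn_extChartAt_symm x) fun u hu =>
      (extChartAt (𝓡 (2 * m + 1)) x).map_target hu
  refine (contMDiffOn_iff_contDiffOn.1 h2).congr fun u hu => ?_
  exact coframe_apply ((extChartAt (𝓡 (2 * m + 1)) x).map_target hu) _

theorem contDiffOn_chart {F : Type*} [NormedAddCommGroup F] [NormedSpace ℝ F] {f : M → F}
    (hf : ContMDiffOn (𝓡 (2 * m + 1)) 𝓘(ℝ, F) ∞ f (extChartAt (𝓡 (2 * m + 1)) x).source) :
    ContDiffOn ℝ ∞ (fun u => f ((extChartAt (𝓡 (2 * m + 1)) x).symm u))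
      (extChartAt (𝓡 (2 * m + 1)) x).target :=
  contMDiffOn_iff_contDiffOn.1 (hf.comp (contMDiffOn_extChartAt_symm x) fun u hu =>
      (extChartAt (𝓡 (2 * m + 1)) x).map_target hu)

end Frames

/-! ### Coefficients of a connection in a chart -/

section Connection

variable {m : ℕ} {M : Type*} [TopologicalSpace M] [ChartedSpace (Model m) M]
  [IsManifold (𝓡 (2 * m + 1)) ∞ M] {x p : M} (cov : AffineConnection m M)

/-- The coefficients of a connection in the preferred chart at `x`. -/
def conn (x : M) (u : Model m) : Model m →L[ℝ] Model m →L[ℝ] Model m :=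
  ∑ j, (ContinuousLinearMap.smulRightL ℝ (Model m) (Model m) (EuclideanSpace.proj j)) ∘L
    (coframe x ((extChartAt (𝓡 (2 * m + 1)) x).symm u) ∘L
      (cov (coordField x j) ((extChartAt (𝓡 (2 * m + 1)) x).symm u) : Model m →L[ℝ] Model m) ∘L
        frameMap x ((extChartAt (𝓡 (2 * m + 1)) x).symm u))

theorem conn_apply (x : M) (u v y : Model m) : conn cov x u v y = ∑ j, coord y j •
    coframe x ((extChartAt (𝓡 (2 * m + 1)) x).symm u)
      (cov (coordField x j) ((extChartAt (𝓡 (2 * m + 1)) x).symm u)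
        (frameMap x ((extChartAt (𝓡 (2 * m + 1)) x).symm u) v)) := by
  rw [conn, _root_.sum_apply, _root_.sum_apply]
  rfl

theorem diffAt_coordField (hp : p ∈ (extChartAt (𝓡 (2 * m + 1)) x).source)
    (j : Fin (2 * m + 1)) : DiffAt (coordField x j) p :=
  diffAt_framed hp (differentiableAt_const _)

/-- Differentiability is proved together with the formula because additivity of the covariant
derivative requires it at each step. -/
theorem cov_sum {ι : Type*} (s : Finset ι) {g : ι → M → ℝ}
    {Y : ι → Π p : M, TangentSpace (𝓡 (2 * m + 1)) p}
    (hg : ∀ i, MDifferentiableAt (𝓡 (2 * m + 1)) 𝓘(ℝ, ℝ) (g i) p) (hY : ∀ i, DiffAt (Y i) p)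
    (v : TangentSpace (𝓡 (2 * m + 1)) p) :
    DiffAt (fun q => ∑ i ∈ s, g i q • Y i q) p ∧
      cov (fun q => ∑ i ∈ s, g i q • Y i q) p v =
        ∑ i ∈ s, (g i p • cov (Y i) p v + mvfderiv (𝓡 (2 * m + 1)) (g i) p v • Y i p) := by
  classical
  induction s using Finset.induction_on with
  | empty =>
    simp only [Finset.sum_empty]
    refine ⟨mdifferentiableAt_zeroSection .., ?_⟩
    have h := congrFun (CovariantDerivative.zero cov) p
    exact congrArg (fun L => L v) h
  | insert i s hi ih =>
    simp only [Finset.sum_insert hi]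
    have h1 : DiffAt (g i • Y i) p := (hg i).smul_section (hY i)
    have h2 := cov.isCovariantDerivativeOnUniv.add h1 ih.1
    have h3 := cov.isCovariantDerivativeOnUniv.leibniz (hY i) (hg i)
    refine ⟨mdifferentiableAt_add_section h1 ih.1, ?_⟩
    refine (congrArg (fun L => L v) h2).trans ?_
    rw [← ih.2]
    exact congrArg (fun L : TangentSpace (𝓡 (2 * m + 1)) p →L[ℝ] TangentSpace (𝓡 (2 * m + 1)) p =>
      L v + cov (fun q => ∑ i ∈ s, g i q • Y i q) p v) h3

/-- The Leibniz rule in the preferred chart at `x`. -/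
theorem cov_framed {Z : Model m → Model m} (hp : p ∈ (extChartAt (𝓡 (2 * m + 1)) x).source)
    (hZ : DifferentiableAt ℝ Z (extChartAt (𝓡 (2 * m + 1)) x p)) (v : Model m) :
    cov (framed x Z) p (frameMap x p v) =
      frameMap x p (fderiv ℝ Z (extChartAt (𝓡 (2 * m + 1)) x p) v +
        conn cov x (extChartAt (𝓡 (2 * m + 1)) x p) v (Z (extChartAt (𝓡 (2 * m + 1)) x p))) := by
  have hZc : ∀ c, DifferentiableAt ℝ (fun u => coord (Z u) c)
      (extChartAt (𝓡 (2 * m + 1)) x p) := fun c =>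
    (EuclideanSpace.proj (𝕜 := ℝ) c : Model m →L[ℝ] ℝ).differentiableAt.comp _ hZ
  have hg : ∀ c, MDifferentiableAt (𝓡 (2 * m + 1)) 𝓘(ℝ, ℝ)
      (fun q => coord (Z (extChartAt (𝓡 (2 * m + 1)) x q)) c) p := fun c =>
    (hZc c).mdifferentiableAt.comp p (mdifferentiableAt_chart hp)
  have h1 := (cov_sum cov Finset.univ hg (fun c => diffAt_coordField hp c) (frameMap x p v)).2
  have h2 : framed x Z = fun q => ∑ c, coord (Z (extChartAt (𝓡 (2 * m + 1)) x q)) c •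
      coordField x c q := by
    funext q
    have := congrArg (frameMap x q) (sum_coord_smul_e (Z (extChartAt (𝓡 (2 * m + 1)) x q)))
    rw [map_sum] at this
    refine this.symm.trans (Finset.sum_congr rfl fun c _ => ?_)
    rw [map_smul]
    rfl
  rw [h2]
  refine h1.trans ?_
  have h3 : ∀ c, mvfderiv (𝓡 (2 * m + 1)) (fun q => coord (Z (extChartAt (𝓡 (2 * m + 1)) x q)) c) p
      (frameMap x p v) = coord (fderiv ℝ Z (extChartAt (𝓡 (2 * m + 1)) x p) v) c := by
    intro c
    rw [mvfderiv_frameMap hp (hg c)]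
    have h4 : (fun u => coord (Z (extChartAt (𝓡 (2 * m + 1)) x
        ((extChartAt (𝓡 (2 * m + 1)) x).symm u))) c) =ᶠ[𝓝 (extChartAt (𝓡 (2 * m + 1)) x p)]
        fun u => coord (Z u) c := by
      filter_upwards [(isOpen_extChartAt_target (I := 𝓡 (2 * m + 1)) x).mem_nhds
        ((extChartAt (𝓡 (2 * m + 1)) x).map_source hp)] with u hu
      rw [(extChartAt (𝓡 (2 * m + 1)) x).right_inv hu]
    rw [h4.fderiv_eq]
    have h5 := ((EuclideanSpace.proj (𝕜 := ℝ) c : Model m →L[ℝ] ℝ).hasFDerivAt.comp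
      (extChartAt (𝓡 (2 * m + 1)) x p) hZ.hasFDerivAt).fderiv
    exact congrArg (fun L => L v) h5
  have h6 : frameMap x p (fderiv ℝ Z (extChartAt (𝓡 (2 * m + 1)) x p) v) =
      ∑ c, coord (fderiv ℝ Z (extChartAt (𝓡 (2 * m + 1)) x p) v) c • coordField x c p := by
    have := congrArg (frameMap x p) (sum_coord_smul_e
      (fderiv ℝ Z (extChartAt (𝓡 (2 * m + 1)) x p) v))
    rw [map_sum] at this
    refine this.symm.trans (Finset.sum_congr rfl fun c _ => ?_)
    rw [map_smul]
    rfl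
  have h7 : frameMap x p (conn cov x (extChartAt (𝓡 (2 * m + 1)) x p) v
      (Z (extChartAt (𝓡 (2 * m + 1)) x p))) = ∑ c, coord (Z (extChartAt (𝓡 (2 * m + 1)) x p)) c •
        cov (coordField x c) p (frameMap x p v) := by
    rw [conn_apply, (extChartAt (𝓡 (2 * m + 1)) x).left_inv hp, map_sum]
    refine Finset.sum_congr rfl fun c _ => ?_
    rw [map_smul]
    exact congrArg _ (frameMap_coframe hp _)
  rw [map_add]
  refine Eq.trans ?_ (congrArg₂ (· + ·) h6.symm h7.symm)
  refine Eq.trans (Finset.sum_congr rfl fun c _ => ?_) Finset.sum_add_distrib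
  exact (add_comm _ _).trans (congrArg (fun t : ℝ => t • (coordField x c p : Model m) +
    coord (Z (extChartAt (𝓡 (2 * m + 1)) x p)) c •
      (cov (coordField x c) p (frameMap x p v) : Model m)) (h3 c))

theorem cov_framed_const (hp : p ∈ (extChartAt (𝓡 (2 * m + 1)) x).source) (v y : Model m) :
    cov (framed x fun _ => y) p (frameMap x p v) =
      frameMap x p (conn cov x (extChartAt (𝓡 (2 * m + 1)) x p) v y) := by
  rw [cov_framed cov hp (differentiableAt_const _), fderiv_fun_const, Pi.zero_apply,
    _root_.zero_apply, zero_add]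

/-- Smoothness of the connection is used here for globally defined fields, while coordinate fields
matter only on a chart domain. They are cut off by a bump function equal to 1 near the point, and
locality shows that the value does not change. -/
theorem contDiffOn_conn [T2Space M] (hcov : CovariantDerivative.ContMDiffCovariantDerivative cov ∞)
    (x : M) : ContDiffOn ℝ ∞ (conn cov x) (extChartAt (𝓡 (2 * m + 1)) x).target := by
  have key : ∀ j v, ContDiffOn ℝ ∞ (fun u => coframe x ((extChartAt (𝓡 (2 * m + 1)) x).symm u)
      (cov (coordField x j) ((extChartAt (𝓡 (2 * m + 1)) x).symm u)
        (frameMap x ((extChartAt (𝓡 (2 * m + 1)) x).symm u) v)))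
      (extChartAt (𝓡 (2 * m + 1)) x).target := by
    intro j v u₀ hu₀
    refine ContDiffAt.contDiffWithinAt ?_
    have hp := (extChartAt (𝓡 (2 * m + 1)) x).map_target hu₀
    set p := (extChartAt (𝓡 (2 * m + 1)) x).symm u₀ with hpdef
    have hs := (isOpen_extChartAt_source (I := 𝓡 (2 * m + 1)) x).mem_nhds hp
    obtain ⟨f, hf⟩ := (SmoothBumpFunction.nhds_basis_support (I := 𝓡 (2 * m + 1)) hs).ex_mem
    have hframe : ∀ w : Model m, ContMDiffOn (𝓡 (2 * m + 1)) ((𝓡 (2 * m + 1)).prod 𝓘(ℝ, Model m)) ∞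
      (fun p => TotalSpace.mk' (Model m) (E := fun p => TangentSpace (𝓡 (2 * m + 1)) p) p
        (framed x (fun _ => w) p)) (extChartAt (𝓡 (2 * m + 1)) x).source := fun w =>
      contMDiffOn_framed contDiffOn_const
    have hY : ContMDiff (𝓡 (2 * m + 1)) ((𝓡 (2 * m + 1)).prod 𝓘(ℝ, Model m)) ∞
        (fun p => TotalSpace.mk' (Model m) (E := fun p => TangentSpace (𝓡 (2 * m + 1)) p) p
          (f p • framed x (fun _ => e j) p)) :=
      ContMDiffOn.smul_section_of_tsupport f.contMDiff.contMDiffOn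
        (isOpen_extChartAt_source x) hf (hframe _)
    have hD := hcov.contMDiff.contMDiff (σ := fun p => f p • framed x (fun _ => e j) p)
      (by simpa using hY.contMDiffOn)
    have h1 := contDiffOn_coframe (Y := fun p => cov (fun p => f p • framed x (fun _ => e j) p) p
      (frameMap x p v)) (((hD.mono (Set.subset_univ _)).clm_bundle_apply (hframe v)))
    refine (h1.contDiffAt ((isOpen_extChartAt_target (I := 𝓡 (2 * m + 1)) x).mem_nhds
      hu₀)).congr_of_eventuallyEq ?_
    have hc : ContinuousAt (extChartAt (𝓡 (2 * m + 1)) x).symm u₀ :=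
      (continuousOn_extChartAt_symm x).continuousAt
        ((isOpen_extChartAt_target (I := 𝓡 (2 * m + 1)) x).mem_nhds hu₀)
    have h2 := hc.eventually (f.eventuallyEq_one.eventually_nhds)
    filter_upwards [h2, (isOpen_extChartAt_target (I := 𝓡 (2 * m + 1)) x).mem_nhds hu₀] with u hu hut
    have hq := (extChartAt (𝓡 (2 * m + 1)) x).map_target hut
    congr 1
    have h3 : cov (coordField x j) ((extChartAt (𝓡 (2 * m + 1)) x).symm u) =
        cov (fun p => f p • framed x (fun _ => e j) p)
          ((extChartAt (𝓡 (2 * m + 1)) x).symm u) := by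
      refine cov.isCovariantDerivativeOnUniv.congr_of_eventuallyEq (diffAt_coordField hq j)
        ((hY _).mdifferentiableAt (by simp)) Filter.univ_mem ?_
      filter_upwards [hu] with q hq
      rw [hq]
      exact (one_smul ℝ _).symm
    rw [h3]
  refine contDiffOn_clm_apply.2 fun v => contDiffOn_clm_apply.2 fun y => ?_
  simp only [conn_apply]
  exact ContDiffOn.sum fun j _ => contDiffOn_const.fun_smul (key j v)

/-- The transformation rule of the coefficients of a connection. -/
theorem conn_transition {u : Model m} (hu : u ∈ (overlap x p : Set (Model m))) (v y : Model m) :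
    fderiv ℝ (fun u => fderiv ℝ (transition x p) u y) u v +
      conn cov p (transition x p u) (fderiv ℝ (transition x p) u v)
        (fderiv ℝ (transition x p) u y) = fderiv ℝ (transition x p) u (conn cov x u v y) := by
  set q := (extChartAt (𝓡 (2 * m + 1)) x).symm u with hq
  have hqx : q ∈ (extChartAt (𝓡 (2 * m + 1)) x).source :=
    (extChartAt (𝓡 (2 * m + 1)) x).map_target hu.1
  have hqp : q ∈ (extChartAt (𝓡 (2 * m + 1)) p).source := hu.2
  have hqu : extChartAt (𝓡 (2 * m + 1)) x q = u := (extChartAt (𝓡 (2 * m + 1)) x).right_inv hu.1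
  have hτ : transition x p u = extChartAt (𝓡 (2 * m + 1)) p q := rfl
  have hup : extChartAt (𝓡 (2 * m + 1)) p q ∈ (overlap p x : Set (Model m)) := by
    refine ⟨(extChartAt (𝓡 (2 * m + 1)) p).map_source hqp, ?_⟩
    rw [Set.mem_preimage, (extChartAt (𝓡 (2 * m + 1)) p).left_inv hqp]
    exact hqx
  have hopen := (isOpen_overlap x p).mem_nhds hu
  have hD : DifferentiableAt ℝ (fun u => fderiv ℝ (transition x p) u y) u :=
    (((contDiffOn_fderiv_apply (isOpen_overlap x p) (contDiffOn_transition x p) y)).contDiffAt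
      hopen).differentiableAt (by simp)
  have hT : DifferentiableAt ℝ (transition p x : Model m → Model m)
      (extChartAt (𝓡 (2 * m + 1)) p q) :=
    ((contDiffOn_transition p x).contDiffAt ((isOpen_overlap p x).mem_nhds hup)).differentiableAt
      (by simp)
  have hpx : transition p x (extChartAt (𝓡 (2 * m + 1)) p q) = u := by
    rw [transition, (extChartAt (𝓡 (2 * m + 1)) p).left_inv hqp, hqu]
  have hD' : DifferentiableAt ℝ (fun u => fderiv ℝ (transition x p) u y)
      (transition p x (extChartAt (𝓡 (2 * m + 1)) p q)) := by rwa [hpx]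
  -- the constant field of the chart at `x`, in the chart at `p`
  let Z : Model m → Model m := fun u' => fderiv ℝ (transition x p) (transition p x u') y
  have hZ : DifferentiableAt ℝ Z (extChartAt (𝓡 (2 * m + 1)) p q) := hD'.comp _ hT
  -- The same vector field is written in the two charts, and the Leibniz rule is applied in each;
  -- comparing the results gives the transformation rule.
  have h1 : cov (framed x fun _ => y) q = cov (framed p Z) q := by
    refine cov.isCovariantDerivativeOnUniv.congr_of_eventuallyEq
      (diffAt_framed hqx (differentiableAt_const _)) (diffAt_framed hqp hZ) Filter.univ_mem ?_
    filter_upwards [(isOpen_extChartAt_source (I := 𝓡 (2 * m + 1)) x).mem_nhds hqx,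
      (isOpen_extChartAt_source (I := 𝓡 (2 * m + 1)) p).mem_nhds hqp] with q' h h'
    have ho : extChartAt (𝓡 (2 * m + 1)) x q' ∈ (overlap x p : Set (Model m)) := by
      refine ⟨(extChartAt (𝓡 (2 * m + 1)) x).map_source h, ?_⟩
      rw [Set.mem_preimage, (extChartAt (𝓡 (2 * m + 1)) x).left_inv h]
      exact h'
    have h2 := frameMap_fderiv_transition ho y
    rw [(extChartAt (𝓡 (2 * m + 1)) x).left_inv h] at h2
    change frameMap x q' y = frameMap p q' (fderiv ℝ (transition x p)
      (transition p x (extChartAt (𝓡 (2 * m + 1)) p q')) y)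
    rw [transition, (extChartAt (𝓡 (2 * m + 1)) p).left_inv h', h2]
  have h2 := cov_framed_const cov hqx v y
  rw [h1, hqu, ← frameMap_fderiv_transition hu v, ← hq] at h2
  have h3 := (cov_framed cov hqp hZ (fderiv ℝ (transition x p) u v)).symm.trans h2
  rw [hq, ← frameMap_fderiv_transition hu, ← hq] at h3
  have h4 := congrArg (coframe p q) h3
  rw [coframe_frameMap hqp, coframe_frameMap hqp] at h4
  rw [hτ, ← h4]
  have h5 : Z (extChartAt (𝓡 (2 * m + 1)) p q) = fderiv ℝ (transition x p) u y := by
    simp only [Z, hpx]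
  have h6 : fderiv ℝ Z (extChartAt (𝓡 (2 * m + 1)) p q) (fderiv ℝ (transition x p) u v) =
      fderiv ℝ (fun u => fderiv ℝ (transition x p) u y) u v := by
    have h7 := (hD'.hasFDerivAt.comp _ hT.hasFDerivAt).fderiv
    have h8 : fderiv ℝ (transition p x) (extChartAt (𝓡 (2 * m + 1)) p q)
        (fderiv ℝ (transition x p) u v) = v := by
      rw [fderiv_transition hup, (extChartAt (𝓡 (2 * m + 1)) p).left_inv hqp, hq,
        frameMap_fderiv_transition hu, ← hq, coframe_frameMap hqx]
    refine (congrArg (fun L => L (fderiv ℝ (transition x p) u v)) h7).trans ?_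
    rw [ContinuousLinearMap.comp_apply, h8, hpx]
  rw [h5, h6]

end Connection

/-! ### The curvature under a change of coordinates -/

section Transition

variable {E : Type*} [NormedAddCommGroup E] [NormedSpace ℝ E] {u : E} {τ : E → E}
  {Γ Γ' : E → E →L[ℝ] E →L[ℝ] E}

theorem HasFDerivAt.clm_apply_const {F : Type*} [NormedAddCommGroup F] [NormedSpace ℝ F]
    {c : E → E →L[ℝ] F} {c' : E →L[ℝ] E →L[ℝ] F} (hc : HasFDerivAt c c' u) (w : E) :
    HasFDerivAt (fun u => c u w) (c'.flip w) u :=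
  (hc.clm_apply (hasFDerivAt_const w u)).congr_fderiv (by simp)

theorem HasFDerivAt.bilinear_comp {F : Type*} [NormedAddCommGroup F] [NormedSpace ℝ F]
    {c : E → E →L[ℝ] F} {c' : E →L[ℝ] E →L[ℝ] F} {b : E → E} {b' : E →L[ℝ] E}
    {d : E → E} {d' : E →L[ℝ] E}
    (hc : HasFDerivAt c c' (d u)) (hb : HasFDerivAt b b' u) (hd : HasFDerivAt d d' u) :
    HasFDerivAt (fun u => c (d u) (b u)) ((c (d u)).comp b' + (c'.comp d').flip (b u)) u :=
  (HasFDerivAt.comp u hc hd).clm_apply hb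

set_option synthInstance.maxHeartbeats 100000 in
/-- The curvature transforms as a tensor. -/
theorem curvature_transition (hΓ : ContDiffAt ℝ ∞ Γ u) (hΓ' : ContDiffAt ℝ ∞ Γ' (τ u))
    (hτ : ContDiffAt ℝ ∞ τ u)
    (h : ∀ᶠ u in 𝓝 u, ∀ v y, fderiv ℝ (fderiv ℝ τ) u v y +
      Γ' (τ u) (fderiv ℝ τ u v) (fderiv ℝ τ u y) = fderiv ℝ τ u (Γ u v y)) (v w y : E) :
    fderiv ℝ τ u (curvature (fun u v => Γ u v) u v w y) =
      curvature (fun u v => Γ' u v) (τ u) (fderiv ℝ τ u v) (fderiv ℝ τ u w) (fderiv ℝ τ u y) := by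
  have hL : ContDiffAt ℝ ∞ (fderiv ℝ τ) u := hτ.fderiv_right (by simp)
  have hS : ContDiffAt ℝ ∞ (fderiv ℝ (fderiv ℝ τ)) u := hL.fderiv_right (by simp)
  have dτ := (hτ.differentiableAt (by simp)).hasFDerivAt
  have dL := (hL.differentiableAt (by simp)).hasFDerivAt
  have dS := (hS.differentiableAt (by simp)).hasFDerivAt
  have dΓ := (hΓ.differentiableAt (by simp)).hasFDerivAt
  have dΓ' := (hΓ'.differentiableAt (by simp)).hasFDerivAt
  have hΓv : ∀ v w, fderiv ℝ (fun u => Γ u w) u v = fderiv ℝ Γ u v w := by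
    intro v w
    rw [(HasFDerivAt.clm_apply_const dΓ w).fderiv]
    rfl
  have hΓv' : ∀ v w, fderiv ℝ (fun u => Γ' u w) (τ u) v = fderiv ℝ Γ' (τ u) v w := by
    intro v w
    rw [(HasFDerivAt.clm_apply_const dΓ' w).fderiv]
    rfl
  have symm2 : ∀ v w, fderiv ℝ (fderiv ℝ τ) u v w = fderiv ℝ (fderiv ℝ τ) u w v :=
    hτ.isSymmSndFDerivAt (by simpa using ENat.LEInfty.out)
  have symm3 : ∀ v w, fderiv ℝ (fderiv ℝ (fderiv ℝ τ)) u v w =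
      fderiv ℝ (fderiv ℝ (fderiv ℝ τ)) u w v :=
    hL.isSymmSndFDerivAt (by simpa using ENat.LEInfty.out)
  -- This is the derivative, in the direction v, of the transformation rule for Γ.
  have key : ∀ v w, fderiv ℝ (fderiv ℝ τ) u v (Γ u w y) + fderiv ℝ τ u (fderiv ℝ Γ u v w y) =
      fderiv ℝ (fderiv ℝ (fderiv ℝ τ)) u v w y +
        (fderiv ℝ Γ' (τ u) (fderiv ℝ τ u v) (fderiv ℝ τ u w) (fderiv ℝ τ u y) +
          Γ' (τ u) (fderiv ℝ (fderiv ℝ τ) u v w) (fderiv ℝ τ u y) +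
          Γ' (τ u) (fderiv ℝ τ u w) (fderiv ℝ (fderiv ℝ τ) u v y)) := by
    intro v w
    have e1 := dL.clm_apply (HasFDerivAt.clm_apply_const (HasFDerivAt.clm_apply_const dΓ w) y)
    have e2 := HasFDerivAt.clm_apply_const (HasFDerivAt.clm_apply_const dS w) y
    have e3 := (HasFDerivAt.bilinear_comp dΓ' (HasFDerivAt.clm_apply_const dL w) dτ).clm_apply
      (HasFDerivAt.clm_apply_const dL y)
    have e4 := (e2.add e3).congr_of_eventuallyEq (f₁ := fun u => fderiv ℝ τ u (Γ u w y)) (by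
      filter_upwards [h] with u hu
      exact (hu w y).symm)
    have := congrArg (fun L => L v) (e1.unique e4)
    simp only [_root_.add_apply, ContinuousLinearMap.comp_apply, ContinuousLinearMap.flip_apply] at this
    rw [add_comm, this]
    abel
  have h0 := h.self_of_nhds
  -- Antisymmetrising in v and w removes the third derivative of τ and the term containing its
  -- second derivative in (v, w), both of which are symmetric.
  have hk := congrArg₂ (· - ·) (key v w) (key w v)
  simp only [symm3 w v, symm2 w v] at hk
  have c1 : curvature (fun u v => Γ u v) u v w y =
      fderiv ℝ Γ u v w y - fderiv ℝ Γ u w v y + Γ u v (Γ u w y) - Γ u w (Γ u v y) := by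
    rw [curvature, hΓv, hΓv]
    rfl
  have c2 : ∀ v w y, curvature (fun u v => Γ' u v) (τ u) v w y =
      fderiv ℝ Γ' (τ u) v w y - fderiv ℝ Γ' (τ u) w v y + Γ' (τ u) v (Γ' (τ u) w y)
        - Γ' (τ u) w (Γ' (τ u) v y) := by
    intro v w y
    rw [curvature, hΓv', hΓv']
    rfl
  rw [c1, c2, map_sub, map_add, map_sub, ← h0 v (Γ u w y), ← h0 w (Γ u v y), ← h0 w y, ← h0 v y,
    map_add, map_add]
  rw [← sub_eq_zero] at hk ⊢
  rw [← hk]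
  abel

end Transition

/-! ### Naturality of the exterior covariant derivative -/

section

variable {m : ℕ} {n : ℕ} {M : Type*} [TopologicalSpace M] [ChartedSpace (Model m) M]
  [IsManifold (𝓡 (2 * m + 1)) ∞ M]

namespace Sm

theorem ud_congr {f g : Model m → Sm m n} {u : Model m} (h : f =ᶠ[𝓝 u] g) (v : Model m) :
    ud v f u = ud v g u := by
  have : (fun y => fderiv ℝ (fun u => f u y) u v) = fun y => fderiv ℝ (fun u => g u y) u v := by
    funext y
    have h1 : (fun u => f u y) =ᶠ[𝓝 u] fun u => g u y := by
      filter_upwards [h] with u hu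
      rw [hu]
    rw [h1.fderiv_eq]
  rw [ud, ud, this]

theorem nabla_congr {Γ : Model m → Model m →L[ℝ] Model m →L[ℝ] Model m} {f g : Model m → Sm m n}
    {u : Model m} (h : f =ᶠ[𝓝 u] g) : nabla Γ f u = nabla Γ g u := by
  simp only [nabla, hd, ud_congr h, h.self_of_nhds]

theorem fderiv_compContinuousLinearMap {B : Model m → Alt m n} {B' : Model m →L[ℝ] Alt m n}
    {L : Model m → Model m →L[ℝ] Model m} {L' : Model m →L[ℝ] Model m →L[ℝ] Model m} {u : Model m}
    (hB : HasFDerivAt B B' u) (hL : HasFDerivAt L L' u) (v : Model m) :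
    fderiv ℝ (fun u => (B u).compContinuousLinearMap (L u)) u v =
      (B' v).compContinuousLinearMap (L u) +
        fderiv ℝ (fun u' => (B u).compContinuousLinearMap (L u')) u v := by
  have h1 := hB.continuousAlternatingMapCompContinuousLinearMap hL
  have h2 := (hasFDerivAt_const (B u) u).continuousAlternatingMapCompContinuousLinearMap hL
  rw [h1.fderiv, h2.fderiv]
  rw [_root_.add_apply, _root_.add_apply]
  congr 1
  simp

/-- This is the exterior derivative of the pullback of a constant form, hence the pullback of zero;
it rests on the symmetry of the second derivative of τ. -/
theorem dxSum_fderiv_compContinuousLinearMap {τ : Model m → Model m} {u : Model m}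
    (hτ : ContDiffAt ℝ ∞ τ u) (C : Alt m n) :
    dxSum (fun i => fderiv ℝ (fun u => C.compContinuousLinearMap (fderiv ℝ τ u)) u (e i)) = 0 := by
  have h1 : extDeriv (fun x => C.compContinuousLinearMap (fderiv ℝ τ x)) u =
      (extDeriv (fun _ => C) (τ u)).compContinuousLinearMap (fderiv ℝ τ u) :=
    extDeriv_pullback (r := ∞) (differentiableAt_const _) hτ (by simpa using ENat.LEInfty.out)
  rw [dxSum_eq_alternatizeUncurryFin]
  refine h1.trans ?_
  have h3 : extDeriv (fun _ : Model m => C) (τ u) = 0 := by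
    rw [extDeriv, fderiv_fun_const]
    exact map_zero (ContinuousAlternatingMap.alternatizeUncurryFinCLM ℝ (Model m) ℂ)
  rw [h3]
  rfl

section

variable {U V : Set (Model m)} (hU : IsOpen U) (hV : IsOpen V)
  {Γ Γ' : Model m → Model m →L[ℝ] Model m →L[ℝ] Model m} {τ : Model m → Model m}
  (hτ : ContDiffOn ℝ ∞ τ U) {f g : Model m → Sm m n} {u : Model m} (hu : u ∈ U) (hτu : τ u ∈ V)
  (hf : SOn V f) (hg : SOn U g) (hfg : ∀ u ∈ U, g u = pull (fderiv ℝ τ u) (f (τ u)))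
include hU hV hτ hu hτu hf hg hfg

/-- Three dependences on the base point are differentiated: that of f, that of the transformed fibre
variable, and that of the form slots. -/
theorem ud_pull (v y : Model m) :
    ud v g u y = (ud (fderiv ℝ τ u v) f (τ u) (fderiv ℝ τ u y) + fderiv ℝ (f (τ u)) (fderiv ℝ τ u y)
      (fderiv ℝ (fun u => fderiv ℝ τ u y) u v)).compContinuousLinearMap (fderiv ℝ τ u) +
      fderiv ℝ (fun u' => (f (τ u) (fderiv ℝ τ u y)).compContinuousLinearMap
        (fderiv ℝ τ u')) u v := by
  have hτc := hτ.contDiffAt (hU.mem_nhds hu)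
  have hL : ContDiffAt ℝ ∞ (fderiv ℝ τ) u := hτc.fderiv_right (by simp)
  have dτ := (hτc.differentiableAt (by simp)).hasFDerivAt
  have dL := (hL.differentiableAt (by simp)).hasFDerivAt
  have dLy : HasFDerivAt (fun u => fderiv ℝ τ u y) (fderiv ℝ (fun u => fderiv ℝ τ u y) u) u :=
    (HasFDerivAt.clm_apply_const dL y).differentiableAt.hasFDerivAt
  have hB : HasFDerivAt (fun u => f (τ u) (fderiv ℝ τ u y))
      (fderiv ℝ (fun z : Model m × Model m => f z.1 z.2) (τ u, fderiv ℝ τ u y) ∘L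
        (fderiv ℝ τ u).prod (fderiv ℝ (fun u => fderiv ℝ τ u y) u)) u :=
    HasFDerivAt.comp (g := fun z : Model m × Model m => f z.1 z.2)
      (f := fun u => (τ u, fderiv ℝ τ u y)) u (SOn.hasFDerivAt hV hf hτu _) (dτ.prodMk dLy)
  have hgy : (fun u => g u y) =ᶠ[𝓝 u]
      fun u => (f (τ u) (fderiv ℝ τ u y)).compContinuousLinearMap (fderiv ℝ τ u) := by
    filter_upwards [hU.mem_nhds hu] with u hu
    rw [hfg u hu, pull_apply]
  rw [ud_apply hU hg hu, hgy.fderiv_eq, fderiv_compContinuousLinearMap hB dL,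
    ud_apply_fderiv hV hf hτu, SOn.fderiv_fibre hV hf hτu, ← map_add, Prod.mk_add_mk, add_zero,
    zero_add]
  rfl

/-- The second derivative of τ in the fibre variable converts Γ' into Γ by the transformation rule.
The one in the form slots stays, and is removed only by antisymmetrisation. -/
theorem hd_pull (h : ∀ v y, fderiv ℝ (fun u => fderiv ℝ τ u y) u v +
      Γ' (τ u) (fderiv ℝ τ u v) (fderiv ℝ τ u y) = fderiv ℝ τ u (Γ u v y)) (v y : Model m) :
    hd Γ v g u y =
      (hd Γ' (fderiv ℝ τ u v) f (τ u) (fderiv ℝ τ u y)).compContinuousLinearMap (fderiv ℝ τ u) +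
        fderiv ℝ (fun u' => (f (τ u) (fderiv ℝ τ u y)).compContinuousLinearMap
          (fderiv ℝ τ u')) u v := by
  have e1 : vert (Γ u v) (g u) y = (fderiv ℝ (f (τ u)) (fderiv ℝ τ u y)
      (fderiv ℝ τ u (Γ u v y))).compContinuousLinearMap (fderiv ℝ τ u) := by
    have : vert (Γ u v) (g u) y = dir (Γ u v y) (g u) y := rfl
    rw [this, hfg u hu, dir_pull]
    rfl
  have e4 : ∀ A B C D : Alt m n, (A + B).compContinuousLinearMap (fderiv ℝ τ u) + D -
      (B + C).compContinuousLinearMap (fderiv ℝ τ u) =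
        (A - C).compContinuousLinearMap (fderiv ℝ τ u) + D := by
    intro A B C D
    refine ContinuousAlternatingMap.ext fun x => ?_
    change A _ + B _ + D x - (B _ + C _) = A _ - C _ + D x
    ring
  rw [hd, sub_apply, ud_pull hU hV hτ hu hτu hf hg hfg, e1, ← h v y, map_add, e4]
  rfl

/-- Naturality of the exterior covariant derivative under coordinate transformations. -/
theorem nabla_pull (h : ∀ v y, fderiv ℝ (fun u => fderiv ℝ τ u y) u v +
      Γ' (τ u) (fderiv ℝ τ u v) (fderiv ℝ τ u y) = fderiv ℝ τ u (Γ u v y)) :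
    nabla Γ g u = pull (fderiv ℝ τ u) (nabla Γ' f (τ u)) := by
  refine Sm.ext fun y => ?_
  have hlin : ∃ φ : Model m →ₗ[ℝ] Alt m n, ∀ v, hd Γ' v f (τ u) (fderiv ℝ τ u y) = φ v := by
    refine ⟨(fderiv ℝ (fun z : Model m × Model m => f z.1 z.2) (τ u, fderiv ℝ τ u y) ∘L
      ContinuousLinearMap.inl ℝ (Model m) (Model m) - fderiv ℝ (f (τ u)) (fderiv ℝ τ u y) ∘L
        (Γ' (τ u)).flip (fderiv ℝ τ u y)).toLinearMap, fun v => ?_⟩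
    rw [hd, sub_apply, ud_apply_fderiv hV hf hτu]
    rfl
  obtain ⟨φ, hφ⟩ := hlin
  have hz := dxSum_fderiv_compContinuousLinearMap (hτ.contDiffAt (hU.mem_nhds hu))
    (f (τ u) (fderiv ℝ τ u y))
  rw [nabla_apply, pull_apply, nabla_apply]
  simp only [hd_pull hU hV hτ hu hτu hf hg hfg h, hφ]
  rw [dxSum_comp]
  refine (map_add dxSum _ _).trans ?_
  rw [hz, add_zero]

end

end Sm

end

/-! ### Local expressions of sections, of d_∇ and of the curvature -/

section LocalExpressions

variable {m n : ℕ} {M : Type*} [TopologicalSpace M] [ChartedSpace (Model m) M]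
  [IsManifold (𝓡 (2 * m + 1)) ∞ M]

open Sm

theorem Sm.pull_pull (F G : Model m →L[ℝ] Model m) (f : Sm m n) :
    pull F (pull G f) = pull (G ∘L F) f := rfl

theorem Sm.pull_id {F : Model m →L[ℝ] Model m} (hF : ∀ v, F v = v) (f : Sm m n) : pull F f = f := by
  obtain rfl : F = ContinuousLinearMap.id ℝ (Model m) := ContinuousLinearMap.ext hF
  exact Sm.ext fun y => ContinuousAlternatingMap.ext fun _ => rfl

omit [TopologicalSpace M] [ChartedSpace (Model m) M] [IsManifold (𝓡 (2 * m + 1)) ∞ M] in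
/-- The coefficients of a section at a point, as smooth functions on the fibre. -/
def fib (a : WForm m M n) (x : M) (k l : ℕ) : Sm m n := ofFun (a x k l)

/-- The local expression of a section in the preferred chart at `x`. -/
def loc (a : WForm m M n) (x : M) (k l : ℕ) (u : Model m) : Sm m n :=
  pull (frameMap x ((extChartAt (𝓡 (2 * m + 1)) x).symm u))
    (fib a ((extChartAt (𝓡 (2 * m + 1)) x).symm u) k l)

variable {a b : WForm m M n} {x p : M} {k l : ℕ} {u : Model m}

theorem IsSection.contDiff (ha : IsSection a) (x : M) (k l : ℕ) : ContDiff ℝ ∞ (a x k l) :=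
  (exists_multilinear_iff.1 (ha.polynomial x k l)).1

theorem IsSection.fib_apply (ha : IsSection a) (x : M) (k l : ℕ) (y : Model m) :
    fib a x k l y = a x k l y := ofFun_apply (ha.contDiff x k l) y

theorem IsSection.coe_fib (ha : IsSection a) (x : M) (k l : ℕ) :
    (fib a x k l : Model m → Alt m n) = a x k l := coe_ofFun (ha.contDiff x k l)

theorem IsSection.hom_fib (ha : IsSection a) (x : M) (k l : ℕ) : Hom l (fib a x k l) := by
  intro t y
  rw [ha.fib_apply, ha.fib_apply]
  exact (exists_multilinear_iff.1 (ha.polynomial x k l)).2 t y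

theorem IsSection.hom_loc (ha : IsSection a) (x : M) (k l : ℕ) (u : Model m) :
    Hom l (loc a x k l u) := Hom.pull _ (ha.hom_fib _ _ _)

theorem IsSection.loc_apply (ha : IsSection a) (x : M) (k l : ℕ) (u y : Model m) :
    loc a x k l u y = inChart a x k l u y := by
  rw [loc, pull_apply, ha.fib_apply]
  rfl

theorem IsSection.sOn_loc (ha : IsSection a) (x : M) (k l : ℕ) :
    SOn (extChartAt (𝓡 (2 * m + 1)) x).target (loc a x k l) :=
  (ha.smooth x k l).congr fun z _ => ha.loc_apply x k l z.1 z.2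

theorem loc_center (a : WForm m M n) (x : M) (k l : ℕ) :
    loc a x k l (extChartAt (𝓡 (2 * m + 1)) x x) = fib a x k l := by
  rw [loc, extChartAt_to_inv]
  exact pull_id (frameMap_self x) _

theorem loc_transition (a : WForm m M n) (k l : ℕ) (hu : u ∈ (overlap x p : Set (Model m))) :
    loc a x k l u = pull (fderiv ℝ (transition x p) u) (loc a p k l (transition x p u)) := by
  have h : (extChartAt (𝓡 (2 * m + 1)) p).symm (transition x p u) =
      (extChartAt (𝓡 (2 * m + 1)) x).symm u := (extChartAt (𝓡 (2 * m + 1)) p).left_inv hu.2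
  rw [loc, loc, pull_pull, h]
  congr 1
  exact congrArg Sm.pull (ContinuousLinearMap.ext fun v => (frameMap_fderiv_transition hu v).symm)

theorem mem_overlap (hu : u ∈ (extChartAt (𝓡 (2 * m + 1)) x).target) :
    u ∈ (overlap x ((extChartAt (𝓡 (2 * m + 1)) x).symm u) : Set (Model m)) :=
  ⟨hu, mem_extChartAt_source _⟩

/-- A family of homogeneous polynomials with smooth local expressions is a section. -/
theorem isSection_of {X : M → ℕ → ℕ → Sm m n} (hX : ∀ x k l, a x k l = X x k l)
    (hom : ∀ x k l, Hom l (X x k l))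
    (hs : ∀ x k l, SOn (extChartAt (𝓡 (2 * m + 1)) x).target fun u =>
      pull (frameMap x ((extChartAt (𝓡 (2 * m + 1)) x).symm u))
        (X ((extChartAt (𝓡 (2 * m + 1)) x).symm u) k l)) : IsSection a where
  polynomial x k l := exists_multilinear_iff.2 ⟨by rw [hX]; exact Sm.contDiff _, fun t y => by
    rw [hX]; exact hom x k l t y⟩
  smooth x k l := ContDiffOn.congr (hs x k l) fun z _ => by
    rw [inChart, hX]
    rfl

omit [TopologicalSpace M] [ChartedSpace (Model m) M] [IsManifold (𝓡 (2 * m + 1)) ∞ M] in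
theorem fib_eq {X : Sm m n} (h : a x k l = X) : fib a x k l = X := by
  rw [fib, h, ofFun_coe]

theorem ext_fib (ha : IsSection a) (hb : IsSection b)
    (h : ∀ x k l, fib a x k l = fib b x k l) : a = b := by
  funext x k l
  rw [← ha.coe_fib, ← hb.coe_fib, h]

theorem conn_center (cov : AffineConnection m M) (x : M) (v y : Model m) :
    conn cov x (extChartAt (𝓡 (2 * m + 1)) x x) v y =
      ∑ j, coord y j • (cov (coordField x j) x v : Model m) := by
  rw [conn_apply]
  refine Finset.sum_congr rfl fun j _ => ?_
  rw [extChartAt_to_inv, frameMap_self]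
  exact congrArg _ (coframe_self x _)

/-- At the centre of its own chart the frame is the identity, so the formula in Christoffel symbols
is the local operator at that point. -/
theorem dNabla_apply (cov : AffineConnection m M) (ha : IsSection a) (x : M) (k l : ℕ)
    (y : Model m) : dNabla cov a x k l y =
      nabla (conn cov x) (loc a x k l) (extChartAt (𝓡 (2 * m + 1)) x x) y := by
  rw [nabla_apply, dNabla, dxSum_apply]
  refine Finset.sum_congr rfl fun i _ => congrArg _ ?_
  rw [hd, sub_apply, ud_apply (isOpen_extChartAt_target x) (ha.sOn_loc x k l)
    (mem_extChartAt_target x), loc_center]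
  have h1 : (fun u => loc a x k l u y) = fun u => inChart a x k l u y :=
    funext fun u => ha.loc_apply x k l u y
  have h2 : vert (conn cov x (extChartAt (𝓡 (2 * m + 1)) x x) (e i)) (fib a x k l) y =
      fderiv ℝ (a x k l) y (conn cov x (extChartAt (𝓡 (2 * m + 1)) x x) (e i) y) := by
    rw [vert_apply, ha.coe_fib]
  have h3 : conn cov x (extChartAt (𝓡 (2 * m + 1)) x x) (e i) y =
      ∑ j, ∑ c, (coord y j * christoffel cov x c j i) • (e c : Model m) := by
    rw [conn_center]
    refine Finset.sum_congr rfl fun j _ => ?_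
    have := sum_coord_smul_e (cov (coordField x j) x (e i) : Model m)
    refine (congrArg (fun v : Model m => coord y j • v) this.symm).trans ?_
    rw [Finset.smul_sum]
    refine Finset.sum_congr rfl fun c _ => ?_
    rw [smul_smul]
    rfl
  rw [h1, h2, h3, map_sum]
  simp only [map_sum, map_smul]

theorem fib_dNabla (cov : AffineConnection m M) (ha : IsSection a) (x : M) (k l : ℕ) :
    fib (dNabla cov a) x k l =
      nabla (conn cov x) (loc a x k l) (extChartAt (𝓡 (2 * m + 1)) x x) :=
  fib_eq (funext fun y => dNabla_apply cov ha x k l y)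

/-- The exterior covariant derivative in an arbitrary chart. -/
theorem loc_dNabla (cov : AffineConnection m M) (ha : IsSection a) (k l : ℕ)
    (hu : u ∈ (extChartAt (𝓡 (2 * m + 1)) x).target) :
    loc (dNabla cov a) x k l u = nabla (conn cov x) (loc a x k l) u := by
  set p := (extChartAt (𝓡 (2 * m + 1)) x).symm u with hp
  have ho : u ∈ (overlap x p : Set (Model m)) := mem_overlap hu
  have hτ : transition x p u = extChartAt (𝓡 (2 * m + 1)) p p := rfl
  -- The value at p is defined through the preferred chart at p, not through that at x; naturality
  -- under the transition map between them closes the gap.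
  have h := nabla_pull (isOpen_overlap x p) (isOpen_extChartAt_target p)
    (contDiffOn_transition x p) ho (by rw [hτ]; exact mem_extChartAt_target p)
    (ha.sOn_loc p k l) (ContDiffOn.mono (ha.sOn_loc x k l)
      (Set.prod_mono (fun _ h => h.1) subset_rfl) : SOn (overlap x p) (loc a x k l))
    (fun u hu => loc_transition a k l hu) (conn_transition cov ho)
  rw [h, loc_transition _ k l ho, hτ, loc_center, fib_dNabla cov ha]

theorem hom_vert {B : Model m →L[ℝ] Model m} {f : Sm m n} (hf : Hom l f) : Hom l (vert B f) := by
  intro t y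
  have h : ∀ y, vert B f y = dir (B y) f y := fun _ => rfl
  cases l with
  | zero => rw [h, h, Hom.dir_zero hf, Hom.dir_zero hf]; simp
  | succ l =>
    have h2 : dir (t • B y) f (t • y) = t • dir (B y) f (t • y) :=
      _root_.map_smul (fderiv ℝ f (t • y)) t (B y)
    rw [h, h, _root_.map_smul, h2, Hom.dir hf, smul_smul, pow_succ']

theorem Hom.nabla {Γ : Model m → Model m →L[ℝ] Model m →L[ℝ] Model m} {U : Set (Model m)}
    (hU : IsOpen U) {f : Model m → Sm m n} (hf : SOn U f) (hl : ∀ u, Hom l (f u)) (hu : u ∈ U) :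
    Hom l (Sm.nabla Γ f u) := by
  refine Hom.sum fun i _ => Hom.map _ ?_
  intro t y
  have h1 : (fun u => f u (t • y)) = fun u => t ^ l • f u y := funext fun u => hl u t y
  have h2 : fderiv ℝ (fun u => f u (t • y)) u (e i) = t ^ l • fderiv ℝ (fun u => f u y) u (e i) := by
    rw [h1, fderiv_fun_const_smul (SOn.differentiableAt hU hf hu y)]
    rfl
  rw [hd, sub_apply, sub_apply, ud_apply hU hf hu, ud_apply hU hf hu, h2, smul_sub,
    hom_vert (hl u)]

theorem IsSection.dNabla [T2Space M] {cov : AffineConnection m M}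
    (hcov : CovariantDerivative.ContMDiffCovariantDerivative cov ∞) (ha : IsSection a) :
    IsSection (dNabla cov a) := by
  refine isSection_of (fun x k l => funext fun y => dNabla_apply cov ha x k l y)
    (fun x k l => Hom.nabla (isOpen_extChartAt_target x) (ha.sOn_loc x k l) (ha.hom_loc x k l)
      (mem_extChartAt_target x)) fun x k l => ?_
  refine ContDiffOn.congr (SOn.nabla (isOpen_extChartAt_target x) (contDiffOn_conn cov hcov x)
    (ha.sOn_loc x k l)) fun z hz => ?_
  rw [← loc_dNabla cov ha k l hz.1, loc, fib_dNabla cov ha]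

/-- The curvature in an arbitrary chart. -/
theorem curv_center [T2Space M] {cov : AffineConnection m M}
    (hcov : CovariantDerivative.ContMDiffCovariantDerivative cov ∞)
    (hu : u ∈ (extChartAt (𝓡 (2 * m + 1)) x).target) (v w y : Model m) :
    frameMap x ((extChartAt (𝓡 (2 * m + 1)) x).symm u) (curv (conn cov x) u v w y) =
      curv (conn cov ((extChartAt (𝓡 (2 * m + 1)) x).symm u))
        (extChartAt (𝓡 (2 * m + 1)) ((extChartAt (𝓡 (2 * m + 1)) x).symm u)
          ((extChartAt (𝓡 (2 * m + 1)) x).symm u))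
        (frameMap x ((extChartAt (𝓡 (2 * m + 1)) x).symm u) v)
        (frameMap x ((extChartAt (𝓡 (2 * m + 1)) x).symm u) w)
        (frameMap x ((extChartAt (𝓡 (2 * m + 1)) x).symm u) y) := by
  set p := (extChartAt (𝓡 (2 * m + 1)) x).symm u with hp
  have ho : u ∈ (overlap x p : Set (Model m)) := mem_overlap hu
  have hτ : transition x p u = extChartAt (𝓡 (2 * m + 1)) p p := rfl
  have hD : ∀ v, fderiv ℝ (transition x p) u v = frameMap x p v := by
    intro v
    rw [fderiv_transition ho, ← hp, coframe_self]
  have h := curvature_transition (τ := transition x p) (Γ := conn cov x) (Γ' := conn cov p)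
    ((contDiffOn_conn cov hcov x).contDiffAt ((isOpen_extChartAt_target x).mem_nhds hu))
    ((contDiffOn_conn cov hcov p).contDiffAt (by
      rw [hτ]; exact (isOpen_extChartAt_target p).mem_nhds (mem_extChartAt_target p)))
    ((contDiffOn_transition x p).contDiffAt ((isOpen_overlap x p).mem_nhds ho))
    (by
      filter_upwards [(isOpen_overlap x p).mem_nhds ho] with u' hu' v y
      have h1 := conn_transition cov hu' v y
      have h2 : fderiv ℝ (fun u => fderiv ℝ (transition x p) u y) u' v =
          fderiv ℝ (fderiv ℝ (transition x p)) u' v y := by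
        have hL : ContDiffAt ℝ ∞ (fderiv ℝ (transition x p)) u' :=
          ((contDiffOn_transition x p).contDiffAt ((isOpen_overlap x p).mem_nhds hu')).fderiv_right
            (by simp)
        rw [(HasFDerivAt.clm_apply_const (hL.differentiableAt (by simp)).hasFDerivAt y).fderiv]
        rfl
      rw [← h2]
      exact h1) v w y
  simp only [hD, hτ] at h
  exact h

/-- The inner covariant derivative of a coordinate field has the components Γ(e_w, e_j) in the
chart. The outer one differentiates them and adds a second Γ by the Leibniz rule. -/
theorem curvatureComp_eq (cov : AffineConnection m M) [T2Space M]
    (hcov : CovariantDerivative.ContMDiffCovariantDerivative cov ∞) (x : M)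
    (i j k l : Fin (2 * m + 1)) : curvatureComp cov x i j k l =
      coord (curv (conn cov x) (extChartAt (𝓡 (2 * m + 1)) x x) (e k) (e l) (e j)) i := by
  have hx := mem_extChartAt_source (I := 𝓡 (2 * m + 1)) x
  have hΓ := (contDiffOn_conn cov hcov x).contDiffAt
    ((isOpen_extChartAt_target x).mem_nhds (mem_extChartAt_target x))
  have dΓ := (hΓ.differentiableAt (by simp)).hasFDerivAt
  have key : ∀ v w, (cov (fun p => cov (coordField x j) p (coordField x w p)) x (e v) : Model m) =
      fderiv ℝ (fun u => conn cov x u (e w)) (extChartAt (𝓡 (2 * m + 1)) x x) (e v) (e j) +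
        conn cov x (extChartAt (𝓡 (2 * m + 1)) x x) (e v)
          (conn cov x (extChartAt (𝓡 (2 * m + 1)) x x) (e w) (e j)) := by
    intro v w
    have dZ := HasFDerivAt.clm_apply_const (HasFDerivAt.clm_apply_const dΓ (e w)) (e j)
    have h1 : ∀ p ∈ (extChartAt (𝓡 (2 * m + 1)) x).source,
        cov (coordField x j) p (coordField x w p) =
          framed x (fun u => conn cov x u (e w) (e j)) p := fun p hp =>
      cov_framed_const cov hp (e w) (e j)
    have hd2 := diffAt_framed hx dZ.differentiableAt
    have hd1 : DiffAt (fun p => cov (coordField x j) p (coordField x w p)) x := by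
      refine hd2.congr_of_eventuallyEq ?_
      filter_upwards [(isOpen_extChartAt_source x).mem_nhds hx] with p hp
      rw [h1 p hp]
    have h2 : cov (fun p => cov (coordField x j) p (coordField x w p)) x =
        cov (framed x (fun u => conn cov x u (e w) (e j))) x := by
      refine cov.isCovariantDerivativeOnUniv.congr_of_eventuallyEq hd1 hd2 Filter.univ_mem ?_
      filter_upwards [(isOpen_extChartAt_source x).mem_nhds hx] with p hp
      exact h1 p hp
    have h3 := cov_framed cov hx dZ.differentiableAt (e v)
    rw [frameMap_self, frameMap_self] at h3
    rw [h2]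
    refine h3.trans ?_
    rw [dZ.fderiv, (HasFDerivAt.clm_apply_const dΓ (e w)).fderiv]
    rfl
  have h : curv (conn cov x) (extChartAt (𝓡 (2 * m + 1)) x x) (e k) (e l) (e j) =
      (cov (fun p => cov (coordField x j) p (coordField x l p)) x (e k) : Model m) -
        (cov (fun p => cov (coordField x j) p (coordField x k p)) x (e l) : Model m) := by
    rw [key, key, curv, curvature]
    simp only [_root_.sub_apply, _root_.add_apply, mul_apply_eq_comp]
    abel
  rw [h]
  rfl

end LocalExpressions

/-! ### The Wick tensor as a matrix built from a metric and a two-form -/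

section WickMatrix

variable {E : Type*} [NormedAddCommGroup E] [NormedSpace ℝ E] {ι : Type*} [Fintype ι] [DecidableEq ι]
  {G W : E → Matrix ι ι ℝ} {U : Set E} {u : E}

/-- The entrywise derivative of a matrix-valued function. -/
def derivMatrix (G : E → Matrix ι ι ℝ) (u v : E) : Matrix ι ι ℝ :=
  Matrix.of fun i j => fderiv ℝ (fun u => G u i j) u v

omit [DecidableEq ι] in
theorem derivMatrix_mul (hG : ∀ i j, DifferentiableAt ℝ (fun u => G u i j) u)
    (hW : ∀ i j, DifferentiableAt ℝ (fun u => W u i j) u) (v : E) :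
    derivMatrix (fun u => G u * W u) u v = derivMatrix G u v * W u + G u * derivMatrix W u v := by
  ext i j
  have h1 : ∀ k ∈ Finset.univ, HasFDerivAt (fun u => G u i k * W u k j) _ u := fun k _ =>
    (hG i k).hasFDerivAt.mul (hW k j).hasFDerivAt
  have h2 : (fun u => (G u * W u) i j) = fun u => ∑ k, G u i k * W u k j :=
    funext fun u => Matrix.mul_apply
  simp only [derivMatrix, Matrix.of_apply, Matrix.add_apply, Matrix.mul_apply]
  rw [(HasFDerivAt.fun_sum h1).fderiv, _root_.sum_apply, ← Finset.sum_add_distrib]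
  refine Finset.sum_congr rfl fun k _ => ?_
  simp only [_root_.add_apply, _root_.smul_apply, smul_eq_mul]
  ring

omit [Fintype ι] [DecidableEq ι] in
theorem derivMatrix_transpose (G : E → Matrix ι ι ℝ) (u v : E) :
    derivMatrix (fun u => (G u).transpose) u v = (derivMatrix G u v).transpose := rfl

theorem contDiffOn_det (hG : ∀ i j, ContDiffOn ℝ ∞ (fun u => G u i j) U) :
    ContDiffOn ℝ ∞ (fun u => (G u).det) U := by
  simp only [Matrix.det_apply']
  exact ContDiffOn.sum fun σ _ => contDiffOn_const.mul (contDiffOn_prod fun i _ => hG _ _)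

theorem contDiffOn_matrix_inv (hG : ∀ i j, ContDiffOn ℝ ∞ (fun u => G u i j) U)
    (hdet : ∀ u ∈ U, (G u).det ≠ 0) (i j : ι) : ContDiffOn ℝ ∞ (fun u => (G u)⁻¹ i j) U := by
  simp only [Matrix.inv_def, Matrix.smul_apply, Ring.inverse_eq_inv', Matrix.adjugate_apply,
    smul_eq_mul]
  refine ((contDiffOn_det hG).inv hdet).mul (contDiffOn_det fun k l => ?_)
  simp only [Matrix.updateRow_apply]
  split_ifs
  · exact contDiffOn_const
  · exact hG k l

omit [DecidableEq ι] in
theorem contDiffOn_matrix_mul (hG : ∀ i j, ContDiffOn ℝ ∞ (fun u => G u i j) U)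
    (hW : ∀ i j, ContDiffOn ℝ ∞ (fun u => W u i j) U) (i j : ι) :
    ContDiffOn ℝ ∞ (fun u => (G u * W u) i j) U := by
  simp only [Matrix.mul_apply]
  exact ContDiffOn.sum fun k _ => (hG _ _).mul (hW _ _)

/-- The Poisson tensor `g⁻¹ ωᵗ g⁻¹` of a metric and a two-form. -/
def poissonMatrix (G W : Matrix ι ι ℝ) : Matrix ι ι ℝ := G⁻¹ * W.transpose * G⁻¹

/-- The Wick tensor of a metric and a two-form. -/
def wickTensor (G W : Matrix ι ι ℝ) (i j : ι) : ℂ :=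
  ((G⁻¹ i j : ℝ) : ℂ) + Complex.I * ((poissonMatrix G W i j : ℝ) : ℂ)

theorem contDiffOn_poissonMatrix (hG : ∀ i j, ContDiffOn ℝ ∞ (fun u => G u i j) U)
    (hW : ∀ i j, ContDiffOn ℝ ∞ (fun u => W u i j) U) (hdet : ∀ u ∈ U, (G u).det ≠ 0) (i j : ι) :
    ContDiffOn ℝ ∞ (fun u => poissonMatrix (G u) (W u) i j) U :=
  contDiffOn_matrix_mul (contDiffOn_matrix_mul (W := fun u => (W u).transpose)
    (contDiffOn_matrix_inv hG hdet) fun i j => hW j i) (contDiffOn_matrix_inv hG hdet) i j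

theorem contDiffOn_wickTensor (hG : ∀ i j, ContDiffOn ℝ ∞ (fun u => G u i j) U)
    (hW : ∀ i j, ContDiffOn ℝ ∞ (fun u => W u i j) U) (hdet : ∀ u ∈ U, (G u).det ≠ 0) (i j : ι) :
    ContDiffOn ℝ ∞ (fun u => wickTensor (G u) (W u) i j) U :=
  (Complex.ofRealCLM.contDiff.comp_contDiffOn (contDiffOn_matrix_inv hG hdet i j)).add
    (contDiffOn_const.mul
      (Complex.ofRealCLM.contDiff.comp_contDiffOn (contDiffOn_poissonMatrix hG hW hdet i j)))

section Parallel

variable (hU : IsOpen U) (hG : ∀ i j, ContDiffOn ℝ ∞ (fun u => G u i j) U)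
  (hW : ∀ i j, ContDiffOn ℝ ∞ (fun u => W u i j) U) (hdet : ∀ u ∈ U, (G u).det ≠ 0) (hu : u ∈ U)
  {v : E} {A : Matrix ι ι ℝ} (dG : derivMatrix G u v = A.transpose * G u + G u * A)

include hU hG hdet hu dG

/-- Differentiate G G⁻¹ = 1 and multiply by G⁻¹ from the left. -/
theorem derivMatrix_inv : derivMatrix (fun u => (G u)⁻¹) u v = -(A * (G u)⁻¹ + (G u)⁻¹ * A.transpose) := by
  have hn := hU.mem_nhds hu
  have h1 : derivMatrix (fun u => G u * (G u)⁻¹) u v = 0 := by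
    ext i j
    have : (fun u => (G u * (G u)⁻¹) i j) =ᶠ[𝓝 u] fun _ => (1 : Matrix ι ι ℝ) i j := by
      filter_upwards [hn] with u hu
      rw [Matrix.mul_nonsing_inv _ (isUnit_iff_ne_zero.2 (hdet u hu))]
    simp only [derivMatrix, Matrix.of_apply]
    rw [this.fderiv_eq, fderiv_fun_const]
    rfl
  rw [derivMatrix_mul (fun i j => ((hG i j).contDiffAt hn).differentiableAt (by simp))
    (fun i j => ((contDiffOn_matrix_inv hG hdet i j).contDiffAt hn).differentiableAt (by simp)),
    dG] at h1
  have hi : (G u)⁻¹ * G u = 1 := Matrix.nonsing_inv_mul _ (isUnit_iff_ne_zero.2 (hdet u hu))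
  have hi' : G u * (G u)⁻¹ = 1 := Matrix.mul_nonsing_inv _ (isUnit_iff_ne_zero.2 (hdet u hu))
  have h2 := congrArg (fun B => (G u)⁻¹ * B) h1
  simp only [mul_add, add_mul, mul_zero] at h2
  rw [← mul_assoc (G u)⁻¹ (G u) (derivMatrix _ u v), hi, one_mul,
    show (G u)⁻¹ * (A.transpose * G u * (G u)⁻¹) = (G u)⁻¹ * A.transpose by
      rw [mul_assoc A.transpose, hi', mul_one],
    show (G u)⁻¹ * (G u * A * (G u)⁻¹) = A * (G u)⁻¹ by
      rw [← mul_assoc, ← mul_assoc, hi, one_mul]] at h2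
  rw [eq_neg_iff_add_eq_zero, ← h2]
  abel

include hW

theorem derivMatrix_poissonMatrix (dW : derivMatrix W u v = A.transpose * W u + W u * A) :
    derivMatrix (fun u => poissonMatrix (G u) (W u)) u v =
      -(A * poissonMatrix (G u) (W u) + poissonMatrix (G u) (W u) * A.transpose) := by
  have hn := hU.mem_nhds hu
  have dGi : ∀ i j, DifferentiableAt ℝ (fun u => (G u)⁻¹ i j) u := fun i j =>
    ((contDiffOn_matrix_inv hG hdet i j).contDiffAt hn).differentiableAt (by simp)
  have dWt : ∀ i j, DifferentiableAt ℝ (fun u => (W u).transpose i j) u := fun i j =>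
    ((hW j i).contDiffAt hn).differentiableAt (by simp)
  have hm : ∀ i j, DifferentiableAt ℝ (fun u => ((G u)⁻¹ * (W u).transpose) i j) u := fun i j =>
    ((contDiffOn_matrix_mul (W := fun u => (W u).transpose) (contDiffOn_matrix_inv hG hdet)
      (fun i j => hW j i) i j).contDiffAt hn).differentiableAt (by simp)
  simp only [poissonMatrix]
  rw [derivMatrix_mul hm dGi, derivMatrix_mul dGi dWt, derivMatrix_transpose, dW,
    derivMatrix_inv hU hG hdet hu dG, Matrix.transpose_add, Matrix.transpose_mul,
    Matrix.transpose_mul, Matrix.transpose_transpose]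
  noncomm_ring

/-- The Wick tensor of a parallel metric and a parallel two-form is parallel. -/
theorem fderiv_wickTensor (dW : derivMatrix W u v = A.transpose * W u + W u * A) (i j : ι) :
    fderiv ℝ (fun u => wickTensor (G u) (W u) i j) u v +
      ∑ c, ((A i c : ℝ) : ℂ) * wickTensor (G u) (W u) c j +
      ∑ c, ((A j c : ℝ) : ℂ) * wickTensor (G u) (W u) i c = 0 := by
  have hn := hU.mem_nhds hu
  have h1 := congrFun (congrFun (derivMatrix_inv hU hG hdet hu dG) i) j
  have h2 := congrFun (congrFun (derivMatrix_poissonMatrix hU hG hW hdet hu dG dW) i) j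
  have d1 := (((contDiffOn_matrix_inv hG hdet i j).contDiffAt hn).differentiableAt
    (by simp)).hasFDerivAt
  have d2 := (((contDiffOn_poissonMatrix hG hW hdet i j).contDiffAt hn).differentiableAt
    (by simp)).hasFDerivAt
  have d3 : HasFDerivAt (fun u => wickTensor (G u) (W u) i j) _ u :=
    (Complex.ofRealCLM.hasFDerivAt.comp u d1).add
      ((Complex.ofRealCLM.hasFDerivAt.comp u d2).const_mul Complex.I)
  rw [d3.fderiv]
  simp only [derivMatrix, Matrix.of_apply, Matrix.neg_apply, Matrix.add_apply, Matrix.mul_apply,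
    Matrix.transpose_apply] at h1 h2
  simp only [_root_.add_apply, _root_.smul_apply, ContinuousLinearMap.comp_apply,
    Complex.ofRealCLM_apply, smul_eq_mul, h1, h2, wickTensor, mul_add, Finset.sum_add_distrib,
    Complex.ofReal_neg, Complex.ofReal_add, Complex.ofReal_sum, Complex.ofReal_mul, Finset.mul_sum,
    mul_neg]
  have e1 : ∀ x : ι, ((A j x : ℝ) : ℂ) * (((G u)⁻¹ i x : ℝ) : ℂ) =
    (((G u)⁻¹ i x : ℝ) : ℂ) * ((A j x : ℝ) : ℂ) := fun x => mul_comm _ _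
  have e2 : ∀ x : ι, Complex.I * (((A i x : ℝ) : ℂ) * ((poissonMatrix (G u) (W u) x j : ℝ) : ℂ)) =
    ((A i x : ℝ) : ℂ) * (Complex.I * ((poissonMatrix (G u) (W u) x j : ℝ) : ℂ)) := fun x => by ring
  have e3 : ∀ x : ι, Complex.I * (((poissonMatrix (G u) (W u) i x : ℝ) : ℂ) * ((A j x : ℝ) : ℂ)) =
    ((A j x : ℝ) : ℂ) * (Complex.I * ((poissonMatrix (G u) (W u) i x : ℝ) : ℂ)) := fun x => by ring
  simp only [e1, e2, e3]
  ring

end Parallel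

section Algebra

variable {G W F Φ A : Matrix ι ι ℝ}

/-- The Wick tensor in a different frame. -/
theorem wickTensor_change (hF : IsUnit F.det) (i j : ι) :
    wickTensor G W i j = ∑ a, ∑ b,
      wickTensor (F.transpose * G * F) (F.transpose * W * F) a b * ((F i a * F j b : ℝ) : ℂ) := by
  have hF1 : F * F⁻¹ = 1 := Matrix.mul_nonsing_inv _ hF
  have hF2 : F⁻¹.transpose * F.transpose = 1 := by rw [← Matrix.transpose_mul, hF1, Matrix.transpose_one]
  have h1 : F * (F.transpose * G * F)⁻¹ * F.transpose = G⁻¹ := by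
    rw [Matrix.mul_inv_rev, Matrix.mul_inv_rev, ← Matrix.transpose_nonsing_inv, ← mul_assoc,
      hF1, one_mul, mul_assoc, hF2, mul_one]
  have h2 : F * poissonMatrix (F.transpose * G * F) (F.transpose * W * F) * F.transpose =
      poissonMatrix G W := by
    rw [poissonMatrix, poissonMatrix, ← h1, Matrix.transpose_mul, Matrix.transpose_mul,
      Matrix.transpose_transpose]
    noncomm_ring
  have h1' := fun i j => congrFun (congrFun h1 i) j
  have h2' := fun i j => congrFun (congrFun h2 i) j
  simp only [Matrix.mul_apply, Matrix.transpose_apply, Finset.sum_mul] at h1' h2'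
  rw [wickTensor, ← h1', ← h2', Complex.ofReal_sum, Complex.ofReal_sum, Finset.mul_sum,
    ← Finset.sum_add_distrib]
  simp only [Complex.ofReal_sum, Finset.mul_sum, ← Finset.sum_add_distrib]
  rw [Finset.sum_comm]
  refine Finset.sum_congr rfl fun a _ => Finset.sum_congr rfl fun b _ => ?_
  rw [wickTensor]
  push_cast
  ring

variable (hGt : G.transpose = G) (hGu : IsUnit G.det) (hW : W = G * Φ) (hWt : W.transpose = -W)

include hGu hW hWt in
theorem poissonMatrix_eq : poissonMatrix G W = -(Φ * G⁻¹) := by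
  rw [poissonMatrix, hWt, hW, mul_neg, neg_mul, ← mul_assoc, Matrix.nonsing_inv_mul _ hGu, one_mul]

include hGt hWt in
theorem poissonMatrix_transpose : (poissonMatrix G W).transpose = -poissonMatrix G W := by
  rw [poissonMatrix, Matrix.transpose_mul, Matrix.transpose_mul, Matrix.transpose_nonsing_inv, hGt,
    Matrix.transpose_transpose, hWt]
  noncomm_ring

include hGt hWt in
-- The inverse metric is symmetric and drops out, while the Poisson part is antisymmetric and
-- doubles.
theorem wickTensor_sub (i j : ι) : wickTensor G W i j - wickTensor G W j i =
    2 * Complex.I * ((poissonMatrix G W i j : ℝ) : ℂ) := by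
  have h1 : G⁻¹ j i = G⁻¹ i j := by
    have := congrFun (congrFun (Matrix.transpose_nonsing_inv G) i) j
    rwa [hGt, Matrix.transpose_apply] at this
  have h2 : poissonMatrix G W j i = -poissonMatrix G W i j :=
    congrFun (congrFun (poissonMatrix_transpose hGt hWt) i) j
  rw [wickTensor, wickTensor, h1, h2]
  push_cast
  ring

include hGt hGu hW hWt in
-- For a contact metric structure Φ² = -1 + ξ ⊗ λ, so this is the sense in which the Poisson tensor
-- inverts -ω on the contact distribution.
theorem poissonMatrix_transpose_mul : (poissonMatrix G W).transpose * W = Φ * Φ := by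
  rw [poissonMatrix_transpose hGt hWt, poissonMatrix_eq hGu hW hWt, hW, neg_neg, mul_assoc,
    ← mul_assoc G⁻¹, Matrix.nonsing_inv_mul _ hGu, one_mul]

include hGt hGu hW hWt in
/-- The second-order contractions of the Wick tensor with a derivation of metric and two-form are
symmetric. -/
theorem sum_wickTensor_comm (hGA : G * A = -(A.transpose * G)) (hWA : W * A = -(A.transpose * W))
    (j l : ι) : ∑ i, ∑ k, (wickTensor G W i j * wickTensor G W k l -
      wickTensor G W j i * wickTensor G W l k) * (((W * A) i k : ℝ) : ℂ) = 0 := by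
  have hi : G⁻¹ * G = 1 := Matrix.nonsing_inv_mul _ hGu
  -- An endomorphism that is skew for both the metric and the two-form W = GΦ commutes with Φ.
  have hΦA : Φ * A = A * Φ := by
    have h1 : G * (Φ * A) = G * (A * Φ) := by
      rw [← mul_assoc, ← hW, hWA, hW, ← mul_assoc, ← mul_assoc, hGA, neg_mul]
    simpa only [← mul_assoc, hi, one_mul] using congrArg (fun B => G⁻¹ * B) h1
  have hP := poissonMatrix_eq hGu hW hWt
  have key : G⁻¹ * (W * A) * poissonMatrix G W = poissonMatrix G W * (W * A) * G⁻¹ := by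
    have h1 : G⁻¹ * (W * A) = Φ * A := by rw [hW, ← mul_assoc, ← mul_assoc, hi, one_mul]
    rw [h1, hP, show -(Φ * G⁻¹) * (W * A) * G⁻¹ = -(Φ * (G⁻¹ * (W * A)) * G⁻¹) by noncomm_ring, h1,
      hΦA]
    rw [← mul_assoc Φ A, hΦA]
    noncomm_ring
  have h1 : ∀ i j, G⁻¹ j i = G⁻¹ i j := fun i j => by
    have := congrFun (congrFun (Matrix.transpose_nonsing_inv G) i) j
    rwa [hGt, Matrix.transpose_apply] at this
  have h2 : ∀ i j, poissonMatrix G W j i = -poissonMatrix G W i j := fun i j =>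
    congrFun (congrFun (poissonMatrix_transpose hGt hWt) i) j
  have h3 := congrFun (congrFun key j) l
  simp only [Matrix.mul_apply (M := G⁻¹ * (W * A)), Matrix.mul_apply (M := poissonMatrix G W * (W * A)),
    Matrix.mul_apply (M := G⁻¹) (N := W * A), Matrix.mul_apply (M := poissonMatrix G W) (N := W * A),
    Finset.sum_mul] at h3
  replace h3 := (Finset.sum_comm.trans h3).trans Finset.sum_comm
  -- In the difference of h ⊗ h and its transpose only the mixed terms, metric times Poisson,
  -- survive. Their two sums are the two sides of `key`.
  have h4 : ∀ i k, (wickTensor G W i j * wickTensor G W k l -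
      wickTensor G W j i * wickTensor G W l k) * (((W * A) i k : ℝ) : ℂ) =
      2 * Complex.I * ((G⁻¹ j i * (W * A) i k * poissonMatrix G W k l : ℝ) : ℂ) -
      2 * Complex.I * ((poissonMatrix G W j i * (W * A) i k * G⁻¹ k l : ℝ) : ℂ) := by
    intro i k
    simp only [wickTensor]
    rw [h1 j i, h1 k l, h2 j i, h2 k l]
    push_cast
    ring
  simp only [h4, Finset.sum_sub_distrib, ← Finset.mul_sum, ← Complex.ofReal_sum]
  rw [h3, sub_self]

end Algebra

end WickMatrix

/-! ### The structure tensors in a chart, and their parallelism -/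

section LocalData

variable {m : ℕ} {M : Type*} [TopologicalSpace M] [ChartedSpace (Model m) M]
  [IsManifold (𝓡 (2 * m + 1)) ∞ M] (S : ContactMetricStructure m M) {x p : M} {u : Model m}

namespace ContactMetricStructure

/-- The metric at a point, on the model space. -/
def gAt (p : M) : Model m →L[ℝ] Model m →L[ℝ] ℝ := S.g.inner p

/-- The tensor `φ` at a point, on the model space. -/
def phiAt (p : M) : Model m →L[ℝ] Model m := S.phi p

/-- The contact form at a point, on the model space. -/
def lamAt (p : M) : Model m →L[ℝ] ℝ := S.lam p

/-- The Reeb vector at a point, in the model space. -/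
def xiAt (p : M) : Model m := S.reeb p

/-- The two-form `ω` at a point, on the model space. -/
def wAt (p : M) : Model m →L[ℝ] Model m →L[ℝ] ℝ :=
  (S.gAt p).bilinearComp (ContinuousLinearMap.id ℝ (Model m)) (S.phiAt p)

/-- The metric in the preferred chart at `x`. -/
def gLoc (x : M) (u : Model m) : Model m →L[ℝ] Model m →L[ℝ] ℝ :=
  (S.gAt ((extChartAt (𝓡 (2 * m + 1)) x).symm u)).bilinearComp
    (frameMap x ((extChartAt (𝓡 (2 * m + 1)) x).symm u))
    (frameMap x ((extChartAt (𝓡 (2 * m + 1)) x).symm u))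

/-- The two-form `ω` in the preferred chart at `x`. -/
def wLoc (x : M) (u : Model m) : Model m →L[ℝ] Model m →L[ℝ] ℝ :=
  (S.wAt ((extChartAt (𝓡 (2 * m + 1)) x).symm u)).bilinearComp
    (frameMap x ((extChartAt (𝓡 (2 * m + 1)) x).symm u))
    (frameMap x ((extChartAt (𝓡 (2 * m + 1)) x).symm u))

/-- The contact form in the preferred chart at `x`. -/
def lamLoc (x : M) (u : Model m) : Model m →L[ℝ] ℝ :=
  S.lamAt ((extChartAt (𝓡 (2 * m + 1)) x).symm u) ∘L
    (frameMap x ((extChartAt (𝓡 (2 * m + 1)) x).symm u))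

/-- The Reeb field in the preferred chart at `x`. -/
def xiLoc (x : M) (u : Model m) : Model m :=
  coframe x ((extChartAt (𝓡 (2 * m + 1)) x).symm u) (S.xiAt ((extChartAt (𝓡 (2 * m + 1)) x).symm u))

/-- `wAt` is built from g and φ, whose smoothness is part of the data, so that no derivative of λ
has to be handled. -/
theorem wAt_apply (p : M) (a b : Model m) : S.wAt p a b = extDerivOne S.lam p a b :=
  (S.omega_eq p a b).symm

theorem contMDiffOn_framed_const (x : M) (a : Model m) :
    ContMDiffOn (𝓡 (2 * m + 1)) ((𝓡 (2 * m + 1)).prod 𝓘(ℝ, Model m)) ∞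
      (fun p => TotalSpace.mk' (Model m) (E := fun p => TangentSpace (𝓡 (2 * m + 1)) p) p
        (frameMap x p a)) (extChartAt (𝓡 (2 * m + 1)) x).source :=
  contMDiffOn_framed (contDiffOn_const (c := a))

theorem contMDiffOn_inner {Y Z : Π p : M, TangentSpace (𝓡 (2 * m + 1)) p} {s : Set M}
    (hY : ContMDiffOn (𝓡 (2 * m + 1)) ((𝓡 (2 * m + 1)).prod 𝓘(ℝ, Model m)) ∞
      (fun p => TotalSpace.mk' (Model m) (E := fun p => TangentSpace (𝓡 (2 * m + 1)) p) p (Y p)) s)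
    (hZ : ContMDiffOn (𝓡 (2 * m + 1)) ((𝓡 (2 * m + 1)).prod 𝓘(ℝ, Model m)) ∞
      (fun p => TotalSpace.mk' (Model m) (E := fun p => TangentSpace (𝓡 (2 * m + 1)) p) p (Z p)) s) :
    ContMDiffOn (𝓡 (2 * m + 1)) 𝓘(ℝ, ℝ) ∞ (fun p => S.g.inner p (Y p) (Z p)) s := by
  intro p hp
  have : ContMDiffWithinAt (𝓡 (2 * m + 1)) ((𝓡 (2 * m + 1)).prod 𝓘(ℝ)) ∞
      (fun p => TotalSpace.mk' ℝ (E := Bundle.Trivial M ℝ) p (S.g.inner p (Y p) (Z p))) s p := by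
    apply ContMDiffWithinAt.clm_bundle_apply₂ (F₁ := Model m) (F₂ := Model m)
    · exact (S.g.contMDiff p).contMDiffWithinAt
    · exact hY p hp
    · exact hZ p hp
  simp only [contMDiffWithinAt_totalSpace] at this
  exact this.2

theorem contMDiffOn_inner_frame (x : M) (a b : Model m) :
    ContMDiffOn (𝓡 (2 * m + 1)) 𝓘(ℝ, ℝ) ∞
      (fun p => S.g.inner p (frameMap x p a) (frameMap x p b))
      (extChartAt (𝓡 (2 * m + 1)) x).source :=
  S.contMDiffOn_inner (contMDiffOn_framed_const x a) (contMDiffOn_framed_const x b)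

theorem contMDiffOn_inner_phi_frame (x : M) (a b : Model m) :
    ContMDiffOn (𝓡 (2 * m + 1)) 𝓘(ℝ, ℝ) ∞
      (fun p => S.g.inner p (frameMap x p a) (S.phi p (frameMap x p b)))
      (extChartAt (𝓡 (2 * m + 1)) x).source :=
  S.contMDiffOn_inner (contMDiffOn_framed_const x a)
    (ContMDiffOn.clm_bundle_apply (F₁ := Model m) (F₂ := Model m)
      (fun p _ => (S.phi_smooth p).contMDiffWithinAt) (contMDiffOn_framed_const x b))

theorem contMDiffOn_lam_frame (x : M) (a : Model m) :
    ContMDiffOn (𝓡 (2 * m + 1)) 𝓘(ℝ, ℝ) ∞ (fun p => S.lam p (frameMap x p a))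
      (extChartAt (𝓡 (2 * m + 1)) x).source := by
  intro p hp
  have : ContMDiffWithinAt (𝓡 (2 * m + 1)) ((𝓡 (2 * m + 1)).prod 𝓘(ℝ)) ∞
      (fun p => TotalSpace.mk' ℝ (E := Bundle.Trivial M ℝ) p (S.lam p (frameMap x p a)))
      (extChartAt (𝓡 (2 * m + 1)) x).source p := by
    apply ContMDiffWithinAt.clm_bundle_apply (F₁ := Model m)
    · exact (S.lam_smooth p).contMDiffWithinAt
    · exact contMDiffOn_framed_const x a p hp
  simp only [contMDiffWithinAt_totalSpace] at this
  exact this.2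

theorem contDiffOn_gLoc (x : M) :
    ContDiffOn ℝ ∞ (S.gLoc x) (extChartAt (𝓡 (2 * m + 1)) x).target :=
  contDiffOn_clm_apply.2 fun a => contDiffOn_clm_apply.2 fun b =>
    contDiffOn_chart (S.contMDiffOn_inner_frame x a b)

theorem contDiffOn_wLoc (x : M) :
    ContDiffOn ℝ ∞ (S.wLoc x) (extChartAt (𝓡 (2 * m + 1)) x).target :=
  contDiffOn_clm_apply.2 fun a => contDiffOn_clm_apply.2 fun b =>
    contDiffOn_chart (S.contMDiffOn_inner_phi_frame x a b)

theorem contDiffOn_lamLoc (x : M) :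
    ContDiffOn ℝ ∞ (S.lamLoc x) (extChartAt (𝓡 (2 * m + 1)) x).target :=
  contDiffOn_clm_apply.2 fun a => contDiffOn_chart (S.contMDiffOn_lam_frame x a)

theorem contDiffOn_xiLoc (x : M) :
    ContDiffOn ℝ ∞ (S.xiLoc x) (extChartAt (𝓡 (2 * m + 1)) x).target :=
  contDiffOn_coframe fun p _ => (S.reeb_smooth p).contMDiffWithinAt

section Connection

variable {S} {cov : AffineConnection m M}

omit [IsManifold (𝓡 (2 * m + 1)) ∞ M] in
theorem mdifferentiableAt_of_contMDiffOn {f : M → ℝ}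
    (hf : ContMDiffOn (𝓡 (2 * m + 1)) 𝓘(ℝ, ℝ) ∞ f (extChartAt (𝓡 (2 * m + 1)) x).source)
    (hp : p ∈ (extChartAt (𝓡 (2 * m + 1)) x).source) :
    MDifferentiableAt (𝓡 (2 * m + 1)) 𝓘(ℝ, ℝ) f p :=
  ((hf p hp).contMDiffAt ((isOpen_extChartAt_source x).mem_nhds hp)).mdifferentiableAt (by simp)

/-- The condition ∇g = 0 is evaluated on fields with constant components in the chart, whose
covariant derivatives consist of the Γ-term alone. -/
theorem fderiv_gLoc (hcov : S.IsContactMetricConnection cov)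
    (hu : u ∈ (extChartAt (𝓡 (2 * m + 1)) x).target) (v a b : Model m) :
    fderiv ℝ (fun u => S.gLoc x u a b) u v =
      S.gLoc x u (conn cov x u v a) b + S.gLoc x u a (conn cov x u v b) := by
  have hp := (extChartAt (𝓡 (2 * m + 1)) x).map_target hu
  have h := hcov.nabla_g (framed x fun _ => a) (framed x fun _ => b) _
    (diffAt_framed hp (differentiableAt_const _)) (diffAt_framed hp (differentiableAt_const _))
    (frameMap x ((extChartAt (𝓡 (2 * m + 1)) x).symm u) v)
  rw [cov_framed_const cov hp, cov_framed_const cov hp, (extChartAt (𝓡 (2 * m + 1)) x).right_inv hu]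
    at h
  have h2 := mvfderiv_frameMap hp
    (mdifferentiableAt_of_contMDiffOn (S.contMDiffOn_inner_frame x a b) hp) v
  rw [(extChartAt (𝓡 (2 * m + 1)) x).right_inv hu] at h2
  exact h2.symm.trans h

theorem fderiv_wLoc (hcov : S.IsContactMetricConnection cov)
    (hu : u ∈ (extChartAt (𝓡 (2 * m + 1)) x).target) (v a b : Model m) :
    fderiv ℝ (fun u => S.wLoc x u a b) u v =
      S.wLoc x u (conn cov x u v a) b + S.wLoc x u a (conn cov x u v b) := by
  have hp := (extChartAt (𝓡 (2 * m + 1)) x).map_target hu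
  have h := hcov.nabla_omega (framed x fun _ => a) (framed x fun _ => b) _
    (diffAt_framed hp (differentiableAt_const _)) (diffAt_framed hp (differentiableAt_const _))
    (frameMap x ((extChartAt (𝓡 (2 * m + 1)) x).symm u) v)
  rw [cov_framed_const cov hp, cov_framed_const cov hp, (extChartAt (𝓡 (2 * m + 1)) x).right_inv hu]
    at h
  simp only [S.omega_eq] at h
  have h2 := mvfderiv_frameMap hp
    (mdifferentiableAt_of_contMDiffOn (S.contMDiffOn_inner_phi_frame x a b) hp) v
  rw [(extChartAt (𝓡 (2 * m + 1)) x).right_inv hu] at h2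
  exact h2.symm.trans (h.trans (congrArg₂ (fun s t => s + t) (S.omega_eq _ _ _) (S.omega_eq _ _ _)))

theorem frameMap_xiLoc (hu : u ∈ (extChartAt (𝓡 (2 * m + 1)) x).target) :
    frameMap x ((extChartAt (𝓡 (2 * m + 1)) x).symm u) (S.xiLoc x u) =
      S.xiAt ((extChartAt (𝓡 (2 * m + 1)) x).symm u) :=
  frameMap_coframe ((extChartAt (𝓡 (2 * m + 1)) x).map_target hu) _

theorem fderiv_xiLoc (hcov : S.IsContactMetricConnection cov)
    (hu : u ∈ (extChartAt (𝓡 (2 * m + 1)) x).target) (v : Model m) :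
    fderiv ℝ (S.xiLoc x) u v + conn cov x u v (S.xiLoc x u) = 0 := by
  have hp := (extChartAt (𝓡 (2 * m + 1)) x).map_target hu
  have hd : DifferentiableAt ℝ (S.xiLoc x) u := ((S.contDiffOn_xiLoc x).contDiffAt
    ((isOpen_extChartAt_target x).mem_nhds hu)).differentiableAt (by simp)
  have hr := (extChartAt (𝓡 (2 * m + 1)) x).right_inv hu
  have hd' : DifferentiableAt ℝ (S.xiLoc x)
      (extChartAt (𝓡 (2 * m + 1)) x ((extChartAt (𝓡 (2 * m + 1)) x).symm u)) := by rwa [hr]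
  have h1 := cov_framed cov hp hd' v
  have h3 : ∀ q ∈ (extChartAt (𝓡 (2 * m + 1)) x).source, S.reeb q = framed x (S.xiLoc x) q := by
    intro q hq
    have := (extChartAt (𝓡 (2 * m + 1)) x).left_inv hq
    rw [framed, xiLoc, this]
    exact (frameMap_coframe hq _).symm
  have h2 : cov S.reeb ((extChartAt (𝓡 (2 * m + 1)) x).symm u) =
      cov (framed x (S.xiLoc x)) ((extChartAt (𝓡 (2 * m + 1)) x).symm u) := by
    refine cov.isCovariantDerivativeOnUniv.congr_of_eventuallyEq
      (((S.reeb_smooth _).mdifferentiableAt (by simp))) (diffAt_framed hp hd') Filter.univ_mem ?_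
    filter_upwards [(isOpen_extChartAt_source x).mem_nhds hp] with q hq
    exact h3 q hq
  rw [← h2, hcov.nabla_reeb, hr] at h1
  have h4 := congrArg (coframe x ((extChartAt (𝓡 (2 * m + 1)) x).symm u)) h1
  rw [coframe_frameMap hp] at h4
  exact h4.symm.trans (map_zero _)

end Connection

end ContactMetricStructure

end LocalData

/-! ### Matrices of bilinear forms and endomorphisms -/

section BilinearMatrix

variable {m : ℕ}

/-- The matrix of a bilinear form. -/
def formMatrix (B : Model m →L[ℝ] Model m →L[ℝ] ℝ) : Matrix (Fin (2 * m + 1)) (Fin (2 * m + 1)) ℝ :=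
  Matrix.of fun i j => B (e i) (e j)

/-- The matrix of an endomorphism. -/
def opMatrix (F : Model m →L[ℝ] Model m) : Matrix (Fin (2 * m + 1)) (Fin (2 * m + 1)) ℝ :=
  Matrix.of fun i j => coord (F (e j)) i

theorem form_eq_sum_left (B : Model m →L[ℝ] Model m →L[ℝ] ℝ) (y z : Model m) :
    B y z = ∑ c, coord y c * B (e c) z := by
  conv_lhs => rw [← sum_coord_smul_e y]
  rw [map_sum, _root_.sum_apply]
  simp only [_root_.map_smul, _root_.smul_apply, smul_eq_mul]

theorem form_eq_sum_right (B : Model m →L[ℝ] Model m →L[ℝ] ℝ) (y z : Model m) :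
    B y z = ∑ c, B y (e c) * coord z c := by
  conv_lhs => rw [← sum_coord_smul_e z]
  rw [map_sum]
  exact Finset.sum_congr rfl fun c _ => (_root_.map_smul _ _ _).trans (mul_comm _ _)

theorem formMatrix_comp (B : Model m →L[ℝ] Model m →L[ℝ] ℝ) (F : Model m →L[ℝ] Model m) :
    formMatrix (B.bilinearComp F F) = (opMatrix F).transpose * formMatrix B * opMatrix F := by
  ext i j
  rw [mul_assoc, Matrix.mul_apply]
  refine (form_eq_sum_left B (F (e i)) (F (e j))).trans (Finset.sum_congr rfl fun c _ => ?_)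
  rw [Matrix.mul_apply]
  exact congrArg _ (form_eq_sum_right B (e c) (F (e j)))

theorem formMatrix_left (B : Model m →L[ℝ] Model m →L[ℝ] ℝ) (F : Model m →L[ℝ] Model m)
    (i j : Fin (2 * m + 1)) : B (F (e i)) (e j) = ((opMatrix F).transpose * formMatrix B) i j := by
  rw [Matrix.mul_apply]
  exact form_eq_sum_left B _ _

theorem formMatrix_right (B : Model m →L[ℝ] Model m →L[ℝ] ℝ) (F : Model m →L[ℝ] Model m)
    (i j : Fin (2 * m + 1)) : B (e i) (F (e j)) = (formMatrix B * opMatrix F) i j := by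
  rw [Matrix.mul_apply]
  exact form_eq_sum_right B _ _

theorem opMatrix_mul (F G : Model m →L[ℝ] Model m) : opMatrix (F * G) = opMatrix F * opMatrix G := by
  ext i j
  rw [Matrix.mul_apply, opMatrix, Matrix.of_apply, mul_apply_eq_comp]
  conv_lhs => rw [← sum_coord_smul_e (G (e j)), map_sum]
  have : ∀ v : Fin (2 * m + 1) → Model m, coord (∑ c, v c) i = ∑ c, coord (v c) i := fun v =>
    map_sum (EuclideanSpace.proj i : Model m →L[ℝ] ℝ) v Finset.univ
  rw [this]
  refine Finset.sum_congr rfl fun c _ => ?_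
  rw [_root_.map_smul]
  exact mul_comm _ _

end BilinearMatrix

/-! ### Skewness of the curvature for a parallel bilinear form -/

section SkewCurvature

variable {E : Type*} [NormedAddCommGroup E] [NormedSpace ℝ E] {U : Set E} {u : E}
  {Γ : E → E →L[ℝ] E →L[ℝ] E}

set_option synthInstance.maxHeartbeats 100000 in
/-- The curvature of a connection is skew for every parallel bilinear form. -/
theorem form_curvature (hU : IsOpen U) (hΓ : ContDiffOn ℝ ∞ Γ U)
    {w : E → E →L[ℝ] E →L[ℝ] ℝ} (hw : ContDiffOn ℝ ∞ w U)
    (hpar : ∀ u ∈ U, ∀ v x y,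
      fderiv ℝ (fun u => w u x y) u v = w u (Γ u v x) y + w u x (Γ u v y))
    (hu : u ∈ U) (v v' x y : E) :
    w u (curvature (fun u v => Γ u v) u v v' x) y =
      -w u x (curvature (fun u v => Γ u v) u v v' y) := by
  have hn := hU.mem_nhds hu
  have dw' : HasFDerivAt w (fderiv ℝ w u) u :=
    ((hw.contDiffAt hn).differentiableAt (by simp)).hasFDerivAt
  have dw : ∀ z, HasFDerivAt (fun u => w u z) ((fderiv ℝ w u).flip z) u := fun z =>
    HasFDerivAt.clm_apply_const dw' z
  have dΓ := ((hΓ.contDiffAt hn).differentiableAt (by simp)).hasFDerivAt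
  have dZ : ∀ v z, HasFDerivAt (fun u => Γ u v z) _ u := fun v z =>
    HasFDerivAt.clm_apply_const (HasFDerivAt.clm_apply_const dΓ v) z
  have hf : ContDiffAt ℝ ∞ (fun u => w u x y) u :=
    ((hw.clm_apply contDiffOn_const).clm_apply contDiffOn_const).contDiffAt hn
  have d4 : ∀ v a b, (fderiv ℝ w u v) a b = w u (Γ u v a) b + w u a (Γ u v b) := fun v a b => by
    rw [← hpar u hu, (HasFDerivAt.clm_apply_const (dw a) b).fderiv]
    rfl
  have key : ∀ v v', fderiv ℝ (fun u => fderiv ℝ (fun u => w u x y) u v') u v =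
      (w u (Γ u v (Γ u v' x)) y + w u (Γ u v' x) (Γ u v y) +
        w u (fderiv ℝ (fun u => Γ u v') u v x) y) +
      (w u (Γ u v x) (Γ u v' y) + w u x (Γ u v (Γ u v' y)) +
        w u x (fderiv ℝ (fun u => Γ u v') u v y)) := by
    intro v v'
    have e1 : (fun u => fderiv ℝ (fun u => w u x y) u v') =ᶠ[𝓝 u]
        fun u => w u (Γ u v' x) y + w u x (Γ u v' y) := by
      filter_upwards [hn] with u hu
      exact hpar u hu v' x y
    have d1 : HasFDerivAt (fun u => w u (Γ u v' x) y) _ u :=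
      HasFDerivAt.clm_apply_const (dw'.clm_apply (dZ v' x)) y
    have d2 : HasFDerivAt (fun u => w u x (Γ u v' y)) _ u := (dw x).clm_apply (dZ v' y)
    have d3 : ∀ z, fderiv ℝ (fun u => Γ u v') u v z = (fderiv ℝ Γ u v) v' z := fun z => by
      rw [(HasFDerivAt.clm_apply_const dΓ v').fderiv]
      rfl
    rw [e1.fderiv_eq, (d1.fun_add d2).fderiv]
    simp only [_root_.add_apply, ContinuousLinearMap.flip_apply, ContinuousLinearMap.comp_apply,
      d3, d4]
    abel
  -- The second derivatives of w(x, y) are symmetric. Their antisymmetrised expression through Γ is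
  -- w(curvature x, y) + w(x, curvature y).
  have h := fderiv_fderiv_symm hf v v'
  rw [key, key] at h
  simp only [curvature, _root_.sub_apply, _root_.add_apply, mul_apply_eq_comp, map_sub, map_add]
  linarith

end SkewCurvature

/-! ### The Wick tensor of a contact metric structure -/

section LocalData

variable {m : ℕ} {M : Type*} [TopologicalSpace M] [ChartedSpace (Model m) M]
  [IsManifold (𝓡 (2 * m + 1)) ∞ M] (S : ContactMetricStructure m M) {x p : M} {u : Model m}

namespace ContactMetricStructure

theorem formMatrix_gAt_transpose (p : M) : (formMatrix (S.gAt p)).transpose = formMatrix (S.gAt p) := by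
  ext i j
  exact S.g.symm p _ _

/-- A kernel vector v of the matrix would satisfy B(v, v) = 0, against positivity. -/
theorem det_formMatrix {B : Model m →L[ℝ] Model m →L[ℝ] ℝ} (hB : ∀ v, v ≠ 0 → 0 < B v v) :
    IsUnit (formMatrix B).det := by
  rw [isUnit_iff_ne_zero]
  intro h0
  obtain ⟨v, hv, h⟩ := Matrix.exists_mulVec_eq_zero_iff.2 h0
  set y : Model m := WithLp.toLp 2 v with hy
  have hy0 : y ≠ 0 := fun h => hv (by rw [← WithLp.ofLp_toLp 2 v, ← hy, h]; rfl)
  have h1 : B y y = 0 := by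
    rw [form_eq_sum_left]
    refine Finset.sum_eq_zero fun c _ => ?_
    have : B (e c) y = 0 := by
      rw [form_eq_sum_right]
      exact congrFun h c
    rw [this, mul_zero]
  exact (hB y hy0).ne' h1

theorem det_gAt (p : M) : IsUnit (formMatrix (S.gAt p)).det :=
  det_formMatrix fun v hv => S.g.pos p v hv

theorem formMatrix_wAt (p : M) :
    formMatrix (S.wAt p) = formMatrix (S.gAt p) * opMatrix (S.phiAt p) := by
  ext i j
  exact formMatrix_right (S.gAt p) (S.phiAt p) i j

/-- Insert φY for Y in the compatibility of g and φ, and use φ² = -1 + ξ ⊗ λ; the λ-terms vanish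
because λ ∘ φ = 0. -/
theorem inner_phi_antisymm (p : M) (X Y : TangentSpace (𝓡 (2 * m + 1)) p) :
    S.g.inner p X (S.phi p Y) = -S.g.inner p Y (S.phi p X) := by
  have h1 := S.inner_phi_phi p X (S.phi p Y)
  have h2 : S.g.inner p (S.phi p X) (S.phi p (S.phi p Y)) = -S.g.inner p (S.phi p X) Y := by
    rw [S.phi_phi, map_add, map_neg, _root_.map_smul, ← S.lam_eq, S.lam_phi, smul_zero, add_zero]
  rw [S.lam_phi, mul_zero, sub_zero, h2, S.g.symm] at h1
  exact h1.symm

theorem wAt_antisymm (p : M) (a b : Model m) : S.wAt p a b = -S.wAt p b a :=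
  S.inner_phi_antisymm p a b

theorem formMatrix_wAt_transpose (p : M) :
    (formMatrix (S.wAt p)).transpose = -formMatrix (S.wAt p) := by
  ext i j
  exact S.wAt_antisymm p _ _

theorem wAt_xiAt (p : M) : S.wAt p (S.xiAt p) = 0 := by
  ext a
  exact (S.wAt_apply p _ a).trans (S.omega_reeb p a)

theorem lamAt_xiAt (p : M) : S.lamAt p (S.xiAt p) = 1 := S.lam_reeb p

theorem phiAt_phiAt (p : M) (i j : Fin (2 * m + 1)) :
    (opMatrix (S.phiAt p) * opMatrix (S.phiAt p)) i j =
      -coord (e j) i + coord (S.xiAt p) i * S.lamAt p (e j) := by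
  rw [← opMatrix_mul]
  refine (congrArg (fun v : Model m => coord v i) (S.phi_phi p (e j))).trans ?_
  exact congrArg (fun t => -coord (e j : Model m) i + t) (mul_comm _ _)

/-- From ω = gφ one gets g⁻¹φᵗ = g⁻¹ωᵗg⁻¹. The Wick tensor is thereby expressed by two covariant
tensors, and its naturality and parallelism become matrix identities. -/
theorem wick_eq (p : M) (i j : Fin (2 * m + 1)) :
    S.wick p i j = wickTensor (formMatrix (S.gAt p)) (formMatrix (S.wAt p)) i j := by
  have h1 : poissonMatrix (formMatrix (S.gAt p)) (formMatrix (S.wAt p)) =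
      (formMatrix (S.gAt p))⁻¹ * (opMatrix (S.phiAt p)).transpose := by
    rw [poissonMatrix, formMatrix_wAt, Matrix.transpose_mul, formMatrix_gAt_transpose, mul_assoc,
      mul_assoc, Matrix.mul_nonsing_inv _ (S.det_gAt p), mul_one]
  rw [wickTensor, h1, Matrix.mul_apply]
  rfl

/-- The Wick tensor in the preferred chart at `x`. -/
def wickLoc (x : M) (u : Model m) : Fin (2 * m + 1) → Fin (2 * m + 1) → ℂ :=
  wickTensor (formMatrix (S.gLoc x u)) (formMatrix (S.wLoc x u))

theorem det_frameMap (hu : u ∈ (extChartAt (𝓡 (2 * m + 1)) x).target) :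
    IsUnit (opMatrix (frameMap (m := m) x ((extChartAt (𝓡 (2 * m + 1)) x).symm u))).det := by
  have h : opMatrix (frameMap (m := m) x ((extChartAt (𝓡 (2 * m + 1)) x).symm u)) *
      opMatrix (coframe (m := m) x ((extChartAt (𝓡 (2 * m + 1)) x).symm u)) = 1 := by
    rw [← opMatrix_mul]
    ext i j
    refine (congrArg (fun v : Model m => coord v i)
      (frameMap_coframe ((extChartAt (𝓡 (2 * m + 1)) x).map_target hu) (e j : Model m))).trans ?_
    rw [Matrix.one_apply, e, coord, PiLp.single_apply]
  exact (Matrix.isUnit_iff_isUnit_det _).1 (IsUnit.of_mul_eq_one _ h)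

theorem wick_eq_wickLoc (hu : u ∈ (extChartAt (𝓡 (2 * m + 1)) x).target) (i j : Fin (2 * m + 1)) :
    S.wick ((extChartAt (𝓡 (2 * m + 1)) x).symm u) i j = ∑ a, ∑ b, S.wickLoc x u a b *
      ((coord (frameMap x ((extChartAt (𝓡 (2 * m + 1)) x).symm u) (e a)) i *
        coord (frameMap x ((extChartAt (𝓡 (2 * m + 1)) x).symm u) (e b)) j : ℝ) : ℂ) := by
  rw [wick_eq, wickTensor_change (det_frameMap hu), wickLoc, gLoc, wLoc, formMatrix_comp,
    formMatrix_comp]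
  rfl

theorem gLoc_center (x : M) : S.gLoc x (extChartAt (𝓡 (2 * m + 1)) x x) = S.gAt x := by
  ext a b
  rw [gLoc, ContinuousLinearMap.bilinearComp_apply, extChartAt_to_inv, frameMap_self, frameMap_self]

theorem wLoc_center (x : M) : S.wLoc x (extChartAt (𝓡 (2 * m + 1)) x x) = S.wAt x := by
  ext a b
  rw [wLoc, ContinuousLinearMap.bilinearComp_apply, extChartAt_to_inv, frameMap_self, frameMap_self]

theorem xiLoc_center (x : M) : S.xiLoc x (extChartAt (𝓡 (2 * m + 1)) x x) = S.xiAt x := by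
  rw [xiLoc, extChartAt_to_inv, coframe_self]

theorem wickLoc_center (x : M) : S.wickLoc x (extChartAt (𝓡 (2 * m + 1)) x x) = S.wick x := by
  funext i j
  rw [wickLoc, gLoc_center, wLoc_center, wick_eq]

theorem det_gLoc (hu : u ∈ (extChartAt (𝓡 (2 * m + 1)) x).target) :
    (formMatrix (S.gLoc x u)).det ≠ 0 := by
  refine isUnit_iff_ne_zero.1 ?_
  rw [gLoc, formMatrix_comp, Matrix.det_mul, Matrix.det_mul, Matrix.det_transpose]
  exact ((det_frameMap hu).mul (S.det_gAt _)).mul (det_frameMap hu)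

theorem contDiffOn_formMatrix {w : Model m → Model m →L[ℝ] Model m →L[ℝ] ℝ} {U : Set (Model m)}
    (hw : ContDiffOn ℝ ∞ w U) (i j : Fin (2 * m + 1)) :
    ContDiffOn ℝ ∞ (fun u => formMatrix (w u) i j) U :=
  (hw.clm_apply contDiffOn_const).clm_apply contDiffOn_const

theorem contDiffOn_wickLoc (x : M) (i j : Fin (2 * m + 1)) :
    ContDiffOn ℝ ∞ (fun u => S.wickLoc x u i j) (extChartAt (𝓡 (2 * m + 1)) x).target :=
  contDiffOn_wickTensor (contDiffOn_formMatrix (S.contDiffOn_gLoc x))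
    (contDiffOn_formMatrix (S.contDiffOn_wLoc x)) (fun _ hu => S.det_gLoc hu) i j

theorem derivMatrix_formMatrix {w : Model m → Model m →L[ℝ] Model m →L[ℝ] ℝ}
    {A : Model m →L[ℝ] Model m} {v : Model m}
    (h : ∀ a b, fderiv ℝ (fun u => w u a b) u v = w u (A a) b + w u a (A b)) :
    derivMatrix (fun u => formMatrix (w u)) u v =
      (opMatrix A).transpose * formMatrix (w u) + formMatrix (w u) * opMatrix A := by
  ext i j
  rw [Matrix.add_apply, ← formMatrix_left, ← formMatrix_right]
  exact h (e i) (e j)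

variable {S} {cov : AffineConnection m M}

theorem fderiv_wickLoc (hcov : S.IsContactMetricConnection cov)
    (hu : u ∈ (extChartAt (𝓡 (2 * m + 1)) x).target) (v : Model m) (i j : Fin (2 * m + 1)) :
    fderiv ℝ (fun u => S.wickLoc x u i j) u v +
      ∑ c, ((coord (conn cov x u v (e c)) i : ℝ) : ℂ) * S.wickLoc x u c j +
      ∑ c, ((coord (conn cov x u v (e c)) j : ℝ) : ℂ) * S.wickLoc x u i c = 0 :=
  fderiv_wickTensor (isOpen_extChartAt_target x) (contDiffOn_formMatrix (S.contDiffOn_gLoc x))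
    (contDiffOn_formMatrix (S.contDiffOn_wLoc x)) (fun _ hu => S.det_gLoc hu) hu
    (derivMatrix_formMatrix fun a b => fderiv_gLoc hcov hu v a b)
    (derivMatrix_formMatrix fun a b => fderiv_wLoc hcov hu v a b) i j

variable (S)

theorem wick_sub (p : M) (i j : Fin (2 * m + 1)) : S.wick p i j - S.wick p j i =
    2 * Complex.I *
      ((poissonMatrix (formMatrix (S.gAt p)) (formMatrix (S.wAt p)) i j : ℝ) : ℂ) := by
  rw [wick_eq, wick_eq, wickTensor_sub (S.formMatrix_gAt_transpose p) (S.formMatrix_wAt_transpose p)]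

/-- This is `poissonMatrix_transpose_mul` with φ² = -1 + ξ ⊗ λ. The term in ξ is the degeneracy that
transversality compensates. -/
theorem sum_poissonMatrix_wAt (p : M) (v : Model m) (j : Fin (2 * m + 1)) :
    ∑ i, poissonMatrix (formMatrix (S.gAt p)) (formMatrix (S.wAt p)) i j * S.wAt p (e i) v =
      -coord v j + coord (S.xiAt p) j * S.lamAt p v := by
  have h1 := fun l => congrFun (congrFun (poissonMatrix_transpose_mul (S.formMatrix_gAt_transpose p)
    (S.det_gAt p) (S.formMatrix_wAt p) (S.formMatrix_wAt_transpose p)) j) l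
  simp only [phiAt_phiAt] at h1
  simp only [Matrix.mul_apply, Matrix.transpose_apply] at h1
  have h2 : ∀ i, S.wAt p (e i) v = ∑ l, S.wAt p (e i) (e l) * coord v l := fun i =>
    form_eq_sum_right _ _ _
  simp only [h2, Finset.mul_sum]
  rw [Finset.sum_comm]
  simp only [← mul_assoc, ← Finset.sum_mul]
  have h3 : ∀ l, (∑ i, poissonMatrix (formMatrix (S.gAt p)) (formMatrix (S.wAt p)) i j *
      S.wAt p (e i) (e l)) = -coord (e l) j + coord (S.xiAt p) j * S.lamAt p (e l) := h1
  simp only [h3, add_mul, Finset.sum_add_distrib, mul_assoc, ← Finset.mul_sum, neg_mul,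
    Finset.sum_neg_distrib]
  congr 2
  · rw [Finset.sum_eq_single j]
    · simp [coord, e]
    · intro b _ hb
      simp [coord, e, hb.symm]
    · simp
  · conv_rhs => rw [← sum_coord_smul_e v, map_sum]
    refine Finset.sum_congr rfl fun c _ => ?_
    rw [_root_.map_smul, smul_eq_mul, mul_comm]

variable {S} [T2Space M]

theorem wAt_curv (hcov : S.IsContactMetricConnection cov) (x : M) (v v' a b : Model m) :
    S.wAt x (Sm.curv (conn cov x) (extChartAt (𝓡 (2 * m + 1)) x x) v v' a) b =
      -S.wAt x a (Sm.curv (conn cov x) (extChartAt (𝓡 (2 * m + 1)) x x) v v' b) := by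
  have h := form_curvature (isOpen_extChartAt_target x) (contDiffOn_conn cov hcov.smooth x)
    (S.contDiffOn_wLoc x) (fun u hu => fderiv_wLoc hcov hu) (mem_extChartAt_target x) v v' a b
  rwa [wLoc_center] at h

theorem gAt_curv (hcov : S.IsContactMetricConnection cov) (x : M) (v v' a b : Model m) :
    S.gAt x (Sm.curv (conn cov x) (extChartAt (𝓡 (2 * m + 1)) x x) v v' a) b =
      -S.gAt x a (Sm.curv (conn cov x) (extChartAt (𝓡 (2 * m + 1)) x x) v v' b) := by
  have h := form_curvature (isOpen_extChartAt_target x) (contDiffOn_conn cov hcov.smooth x)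
    (S.contDiffOn_gLoc x) (fun u hu => fderiv_gLoc hcov hu) (mem_extChartAt_target x) v v' a b
  rwa [gLoc_center] at h

/-- Both g and ω are parallel, so the curvature is skew for both, and the second-order contractions
cancel in the bracket with R. -/
theorem sum_wick_curv (hcov : S.IsContactMetricConnection cov) (x : M) (v v' : Model m)
    (j l : Fin (2 * m + 1)) : ∑ i, ∑ k, (S.wick x i j * S.wick x k l - S.wick x j i * S.wick x l k) *
      ((S.wAt x (e i) (Sm.curv (conn cov x) (extChartAt (𝓡 (2 * m + 1)) x x) v v' (e k)) : ℝ) : ℂ) =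
      0 := by
  have hskew : ∀ B : Model m →L[ℝ] Model m →L[ℝ] ℝ, ∀ A : Model m →L[ℝ] Model m,
      (∀ a b, B (A a) b = -B a (A b)) →
        formMatrix B * opMatrix A = -((opMatrix A).transpose * formMatrix B) := by
    intro B A h
    ext i j
    rw [← formMatrix_right, Matrix.neg_apply, ← formMatrix_left, h, neg_neg]
  simp only [formMatrix_right, wick_eq]
  exact sum_wickTensor_comm (S.formMatrix_gAt_transpose x) (S.det_gAt x) (S.formMatrix_wAt x)
    (S.formMatrix_wAt_transpose x) (hskew _ _ (gAt_curv hcov x v v'))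
    (hskew _ _ (wAt_curv hcov x v v')) j l

end ContactMetricStructure

end LocalData

/-! ### The operators on sections, reduced to operators on fibres -/

section Operations

variable {m n p q N : ℕ} {M : Type*} [TopologicalSpace M] [ChartedSpace (Model m) M]
  [IsManifold (𝓡 (2 * m + 1)) ∞ M]

open Sm

theorem Sm.dl_pull (F : Model m →L[ℝ] Model m) (f : Sm m n) : dl (pull F f) = pull F (dl f) := by
  refine Sm.ext fun y => ?_
  rw [pull_apply, dl_apply, dl_apply]
  refine Eq.trans ?_ (dxSum_comp (fderiv ℝ f (F y)).toLinearMap F).symm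
  refine congrArg dxSum (funext fun i => ?_)
  rw [dir_pull]
  rfl

/-- The operator is built from y, λ and ξ only, so it is natural for a linear map that carries ξ' to
ξ when λ is pulled back. -/
theorem Sm.dlInv_pull {F : Model m →L[ℝ] Model m} {lam : Model m →L[ℝ] ℝ} {xi xi' : Model m}
    (hxi : F xi' = xi) (l : ℕ) (f : Sm m (n + 1)) :
    dlInv (lam ∘L F) xi' l (pull F f) = pull F (dlInv lam xi l f) := by
  have h0 : ∀ (v : Model m) {n : ℕ} (α : Alt m (n + 1)),
      inner v (α.compContinuousLinearMap F) = (inner (F v) α).compContinuousLinearMap F := by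
    intro v n α
    ext w
    rw [inner_apply]
    change α (fun i => F ((Fin.cons v w : Fin (n + 1) → Model m) i)) = α (Fin.cons (F v) fun i => F (w i))
    congr 1
    funext i
    refine Fin.cases rfl (fun i => rfl) i
  have h1 : ∀ f : Sm m (n + 1), ins (projL (lam ∘L F) xi') (pull F f) = pull F (ins (projL lam xi) f) := by
    intro f
    refine Sm.ext fun y => ?_
    rw [pull_apply]
    refine (h0 _ _).trans ?_
    rw [projL_apply, map_sub, _root_.map_smul, hxi]
    rfl
  have h2 : ∀ f : Sm m (n + 1), map (lamL (lam ∘L F) xi') (pull F f) = pull F (map (lamL lam xi) f) := by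
    intro f
    refine Sm.ext fun y => ?_
    rw [pull_apply, map_apply, map_apply, lamL_apply, lamL_apply, wedge_comp, pull_apply, h0, hxi]
    rfl
  rw [dlInv_eq, dlInv_eq, h2, ← map_sub, h1, h1, map_add, _root_.map_smul, _root_.map_smul]

theorem Sm.SOn.dl {U : Set (Model m)} (hU : IsOpen U) {f : Model m → Sm m n} (hf : SOn U f) :
    SOn U fun u => dl (f u) := by
  simp only [dl_eq_sum]
  exact SOn.sum fun i _ => SOn.map _ (SOn.dir hU hf _)

theorem Sm.SOn.ins {U : Set (Model m)} {f : Model m → Sm m (n + 1)} (hf : SOn U f)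
    {B : Model m → Model m →L[ℝ] Model m} (hB : ContDiffOn ℝ ∞ B U) :
    SOn U fun u => ins (B u) (f u) := by
  have h1 : ContDiffOn ℝ ∞ (fun z : Model m × Model m => innerCLM (m := m) n (B z.1 z.2))
      (U ×ˢ Set.univ) := (innerCLM n).contDiff.comp_contDiffOn
    ((hB.comp contDiffOn_fst fun _ hz => hz.1).clm_apply contDiffOn_snd)
  exact h1.clm_apply hf

theorem contDiff_oneForm : ContDiff ℝ ∞ (fun α : Model m →L[ℝ] ℝ => (oneForm α : Alt m 1)) := by
  have : (fun α : Model m →L[ℝ] ℝ => (oneForm α : Alt m 1)) = fun α =>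
      ∑ i, (Complex.ofRealCLM (α (e i))) • (dx i : Alt m 1) := funext fun α => oneForm_eq_sum α
  rw [this]
  exact ContDiff.sum fun i _ => ContDiff.fun_smul
    (Complex.ofRealCLM.contDiff.comp (contDiff_id.clm_apply contDiff_const)) contDiff_const

theorem Sm.SOn.map_lamL {U : Set (Model m)} {f : Model m → Sm m (n + 1)} (hf : SOn U f)
    {lam : Model m → Model m →L[ℝ] ℝ} {xi : Model m → Model m} (hlam : ContDiffOn ℝ ∞ lam U)
    (hxi : ContDiffOn ℝ ∞ xi U) : SOn U fun u => Sm.map (lamL (lam u) (xi u)) (f u) := by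
  have h1 : ContDiffOn ℝ ∞ (fun z : Model m × Model m => innerCLM (m := m) n (xi z.1) (f z.1 z.2))
      (U ×ˢ Set.univ) := ((innerCLM n).contDiff.comp_contDiffOn
    (hxi.comp contDiffOn_fst fun _ hz => hz.1)).clm_apply hf
  have h2 : ContDiffOn ℝ ∞ (fun z : Model m × Model m =>
      wedgeCLM (m := m) (Nat.add_comm 1 n) (oneForm (lam z.1))) (U ×ˢ Set.univ) :=
    (wedgeCLM (m := m) (Nat.add_comm 1 n)).contDiff.comp_contDiffOn
      (contDiff_oneForm.comp_contDiffOn (hlam.comp contDiffOn_fst fun _ hz => hz.1))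
  exact h2.clm_apply h1

theorem Sm.SOn.dlInv {U : Set (Model m)} {f : Model m → Sm m (n + 1)} (hf : SOn U f)
    {lam : Model m → Model m →L[ℝ] ℝ} {xi : Model m → Model m} (hlam : ContDiffOn ℝ ∞ lam U)
    (hxi : ContDiffOn ℝ ∞ xi U) (l : ℕ) : SOn U fun u => dlInv (lam u) (xi u) l (f u) := by
  have hB : ContDiffOn ℝ ∞ (fun u => projL (lam u) (xi u)) U :=
    contDiffOn_const.sub (hlam.smulRight hxi)
  have h1 := SOn.map_lamL hf hlam hxi
  simp only [dlInv_eq]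
  exact SOn.add (SOn.smul _ (SOn.ins (SOn.sub hf h1) hB)) (SOn.smul _ (SOn.ins h1 hB))

variable {a b : WForm m M n} {x : M} {k l : ℕ} {u : Model m}

/-- A family of homogeneous polynomials with smooth local expressions is a section. -/
theorem isSection_of_pull {X : M → ℕ → ℕ → Sm m n} (hX : ∀ x k l, a x k l = X x k l)
    (hom : ∀ x k l, Hom l (X x k l)) {f : M → ℕ → ℕ → Model m → Sm m n}
    (hf : ∀ x k l, SOn (extChartAt (𝓡 (2 * m + 1)) x).target (f x k l))
    (h : ∀ x k l, ∀ u ∈ (extChartAt (𝓡 (2 * m + 1)) x).target,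
      pull (frameMap x ((extChartAt (𝓡 (2 * m + 1)) x).symm u))
        (X ((extChartAt (𝓡 (2 * m + 1)) x).symm u) k l) = f x k l u) : IsSection a :=
  isSection_of hX hom fun x k l => ContDiffOn.congr (hf x k l) fun z hz =>
    congrArg (fun s : Sm m n => s z.2) (h x k l z.1 hz.1)

theorem fib_add (ha : IsSection a) (hb : IsSection b) (x : M) :
    fib (a + b) x = fib a x + fib b x := by
  funext k l
  refine fib_eq (funext fun y => ?_)
  exact congrArg₂ (fun s t => s + t) (ha.fib_apply x k l y).symm (hb.fib_apply x k l y).symm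

theorem fib_sub (ha : IsSection a) (hb : IsSection b) (x : M) :
    fib (a - b) x = fib a x - fib b x := by
  funext k l
  refine fib_eq (funext fun y => ?_)
  exact congrArg₂ (fun s t => s - t) (ha.fib_apply x k l y).symm (hb.fib_apply x k l y).symm

theorem fib_smul (c : ℂ) (ha : IsSection a) (x : M) : fib (c • a) x = c • fib a x := by
  funext k l
  refine fib_eq (funext fun y => ?_)
  exact congrArg (fun s => c • s) (ha.fib_apply x k l y).symm

theorem IsSection.add (ha : IsSection a) (hb : IsSection b) : IsSection (a + b) :=
  isSection_of_pull (X := fun x => fib a x + fib b x)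
    (fun x k l => funext fun y => congrArg₂ (fun s t => s + t) (ha.fib_apply x k l y).symm
      (hb.fib_apply x k l y).symm)
    (fun x k l => (ha.hom_fib x k l).add (hb.hom_fib x k l))
    (fun x k l => SOn.add (ha.sOn_loc x k l) (hb.sOn_loc x k l)) fun _ _ _ _ _ => map_add _ _ _

theorem IsSection.smul (c : ℂ) (ha : IsSection a) : IsSection (c • a) :=
  isSection_of_pull (X := fun x => c • fib a x)
    (fun x k l => funext fun y => congrArg (fun s => c • s) (ha.fib_apply x k l y).symm)
    (fun x k l => (ha.hom_fib x k l).smul c)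
    (fun x k l => SOn.smul c (ha.sOn_loc x k l)) fun _ _ _ _ _ => (pull _).map_smul c _

theorem IsSection.sub (ha : IsSection a) (hb : IsSection b) : IsSection (a - b) := by
  have := ha.add (hb.smul (-1))
  rwa [neg_one_smul, ← sub_eq_add_neg] at this

theorem isSection_zero : IsSection (0 : WForm m M n) :=
  isSection_of_pull (X := fun _ _ _ => 0) (fun _ _ _ => rfl) (fun _ _ l => hom_zero l)
    (f := fun _ _ _ _ => 0) (fun _ _ _ => SOn.const 0) fun _ _ _ _ _ => map_zero _

theorem IsSection.divNu (ha : IsSection a) : IsSection (divNu a) where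
  polynomial x k := ha.polynomial x (k + 1)
  smooth x k := ha.smooth x (k + 1)

omit [TopologicalSpace M] [ChartedSpace (Model m) M] [IsManifold (𝓡 (2 * m + 1)) ∞ M] in
theorem fib_divNu (a : WForm m M n) (x : M) : fib (divNu a) x = dn (fib a x) := rfl

theorem IsSection.delta_eq (ha : IsSection a) (x : M) (k l : ℕ) :
    delta a x k l = dl (fib a x k (l + 1)) := by
  funext y
  rw [dl_apply, dxSum_apply, delta]
  simp only [dir_apply, ha.coe_fib]

theorem IsSection.fib_delta (ha : IsSection a) (x : M) (k l : ℕ) :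
    fib (delta a) x k l = dl (fib a x k (l + 1)) := fib_eq (ha.delta_eq x k l)

theorem IsSection.delta (ha : IsSection a) : IsSection (delta a) :=
  isSection_of_pull (fun x k l => ha.delta_eq x k l) (fun x k l => (ha.hom_fib x k (l + 1)).dl)
    (fun x k l => SOn.dl (isOpen_extChartAt_target x) (ha.sOn_loc x k (l + 1)))
    fun _ _ _ _ _ => (dl_pull _ _).symm

namespace ContactMetricStructure

variable (S : ContactMetricStructure m M)

theorem deltaInv_eq {a : WForm m M (n + 1)} (ha : IsSection a) (x : M) (k l : ℕ) :
    S.deltaInv a x k (l + 1) = dlInv (S.lamAt x) (S.xiAt x) l (fib a x k l) := by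
  funext y
  change _ = ((l : ℂ) + n + 1)⁻¹ • inner (projL (S.lamAt x) (S.xiAt x) y)
      (fib a x k l y - lamL (S.lamAt x) (S.xiAt x) (fib a x k l y))
    + ((l : ℂ) + n)⁻¹ • inner (projL (S.lamAt x) (S.xiAt x) y)
      (lamL (S.lamAt x) (S.xiAt x) (fib a x k l y))
  rw [ha.fib_apply]
  rfl

theorem fib_deltaInv {a : WForm m M (n + 1)} (ha : IsSection a) (x : M) (k l : ℕ) :
    fib (S.deltaInv a) x k (l + 1) = dlInv (S.lamAt x) (S.xiAt x) l (fib a x k l) :=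
  fib_eq (S.deltaInv_eq ha x k l)

theorem fib_deltaInv_zero (a : WForm m M (n + 1)) (x : M) (k : ℕ) :
    fib (S.deltaInv a) x k 0 = 0 := fib_eq rfl

theorem isSection_deltaInv {a : WForm m M (n + 1)} (ha : IsSection a) : IsSection (S.deltaInv a) := by
  refine isSection_of_pull (X := fun x k l => match l with
      | 0 => 0
      | l + 1 => dlInv (S.lamAt x) (S.xiAt x) l (fib a x k l))
    (f := fun x k l u => match l with
      | 0 => 0
      | l + 1 => dlInv (S.lamLoc x u) (S.xiLoc x u) l (loc a x k l u)) ?_ ?_ ?_ ?_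
  · rintro x k (_ | l)
    · rfl
    · exact S.deltaInv_eq ha x k l
  · rintro x k (_ | l)
    · exact hom_zero 0
    · exact (ha.hom_fib x k l).dlInv l
  · rintro x k (_ | l)
    · exact SOn.const 0
    · exact SOn.dlInv (ha.sOn_loc x k l) (S.contDiffOn_lamLoc x) (S.contDiffOn_xiLoc x) l
  · rintro x k (_ | l) u hu
    · exact map_zero _
    · exact (dlInv_pull (frameMap_xiLoc hu) l _).symm

/-- Homogeneity matches the index ranges, and `star_apply_eq_sum` matches the contractions; from
here on the product is handled fibre by fibre. -/
theorem circ_eq (hN : p + q = N) {a : WForm m M p} {b : WForm m M q} (ha : IsSection a)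
    (hb : IsSection b) (x : M) (k l : ℕ) :
    S.circ hN a b x k l = Sm.circ (S.wick x) hN (fib a x) (fib b x) k l := by
  funext y
  rw [Sm.circ_eq _ _ (ha.hom_fib x) (hb.hom_fib x)]
  simp only [Sm.sum_apply, Sm.smul_apply, star_apply_eq_sum, Finset.smul_sum, smul_smul, ha.coe_fib,
    hb.coe_fib]
  rfl

theorem fib_circ (hN : p + q = N) {a : WForm m M p} {b : WForm m M q} (ha : IsSection a)
    (hb : IsSection b) (x : M) :
    fib (S.circ hN a b) x = Sm.circ (S.wick x) hN (fib a x) (fib b x) :=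
  funext fun k => funext fun l => fib_eq (S.circ_eq hN ha hb x k l)

theorem loc_circ (hN : p + q = N) {a : WForm m M p} {b : WForm m M q} (ha : IsSection a)
    (hb : IsSection b) (k l : ℕ) (hu : u ∈ (extChartAt (𝓡 (2 * m + 1)) x).target) :
    loc (S.circ hN a b) x k l u = Sm.circ (S.wickLoc x u) hN (fun k l => loc a x k l u)
      (fun k l => loc b x k l u) k l := by
  rw [loc, S.fib_circ hN ha hb]
  exact pull_circ hN _ _ _ (S.wick_eq_wickLoc hu) _ _ k l

theorem isSection_circ (hN : p + q = N) {a : WForm m M p} {b : WForm m M q} (ha : IsSection a)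
    (hb : IsSection b) : IsSection (S.circ hN a b) :=
  isSection_of_pull (S.circ_eq hN ha hb)
    (fun x => hom_circ _ _ (ha.hom_fib x) (hb.hom_fib x))
    (f := fun x k l u => Sm.circ (S.wickLoc x u) hN (fun k l => loc a x k l u)
      (fun k l => loc b x k l u) k l)
    (fun x k l => SOn.circ (isOpen_extChartAt_target x) (S.contDiffOn_wickLoc x) hN
      (fun k l => ha.sOn_loc x k l) (fun k l => hb.sOn_loc x k l) k l)
    fun _ k l _ hu => pull_circ hN _ _ _ (S.wick_eq_wickLoc hu) _ _ k l

theorem isSection_comm {r : WForm m M 1} (hr : IsSection r) (ha : IsSection a) :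
    IsSection (S.comm r a) :=
  (S.isSection_circ _ hr ha).sub ((S.isSection_circ _ ha hr).smul _)

theorem fib_comm {r : WForm m M 1} (hr : IsSection r) (ha : IsSection a) (x : M) :
    fib (S.comm r a) x = gcomm (S.wick x) (Nat.add_comm 1 n) rfl (fib r x) (fib a x) := by
  rw [comm, fib_sub (S.isSection_circ _ hr ha) ((S.isSection_circ _ ha hr).smul _),
    fib_smul _ (S.isSection_circ _ ha hr), S.fib_circ _ hr ha, S.fib_circ _ ha hr, gcomm_def, one_mul]

/-- The bracket `(i/ν) [r, ·]` with a one-form. -/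
def bracket (r : WForm m M 1) (a : WForm m M n) : WForm m M (n + 1) :=
  Complex.I • divNu (S.comm r a)

theorem isSection_bracket {r : WForm m M 1} (hr : IsSection r) (ha : IsSection a) :
    IsSection (S.bracket r a) := (S.isSection_comm hr ha).divNu.smul _

theorem fib_bracket {r : WForm m M 1} (hr : IsSection r) (ha : IsSection a) (x : M) :
    fib (S.bracket r a) x = br (S.wick x) (Nat.add_comm 1 n) rfl (fib r x) (fib a x) := by
  rw [bracket, fib_smul _ (S.isSection_comm hr ha).divNu, fib_divNu, S.fib_comm hr ha]
  rfl

theorem isSection_rr {r : WForm m M 1} (hr : IsSection r) : IsSection (S.rr r) :=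
  (S.isSection_circ _ hr hr).divNu.smul _

theorem fib_rr {r : WForm m M 1} (hr : IsSection r) (x : M) :
    fib (S.rr r) x = sq (S.wick x) (fib r x) := by
  rw [rr, fib_smul _ (S.isSection_circ _ hr hr).divNu, fib_divNu, S.fib_circ _ hr hr]
  rfl

end ContactMetricStructure

section Nabla

variable {cov : AffineConnection m M}

theorem loc_add (ha : IsSection a) (hb : IsSection b) (x : M) (k l : ℕ) :
    loc (a + b) x k l = fun u => loc a x k l u + loc b x k l u := by
  funext u
  rw [loc, fib_add ha hb]
  exact map_add _ _ _

theorem loc_smul (c : ℂ) (ha : IsSection a) (x : M) (k l : ℕ) :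
    loc (c • a) x k l = fun u => c • loc a x k l u := by
  funext u
  rw [loc, fib_smul c ha]
  exact (pull _).map_smul c _

theorem fib_dNabla_add (ha : IsSection a) (hb : IsSection b) (x : M) :
    fib (dNabla cov (a + b)) x = fib (dNabla cov a) x + fib (dNabla cov b) x := by
  funext k l
  rw [fib_dNabla cov (ha.add hb), loc_add ha hb, nabla_add (isOpen_extChartAt_target x)
    (ha.sOn_loc x k l) (hb.sOn_loc x k l) (mem_extChartAt_target x), ← fib_dNabla cov ha,
    ← fib_dNabla cov hb]
  rfl

theorem fib_dNabla_smul (c : ℂ) (ha : IsSection a) (x : M) :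
    fib (dNabla cov (c • a)) x = c • fib (dNabla cov a) x := by
  funext k l
  rw [fib_dNabla cov (ha.smul c), loc_smul c ha, nabla_smul (isOpen_extChartAt_target x) c
    (ha.sOn_loc x k l) (mem_extChartAt_target x), ← fib_dNabla cov ha]
  rfl

theorem fib_dNabla_sub (ha : IsSection a) (hb : IsSection b) (x : M) :
    fib (dNabla cov (a - b)) x = fib (dNabla cov a) x - fib (dNabla cov b) x := by
  rw [sub_eq_add_neg a, ← neg_one_smul ℂ b, fib_dNabla_add ha (hb.smul _), fib_dNabla_smul _ hb,
    neg_one_smul, ← sub_eq_add_neg]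

theorem dNabla_divNu (a : WForm m M n) : dNabla cov (divNu a) = divNu (dNabla cov a) := rfl

variable {S : ContactMetricStructure m M}

/-- The product is written in one chart around x, where the Wick tensor is parallel, so that d_∇
acts as a graded derivation. -/
theorem fib_dNabla_circ (hcov : S.IsContactMetricConnection cov) (hN : p + q = N)
    (hl : p + 1 + q = N + 1) (hr : p + (q + 1) = N + 1)
    {a : WForm m M p} {b : WForm m M q} (ha : IsSection a) (hb : IsSection b) (x : M) :
    fib (dNabla cov (S.circ hN a b)) x = Sm.circ (S.wick x) hl (fib (dNabla cov a) x) (fib b x) +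
      (-1 : ℂ) ^ p • Sm.circ (S.wick x) hr (fib a x) (fib (dNabla cov b) x) := by
  funext k l
  have hx := mem_extChartAt_target (I := 𝓡 (2 * m + 1)) x
  have hU := isOpen_extChartAt_target (I := 𝓡 (2 * m + 1)) x
  have h1 : loc (S.circ hN a b) x k l =ᶠ[𝓝 (extChartAt (𝓡 (2 * m + 1)) x x)]
      fun u => Sm.circ (S.wickLoc x u) hN (fun k l => loc a x k l u) (fun k l => loc b x k l u) k l := by
    filter_upwards [hU.mem_nhds hx] with u hu
    exact S.loc_circ hN ha hb k l hu
  rw [fib_dNabla cov (S.isSection_circ hN ha hb), nabla_congr h1,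
    nabla_circ hU (S.contDiffOn_wickLoc x) (fun u hu => ContactMetricStructure.fderiv_wickLoc hcov hu)
      hN hl hr (fun k l => ha.sOn_loc x k l) (fun k l => hb.sOn_loc x k l) hx,
    S.wickLoc_center]
  have ea : (fun k l => nabla (conn cov x) (fun u => loc a x k l u)
      (extChartAt (𝓡 (2 * m + 1)) x x)) = fib (dNabla cov a) x :=
    funext fun k => funext fun l => (fib_dNabla cov ha x k l).symm
  have eb : (fun k l => nabla (conn cov x) (fun u => loc b x k l u)
      (extChartAt (𝓡 (2 * m + 1)) x x)) = fib (dNabla cov b) x :=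
    funext fun k => funext fun l => (fib_dNabla cov hb x k l).symm
  have ea' : (fun k l => loc a x k l (extChartAt (𝓡 (2 * m + 1)) x x)) = fib a x :=
    funext fun k => funext fun l => loc_center a x k l
  have eb' : (fun k l => loc b x k l (extChartAt (𝓡 (2 * m + 1)) x x)) = fib b x :=
    funext fun k => funext fun l => loc_center b x k l
  rw [ea, eb, ea', eb']
  rfl

/-- The exterior covariant derivative is a graded derivation of the bracket. -/
theorem fib_dNabla_bracket (hcov : S.IsContactMetricConnection cov) {r : WForm m M 1}
    (hr : IsSection r) (ha : IsSection a) (h2 : 2 + n = n + 2) (h2' : n + 2 = n + 2)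
    (h1 : 1 + (n + 1) = n + 2) (h1' : n + 1 + 1 = n + 2) (x : M) :
    fib (dNabla cov (S.bracket r a)) x =
      br (S.wick x) h2 h2' (fib (dNabla cov r) x) (fib a x) -
        br (S.wick x) h1 h1' (fib r x) (fib (dNabla cov a) x) := by
  have e1 : fib (dNabla cov (S.comm r a)) x =
      gcomm (S.wick x) h2 h2' (fib (dNabla cov r) x) (fib a x) -
        gcomm (S.wick x) h1 h1' (fib r x) (fib (dNabla cov a) x) := by
    rw [ContactMetricStructure.comm, fib_dNabla_sub (S.isSection_circ _ hr ha)
      ((S.isSection_circ _ ha hr).smul _), fib_dNabla_smul _ (S.isSection_circ _ ha hr),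
      fib_dNabla_circ hcov _ h2 h1 hr ha, fib_dNabla_circ hcov _ h1' h2' ha hr, gcomm_def, gcomm_def]
    have s1 : (-1 : ℂ) ^ (2 * n) = 1 := Even.neg_one_pow ⟨n, by ring⟩
    have s2 : (-1 : ℂ) ^ n * (-1 : ℂ) ^ n = 1 := by
      rw [← pow_add]
      exact Even.neg_one_pow ⟨n, rfl⟩
    have s3 : (-1 : ℂ) ^ (1 * (n + 1)) = -(-1 : ℂ) ^ n := by rw [one_mul, pow_succ, mul_neg_one]
    rw [s1, s3, pow_one, smul_add, smul_smul, s2]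
    module
  rw [ContactMetricStructure.bracket, fib_dNabla_smul _ (S.isSection_comm hr ha).divNu, dNabla_divNu,
    fib_divNu, e1]
  exact smul_sub _ _ _

/-- The exterior covariant derivative of `(i/ν) r ∘ r`. -/
theorem fib_dNabla_rr (hcov : S.IsContactMetricConnection cov) {r : WForm m M 1}
    (hr : IsSection r) (x : M) : fib (dNabla cov (S.rr r)) x =
      br (p := 2) (q := 1) (S.wick x) rfl rfl (fib (dNabla cov r) x) (fib r x) := by
  rw [ContactMetricStructure.rr, fib_dNabla_smul _ (S.isSection_circ _ hr hr).divNu, dNabla_divNu,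
    fib_divNu, fib_dNabla_circ (p := 1) (q := 1) (N := 2) hcov rfl rfl rfl hr hr, br, gcomm_def, pow_one]
  norm_num
  rw [← sub_eq_add_neg]

end Nabla

end Operations

/-! ### Two-forms from bilinear maps, and the torsion in a chart -/

section SpecialForms

variable {m n : ℕ} {M : Type*} [TopologicalSpace M] [ChartedSpace (Model m) M]
  [IsManifold (𝓡 (2 * m + 1)) ∞ M]

open Sm

namespace Sm

variable {U : Set (Model m)} {u : Model m}

theorem pull_single (F : Model m →L[ℝ] Model m) (L : ℕ) (f : Sm m n) (k l : ℕ) :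
    pull F (single L f k l) = single L (pull F f) k l := by
  rw [single, single]
  split_ifs
  · rfl
  · exact map_zero _

theorem SOn.single {f : Model m → Sm m n} (hf : SOn U f) (L k l : ℕ) :
    SOn U fun u => single L (f u) k l := by
  by_cases h : k = 0 ∧ l = L
  · simp only [Sm.single, if_pos h]
    exact hf
  · simp only [Sm.single, if_neg h]
    exact SOn.const 0

/-- A form on a vector space, as a form-valued function that is constant. -/
def constForm (α : Alt m n) : Sm m n where
  val _ := α
  property := show ContDiff ℝ ∞ (fun _ => α) from contDiff_const

theorem vert_constForm (B : Model m →L[ℝ] Model m) (α : Alt m n) : vert B (constForm α) = 0 := by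
  refine Sm.ext fun y => ?_
  rw [vert_apply]
  exact congrArg (fun L => L (B y)) (fderiv_const_apply (𝕜 := ℝ) (x := y) α)

theorem hom_constForm (α : Alt m n) : Hom 0 (constForm α) := by
  intro t y
  rw [pow_zero, one_smul]
  rfl

theorem nabla_zero {Γ : Model m → Model m →L[ℝ] Model m →L[ℝ] Model m} (hU : IsOpen U) (hu : u ∈ U) :
    nabla Γ (fun _ => (0 : Sm m n)) u = 0 := by
  have h := nabla_smul hU (Γ := Γ) (0 : ℂ) (SOn.const (U := U) (0 : Sm m n)) hu
  simpa using h

theorem dl_linearForm (w : Model m →L[ℝ] Model m →L[ℝ] ℝ) (y : Model m) :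
    dl (linearForm w) y = ∑ i, ∑ j, ((w (e i) (e j) : ℝ) : ℂ) • wedge rfl (dx i) (dx j) := by
  rw [dl_apply, dxSum_apply]
  refine Finset.sum_congr rfl fun i _ => ?_
  rw [dir_linearForm, oneForm_eq_sum, wedge_sum]
  exact Finset.sum_congr rfl fun j _ => wedge_smul_right _ _ _ _

/-- For fixed last argument the curvature is a bilinear map. -/
theorem exists_curv_eq {Γ : Model m → Model m →L[ℝ] Model m →L[ℝ] Model m} (hU : IsOpen U)
    (hΓ : ContDiffOn ℝ ∞ Γ U) (hu : u ∈ U) (y : Model m) :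
    ∃ C : Model m →L[ℝ] Model m →L[ℝ] Model m, ∀ v w, C v w = curv Γ u v w y := by
  have hn := hU.mem_nhds hu
  have h1 : ContDiffOn ℝ ∞ (fun u => (Γ u).flip y) U := contDiffOn_clm_apply.2 fun w =>
    (hΓ.clm_apply contDiffOn_const).clm_apply contDiffOn_const
  have d1 := ((h1.contDiffAt hn).differentiableAt (by simp)).hasFDerivAt
  have d2 : ∀ w, HasFDerivAt (fun u => Γ u w) (fderiv ℝ (fun u => Γ u w) u) u := fun w =>
    (((hΓ.clm_apply contDiffOn_const).contDiffAt hn).differentiableAt (by simp)).hasFDerivAt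
  have h2 : ∀ v w, fderiv ℝ (fun u => (Γ u).flip y) u v w = fderiv ℝ (fun u => Γ u w) u v y := by
    intro v w
    have e1 := (HasFDerivAt.clm_apply_const d1 w).fderiv
    have e2 := (HasFDerivAt.clm_apply_const (d2 w) y).fderiv
    exact congrArg (fun L => L v) (e1.symm.trans e2)
  refine ⟨fderiv ℝ (fun u => (Γ u).flip y) u - (fderiv ℝ (fun u => (Γ u).flip y) u).flip +
    (Γ u).bilinearComp (ContinuousLinearMap.id ℝ _) ((Γ u).flip y) -
    ((Γ u).bilinearComp (ContinuousLinearMap.id ℝ _) ((Γ u).flip y)).flip, fun v w => ?_⟩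
  simp only [curv, curvature, _root_.sub_apply, _root_.add_apply, mul_apply_eq_comp,
    ContinuousLinearMap.flip_apply, ContinuousLinearMap.bilinearComp_apply, ContinuousLinearMap.id_apply,
    ← h2]

theorem sum_form_wedge (B : Model m →L[ℝ] Model m →L[ℝ] ℝ) :
    ∑ i, ∑ j, ((B (e i) (e j) : ℝ) : ℂ) • (wedge rfl (dx i) (dx j) : Alt m 2) =
      dxSum fun i => oneForm (B (e i)) := by
  rw [dxSum_apply]
  refine Finset.sum_congr rfl fun i _ => ?_
  rw [oneForm_eq_sum, wedge_sum]
  exact Finset.sum_congr rfl fun j _ => (wedge_smul_right _ _ _ _).symm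

theorem dxSum_oneForm_antisymm (B : Model m →L[ℝ] Model m →L[ℝ] ℝ) :
    (dxSum fun i => oneForm (B (e i)) : Alt m 2) = (1 / 2 : ℂ) • ∑ i, ∑ j,
      ((B (e i) (e j) - B (e j) (e i) : ℝ) : ℂ) • wedge rfl (dx i) (dx j) := by
  have h1 : ∑ i, ∑ j, ((B (e j) (e i) : ℝ) : ℂ) • wedge rfl (dx i) (dx j) =
      -∑ i, ∑ j, ((B (e i) (e j) : ℝ) : ℂ) • (wedge rfl (dx i) (dx j) : Alt m 2) := by
    rw [Finset.sum_comm, ← Finset.sum_neg_distrib]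
    refine Finset.sum_congr rfl fun i _ => ?_
    rw [← Finset.sum_neg_distrib]
    refine Finset.sum_congr rfl fun j _ => ?_
    rw [wedge_one_anticomm, smul_neg]
  simp only [Complex.ofReal_sub, sub_smul, Finset.sum_sub_distrib]
  rw [h1, sub_neg_eq_add, smul_add, ← add_smul, sum_form_wedge]
  norm_num

/-- Two-forms with coefficients given by a bilinear map are natural. -/
theorem sum_form_wedge_comp (B : Model m →L[ℝ] Model m →L[ℝ] ℝ) (F : Model m →L[ℝ] Model m) :
    (∑ i, ∑ j, ((B (e i) (e j) : ℝ) : ℂ) • (wedge rfl (dx i) (dx j) : Alt m 2)).compContinuousLinearMap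
      F = ∑ i, ∑ j, ((B (F (e i)) (F (e j)) : ℝ) : ℂ) • wedge rfl (dx i) (dx j) := by
  have h := dxSum_comp (m := m) (n := 1)
    { toFun := fun v => oneForm (B v)
      map_add' := fun v w => by
        simp only [oneForm_eq_sum, map_add, _root_.add_apply, Complex.ofReal_add, add_smul,
          Finset.sum_add_distrib]
      map_smul' := fun c w => by
        simp only [oneForm_eq_sum, _root_.map_smul, _root_.smul_apply, smul_eq_mul,
          Complex.ofReal_mul, mul_smul, Finset.smul_sum]
        rfl } F
  have h' := sum_form_wedge (B.bilinearComp F F)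
  rw [sum_form_wedge]
  exact h.trans h'.symm

end Sm

variable {cov : AffineConnection m M} {a b : WForm m M n} {x : M} {k l : ℕ}

/-- Pulled back to the chart, coordinate fields are constant near the centre, so their Lie bracket
is zero. -/
theorem mlieBracket_coordField (x : M) (i j : Fin (2 * m + 1)) :
    VectorField.mlieBracket (𝓡 (2 * m + 1)) (coordField x i) (coordField x j) x = 0 := by
  have h : ∀ i, VectorField.mpullbackWithin 𝓘(ℝ, Model m) (𝓡 (2 * m + 1))
      (extChartAt (𝓡 (2 * m + 1)) x).symm (coordField x i) (Set.range (𝓡 (2 * m + 1)))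
      =ᶠ[𝓝 (extChartAt (𝓡 (2 * m + 1)) x x)] fun _ => (e i : Model m) := by
    intro i
    filter_upwards [(isOpen_extChartAt_target (I := 𝓡 (2 * m + 1)) x).mem_nhds
      (mem_extChartAt_target (I := 𝓡 (2 * m + 1)) x)] with u hu
    have hp := (extChartAt (𝓡 (2 * m + 1)) x).map_target hu
    have h1 := frameMap_eq_mfderiv (m := m) hp
    rw [(extChartAt (𝓡 (2 * m + 1)) x).right_inv hu] at h1
    have h2 := isInvertible_mfderivWithin_extChartAt_symm (I := 𝓡 (2 * m + 1)) hu
    rw [VectorField.mpullbackWithin_apply]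
    rw [ModelWithCorners.range_eq_univ, mfderivWithin_univ] at h2 ⊢
    have h3 : coordField x i ((extChartAt (𝓡 (2 * m + 1)) x).symm u) =
        mfderiv 𝓘(ℝ, Model m) (𝓡 (2 * m + 1)) (extChartAt (𝓡 (2 * m + 1)) x).symm u (e i : Model m) := by
      rw [← h1]
      rfl
    rw [h3]
    exact h2.inverse_apply_self _
  rw [← VectorField.mlieBracketWithin_univ, VectorField.mlieBracketWithin_apply]
  have h0 : VectorField.lieBracketWithin ℝ
      (VectorField.mpullbackWithin 𝓘(ℝ, Model m) (𝓡 (2 * m + 1))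
        (extChartAt (𝓡 (2 * m + 1)) x).symm (coordField x i) (Set.range (𝓡 (2 * m + 1))))
      (VectorField.mpullbackWithin 𝓘(ℝ, Model m) (𝓡 (2 * m + 1))
        (extChartAt (𝓡 (2 * m + 1)) x).symm (coordField x j) (Set.range (𝓡 (2 * m + 1))))
      ((extChartAt (𝓡 (2 * m + 1)) x).symm ⁻¹' Set.univ ∩ Set.range (𝓡 (2 * m + 1)))
      (extChartAt (𝓡 (2 * m + 1)) x x) = 0 := by
    refine ((h i).lieBracketWithin_vectorField_eq_nhds (h j)).trans ?_
    simp [VectorField.lieBracketWithin]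
  exact (congrArg _ h0).trans (map_zero _)

theorem conn_center_e (cov : AffineConnection m M) (x : M) (v : Model m) (j : Fin (2 * m + 1)) :
    conn cov x (extChartAt (𝓡 (2 * m + 1)) x x) v (e j) = cov (coordField x j) x v := by
  rw [conn_center, Finset.sum_eq_single j]
  · simp only [coord, e, PiLp.single_apply, if_pos, one_smul]
    rfl
  · intro b _ hb
    simp [coord, e, hb]
  · simp

/-- Coordinate fields commute, and therefore the torsion is the antisymmetric part of Γ. -/
theorem torsion_center (cov : AffineConnection m M) (x : M) (i j : Fin (2 * m + 1)) :
    (cov.torsion x (e i : Model m) (e j : Model m) : Model m) =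
      conn cov x (extChartAt (𝓡 (2 * m + 1)) x x) (e i) (e j) -
        conn cov x (extChartAt (𝓡 (2 * m + 1)) x x) (e j) (e i) := by
  have hx := mem_extChartAt_source (I := 𝓡 (2 * m + 1)) x
  have h := cov.torsion_apply (diffAt_coordField hx i) (diffAt_coordField hx j)
  have hc : ∀ i, coordField x i x = (e i : Model m) := fun i => frameMap_self x _
  rw [mlieBracket_coordField, hc, hc, sub_zero] at h
  rw [conn_center_e, conn_center_e]
  exact h

end SpecialForms

/-! ### The solder form, the contact form, ω and T as sections -/

section SpecialSections

variable {m n : ℕ} {M : Type*} [TopologicalSpace M] [ChartedSpace (Model m) M]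
  [IsManifold (𝓡 (2 * m + 1)) ∞ M]

open Sm

variable {cov : AffineConnection m M} {a b : WForm m M n} {x : M} {k l : ℕ} {u : Model m}

theorem fib_dNabla_eq (ha : IsSection a) {f : Model m → Sm m n}
    (h : ∀ u ∈ (extChartAt (𝓡 (2 * m + 1)) x).target, loc a x k l u = f u) :
    fib (dNabla cov a) x k l = nabla (conn cov x) f (extChartAt (𝓡 (2 * m + 1)) x x) := by
  rw [fib_dNabla cov ha]
  refine nabla_congr ?_
  filter_upwards [(isOpen_extChartAt_target (I := 𝓡 (2 * m + 1)) x).mem_nhds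
    (mem_extChartAt_target (I := 𝓡 (2 * m + 1)) x)] with u hu
  exact h u hu

theorem fib_dNabla_dNabla [T2Space M]
    (hcov : CovariantDerivative.ContMDiffCovariantDerivative cov ∞) (ha : IsSection a) (x : M)
    (k l : ℕ) : fib (dNabla cov (dNabla cov a)) x k l =
      (-1 / 2 : ℂ) • ∑ i, ∑ j, map (wedgeL (Nat.add_comm 2 n) (wedge rfl (dx i) (dx j)))
        (vert (curv (conn cov x) (extChartAt (𝓡 (2 * m + 1)) x x) (e i) (e j)) (fib a x k l)) := by
  rw [fib_dNabla_eq (ha.dNabla hcov) fun u hu => loc_dNabla cov ha k l hu,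
    nabla_nabla (isOpen_extChartAt_target x) (contDiffOn_conn cov hcov x) (ha.sOn_loc x k l)
      (mem_extChartAt_target x), loc_center]

/-- The section with a single component, of order zero in the formal parameter. -/
def singleForm (L : ℕ) (f : M → Sm m n) : WForm m M n := fun x k l => single L (f x) k l

omit [TopologicalSpace M] [ChartedSpace (Model m) M] [IsManifold (𝓡 (2 * m + 1)) ∞ M] in
theorem fib_singleForm (L : ℕ) (f : M → Sm m n) (x : M) : fib (singleForm L f) x = single L (f x) :=
  funext fun _ => funext fun _ => fib_eq rfl

section

variable {L : ℕ} {f : M → Sm m n} {g : M → Model m → Sm m n}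

theorem isSection_singleForm (hom : ∀ x, Hom L (f x))
    (hg : ∀ x, SOn (extChartAt (𝓡 (2 * m + 1)) x).target (g x))
    (h : ∀ x, ∀ u ∈ (extChartAt (𝓡 (2 * m + 1)) x).target,
      pull (frameMap x ((extChartAt (𝓡 (2 * m + 1)) x).symm u))
        (f ((extChartAt (𝓡 (2 * m + 1)) x).symm u)) = g x u) : IsSection (singleForm L f) :=
  isSection_of_pull (X := fun x => single L (f x)) (fun _ _ _ => rfl)
    (fun x => Hom.single (hom x)) (f := fun x k l u => single L (g x u) k l)
    (fun x k l => SOn.single (hg x) L k l) fun x k l u hu => by rw [pull_single, h x u hu]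

theorem fib_dNabla_singleForm (hs : IsSection (singleForm L f))
    (h : ∀ u ∈ (extChartAt (𝓡 (2 * m + 1)) x).target,
      pull (frameMap x ((extChartAt (𝓡 (2 * m + 1)) x).symm u))
        (f ((extChartAt (𝓡 (2 * m + 1)) x).symm u)) = g x u) :
    fib (dNabla cov (singleForm L f)) x =
      single L (nabla (conn cov x) (g x) (extChartAt (𝓡 (2 * m + 1)) x x)) := by
  funext k l
  rw [fib_dNabla_eq hs (f := fun u => single L (g x u) k l) fun u hu => by
    rw [loc, fib_singleForm, pull_single, h u hu]]
  by_cases hkl : k = 0 ∧ l = L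
  · simp only [single, if_pos hkl]
  · simp only [single, if_neg hkl]
    exact nabla_zero (isOpen_extChartAt_target x) (mem_extChartAt_target x)

end

namespace ContactMetricStructure

variable (S : ContactMetricStructure m M)

/-- The solder form `ω_{ij} yⁱ dxʲ`. -/
def solder : WForm m M 1 := singleForm 1 fun x => linearForm (S.wAt x)

theorem isSection_solder : IsSection S.solder :=
  isSection_singleForm (fun _ => hom_linearForm _) (fun x => SOn.linearForm (S.contDiffOn_wLoc x))
    fun _ _ _ => rfl

theorem fib_solder (x : M) : fib S.solder x = single 1 (linearForm (S.wAt x)) := fib_singleForm _ _ x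

/-- The contact form, as a section. -/
def lamForm : WForm m M 1 := singleForm 0 fun x => constForm (oneForm (S.lamAt x))

theorem isSection_lamForm : IsSection S.lamForm :=
  isSection_singleForm (fun _ => hom_constForm _)
    (g := fun x u => constForm (oneForm (S.lamLoc x u)))
    (fun x => contDiff_oneForm.comp_contDiffOn ((S.contDiffOn_lamLoc x).comp contDiffOn_fst
      fun _ hz => hz.1)) fun _ _ _ => rfl

theorem wAt_eq_fderiv (x : M) (v w : Model m) : S.wAt x v w =
    fderiv ℝ (S.lamLoc x) (extChartAt (𝓡 (2 * m + 1)) x x) v w -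
      fderiv ℝ (S.lamLoc x) (extChartAt (𝓡 (2 * m + 1)) x x) w v := by
  have hd := (((S.contDiffOn_lamLoc x).contDiffAt ((isOpen_extChartAt_target x).mem_nhds
    (mem_extChartAt_target x))).differentiableAt (by simp)).hasFDerivAt
  have h1 := ((ContinuousAlternatingMap.ofSubsingletonLIE (𝕜 := ℝ) (E := Model m) (F := ℝ)
    (0 : Fin 1)).toContinuousLinearEquiv.toContinuousLinearMap.hasFDerivAt.comp _ hd).fderiv
  have h2 : extDeriv (fun u => ContinuousAlternatingMap.ofSubsingleton ℝ (Model m) ℝ (0 : Fin 1)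
      (S.lamLoc x u)) (extChartAt (𝓡 (2 * m + 1)) x x) ![v, w] =
      fderiv ℝ (S.lamLoc x) (extChartAt (𝓡 (2 * m + 1)) x x) v w -
        fderiv ℝ (S.lamLoc x) (extChartAt (𝓡 (2 * m + 1)) x x) w v := by
    rw [extDeriv, ContinuousAlternatingMap.alternatizeUncurryFin_apply, Fin.sum_univ_two]
    refine (congrArg₂ (fun s t => (-1 : ℤ) ^ 0 • s + (-1 : ℤ) ^ 1 • t)
      (congrArg (fun L => L v (Fin.removeNth 0 ![v, w])) h1)
      (congrArg (fun L => L w (Fin.removeNth 1 ![v, w])) h1)).trans ?_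
    rw [pow_zero, pow_one, one_smul, neg_smul, one_smul, ← sub_eq_add_neg]
    rfl
  exact (S.wAt_apply x v w).trans h2

/-- Half of δ applied to the solder form replaces its y by dx. In this shape the square of the
solder form can be recognised as ω. -/
theorem omegaForm_eq : S.omegaForm =
    singleForm 0 fun x => (1 / 2 : ℂ) • dl (linearForm (S.wAt x)) := by
  funext x k l y
  rcases k with _ | k
  · rcases l with _ | l
    · refine Eq.trans ?_ (congrArg (fun s => (1 / 2 : ℂ) • s) (dl_linearForm (S.wAt x) y).symm)
      refine congrArg (fun s => (1 / 2 : ℂ) • s) (Finset.sum_congr rfl fun i _ =>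
        Finset.sum_congr rfl fun j _ => ?_)
      rw [wAt_apply, Complex.coe_smul]
      rfl
    · rfl
  · rfl

theorem isSection_omegaForm : IsSection S.omegaForm := by
  rw [omegaForm_eq]
  exact isSection_singleForm (fun x => ((hom_linearForm (S.wAt x)).dl).smul _)
    (g := fun x u => (1 / 2 : ℂ) • dl (linearForm (S.wLoc x u)))
    (fun x => SOn.smul _ (SOn.dl (isOpen_extChartAt_target x)
      (SOn.linearForm (S.contDiffOn_wLoc x)))) fun x u hu => by
        rw [(pull _).map_smul, ← dl_pull]
        rfl

theorem fib_omegaForm (x : M) :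
    fib S.omegaForm x = single 0 ((1 / 2 : ℂ) • dl (linearForm (S.wAt x))) := by
  rw [omegaForm_eq, fib_singleForm]

/-- The contact form does not depend on y, so the vertical terms of d_∇ vanish and d_∇λ = dλ = ω for
any connection. -/
theorem dNabla_lamForm (cov : AffineConnection m M) (x : M) :
    fib (dNabla cov S.lamForm) x = fib S.omegaForm x := by
  rw [lamForm, fib_dNabla_singleForm (g := fun x u => constForm (oneForm (S.lamLoc x u)))
    S.isSection_lamForm fun _ _ => rfl, fib_omegaForm]
  congr 1
  refine Sm.ext fun y => ?_
  have hx := mem_extChartAt_target (I := 𝓡 (2 * m + 1)) x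
  have hU := isOpen_extChartAt_target (I := 𝓡 (2 * m + 1)) x
  have hs : SOn (extChartAt (𝓡 (2 * m + 1)) x).target
      (fun u => constForm (oneForm (S.lamLoc x u))) :=
    contDiff_oneForm.comp_contDiffOn ((S.contDiffOn_lamLoc x).comp contDiffOn_fst fun _ hz => hz.1)
  have hd := (((S.contDiffOn_lamLoc x).contDiffAt (hU.mem_nhds hx)).differentiableAt
    (by simp)).hasFDerivAt
  have h1 : ∀ i, Sm.hd (conn cov x) (e i) (fun u => constForm (oneForm (S.lamLoc x u)))
      (extChartAt (𝓡 (2 * m + 1)) x x) y =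
        oneForm (fderiv ℝ (S.lamLoc x) (extChartAt (𝓡 (2 * m + 1)) x x) (e i)) := by
    intro i
    rw [Sm.hd, vert_constForm, sub_zero, ud_apply hU hs hx]
    have h2 := (((ContinuousAlternatingMap.ofSubsingletonLIE (𝕜 := ℝ) (E := Model m) (F := ℂ)
      (0 : Fin 1)).toContinuousLinearEquiv.toContinuousLinearMap ∘L
        ContinuousLinearMap.compL ℝ (Model m) ℝ ℂ Complex.ofRealCLM).hasFDerivAt.comp _ hd).fderiv
    exact congrArg (fun L => L (e i)) h2
  rw [nabla_apply]
  simp only [h1]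
  have h3 := congrArg (fun s => (1 / 2 : ℂ) • s) (dl_linearForm (S.wAt x) y)
  refine Eq.trans ?_ h3.symm
  simp only [wAt_eq_fderiv]
  exact dxSum_oneForm_antisymm _

/-- ω = d_∇λ, and d_∇² acts by vertical vector fields, which annihilate the y-independent λ. -/
theorem dNabla_omegaForm [T2Space M]
    (hcov : CovariantDerivative.ContMDiffCovariantDerivative cov ∞) (x : M) :
    fib (dNabla cov S.omegaForm) x = 0 := by
  have h : dNabla cov S.lamForm = S.omegaForm :=
    ext_fib (S.isSection_lamForm.dNabla hcov) S.isSection_omegaForm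
      fun x k l => congrFun (congrFun (S.dNabla_lamForm cov x) k) l
  rw [← h]
  funext k l
  rw [fib_dNabla_dNabla hcov S.isSection_lamForm, lamForm, fib_singleForm]
  have h0 : ∀ B : Model m →L[ℝ] Model m, vert B (single 0 (constForm (oneForm (S.lamAt x))) k l) = 0 := by
    intro B
    rw [single]
    split_ifs
    · exact vert_constForm _ _
    · exact map_zero _
  simp only [h0, map_zero, Finset.sum_const_zero, smul_zero]
  rfl

/-- As ω is parallel, d_∇ of the solder form involves only the antisymmetric part of Γ. The sign
agrees with `torsionComp`, which is minus the usual torsion. -/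
theorem torsionForm_apply {S : ContactMetricStructure m M} (hcov : S.IsContactMetricConnection cov)
    (x : M) (k l : ℕ) : S.torsionForm cov x k l =
      ((-fib (dNabla cov S.solder) x k l : Sm m 2) : Model m → Alt m 2) := by
  have h0 : fib (dNabla cov S.solder) x = single 1 (nabla (conn cov x)
      (fun u => linearForm (S.wLoc x u)) (extChartAt (𝓡 (2 * m + 1)) x x)) :=
    fib_dNabla_singleForm (g := fun x u => linearForm (S.wLoc x u)) S.isSection_solder fun _ _ => rfl
  rw [h0]
  funext y
  rcases k with _ | k
  · rcases l with _ | _ | l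
    · exact neg_zero.symm
    · have h := nabla_linearForm (isOpen_extChartAt_target x) (S.contDiffOn_wLoc x)
        (fun u hu => fderiv_wLoc hcov hu) (mem_extChartAt_target x) y
      rw [wLoc_center] at h
      refine Eq.trans ?_ (congrArg Neg.neg h).symm
      rw [← smul_neg]
      refine congrArg (fun s => (1 / 2 : ℂ) • s) ?_
      rw [Finset.sum_comm, ← Finset.sum_neg_distrib]
      refine Finset.sum_congr rfl fun i _ => ?_
      rw [Finset.sum_comm, ← Finset.sum_neg_distrib]
      refine Finset.sum_congr rfl fun j _ => ?_
      rw [← Finset.sum_smul, ← neg_smul, ← Complex.ofReal_neg, Complex.coe_smul]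
      congr 1
      have h1 : ∀ n, torsionComp cov x n i j = -coord (conn cov x (extChartAt (𝓡 (2 * m + 1)) x x)
          (e i) (e j) - conn cov x (extChartAt (𝓡 (2 * m + 1)) x x) (e j) (e i)) n := fun n =>
        congrArg (fun v : Model m => -coord v n) (torsion_center cov x i j)
      have h2 : ∀ k n, S.omegaComp x k n = S.wAt x (e k) (e n) := fun k n =>
        (S.wAt_apply x (e k) (e n)).symm
      simp only [h1, h2, mul_neg, Finset.sum_neg_distrib, ← form_eq_sum_right]
      rw [← form_eq_sum_left]
    · exact neg_zero.symm
  · exact neg_zero.symm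

theorem torsionForm_eq [T2Space M] {S : ContactMetricStructure m M}
    (hcov : S.IsContactMetricConnection cov) :
    S.torsionForm cov = (-1 : ℂ) • dNabla cov S.solder := by
  funext x k l
  rw [torsionForm_apply hcov]
  funext y
  rw [Pi.smul_apply, Pi.smul_apply, Pi.smul_apply, Pi.smul_apply,
    ← (S.isSection_solder.dNabla hcov.smooth).fib_apply, neg_one_smul]
  rfl

end ContactMetricStructure

end SpecialSections

/-! ### The curvature form and the brackets with R and with the solder form -/

section CurvatureAndTransversality

variable {m n : ℕ} {M : Type*} [TopologicalSpace M] [ChartedSpace (Model m) M]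
  [IsManifold (𝓡 (2 * m + 1)) ∞ M]

open Sm

variable {cov : AffineConnection m M} {a b : WForm m M n} {x : M} {k l : ℕ} {u : Model m}

namespace ContactMetricStructure

variable {S : ContactMetricStructure m M}

variable (S) in
theorem curvatureForm_eq [T2Space M]
    (hcov : CovariantDerivative.ContMDiffCovariantDerivative cov ∞) :
    S.curvatureForm cov = singleForm 2 fun x => (-1 / 4 : ℂ) • quadraticForm (S.wAt x)
      fun i j => curv (conn cov x) (extChartAt (𝓡 (2 * m + 1)) x x) (e i) (e j) := by
  funext x k l y
  rcases k with _ | k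
  · rcases l with _ | _ | _ | l
    · rfl
    · rfl
    · refine congrArg (fun s => (-1 / 4 : ℂ) • s) ?_
      refine Eq.trans ?_ (quadraticForm_apply _ y).symm
      have hsw : ∀ f : Fin (2 * m + 1) → Fin (2 * m + 1) → Fin (2 * m + 1) → Fin (2 * m + 1) → Alt m 2,
          ∑ i, ∑ j, ∑ k, ∑ l, f i j k l = ∑ k, ∑ l, ∑ i, ∑ j, f i j k l := fun f =>
        (Finset.sum_congr rfl fun i _ => Finset.sum_comm.trans
          (Finset.sum_congr rfl fun k _ => Finset.sum_comm)).trans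
          (Finset.sum_comm.trans (Finset.sum_congr rfl fun k _ => Finset.sum_comm))
      refine (hsw _).trans (Finset.sum_congr rfl fun k _ => Finset.sum_congr rfl fun l _ => ?_)
      have h1 : ∀ i n, S.omegaComp x i n = S.wAt x (e i) (e n) := fun i n =>
        (S.wAt_apply x (e i) (e n)).symm
      have h2 : ∀ i j, coord y i * coord y j * ∑ n, S.omegaComp x i n * curvatureComp cov x n j k l =
          coord y i * (S.wAt x (e i) (curv (conn cov x) (extChartAt (𝓡 (2 * m + 1)) x x) (e k) (e l)
            (coord y j • e j))) := fun i j => by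
        simp only [h1, curvatureComp_eq cov hcov, ← form_eq_sum_right]
        rw [_root_.map_smul, _root_.map_smul, smul_eq_mul, mul_assoc]
      simp only [h2, ← Finset.sum_smul, ← Finset.mul_sum, ← map_sum, sum_coord_smul_e]
      rw [← form_eq_sum_left, Complex.coe_smul]
    · rfl
  · rfl

/-- The left side takes the curvature at each point in the preferred chart of that point.
Tensoriality rewrites it in the one chart at x, in which it can be differentiated. -/
theorem pull_quadraticForm_curv [T2Space M]
    (hcov : CovariantDerivative.ContMDiffCovariantDerivative cov ∞)
    (hu : u ∈ (extChartAt (𝓡 (2 * m + 1)) x).target) :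
    pull (frameMap x ((extChartAt (𝓡 (2 * m + 1)) x).symm u))
      (quadraticForm (S.wAt ((extChartAt (𝓡 (2 * m + 1)) x).symm u))
        fun i j => curv (conn cov ((extChartAt (𝓡 (2 * m + 1)) x).symm u))
          (extChartAt (𝓡 (2 * m + 1)) ((extChartAt (𝓡 (2 * m + 1)) x).symm u)
            ((extChartAt (𝓡 (2 * m + 1)) x).symm u)) (e i) (e j)) =
      quadraticForm (S.wLoc x u) fun i j => curv (conn cov x) u (e i) (e j) := by
  refine Sm.ext fun y => ?_
  set p := (extChartAt (𝓡 (2 * m + 1)) x).symm u with hp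
  rw [pull_apply, quadraticForm_apply, quadraticForm_apply]
  obtain ⟨C, hC⟩ := exists_curv_eq (isOpen_extChartAt_target (I := 𝓡 (2 * m + 1)) p)
    (contDiffOn_conn cov hcov p) (mem_extChartAt_target p) (frameMap x p y)
  have h := sum_form_wedge_comp ((ContinuousLinearMap.compL ℝ (Model m) (Model m) ℝ
    (S.wAt p (frameMap x p y))) ∘L C) (frameMap x p)
  simp only [ContinuousLinearMap.comp_apply, ContinuousLinearMap.compL_apply, hC] at h
  refine h.trans (Finset.sum_congr rfl fun i _ => Finset.sum_congr rfl fun j _ => ?_)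
  rw [← curv_center hcov hu]
  rfl

theorem isSection_curvatureForm [T2Space M]
    (hcov : CovariantDerivative.ContMDiffCovariantDerivative cov ∞) :
    IsSection (S.curvatureForm cov) := by
  rw [S.curvatureForm_eq hcov]
  refine isSection_singleForm (fun x => Hom.smul _ (hom_quadraticForm _))
    (g := fun x u => (-1 / 4 : ℂ) • quadraticForm (S.wLoc x u)
      fun i j => curv (conn cov x) u (e i) (e j))
    (fun x => SOn.smul _ (SOn.quadraticForm (S.contDiffOn_wLoc x) fun i j => contDiffOn_curvature
      (isOpen_extChartAt_target x)
      (fun v => (contDiffOn_conn cov hcov x).clm_apply contDiffOn_const) _ _)) fun x u hu => ?_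
  rw [(pull _).map_smul, pull_quadraticForm_curv hcov hu]

theorem fib_curvatureForm [T2Space M]
    (hcov : CovariantDerivative.ContMDiffCovariantDerivative cov ∞) (x : M) :
    fib (S.curvatureForm cov) x = single 2 ((-1 / 4 : ℂ) • quadraticForm (S.wAt x)
      fun i j => curv (conn cov x) (extChartAt (𝓡 (2 * m + 1)) x x) (e i) (e j)) := by
  rw [S.curvatureForm_eq hcov, fib_singleForm]

/-- Only the exterior covariant derivative of the curvature enters, since ω is parallel, and it
vanishes by the second Bianchi identity. -/
theorem dNabla_curvatureForm [T2Space M] (hcov : S.IsContactMetricConnection cov) (x : M) :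
    fib (dNabla cov (S.curvatureForm cov)) x = 0 := by
  have hs := isSection_curvatureForm (S := S) hcov.smooth
  rw [S.curvatureForm_eq hcov.smooth] at hs ⊢
  rw [fib_dNabla_singleForm (g := fun x u => (-1 / 4 : ℂ) • quadraticForm (S.wLoc x u)
      fun i j => curv (conn cov x) u (e i) (e j)) hs fun u hu => by
    rw [(pull _).map_smul, pull_quadraticForm_curv hcov.smooth hu]]
  have hU := isOpen_extChartAt_target (I := 𝓡 (2 * m + 1)) x
  have hx := mem_extChartAt_target (I := 𝓡 (2 * m + 1)) x
  have h := nabla_quadraticForm hU (contDiffOn_conn cov hcov.smooth x) (S.contDiffOn_wLoc x)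
    (fun u hu => fderiv_wLoc hcov hu) hx
  have h2 := nabla_smul hU (Γ := conn cov x) (-1 / 4 : ℂ) (SOn.quadraticForm (S.contDiffOn_wLoc x)
    (A := fun u i j => curv (conn cov x) u (e i) (e j)) fun i j => contDiffOn_curvature hU
      (fun v => (contDiffOn_conn cov hcov.smooth x).clm_apply contDiffOn_const) _ _) hx
  rw [h, smul_zero] at h2
  rw [h2]
  funext k l
  exact ite_self _

theorem isTransverse_iff (ha : IsSection a) :
    S.IsTransverse a ↔ ∀ x k l, dir (S.xiAt x) (fib a x k l) = 0 := by
  refine forall_congr' fun x => forall_congr' fun k => forall_congr' fun l => ?_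
  constructor
  · intro h
    refine Sm.ext fun y => ?_
    rw [dir_apply, ha.coe_fib]
    exact h y
  · intro h y
    have := congrArg (eval y) h
    rw [← ha.coe_fib]
    exact this

theorem inFiltration_iff (ha : IsSection a) {d : ℕ} :
    InFiltration d a ↔ ∀ x, Filt d (fib a x) := by
  refine forall_congr' fun x => forall_congr' fun k => forall_congr' fun l => ?_
  refine imp_congr Iff.rfl ?_
  rw [← ha.coe_fib]
  exact ⟨fun h => Sm.ext fun y => congrFun h y, fun h => by rw [h]; rfl⟩

/-- `∇∇ = (i/ν) [R, ·]` on transverse sections. -/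
theorem fib_dNabla_dNabla_eq_br [T2Space M] (hcov : S.IsContactMetricConnection cov)
    (ha : IsSection a) (ht : S.IsTransverse a) (h2 : 2 + n = n + 2) (h2' : n + 2 = n + 2) (x : M) :
    fib (dNabla cov (dNabla cov a)) x =
      br (S.wick x) h2 h2' (fib (S.curvatureForm cov) x) (fib a x) := by
  have ht' := (isTransverse_iff ha).1 ht
  funext k l
  have hb := bracket_quadraticForm (S.wick x) h2 h2' (S.wick_sub x) (S.sum_poissonMatrix_wAt x)
    (A := fun i j => curv (conn cov x) (extChartAt (𝓡 (2 * m + 1)) x x) (e i) (e j))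
    (fun i j y z => by rw [S.wAt_antisymm x y, wAt_curv hcov, neg_neg])
    (fun i j => sum_wick_curv hcov x (e i) (e j)) (b := fib a x) (fun k l => ht' x k l) k l
  rw [fib_dNabla_dNabla hcov.smooth ha, fib_curvatureForm hcov.smooth]
  have h3 : single 2 ((-1 / 4 : ℂ) • quadraticForm (S.wAt x)
      fun i j => curv (conn cov x) (extChartAt (𝓡 (2 * m + 1)) x x) (e i) (e j)) =
      (-1 / 4 : ℂ) • single 2 (quadraticForm (S.wAt x)
      fun i j => curv (conn cov x) (extChartAt (𝓡 (2 * m + 1)) x x) (e i) (e j)) := by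
    funext k l
    rw [single]
    split_ifs with h
    · simp only [Pi.smul_apply, single, if_pos h]
    · simp only [Pi.smul_apply, single, if_neg h, smul_zero]
  -- The normalisations agree: -1/4 in R times the factor 2 of `bracket_quadraticForm` is the -1/2
  -- of d_∇².
  rw [h3, br, gcomm_smul_left]
  refine Eq.trans ?_ (smul_comm (-1 / 4 : ℂ) Complex.I (gcomm (S.wick x) h2 h2' (single 2
    (quadraticForm (S.wAt x) fun i j => curv (conn cov x) (extChartAt (𝓡 (2 * m + 1)) x x) (e i)
      (e j))) (fib a x) (k + 1) l))
  refine Eq.trans ?_ (congrArg (fun s : Sm m (n + 2) => (-1 / 4 : ℂ) • s) hb.symm)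
  rw [smul_smul]
  norm_num

/-- `(i/ν) [s, ·] = δ` on transverse sections, for the solder form `s`. -/
theorem fib_bracket_solder (ha : IsSection a) (ht : S.IsTransverse a) (h1 : 1 + n = n + 1)
    (h1' : n + 1 = n + 1) (x : M) :
    br (S.wick x) h1 h1' (fib S.solder x) (fib a x) = fib (delta a) x := by
  have ht' := (isTransverse_iff ha).1 ht
  funext k l
  rw [ha.fib_delta, fib_solder]
  exact bracket_linearForm (S.wick x) h1 h1' (S.wick_sub x) (S.sum_poissonMatrix_wAt x)
    (fun k l => ht' x k l) k l

variable (S) in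
/-- `(i/ν) s ∘ s = ω` for the solder form `s`. -/
theorem sq_solder (x : M) : sq (S.wick x) (fib S.solder x) = fib S.omegaForm x := by
  rw [fib_solder, fib_omegaForm]
  funext k l
  exact circ_linearForm_self (S.wick x) (S.wick_sub x) (S.sum_poissonMatrix_wAt x) (S.wAt_xiAt x) k l

variable (S) in
theorem isTransverse_solder : S.IsTransverse S.solder := by
  refine (isTransverse_iff S.isSection_solder).2 fun x k l => ?_
  rw [fib_solder, single]
  split_ifs
  · refine Sm.ext fun y => ?_
    rw [dir_linearForm, wAt_xiAt]
    ext v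
    exact Complex.ofReal_zero
  · exact map_zero _

theorem isTransverse_curvatureForm [T2Space M] (hcov : S.IsContactMetricConnection cov) :
    S.IsTransverse (S.curvatureForm cov) := by
  refine (isTransverse_iff (isSection_curvatureForm hcov.smooth)).2 fun x k l => ?_
  rw [fib_curvatureForm hcov.smooth, single]
  split_ifs
  · rw [_root_.map_smul]
    refine Sm.ext fun y => ?_
    refine (congrArg (fun s => (-1 / 4 : ℂ) • s) (dir_quadraticForm (fun i j y z => by
      rw [S.wAt_antisymm x y, wAt_curv hcov, neg_neg]) _ _)).trans ?_
    rw [wAt_xiAt]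
    simp
  · exact map_zero _

end ContactMetricStructure

end CurvatureAndTransversality

/-! ### All operators preserve ξ-transversality -/

section Transversality

variable {m n p q N : ℕ} {M : Type*} [TopologicalSpace M] [ChartedSpace (Model m) M]
  [IsManifold (𝓡 (2 * m + 1)) ∞ M]

open Sm

theorem Sm.sum_smul_dir {ι : Type*} (s : Finset ι) (c : ι → ℝ) (v : ι → Model m) (f : Sm m n) :
    ∑ i ∈ s, ((c i : ℝ) : ℂ) • dir (v i) f = dir (∑ i ∈ s, c i • v i) f := by
  refine Sm.ext fun y => ?_
  rw [dir_apply, map_sum, sum_apply]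
  refine Finset.sum_congr rfl fun i _ => ?_
  rw [_root_.map_smul, smul_apply, dir_apply, Complex.coe_smul]

theorem Sm.dir_add_vec (v w : Model m) (f : Sm m n) : dir (v + w) f = dir v f + dir w f :=
  Sm.ext fun y => by
    simp only [add_apply, dir_apply]
    exact map_add _ _ _

/-- The covariant derivative of a function that is constant along a parallel vector field has the
same property. -/
theorem Sm.dir_hd_eq_zero {U : Set (Model m)} {u : Model m}
    {Γ : Model m → Model m →L[ℝ] Model m →L[ℝ] Model m} (hU : IsOpen U)
    {f : Model m → Sm m n} (hf : SOn U f) {ξ : Model m → Model m} (hξ : ContDiffOn ℝ ∞ ξ U)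
    (hu : u ∈ U) (v : Model m) (hpar : fderiv ℝ ξ u v + Γ u v (ξ u) = 0)
    (h0 : ∀ u ∈ U, dir (ξ u) (f u) = 0) : dir (ξ u) (Sm.hd Γ v f u) = 0 := by
  have hc : ∀ i, ContDiffOn ℝ ∞ (fun u => ((coord (ξ u) i : ℝ) : ℂ)) U := fun i =>
    Complex.ofRealCLM.contDiff.comp_contDiffOn
      ((EuclideanSpace.proj i : Model m →L[ℝ] ℝ).contDiff.comp_contDiffOn hξ)
  have hd : ∀ i, fderiv ℝ (fun u => ((coord (ξ u) i : ℝ) : ℂ)) u v =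
      ((coord (fderiv ℝ ξ u v) i : ℝ) : ℂ) := fun i => by
    have h1 := (((hξ.contDiffAt (hU.mem_nhds hu)).differentiableAt (by simp)).hasFDerivAt)
    have h2 := ((Complex.ofRealCLM ∘L
      (EuclideanSpace.proj i : Model m →L[ℝ] ℝ)).hasFDerivAt.comp u h1).fderiv
    exact congrArg (fun L => L v) h2
  -- The identity "derivative of f along ξ is zero" is differentiated covariantly. The terms without
  -- a derivative of f in the base form the covariant derivative of ξ and drop out.
  have h1 : Sm.hd Γ v (fun u => ∑ i, ((coord (ξ u) i : ℝ) : ℂ) • dir (e i) (f u)) u = 0 := by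
    have e1 : (fun u => ∑ i, ((coord (ξ u) i : ℝ) : ℂ) • dir (e i) (f u)) =ᶠ[𝓝 u] fun _ => 0 := by
      filter_upwards [hU.mem_nhds hu] with u hu
      rw [sum_smul_dir, sum_coord_smul_e, h0 u hu]
    rw [Sm.hd, ud_congr e1, show ∑ i, ((coord (ξ u) i : ℝ) : ℂ) • dir (e i) (f u) = 0 from
      e1.self_of_nhds, map_zero, sub_zero]
    refine Sm.ext fun y => ?_
    rw [ud_apply hU (SOn.const 0) hu]
    exact congrArg (fun L => L v) (fderiv_const_apply (𝕜 := ℝ) (x := u) (0 : Alt m n))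
  rw [hd_sum hU (fun i _ => SOn.smul_fun (hc i) (SOn.dir hU hf _)) hu] at h1
  simp only [hd_smul_fun hU (hc _) (SOn.dir hU hf _) hu, hd_dir hU hf hu, hd, smul_add,
    Finset.sum_add_distrib] at h1
  rw [sum_smul_dir, sum_smul_dir, sum_smul_dir, sum_coord_smul_e, sum_coord_smul_e] at h1
  have h2 : ∑ i, coord (ξ u) i • Γ u v (e i) = Γ u v (ξ u) := by
    conv_rhs => rw [← sum_coord_smul_e (ξ u), map_sum]
    exact Finset.sum_congr rfl fun i _ => (_root_.map_smul _ _ _).symm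
  have h3 : dir (Γ u v (ξ u)) (f u) + dir (fderiv ℝ ξ u v) (f u) = 0 := by
    rw [← dir_add_vec, add_comm, hpar]
    exact Sm.ext fun y => (dir_apply _ _ _).trans (map_zero _)
  rwa [h2, add_assoc, h3, add_zero] at h1

variable {cov : AffineConnection m M} {a b : WForm m M n} {x : M} {k l : ℕ} {u : Model m}

namespace ContactMetricStructure

variable {S : ContactMetricStructure m M}

theorem dir_xiLoc_loc (ha : IsSection a) (ht : S.IsTransverse a)
    (hu : u ∈ (extChartAt (𝓡 (2 * m + 1)) x).target) :
    dir (S.xiLoc x u) (loc a x k l u) = 0 := by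
  rw [loc, dir_pull, frameMap_xiLoc hu, (isTransverse_iff ha).1 ht, map_zero]

/-- This is where ∇ξ = 0 is needed: covariant differentiation commutes with the derivative along ξ.
-/
theorem isTransverse_dNabla [T2Space M] (hcov : S.IsContactMetricConnection cov) (ha : IsSection a)
    (ht : S.IsTransverse a) : S.IsTransverse (dNabla cov a) := by
  refine (isTransverse_iff (ha.dNabla hcov.smooth)).2 fun x k l => ?_
  rw [fib_dNabla cov ha, nabla, map_sum, ← S.xiLoc_center]
  refine Finset.sum_eq_zero fun i _ => ?_
  rw [dir_map, dir_hd_eq_zero (isOpen_extChartAt_target x) (ha.sOn_loc x k l)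
    (S.contDiffOn_xiLoc x) (mem_extChartAt_target x) (e i)
    (fderiv_xiLoc hcov (mem_extChartAt_target x) (e i)) (fun u hu => dir_xiLoc_loc ha ht hu), map_zero]

theorem IsTransverse.add (ha : IsSection a) (hb : IsSection b) (hta : S.IsTransverse a)
    (htb : S.IsTransverse b) : S.IsTransverse (a + b) :=
  (isTransverse_iff (ha.add hb)).2 fun x k l => by
    rw [fib_add ha hb, Pi.add_apply, Pi.add_apply, map_add, (isTransverse_iff ha).1 hta,
      (isTransverse_iff hb).1 htb, add_zero]

theorem IsTransverse.smul (c : ℂ) (ha : IsSection a) (hta : S.IsTransverse a) :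
    S.IsTransverse (c • a) :=
  (isTransverse_iff (ha.smul c)).2 fun x k l => by
    rw [fib_smul c ha, Pi.smul_apply, Pi.smul_apply, _root_.map_smul, (isTransverse_iff ha).1 hta,
      smul_zero]

theorem IsTransverse.sub (ha : IsSection a) (hb : IsSection b) (hta : S.IsTransverse a)
    (htb : S.IsTransverse b) : S.IsTransverse (a - b) :=
  (isTransverse_iff (ha.sub hb)).2 fun x k l => by
    rw [fib_sub ha hb, Pi.sub_apply, Pi.sub_apply, map_sub, (isTransverse_iff ha).1 hta,
      (isTransverse_iff hb).1 htb, sub_zero]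

theorem isTransverse_deltaInv {a : WForm m M (n + 1)} (ha : IsSection a) (hta : S.IsTransverse a) :
    S.IsTransverse (S.deltaInv a) :=
  (isTransverse_iff (S.isSection_deltaInv ha)).2 fun x k l => by
    rcases l with _ | l
    · rw [S.fib_deltaInv_zero, map_zero]
    · rw [S.fib_deltaInv ha, dir_dlInv (S.lamAt_xiAt x) l ((isTransverse_iff ha).1 hta x k l)]

theorem isTransverse_circ (hN : p + q = N) {a : WForm m M p} {b : WForm m M q} (ha : IsSection a)
    (hb : IsSection b) (hta : S.IsTransverse a) (htb : S.IsTransverse b) :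
    S.IsTransverse (S.circ hN a b) :=
  (isTransverse_iff (S.isSection_circ hN ha hb)).2 fun x k l => by
    rw [S.fib_circ hN ha hb, dir_circ (S.wick x) hN ((isTransverse_iff ha).1 hta x)
      ((isTransverse_iff hb).1 htb x)]

theorem isTransverse_bracket {r : WForm m M 1} (hr : IsSection r) (ha : IsSection a)
    (htr : S.IsTransverse r) (hta : S.IsTransverse a) : S.IsTransverse (S.bracket r a) :=
  IsTransverse.smul _ (S.isSection_comm hr ha).divNu fun x k l =>
    IsTransverse.sub (S.isSection_circ _ hr ha) ((S.isSection_circ _ ha hr).smul _)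
      (isTransverse_circ _ hr ha htr hta)
      (IsTransverse.smul _ (S.isSection_circ _ ha hr) (isTransverse_circ _ ha hr hta htr)) x (k + 1) l

theorem isTransverse_rr {r : WForm m M 1} (hr : IsSection r) (htr : S.IsTransverse r) :
    S.IsTransverse (S.rr r) :=
  IsTransverse.smul _ (S.isSection_circ _ hr hr).divNu fun x k l =>
    isTransverse_circ _ hr hr htr htr x (k + 1) l

theorem isTransverse_omegaForm : S.IsTransverse S.omegaForm :=
  (isTransverse_iff S.isSection_omegaForm).2 fun x k l => by
    rw [fib_omegaForm, single]
    split_ifs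
    · rw [_root_.map_smul, ((hom_linearForm _).dl).dir_zero, smul_zero]
    · exact map_zero _

end ContactMetricStructure

end Transversality

/-! ### The Fedosov connection, its square and the Bianchi identity -/

section WeylCurvature

variable {m n p q N : ℕ} {M : Type*} [TopologicalSpace M] [ChartedSpace (Model m) M]
  [IsManifold (𝓡 (2 * m + 1)) ∞ M]

open Sm

theorem Sm.br_eq_neg_br (h : Fin (2 * m + 1) → Fin (2 * m + 1) → ℂ) (h2 : 1 + 2 = 3)
    (h2' : 2 + 1 = 3) (b : ℕ → ℕ → Sm m 1) (a : ℕ → ℕ → Sm m 2) :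
    br h h2 h2' b a = -br h h2' h2 a b := by
  rw [br, br, gcomm_def, gcomm_def]
  norm_num
  rw [← smul_neg]
  refine congrArg (fun s => Complex.I • s) ?_
  exact (congrArg dn (neg_sub (circ h h2' a b) (circ h h2 b a))).symm

theorem Sm.br_sub_right (h : Fin (2 * m + 1) → Fin (2 * m + 1) → ℂ) (hN : p + q = N)
    (hN' : q + p = N) (a : ℕ → ℕ → Sm m p) (b b' : ℕ → ℕ → Sm m q) :
    br h hN hN' a (b - b') = br h hN hN' a b - br h hN hN' a b' := by
  rw [eq_sub_iff_add_eq, ← br_add_right, sub_add_cancel]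

variable {cov : AffineConnection m M} {a b : WForm m M n} {x : M} {k l : ℕ} {r : WForm m M 1}

namespace ContactMetricStructure

variable {S : ContactMetricStructure m M} [T2Space M] (hcov : S.IsContactMetricConnection cov)
include hcov

theorem isSection_torsionForm : IsSection (S.torsionForm cov) := by
  rw [torsionForm_eq hcov]
  exact (S.isSection_solder.dNabla hcov.smooth).smul _

theorem isTransverse_torsionForm : S.IsTransverse (S.torsionForm cov) := by
  rw [torsionForm_eq hcov]
  exact IsTransverse.smul _ (S.isSection_solder.dNabla hcov.smooth)
    (isTransverse_dNabla hcov S.isSection_solder S.isTransverse_solder)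

/-- `D = d_∇ + (i/ν) [r - s, ·]` with the solder form `s`. -/
theorem fedosov_eq (hr : IsSection r) (ha : IsSection a) (hta : S.IsTransverse a) :
    S.fedosov cov r a = dNabla cov a + S.bracket (r - S.solder) a := by
  have hs := S.isSection_solder
  have hD : IsSection (dNabla cov a) := ha.dNabla hcov.smooth
  have h1 : IsSection (dNabla cov a - delta a) := hD.sub ha.delta
  have hb := S.isSection_bracket hr ha
  refine ext_fib (h1.add hb) (hD.add (S.isSection_bracket (hr.sub hs) ha)) fun x k l => ?_
  change fib (dNabla cov a - delta a + S.bracket r a) x k l = _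
  rw [fib_add h1 hb, fib_sub hD ha.delta, fib_add hD (S.isSection_bracket (hr.sub hs) ha),
    S.fib_bracket hr ha, S.fib_bracket (hr.sub hs) ha, fib_sub hr hs, br_sub_left,
    fib_bracket_solder ha hta]
  simp only [Pi.add_apply, Pi.sub_apply]
  abel

theorem isSection_fedosov (hr : IsSection r) (ha : IsSection a) (hta : S.IsTransverse a) :
    IsSection (S.fedosov cov r a) := by
  rw [fedosov_eq hcov hr ha hta]
  exact (ha.dNabla hcov.smooth).add (S.isSection_bracket (hr.sub S.isSection_solder) ha)

theorem isTransverse_fedosov (hr : IsSection r) (htr : S.IsTransverse r) (ha : IsSection a)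
    (hta : S.IsTransverse a) : S.IsTransverse (S.fedosov cov r a) := by
  rw [fedosov_eq hcov hr ha hta]
  exact IsTransverse.add (ha.dNabla hcov.smooth)
    (S.isSection_bracket (hr.sub S.isSection_solder) ha) (isTransverse_dNabla hcov ha hta)
    (isTransverse_bracket (hr.sub S.isSection_solder) ha
      (IsTransverse.sub hr S.isSection_solder htr S.isTransverse_solder) hta)

theorem isSection_weylCurvature (hr : IsSection r) : IsSection (S.weylCurvature cov r) :=
  ((((S.isSection_omegaForm.sub hr.delta).add (isSection_torsionForm hcov)).add
    (isSection_curvatureForm hcov.smooth)).add (hr.dNabla hcov.smooth)).add (S.isSection_rr hr)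

/-- `Ω = R + d_∇ ρ + (i/ν) ρ ∘ ρ` for `ρ = r - s` with the solder form `s`. -/
theorem weylCurvature_eq (hr : IsSection r) (htr : S.IsTransverse r) : S.weylCurvature cov r =
    S.curvatureForm cov + dNabla cov (r - S.solder) + S.rr (r - S.solder) := by
  have hs := S.isSection_solder
  have hρ := hr.sub hs
  have h1 := S.isSection_omegaForm.sub hr.delta
  have h2 := h1.add (isSection_torsionForm hcov)
  have hR : IsSection (S.curvatureForm cov) := isSection_curvatureForm hcov.smooth
  have h3 := h2.add hR
  have hD : IsSection (dNabla cov r) := hr.dNabla hcov.smooth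
  have hDρ : IsSection (dNabla cov (r - S.solder)) := hρ.dNabla hcov.smooth
  have hDs : IsSection (dNabla cov S.solder) := hs.dNabla hcov.smooth
  have h4 := h3.add hD
  refine ext_fib (isSection_weylCurvature hcov hr) ((hR.add hDρ).add (S.isSection_rr hρ))
    fun x k l => ?_
  -- With ρ = r - s, expanding (i/ν) ρ ∘ ρ yields -δr from the mixed terms and ω from s ∘ s, while
  -- d_∇(-s) yields T.
  rw [weylCurvature, fib_add h4 (S.isSection_rr hr), fib_add h3 hD, fib_add h2 hR,
    fib_add h1 (isSection_torsionForm hcov), fib_sub S.isSection_omegaForm hr.delta,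
    fib_add (hR.add hDρ) (S.isSection_rr hρ), fib_add hR hDρ, S.fib_rr hr, S.fib_rr hρ, fib_sub hr hs,
    sq_sub, fib_bracket_solder hr htr, S.sq_solder, fib_dNabla_sub hr hs, torsionForm_eq hcov,
    fib_smul _ hDs, neg_one_smul]
  simp only [Pi.add_apply, Pi.sub_apply, Pi.neg_apply]
  abel

theorem isTransverse_weylCurvature (hr : IsSection r) (htr : S.IsTransverse r) :
    S.IsTransverse (S.weylCurvature cov r) := by
  have hρ := hr.sub S.isSection_solder
  have htρ := IsTransverse.sub hr S.isSection_solder htr S.isTransverse_solder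
  have hR : IsSection (S.curvatureForm cov) := isSection_curvatureForm hcov.smooth
  have hDρ : IsSection (dNabla cov (r - S.solder)) := hρ.dNabla hcov.smooth
  rw [weylCurvature_eq hcov hr htr]
  exact IsTransverse.add (hR.add hDρ) (S.isSection_rr hρ) (IsTransverse.add hR hDρ
    (isTransverse_curvatureForm hcov) (isTransverse_dNabla hcov hρ htρ)) (isTransverse_rr hρ htρ)

/-- `D² = (i/ν) [Ω, ·]`. -/
theorem fib_fedosov_fedosov (hr : IsSection r) (htr : S.IsTransverse r) (ha : IsSection a)
    (hta : S.IsTransverse a) (h2 : 2 + n = n + 2) (h2' : n + 2 = n + 2) (x : M) :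
    fib (S.fedosov cov r (S.fedosov cov r a)) x =
      br (S.wick x) h2 h2' (fib (S.weylCurvature cov r) x) (fib a x) := by
  have hs := S.isSection_solder
  have hρ := hr.sub hs
  have hD : IsSection (dNabla cov a) := ha.dNabla hcov.smooth
  have hb := S.isSection_bracket hρ ha
  have hR : IsSection (S.curvatureForm cov) := isSection_curvatureForm hcov.smooth
  have hDρ : IsSection (dNabla cov (r - S.solder)) := hρ.dNabla hcov.smooth
  -- In the square of d_∇ + (i/ν)[ρ, ·] the term d_∇² gives R, the derivation rule gives d_∇ρ and a
  -- cross term that cancels the other one, and the Jacobi identity gives (i/ν) ρ ∘ ρ.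
  rw [fedosov_eq hcov hr (isSection_fedosov hcov hr ha hta) (isTransverse_fedosov hcov hr htr ha hta),
    fedosov_eq hcov hr ha hta, weylCurvature_eq hcov hr htr,
    fib_add ((hD.add hb).dNabla hcov.smooth) (S.isSection_bracket hρ (hD.add hb)),
    fib_dNabla_add hD hb, fib_dNabla_dNabla_eq_br hcov ha hta h2 h2',
    fib_dNabla_bracket hcov hρ ha h2 h2' (by omega) rfl, S.fib_bracket hρ (hD.add hb), fib_add hD hb,
    br_add_right, S.fib_bracket hρ ha,
    br_br (S.wick x) (Nat.add_comm 1 n) rfl (Nat.add_comm 1 (n + 1)) rfl h2 h2' (hρ.hom_fib x)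
      (ha.hom_fib x),
    fib_add (hR.add hDρ) (S.isSection_rr hρ), fib_add hR hDρ, S.fib_rr hρ, br_add_left, br_add_left]
  abel

/-- D² is the bracket with ω, which is central because it contains no y. -/
theorem isAbelian_of_weylCurvature_eq (hr : IsSection r) (htr : S.IsTransverse r)
    (h : S.weylCurvature cov r = S.omegaForm) : S.IsAbelian cov r := by
  intro n a ha
  have h1 := isSection_fedosov hcov hr ha.isSection ha.transverse
  have h2 := isTransverse_fedosov hcov hr htr ha.isSection ha.transverse
  refine ext_fib (isSection_fedosov hcov hr h1 h2) isSection_zero fun x k l => ?_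
  rw [fib_fedosov_fedosov hcov hr htr ha.isSection ha.transverse (Nat.add_comm 2 n) rfl, h,
    S.fib_omegaForm, br]
  have h3 := gcomm_single_zero (S.wick x) (Nat.add_comm 2 n) rfl
    (Hom.smul (1 / 2 : ℂ) (hom_linearForm (S.wAt x)).dl) (fib a x) (k + 1) l
  refine (congrArg (fun s => Complex.I • s) h3).trans ?_
  rw [smul_zero]
  exact (fib_eq rfl).symm

/-- The Bianchi identity for the Weyl curvature. -/
theorem delta_weylCurvature (hr : IsSection r) (htr : S.IsTransverse r) :
    delta (S.weylCurvature cov r - S.omegaForm) =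
      dNabla cov (S.weylCurvature cov r - S.omegaForm) +
        S.bracket r (S.weylCurvature cov r - S.omegaForm) := by
  have hs := S.isSection_solder
  have hρ := hr.sub hs
  have htρ := IsTransverse.sub hr hs htr S.isTransverse_solder
  have hR : IsSection (S.curvatureForm cov) := isSection_curvatureForm hcov.smooth
  have hDρ : IsSection (dNabla cov (r - S.solder)) := hρ.dNabla hcov.smooth
  have hΩ := isSection_weylCurvature hcov hr
  have hA := hΩ.sub S.isSection_omegaForm
  have htA := IsTransverse.sub hΩ S.isSection_omegaForm
    (isTransverse_weylCurvature hcov hr htr) isTransverse_omegaForm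
  refine ext_fib hA.delta ((hA.dNabla hcov.smooth).add (S.isSection_bracket hr hA)) fun x k l => ?_
  -- For ρ the Bianchi identity is d_∇Ω + (i/ν)[ρ, Ω] = 0. Since d_∇R = 0 and d_∇²ρ = (i/ν)[R, ρ],
  -- the brackets cancel in pairs, and ρ commutes with ρ ∘ ρ.
  have e1 : fib (dNabla cov (S.weylCurvature cov r)) x +
      br (S.wick x) (Nat.add_comm 1 2) rfl (fib (r - S.solder) x) (fib (S.weylCurvature cov r) x) = 0 := by
    have h1 : fib (dNabla cov (S.weylCurvature cov r)) x =
        br (p := 2) (q := 1) (S.wick x) rfl rfl (fib (S.curvatureForm cov) x) (fib (r - S.solder) x) +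
          br (p := 2) (q := 1) (S.wick x) rfl rfl (fib (dNabla cov (r - S.solder)) x) (fib (r - S.solder) x) := by
      rw [weylCurvature_eq hcov hr htr, fib_dNabla_add (hR.add hDρ) (S.isSection_rr hρ),
        fib_dNabla_add hR hDρ, dNabla_curvatureForm hcov, zero_add,
        fib_dNabla_dNabla_eq_br hcov hρ htρ rfl rfl, fib_dNabla_rr hcov hρ]
    have h2 : fib (S.weylCurvature cov r) x = fib (S.curvatureForm cov) x +
        fib (dNabla cov (r - S.solder)) x + sq (S.wick x) (fib (r - S.solder) x) := by
      rw [weylCurvature_eq hcov hr htr, fib_add (hR.add hDρ) (S.isSection_rr hρ), fib_add hR hDρ,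
        S.fib_rr hρ]
    rw [h1, h2, br_add_right, br_add_right, br_sq (S.wick x) _ _ (hρ.hom_fib x), br_eq_neg_br,
      br_eq_neg_br]
    abel
  have e2 : br (S.wick x) (Nat.add_comm 1 2) rfl (fib (r - S.solder) x) (fib S.omegaForm x) = 0 := by
    rw [br_eq_neg_br, S.fib_omegaForm, br]
    funext k l
    have h3 := gcomm_single_zero (S.wick x) (rfl : 2 + 1 = 3) rfl
      (Hom.smul (1 / 2 : ℂ) (hom_linearForm (S.wAt x)).dl) (fib (r - S.solder) x) (k + 1) l
    exact (congrArg (fun s : Sm m 3 => -(Complex.I • s)) h3).trans (by simp)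
  -- ω is central and closed under d_∇, so it may be subtracted from Ω.
  have e3 : fib (dNabla cov (S.weylCurvature cov r - S.omegaForm)) x +
      br (S.wick x) (Nat.add_comm 1 2) rfl (fib (r - S.solder) x)
        (fib (S.weylCurvature cov r - S.omegaForm) x) = 0 := by
    rw [fib_dNabla_sub hΩ S.isSection_omegaForm, S.dNabla_omegaForm hcov.smooth, sub_zero,
      fib_sub hΩ S.isSection_omegaForm, br_sub_right, e2, sub_zero, e1]
  -- Splitting ρ = r - s isolates (i/ν)[s, ·], which is δ on the transverse form Ω - ω.
  rw [fib_sub hr hs, br_sub_left, fib_bracket_solder hA htA] at e3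
  rw [fib_add (hA.dNabla hcov.smooth) (S.isSection_bracket hr hA), S.fib_bracket hr hA]
  have e4 := congrFun (congrFun e3 k) l
  simp only [Pi.add_apply, Pi.sub_apply, Pi.zero_apply] at e4 ⊢
  rw [add_sub_assoc', sub_eq_zero] at e4
  exact e4.symm

end ContactMetricStructure

end WeylCurvature

/-! ### Degree estimates, iteration and uniqueness -/

section Filtration

variable {m n p q N : ℕ} {M : Type*} [TopologicalSpace M] [ChartedSpace (Model m) M]
  [IsManifold (𝓡 (2 * m + 1)) ∞ M]

open Sm

variable {cov : AffineConnection m M} {a b : WForm m M n} {x : M} {k l d d' : ℕ} {r r' : WForm m M 1}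

section

omit [TopologicalSpace M] [ChartedSpace (Model m) M] [IsManifold (𝓡 (2 * m + 1)) ∞ M]

theorem InFiltration.mono (h : d' ≤ d) (ha : InFiltration d a) : InFiltration d' a :=
  fun x k l hkl => ha x k l (by omega)

theorem InFiltration.add (ha : InFiltration d a) (hb : InFiltration d b) : InFiltration d (a + b) :=
  fun x k l hkl => by
    rw [Pi.add_apply, Pi.add_apply, Pi.add_apply, ha x k l hkl, hb x k l hkl, add_zero]

theorem InFiltration.sub (ha : InFiltration d a) (hb : InFiltration d b) : InFiltration d (a - b) :=
  fun x k l hkl => by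
    rw [Pi.sub_apply, Pi.sub_apply, Pi.sub_apply, ha x k l hkl, hb x k l hkl, sub_zero]

theorem eq_of_forall_inFiltration (h : ∀ d, InFiltration d (a - b)) : a = b := by
  funext x k l
  exact sub_eq_zero.1 (h (2 * k + l + 1) x k l (Nat.lt_succ_self _))

theorem fib_zero (x : M) : fib (0 : WForm m M n) x = 0 :=
  funext fun _ => funext fun _ => fib_eq (X := 0) rfl

theorem InFiltration.fib (ha : InFiltration d a) (x : M) : Filt d (fib a x) :=
  fun k l hkl => fib_eq (ha x k l hkl)

end

theorem InFiltration.dNabla (hs : IsSection a) (ha : InFiltration d a) :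
    InFiltration d (dNabla cov a) := by
  intro x k l hkl
  have h0 : WickFedosov.fib (WickFedosov.dNabla cov a) x k l = 0 := by
    rw [fib_dNabla_eq hs (f := fun _ => 0) fun u hu => by rw [loc, ha.fib _ k l hkl, map_zero],
      nabla_zero (isOpen_extChartAt_target x) (mem_extChartAt_target x)]
  funext y
  rw [dNabla_apply cov hs, ← fib_dNabla cov hs, h0]
  rfl

namespace ContactMetricStructure

variable {S : ContactMetricStructure m M}

theorem inFiltration_deltaInv {a : WForm m M (n + 1)} (hs : IsSection a) (ha : InFiltration d a) :
    InFiltration (d + 1) (S.deltaInv a) := by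
  intro x k l hkl
  rcases l with _ | l
  · rfl
  · rw [S.deltaInv_eq hs, ha.fib x k l (by omega), map_zero]
    rfl

/-- The division by ν lowers the degree by two, which is exactly what r ∈ F² contributes. -/
theorem inFiltration_bracket {r : WForm m M 1} (hr : IsSection r) (ha : IsSection a)
    (hfr : InFiltration 2 r) (hfa : InFiltration d a) : InFiltration d (S.bracket r a) := by
  refine (inFiltration_iff (S.isSection_bracket hr ha)).2 fun x => ?_
  rw [S.fib_bracket hr ha, br, gcomm_def]
  refine Filt.smul _ (Filt.dn (Filt.sub ?_ (Filt.smul _ ?_)))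
  · exact ((hfr.fib x).circ _ _ (hfa.fib x)).mono (by omega)
  · exact ((hfa.fib x).circ _ _ (hfr.fib x)).mono (by omega)

theorem inFiltration_rr_sub (hr : IsSection r) (hr' : IsSection r') (hf : InFiltration 2 r)
    (hf' : InFiltration 2 r') (hd : InFiltration d (r - r')) :
    InFiltration d (S.rr r - S.rr r') := by
  refine (inFiltration_iff ((S.isSection_rr hr).sub (S.isSection_rr hr'))).2 fun x => ?_
  have h := hd.fib x
  rw [fib_sub hr hr'] at h
  rw [fib_sub (S.isSection_rr hr) (S.isSection_rr hr'), S.fib_rr hr, S.fib_rr hr', sq_sub_sq]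
  refine Filt.smul _ (Filt.dn (Filt.add ?_ ?_))
  · exact ((hf.fib x).circ _ _ h).mono (by omega)
  · exact (h.circ _ _ (hf'.fib x)).mono (by omega)

theorem inFiltration_rr (hr : IsSection r) (hf : InFiltration 2 r) : InFiltration 2 (S.rr r) := by
  refine (inFiltration_iff (S.isSection_rr hr)).2 fun x => ?_
  rw [S.fib_rr hr]
  exact Filt.smul _ (Filt.dn ((hf.fib x).circ _ _ (hf.fib x)))

theorem inFiltration_torsionForm (S : ContactMetricStructure m M) (cov : AffineConnection m M) :
    InFiltration 1 (S.torsionForm cov) := by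
  intro x k l hkl
  obtain rfl : k = 0 := by omega
  obtain rfl : l = 0 := by omega
  rfl

theorem inFiltration_curvatureForm (S : ContactMetricStructure m M) (cov : AffineConnection m M) :
    InFiltration 1 (S.curvatureForm cov) := by
  intro x k l hkl
  obtain rfl : k = 0 := by omega
  obtain rfl : l = 0 := by omega
  rfl

theorem deltaInv_add {a b : WForm m M (n + 1)} (ha : IsSection a) (hb : IsSection b) :
    S.deltaInv (a + b) = S.deltaInv a + S.deltaInv b := by
  refine ext_fib (S.isSection_deltaInv (ha.add hb))
    ((S.isSection_deltaInv ha).add (S.isSection_deltaInv hb)) fun x k l => ?_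
  rw [fib_add (S.isSection_deltaInv ha) (S.isSection_deltaInv hb), Pi.add_apply, Pi.add_apply]
  rcases l with _ | l
  · rw [S.fib_deltaInv_zero, S.fib_deltaInv_zero, S.fib_deltaInv_zero, add_zero]
  · rw [S.fib_deltaInv (ha.add hb), S.fib_deltaInv ha, S.fib_deltaInv hb, fib_add ha hb]
    exact map_add _ _ _

theorem deltaInv_sub {a b : WForm m M (n + 1)} (ha : IsSection a) (hb : IsSection b) :
    S.deltaInv (a - b) = S.deltaInv a - S.deltaInv b := by
  rw [eq_sub_iff_add_eq, ← deltaInv_add (ha.sub hb) hb, sub_add_cancel]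

/-- The interior product with P y squares to zero and commutes with the splitting into the two
λ-components, so the different weights do no harm. -/
theorem deltaInv_deltaInv {a : WForm m M (n + 2)} (ha : IsSection a) :
    S.deltaInv (S.deltaInv a) = 0 := by
  refine ext_fib (S.isSection_deltaInv (S.isSection_deltaInv ha)) isSection_zero fun x k l => ?_
  rw [fib_zero]
  rcases l with _ | _ | l
  · exact S.fib_deltaInv_zero _ x k
  · rw [S.fib_deltaInv (S.isSection_deltaInv ha), S.fib_deltaInv_zero, map_zero]
    rfl
  · rw [S.fib_deltaInv (S.isSection_deltaInv ha), S.fib_deltaInv ha, dlInv_dlInv (S.lamAt_xiAt x)]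
    rfl

/-- The Hodge decomposition for elements of the kernel of `δ⁻¹` without harmonic part. -/
theorem eq_deltaInv_delta {a : WForm m M (n + 1)} (ha : IsSection a) (hta : S.IsTransverse a)
    (h : S.deltaInv a = 0)
    (h0 : n = 0 → ∀ x k, Sm.map (lamL (S.lamAt x) (S.xiAt x)) (WickFedosov.fib a x k 0) = 0) :
    a = S.deltaInv (delta a) := by
  have hz : ∀ x k l, dlInv (S.lamAt x) (S.xiAt x) l (WickFedosov.fib a x k l) = 0 := fun x k l => by
    rw [← S.fib_deltaInv ha, h, fib_zero]
    rfl
  refine ext_fib ha (S.isSection_deltaInv ha.delta) fun x k l => ?_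
  -- The image of δ⁻¹ has no component of y-degree zero, so there a itself must vanish; this follows
  -- from a = δδ⁻¹a and δ⁻¹a = 0.
  rcases l with _ | l
  · rw [S.fib_deltaInv_zero, ← dl_dlInv_zero (S.lamAt_xiAt x) (ha.hom_fib x k 0)
      fun hn => h0 hn x k, hz, map_zero]
  · rw [S.fib_deltaInv ha.delta, ha.fib_delta]
    have := dl_dlInv_add_dlInv_dl (S.lamAt_xiAt x) (ha.hom_fib x k (l + 1))
      ((isTransverse_iff ha).1 hta x k (l + 1))
    rw [hz, map_zero, zero_add] at this
    exact this.symm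

/-- A component of y-degree zero is constant on the fibre, so the vanishing of its contraction with
ξ at y = 0 gives the vanishing of its λ-part everywhere. -/
theorem map_lamL_of_reebPart (hr : IsSection r) (h : ∀ x k, S.reebPart r x k = 0) (x : M) (k : ℕ) :
    Sm.map (lamL (S.lamAt x) (S.xiAt x)) (WickFedosov.fib r x k 0) = 0 := by
  refine Sm.ext fun y => ?_
  have h1 : WickFedosov.fib r x k 0 y = r x k 0 0 := by
    have h2 := hr.hom_fib x k 0 0 y
    rw [pow_zero, one_smul, zero_smul, hr.fib_apply] at h2
    exact h2.symm
  have h3 : inner (S.xiAt x) (r x k 0 0) = 0 := by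
    ext v
    rw [inner_apply]
    refine Eq.trans (congrArg _ (funext fun i => ?_)) (h x k)
    obtain rfl : i = 0 := Fin.fin_one_eq_zero i
    rfl
  rw [map_apply, lamL_apply, h1, h3, wedge_zero]
  rfl

variable [T2Space M] (hcov : S.IsContactMetricConnection cov)
include hcov

/-- The right-hand side of the equation for `r`. -/
theorem iterMap_eq (hr : IsSection r) : S.iterMap cov r = S.deltaInv
    (S.torsionForm cov + S.curvatureForm cov + dNabla cov r + S.rr r) := by
  have hT := isSection_torsionForm (S := S) hcov
  have hR : IsSection (S.curvatureForm cov) := isSection_curvatureForm hcov.smooth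
  have hD : IsSection (WickFedosov.dNabla cov r) := hr.dNabla hcov.smooth
  rw [iterMap, add_assoc (S.torsionForm cov + S.curvatureForm cov),
    deltaInv_add (hT.add hR) (hD.add (S.isSection_rr hr))]

theorem isSection_rhs (hr : IsSection r) :
    IsSection (S.torsionForm cov + S.curvatureForm cov + dNabla cov r + S.rr r) :=
  (((isSection_torsionForm hcov).add (isSection_curvatureForm hcov.smooth)).add
    (hr.dNabla hcov.smooth)).add (S.isSection_rr hr)

theorem memTransverse_iterMap (hr : S.MemTransverse 2 r) : S.MemTransverse 2 (S.iterMap cov r) := by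
  have hT := isSection_torsionForm (S := S) hcov
  have hR : IsSection (S.curvatureForm cov) := isSection_curvatureForm hcov.smooth
  have hs := hr.isSection
  have hD : IsSection (WickFedosov.dNabla cov r) := hs.dNabla hcov.smooth
  rw [iterMap_eq hcov hs]
  refine ⟨S.isSection_deltaInv (isSection_rhs hcov hs), ?_, ?_⟩
  · exact isTransverse_deltaInv (isSection_rhs hcov hs)
      (IsTransverse.add ((hT.add hR).add hD) (S.isSection_rr hs)
        (IsTransverse.add (hT.add hR) hD (IsTransverse.add hT hR (isTransverse_torsionForm hcov)
          (isTransverse_curvatureForm hcov)) (isTransverse_dNabla hcov hs hr.transverse))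
        (isTransverse_rr hs hr.transverse))
  · refine inFiltration_deltaInv (isSection_rhs hcov hs) ?_
    -- It suffices that the argument of δ⁻¹ lies in F¹, as δ⁻¹ raises the degree by one; the lowest
    -- term is T, of degree one.
    exact (((S.inFiltration_torsionForm cov).add (S.inFiltration_curvatureForm cov)).add
      ((hr.filtration.dNabla hs).mono one_le_two)).add ((inFiltration_rr hs hr.filtration).mono one_le_two)

theorem inFiltration_dNabla_add_rr_sub (hr : S.MemTransverse 2 r) (hr' : S.MemTransverse 2 r')
    (hd : InFiltration d (r - r')) :
    InFiltration d ((S.torsionForm cov + S.curvatureForm cov + dNabla cov r + S.rr r) -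
      (S.torsionForm cov + S.curvatureForm cov + dNabla cov r' + S.rr r')) := by
  have hs := hr.isSection
  have hs' := hr'.isSection
  have h1 := hd.dNabla (cov := cov) (hs.sub hs')
  have h2 : WickFedosov.dNabla cov (r - r') =
      WickFedosov.dNabla cov r - WickFedosov.dNabla cov r' := by
    refine ext_fib ((hs.sub hs').dNabla hcov.smooth)
      ((hs.dNabla hcov.smooth).sub (hs'.dNabla hcov.smooth)) fun x k l => ?_
    rw [fib_dNabla_sub hs hs', fib_sub (hs.dNabla hcov.smooth) (hs'.dNabla hcov.smooth)]
  rw [h2] at h1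
  have h3 := h1.add (inFiltration_rr_sub (S := S) hs hs' hr.filtration hr'.filtration hd)
  convert h3 using 1
  abel

/-- The map `iterMap` is a contraction for the filtration. -/
theorem inFiltration_iterMap_sub (hr : S.MemTransverse 2 r) (hr' : S.MemTransverse 2 r')
    (hd : InFiltration d (r - r')) :
    InFiltration (d + 1) (S.iterMap cov r - S.iterMap cov r') := by
  have hZ := isSection_rhs (S := S) hcov hr.isSection
  have hZ' := isSection_rhs (S := S) hcov hr'.isSection
  rw [iterMap_eq hcov hr.isSection, iterMap_eq hcov hr'.isSection, ← deltaInv_sub hZ hZ']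
  exact inFiltration_deltaInv (hZ.sub hZ') (inFiltration_dNabla_add_rr_sub hcov hr hr' hd)

theorem memTransverse_iterate (hr : S.MemTransverse 2 r) (N : ℕ) :
    S.MemTransverse 2 ((S.iterMap cov)^[N] r) := by
  induction N with
  | zero => exact hr
  | succ N ih =>
    rw [Function.iterate_succ_apply']
    exact memTransverse_iterMap hcov ih

theorem inFiltration_iterate_sub (hr : S.MemTransverse 2 r) (hr' : S.MemTransverse 2 r') (N : ℕ) :
    InFiltration (N + 2) ((S.iterMap cov)^[N] r - (S.iterMap cov)^[N] r') := by
  induction N with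
  | zero => exact hr.filtration.sub hr'.filtration
  | succ N ih =>
    rw [Function.iterate_succ_apply', Function.iterate_succ_apply', Nat.add_right_comm]
    exact inFiltration_iterMap_sub hcov (memTransverse_iterate hcov hr N)
      (memTransverse_iterate hcov hr' N) ih

/-- The iterates of 0 stabilise in each degree because the map is a contraction. Their limit is
taken coefficientwise, which preserves smoothness, transversality and the filtration, each being a
condition on single coefficients. -/
theorem exists_iterMap_eq : ∃ r, S.MemTransverse 2 r ∧ S.iterMap cov r = r := by
  have h0 : S.MemTransverse 2 (0 : WForm m M 1) :=
    ⟨isSection_zero, (isTransverse_iff isSection_zero).2 fun x k l => by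
      rw [fib_zero]
      exact map_zero _, fun _ _ _ _ => rfl⟩
  have hmem := memTransverse_iterate hcov h0
  set s : ℕ → WForm m M 1 := fun N => (S.iterMap cov)^[N] 0 with hs
  have hstep : ∀ N, InFiltration (N + 2) (s (N + 1) - s N) := fun N =>
    inFiltration_iterate_sub hcov (memTransverse_iterMap hcov h0) h0 N
  have hconst : ∀ x k l N N', 2 * k + l ≤ N + 1 → N ≤ N' → s N' x k l = s N x k l := by
    intro x k l N N' hN hNN
    induction N', hNN using Nat.le_induction with
    | base => rfl
    | succ N' hN' ih =>
      rw [← ih]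
      exact sub_eq_zero.1 (hstep N' x k l (by omega))
  -- The component of total degree d is taken from the d-th iterate; components of degree at most N
  -- + 1 no longer change after the N-th iterate.
  set r : WForm m M 1 := fun x k l => s (2 * k + l) x k l with hrd
  have hr : S.MemTransverse 2 r :=
    ⟨⟨fun x k l => (hmem (2 * k + l)).isSection.polynomial x k l,
      fun x k l => (hmem (2 * k + l)).isSection.smooth x k l⟩,
      fun x k l => (hmem (2 * k + l)).transverse x k l,
      fun x k l => (hmem (2 * k + l)).filtration x k l⟩
  have hlim : ∀ N, InFiltration (N + 2) (r - s N) := by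
    intro N x k l hkl
    change s (2 * k + l) x k l - s N x k l = 0
    rw [sub_eq_zero]
    rcases le_total (2 * k + l) N with h | h
    · exact (hconst x k l _ _ (by omega) h).symm
    · exact hconst x k l _ _ (by omega) h
  refine ⟨r, hr, eq_of_forall_inFiltration fun d => ?_⟩
  -- Both the image of r and r itself are close to the (d + 1)-st iterate, hence to each other; d is
  -- arbitrary.
  have h1 := inFiltration_iterMap_sub hcov hr (hmem d) (hlim d)
  have h2 := hlim (d + 1)
  have e1 : s (d + 1) = S.iterMap cov (s d) := Function.iterate_succ_apply' _ _ _
  rw [e1] at h2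
  have h3 := (h1.mono (d' := d) (by omega)).sub (h2.mono (d' := d) (by omega))
  rwa [sub_sub_sub_cancel_right] at h3

omit hcov [T2Space M] in
theorem weylCurvature_eq_iff (S : ContactMetricStructure m M) (cov : AffineConnection m M)
    (r : WForm m M 1) : S.weylCurvature cov r = S.omegaForm ↔
      delta r = S.torsionForm cov + S.curvatureForm cov + dNabla cov r + S.rr r := by
  rw [weylCurvature, ← sub_eq_zero, ← sub_eq_zero (a := delta r), ← neg_eq_zero]
  refine Eq.congr_left ?_
  abel

theorem deltaInv_of_iterMap_eq (hr : IsSection r) (h : S.iterMap cov r = r) : S.deltaInv r = 0 := by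
  rw [← h, iterMap_eq hcov hr, deltaInv_deltaInv (isSection_rhs hcov hr)]

/-- δ⁻¹ produces only positive y-degree, so nothing is left at y = 0. -/
theorem reebPart_of_iterMap_eq (hr : IsSection r) (h : S.iterMap cov r = r) : S.reebPart r = 0 := by
  rw [← h, iterMap_eq hcov hr]
  rfl

/-- A fixed point of `iterMap` has Weyl curvature `ω`. -/
theorem weylCurvature_of_iterMap_eq (hr : S.MemTransverse 2 r) (h : S.iterMap cov r = r) :
    S.weylCurvature cov r = S.omegaForm := by
  have hs := hr.isSection
  have hΩ := isSection_weylCurvature hcov hs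
  have hA := hΩ.sub S.isSection_omegaForm
  have hZ := isSection_rhs (S := S) hcov hs
  have hA' : S.weylCurvature cov r - S.omegaForm =
      (S.torsionForm cov + S.curvatureForm cov + dNabla cov r + S.rr r) - delta r := by
    rw [weylCurvature]
    abel
  have htA : S.IsTransverse (S.weylCurvature cov r - S.omegaForm) :=
    IsTransverse.sub hΩ S.isSection_omegaForm (isTransverse_weylCurvature hcov hs hr.transverse)
      isTransverse_omegaForm
  -- The fixed point equation says that δ⁻¹ of the right-hand side is r, and the Hodge decomposition
  -- of the normalised r says that δ⁻¹δr is r as well.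
  have hz : S.deltaInv (S.weylCurvature cov r - S.omegaForm) = 0 := by
    rw [hA', deltaInv_sub hZ hs.delta, ← iterMap_eq hcov hs, ← eq_deltaInv_delta hs hr.transverse
      (deltaInv_of_iterMap_eq hcov hs h) fun _ => map_lamL_of_reebPart hs fun x k =>
        congrFun (congrFun (reebPart_of_iterMap_eq hcov hs h) x) k, h, sub_self]
  -- The exceptional harmonic part occurs only for one-forms, and Ω - ω is a two-form.
  have hfix := eq_deltaInv_delta hA htA hz fun h => absurd h one_ne_zero
  refine eq_of_forall_inFiltration fun d => ?_
  induction d with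
  | zero => exact fun x k l hkl => absurd hkl (Nat.not_lt_zero _)
  | succ d ih =>
    -- By the Bianchi identity Ω - ω is δ⁻¹ of terms that do not lower the degree, so each pass
    -- through the equation raises its filtration degree by one.
    rw [hfix, delta_weylCurvature hcov hs hr.transverse]
    exact inFiltration_deltaInv ((hA.dNabla hcov.smooth).add (S.isSection_bracket hs hA))
      ((ih.dNabla hA).add (inFiltration_bracket hs hA hr.filtration ih))

/-- Elements with Weyl curvature `ω` are determined by `(i_ξ r)|_{y = 0}`. -/
theorem eq_of_reebPart_eq (hr : S.MemTransverse 2 r) (hr' : S.MemTransverse 2 r')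
    (h : S.deltaInv r = 0) (h' : S.deltaInv r' = 0) (hΩ : S.weylCurvature cov r = S.omegaForm)
    (hΩ' : S.weylCurvature cov r' = S.omegaForm) (hreeb : S.reebPart r = S.reebPart r') : r = r' := by
  have hs := hr.isSection
  have hs' := hr'.isSection
  have hc := hs.sub hs'
  -- The difference is normalised and has no harmonic part, so it is recovered from its image under
  -- δ.
  have hfix : r - r' = S.deltaInv (delta (r - r')) :=
    eq_deltaInv_delta hc (IsTransverse.sub hs hs' hr.transverse hr'.transverse)
      (by rw [deltaInv_sub hs hs', h, h', sub_zero]) fun _ => map_lamL_of_reebPart hc fun x k =>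
        sub_eq_zero.2 (congrFun (congrFun hreeb x) k)
  have hdel : delta (r - r') = delta r - delta r' :=
    ext_fib hc.delta (hs.delta.sub hs'.delta) fun x k l => by
      rw [hc.fib_delta, fib_sub hs.delta hs'.delta, Pi.sub_apply, Pi.sub_apply, hs.fib_delta,
        hs'.fib_delta, fib_sub hs hs']
      exact map_sub _ _ _
  refine eq_of_forall_inFiltration fun d => ?_
  induction d with
  | zero => exact fun x k l hkl => absurd hkl (Nat.not_lt_zero _)
  | succ d ih =>
    rw [hfix]
    refine inFiltration_deltaInv hc.delta ?_
    -- The curvature condition expresses δr - δr' through d_∇ and the difference of the squares,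
    -- neither of which lowers the degree of r - r'; T and R cancel.
    rw [hdel, (weylCurvature_eq_iff S cov r).1 hΩ, (weylCurvature_eq_iff S cov r').1 hΩ']
    exact inFiltration_dNabla_add_rr_sub hcov hr hr' ih

/-- The fixed point of `iterMap` is unique, and the limit of the iteration. -/
theorem inFiltration_sub_iterate (hr : S.MemTransverse 2 r) (h : S.iterMap cov r = r)
    (hr' : S.MemTransverse 2 r') (N : ℕ) : InFiltration (N + 2) (r - (S.iterMap cov)^[N] r') := by
  have h1 := inFiltration_iterate_sub hcov hr hr' N
  rwa [Function.iterate_fixed h] at h1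

end ContactMetricStructure

end Filtration

end WickFedosov

end

theorem theorem3p3 {m : ℕ} {M : Type*} [TopologicalSpace M] [T2Space M]
    [ChartedSpace (WickFedosov.Model m) M] [IsManifold (𝓡 (2 * m + 1)) ∞ M]
    (S : WickFedosov.ContactMetricStructure m M) (cov : WickFedosov.AffineConnection m M)
    (hcov : S.IsContactMetricConnection cov) :
    (∃ r : WickFedosov.WForm m M 1,
      (S.MemTransverse 2 r ∧ S.deltaInv r = 0 ∧ S.reebPart r = 0 ∧
        S.weylCurvature cov r = S.omegaForm) ∧
      S.IsAbelian cov r ∧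
      (∀ r' : WickFedosov.WForm m M 1, S.MemTransverse 2 r' → S.deltaInv r' = 0 →
        S.reebPart r' = 0 → S.weylCurvature cov r' = S.omegaForm → r' = r) ∧
      (∀ r' : WickFedosov.WForm m M 1, S.MemTransverse 2 r' →
        (S.iterMap cov r' = r' ↔ r' = r)) ∧
      (∀ r₀ : WickFedosov.WForm m M 1, S.MemTransverse 2 r₀ → ∀ N : ℕ,
        WickFedosov.InFiltration (N + 2) (r - (S.iterMap cov)^[N] r₀))) ∧
    (∀ r r' : WickFedosov.WForm m M 1, S.MemTransverse 2 r → S.MemTransverse 2 r' →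
      S.deltaInv r = 0 → S.deltaInv r' = 0 →
      S.weylCurvature cov r = S.omegaForm → S.weylCurvature cov r' = S.omegaForm →
      S.reebPart r = S.reebPart r' → r = r') ∧
    (∀ r : WickFedosov.WForm m M 1, S.weylCurvature cov r = S.omegaForm ↔
      WickFedosov.delta r = S.torsionForm cov + S.curvatureForm cov +
        WickFedosov.dNabla cov r + S.rr r) := by
  have hfix_unique : ∀ r r' : WickFedosov.WForm m M 1, S.MemTransverse 2 r → S.iterMap cov r = r →
      S.MemTransverse 2 r' → S.iterMap cov r' = r' → r' = r := by
    intro r r' hr h hr' h'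
    -- A fixed point equals all of its iterates, so the convergence estimate bounds the difference
    -- of two fixed points in every degree.
    refine (WickFedosov.eq_of_forall_inFiltration fun N => ?_).symm
    have h1 := WickFedosov.ContactMetricStructure.inFiltration_sub_iterate hcov hr h hr' N
    rw [Function.iterate_fixed h'] at h1
    exact h1.mono (Nat.le_add_right N 2)
  obtain ⟨r, hr, hfix⟩ := WickFedosov.ContactMetricStructure.exists_iterMap_eq hcov
  have h1 := WickFedosov.ContactMetricStructure.deltaInv_of_iterMap_eq hcov hr.isSection hfix
  have h2 := WickFedosov.ContactMetricStructure.reebPart_of_iterMap_eq hcov hr.isSection hfix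
  have h3 := WickFedosov.ContactMetricStructure.weylCurvature_of_iterMap_eq hcov hr hfix
  refine ⟨⟨r, ⟨hr, h1, h2, h3⟩, WickFedosov.ContactMetricStructure.isAbelian_of_weylCurvature_eq hcov
    hr.isSection hr.transverse h3, fun r' hr' h1' h2' h3' => ?_, fun r' hr' => ⟨fun h =>
      hfix_unique r r' hr hfix hr' h, fun h => by rw [h, hfix]⟩, fun r₀ hr₀ N =>
      WickFedosov.ContactMetricStructure.inFiltration_sub_iterate hcov hr hfix hr₀ N⟩,
    fun r r' hr hr' h h' hΩ hΩ' => WickFedosov.ContactMetricStructure.eq_of_reebPart_eq hcov hr hr' h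
      h' hΩ hΩ', WickFedosov.ContactMetricStructure.weylCurvature_eq_iff S cov⟩
  exact WickFedosov.ContactMetricStructure.eq_of_reebPart_eq hcov hr' hr h1' h1 h3' h3
    (h2'.trans h2.symm)
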